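/- Let $M$ be a smooth, connected (Hausdorff, second countable) $3$-manifold, possibly with compact boundary, and let $g$ be a smooth Riemannian metric on $M$. A coordinate system at infinity is a diffeomorphism $\Phi=(x^1,x^2,x^3): M\setminus K\to\mathbb R^3\setminus B$, with $K\subset M$ compact and $B$ a closed ball, such that for every $r$ the region $B_r=M\setminus\{|x|>r\}$ is compact. It is asymptotically flat of order $\tau>\tfrac12$ if $\sigma_{ij}=g_{ij}-\delta_{ij}$ satisfies $\sigma_{ij}=O(|x|^{-\tau})$, $\partial_k\sigma_{ij}=O(|x|^{-\tau-1})$, $\partial_k\partial_\ell\sigma_{ij}=O(|x|^{-\tau-2})$ as $|x|\to\infty$. The ADM mass of $(M,g)$ is $$m_{ADM}(M,g)=\lim_{r\to\infty}\frac1{16\pi}\int_{\{|x|=r\}}\sum_{i,j}\left(\partial_i g_{ij}-\partial_j g_{ii}\right)\frac{x^j}{|x|}\,dA,$$ computed in any asymptotically flat coordinate system. The manifold $(M,g)$ is harmonically flat at infinity if there is a coordinate system at infinity in which $g_{ij}=U^4\delta_{ij}$ on $M\setminus K$, where $U>0$ is harmonic for the Euclidean Laplacian and $U(x)\to1$ as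 $|x|\to\infty$. For a compact set $L\subset M$ let $|L|$ be its $g$-volume and $$\mathrm{cap}_g(L)=\inf_\psi\frac1{4\pi}\int_M|\nabla\psi|_g^2\,dV_g,$$ where $\psi$ ranges over the locally Lipschitz functions on $M$ that vanish on $L$ and uniformly approach $1$ at infinity. The isocapacitary (capacity-volume) mass is $$m_{CV}(M,g)=\sup_{\{K_j\}}\limsup_{j\to\infty}\frac1{4\pi\,\mathrm{cap}_g(K_j)^2}\left[|K_j|-\frac{4\pi}3\mathrm{cap}_g(K_j)^3\right]\in[-\infty,\infty],$$ where the supremum is over all exhaustions $\{K_j\}$ of $M$ by compact sets (sequences of compact sets that eventually contain every given compact set). Theorem. If $(M,g)$ is harmonically flat at infinity and $m_{ADM}(M,g)\ge0$, then $$m_{CV}(M,g)\le m_{ADM}(M,g).$$ -/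

import Mathlib

open Set Filter Topology MeasureTheory Manifold Bundle
open scoped ContDiff ENNReal NNReal

noncomputable section

namespace IsocapacitaryMass

/-- Euclidean `3`-space, with its Euclidean norm and Lebesgue measure. -/
abbrev E3 : Type := EuclideanSpace ℝ (Fin 3)

/-- The standard basis vectors of `E3`. -/
def stdVec (i : Fin 3) : E3 := EuclideanSpace.single i (1 : ℝ)

variable {H : Type*} [TopologicalSpace H] {I : ModelWithCorners ℝ E3 H}
  {M : Type*} [TopologicalSpace M] [ChartedSpace H M] [IsManifold I ∞ M]

/-- Smooth Riemannian metrics on the `3`-manifold `M`. The model `I` may be `𝓡 3` (no boundary)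
or `𝓡∂ 3` (manifolds with a possibly empty boundary). -/
abbrev SmoothMetric (I : ModelWithCorners ℝ E3 H) (M : Type*) [TopologicalSpace M] [ChartedSpace H M]
    [IsManifold I ∞ M] : Type _ :=
  ContMDiffRiemannianMetric I ∞ E3 (fun x : M => TangentSpace I x)

/-! ### Metric coefficients and the Riemannian volume measure -/

/-- The coefficients `g_{ij}(y)` of `g` in the local parametrization `f : E3 → M` (the inverse of a
coordinate chart), i.e. `g(∂_i, ∂_j)` with `∂_i = df_y(e_i)`. -/
def coeff (g : SmoothMetric I M) (f : E3 → M) (i j : Fin 3) (y : E3) : ℝ :=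
  g.inner (f y) (mfderiv 𝓘(ℝ, E3) I f y (stdVec i)) (mfderiv 𝓘(ℝ, E3) I f y (stdVec j))

/-- The volume density `√(det g_{ij})` in a local parametrization. -/
def volDensity (g : SmoothMetric I M) (f : E3 → M) (y : E3) : ℝ :=
  √(Matrix.of fun i j => coeff g f i j y).det

/-- The volume measure of `g` on the domain of the preferred chart at `p`, i.e. the image of
`√(det g_{ij}) dx¹ dx² dx³`. (Points of the chart that lie on the boundary of the model range form
a Lebesgue null set.) -/
def chartVolume [MeasurableSpace M] (g : SmoothMetric I M) (p : M) : Measure M :=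
  (((volume : Measure E3).restrict (extChartAt I p).target).withDensity
    (fun y => ENNReal.ofReal (volDensity g (extChartAt I p).symm y))).map (extChartAt I p).symm

/-- A second countable manifold is covered by a sequence of preferred charts. -/
theorem exists_chart_cover (H : Type*) [TopologicalSpace H] (M : Type*) [TopologicalSpace M]
    [ChartedSpace H M] [SecondCountableTopology M] [Nonempty M] :
    ∃ u : ℕ → M, ⋃ n, (chartAt H (u n)).source = univ := by
  obtain ⟨s, hs, hU⟩ := TopologicalSpace.countable_cover_nhds
    (f := fun x : M => (chartAt H x).source) (fun x => chart_source_mem_nhds H x)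
  have hne : s.Nonempty := by
    by_contra h
    rw [not_nonempty_iff_eq_empty] at h
    subst h
    simp only [mem_empty_iff_false, iUnion_of_empty, iUnion_empty] at hU
    exact (empty_ne_univ hU)
  obtain ⟨u, rfl⟩ := hs.exists_eq_range hne
  exact ⟨u, by simpa using hU⟩

/-- The Riemannian volume measure `dV_g` on `M`: cover `M` by countably many charts, make the chart
domains disjoint, and add up the volume measures of the pieces. By the change of variables formula
the result does not depend on the cover. -/
def riemannianVolume [MeasurableSpace M] [SecondCountableTopology M] [Nonempty M]
    (g : SmoothMetric I M) : Measure M :=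
  Measure.sum fun n : ℕ =>
    (chartVolume g ((exists_chart_cover H M).choose n)).restrict
      (disjointed (fun k => (chartAt H ((exists_chart_cover H M).choose k)).source) n)

/-! ### Capacity -/

/-- Local Lipschitz continuity of a function on a manifold (in charts). -/
def IsLocallyLipschitz (I : ModelWithCorners ℝ E3 H) (ψ : M → ℝ) : Prop :=
  ∀ p : M, ∃ C : ℝ≥0, ∃ s ∈ 𝓝[range I] (extChartAt I p p),
    LipschitzOnWith C (ψ ∘ (extChartAt I p).symm) s

/-- The differential `dψ` of a real function on `M` at `x`. -/
def diffAt (I : ModelWithCorners ℝ E3 H) (ψ : M → ℝ) (x : M) : TangentSpace I x →L[ℝ] ℝ :=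
  mfderiv I 𝓘(ℝ, ℝ) ψ x

/-- `|∇ψ|_g²` at `x`, as the square of the `g`-dual norm of `dψ`, i.e. the supremum of `dψ(v)²` over
the vectors `v` with `g(v, v) ≤ 1`. It is used for locally Lipschitz `ψ` only, which are
differentiable almost everywhere. -/
def gradSq (g : SmoothMetric I M) (ψ : M → ℝ) (x : M) : ℝ≥0∞ :=
  ⨆ (v : TangentSpace I x) (_ : g.inner x v v ≤ 1),
    ENNReal.ofReal (diffAt I ψ x v ^ 2)

/-- Competitors for the capacity of `K`: locally Lipschitz functions that vanish on `K` and tend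
uniformly to `1` at infinity. -/
structure IsCompetitor (I : ModelWithCorners ℝ E3 H) (K : Set M) (ψ : M → ℝ) : Prop where
  locallyLipschitz : IsLocallyLipschitz I ψ
  eq_zero : ∀ x ∈ K, ψ x = 0
  tendsto_one : Tendsto ψ (cocompact M) (𝓝 1)

/-- The capacity `inf_ψ (4π)⁻¹ ∫_M |∇ψ|_g² dV_g`. -/
def capacity [MeasurableSpace M] [SecondCountableTopology M] [Nonempty M]
    (g : SmoothMetric I M) (K : Set M) : ℝ≥0∞ :=
  ⨅ (ψ : M → ℝ) (_ : IsCompetitor I K ψ),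
    (∫⁻ x, gradSq g ψ x ∂(riemannianVolume g)) / ENNReal.ofReal (4 * Real.pi)

/-! ### The isocapacitary mass -/

/-- An exhaustion of `M` by compact sets: every compact subset of `M` is eventually contained in
`K j`. (A nested sequence with this property, such as a `CompactExhaustion`, can be extracted from
any such sequence as a subsequence along which a given `limsup` is attained.) -/
structure IsExhaustion (K : ℕ → Set M) : Prop where
  isCompact : ∀ j, IsCompact (K j)
  absorbs : ∀ L : Set M, IsCompact L → ∀ᶠ j in atTop, L ⊆ K j

/-- The quantity `(4π cap(K)²)⁻¹ (|K| - (4π/3) cap(K)³)`. -/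
def deficit [MeasurableSpace M] [SecondCountableTopology M] [Nonempty M]
    (g : SmoothMetric I M) (K : Set M) : ℝ :=
  1 / (4 * Real.pi * (capacity g K).toReal ^ 2) *
    ((riemannianVolume g K).toReal - 4 * Real.pi / 3 * (capacity g K).toReal ^ 3)

/-- The isocapacitary (capacity-volume) mass, an extended real number. -/
def massCV [MeasurableSpace M] [SecondCountableTopology M] [Nonempty M] (g : SmoothMetric I M) : EReal :=
  ⨆ (K : ℕ → Set M) (_ : IsExhaustion K), limsup (fun j => (deficit g (K j) : EReal)) atTop

/-! ### Asymptotically flat and harmonically flat coordinates, ADM mass -/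

/-- `Φ` is a smooth coordinate system at infinity: a diffeomorphism from `M ∖ K`, with `K` compact,
onto the complement of a closed ball in `ℝ³`, such that the region `B_r` enclosed by the coordinate
sphere `S_r` (that is, `M` without the points with coordinates `|x| > r`) is compact. -/
structure IsEndChart (I : ModelWithCorners ℝ E3 H) (Φ : OpenPartialHomeomorph M E3) : Prop where
  isCompact_compl : IsCompact Φ.sourceᶜ
  target_eq : ∃ (c : E3) (R : ℝ), 0 < R ∧ Φ.target = (Metric.closedBall c R)ᶜ
  contMDiffOn : ContMDiffOn I 𝓘(ℝ, E3) ∞ Φ Φ.source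
  contMDiffOn_symm : ContMDiffOn 𝓘(ℝ, E3) I ∞ Φ.symm Φ.target
  isCompact_region : ∀ r : ℝ, IsCompact {x : M | x ∈ Φ.source → ‖Φ x‖ ≤ r}

/-- `Φ` is a system of asymptotically flat coordinates of order `τ > 1/2`: the functions
`σ_{ij} = g_{ij} - δ_{ij}` and their derivatives of order `k = 1, 2` are `O(|x|^{-τ-k})`. -/
structure IsAFChart (g : SmoothMetric I M) (Φ : OpenPartialHomeomorph M E3) (τ : ℝ) : Prop
    extends IsEndChart I Φ where
  half_lt : 1 / 2 < τ
  decay : ∀ i j : Fin 3, ∀ k : ℕ, k ≤ 2 →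
    (fun y : E3 => iteratedFDeriv ℝ k
        (fun z => coeff g Φ.symm i j z - if i = j then (1 : ℝ) else 0) y)
      =O[Bornology.cobounded E3] fun y : E3 => ‖y‖ ^ (-τ - (k : ℝ))

/-- The partial derivative `∂_k g_{ij}` of a metric coefficient in the coordinates `Φ`. -/
def partialCoeff (g : SmoothMetric I M) (Φ : OpenPartialHomeomorph M E3) (k i j : Fin 3) (y : E3) : ℝ :=
  fderiv ℝ (coeff g Φ.symm i j) y (stdVec k)

/-- `(16π)⁻¹ ∫_{S_r} ∑_{i,j} (∂_i g_{ij} - ∂_j g_{ii}) x^j/|x| dA`. The sphere `S_r` is parametrized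
by the unit sphere with its standard surface measure, `x = r θ`, `dA = r² dθ`. -/
def admFlux (g : SmoothMetric I M) (Φ : OpenPartialHomeomorph M E3) (r : ℝ) : ℝ :=
  1 / (16 * Real.pi) *
    ∫ θ : Metric.sphere (0 : E3) 1,
      r ^ 2 * ∑ i : Fin 3, ∑ j : Fin 3,
        (partialCoeff g Φ i i j (r • (θ : E3)) - partialCoeff g Φ j i i (r • (θ : E3))) *
          (θ : E3) j
      ∂((volume : Measure E3).toSphere)

/-- `m` is the ADM mass of `(M, g)`: the limit of the flux integrals in a system of asymptotically
flat coordinates. -/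
def IsADMMass (g : SmoothMetric I M) (m : ℝ) : Prop :=
  ∃ (Φ : OpenPartialHomeomorph M E3) (τ : ℝ), IsAFChart g Φ τ ∧ Tendsto (admFlux g Φ) atTop (𝓝 m)

/-- `(M, g)` is harmonically flat at infinity: in some coordinate system at infinity
`g_{ij} = U⁴ δ_{ij}`, where `U > 0` is harmonic for the Euclidean Laplacian and `U → 1` at infinity.
(Such coordinates are asymptotically flat of order `1`, and `g` is scalar-flat near infinity, so
that its scalar curvature is integrable.) -/
def IsHarmonicallyFlat (g : SmoothMetric I M) : Prop :=
  ∃ (Φ : OpenPartialHomeomorph M E3) (U : E3 → ℝ), IsEndChart I Φ ∧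
    (∀ y ∈ Φ.target, 0 < U y) ∧
    InnerProductSpace.HarmonicOnNhd U Φ.target ∧
    Tendsto U (Bornology.cobounded E3) (𝓝 1) ∧
    ∀ y ∈ Φ.target, ∀ i j : Fin 3, coeff g Φ.symm i j y = if i = j then U y ^ 4 else 0

end IsocapacitaryMass

end

open Set Filter Topology MeasureTheory Manifold Bundle
open scoped ContDiff ENNReal NNReal

namespace IsocapacitaryMass

/-! ### Layer cake -/

/-! Write `U = 1 + a/|x| + O(|x|⁻²)` for the conformal factor near infinity (`harmonic_expansion`,
obtained by representing `U - 1` through Newton potentials). The proof bounds the isocapacitary mass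
by `2a` and identifies the ADM mass with `2a`.

A large compact set `K` is replaced by its Euclidean shadow, the coordinate image of `K` with the
inner coordinate ball filled in. Let `R` be the radius of a ball with the Lebesgue measure of the
shadow.

Capacity (`IsHarmonicChart.capacity_ge`): `cap(K) ≥ R + a`. In coordinates the energy of a
competitor `u` is at least `∫ U²|∇u|²`. As `U` is harmonic where `u ≠ 0`, integration by parts turns
this into `∫ |∇(Uu)|²` plus a flux at infinity, equal to `4πa`. The product `Uu` vanishes on the
shadow and tends to `1`, so the sharp Euclidean isocapacitary inequality bounds its energy below by
`4πR` (`isocapacitary_inequality`, `weighted_energy_ge`).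

Volume (`IsHarmonicChart.volume_le`): `|K| ≤ V₀ + (4π/3)R³ + (6a + ε)·2πR²`, because `U⁶ ≤ 1 + (6a +
ε)/|x|` far out and a centred ball maximises `∫ 1/|x|` among sets of given measure. Inserting `R ≤
cap(K) - a` cancels the cubic terms, and the quadratic terms give `2a` in the limit
(`deficit_estimate`).

The isocapacitary inequality is derived from Prékopa–Leindler: this yields Brunn–Minkowski for a set
and a ball, hence the isoperimetric inequality integrated over level sets. Weighting level sets by
`|{φ ≤ s}|^(-2/3)` and applying Cauchy–Schwarz then takes the place of symmetrisation; neither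
perimeters nor the coarea formula appear.

The ADM mass may be computed in any asymptotically flat chart (`IsHarmonicChart.admMass_eq`). If `X`
is the transition map to the harmonic chart, the metric perturbation is `σ_ij = U(X)⁴⟨∂_iX, ∂_jX⟩ -
δ_ij`. The Koszul formula makes the second derivatives of `X` decay, so `∂_iX` converges to an
orthonormal frame, and `σ` is `(4a/|y|)δ` plus a symmetrised gradient plus `o(1/|y|)`. The flux
averaged over radii is the pairing of `σ` with the divergence-free field `δ_ij Δχ - ∂_i∂_jχ` of a
cutoff `χ`. The gradient part drops out, and what remains is the mass `2a`. -/

theorem lintegral_eq_lintegral_superlevel {α : Type*} [MeasurableSpace α] (μ : Measure α)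
    {f : α → ℝ≥0∞} (hf : Measurable f) (hfin : ∀ x, f x ≠ ⊤) :
    ∫⁻ x, f x ∂μ = ∫⁻ s in Ioi (0 : ℝ), μ {x | ENNReal.ofReal s < f x} := by
  have h := lintegral_eq_lintegral_meas_lt μ (f := fun x => (f x).toReal)
    (Eventually.of_forall fun x => ENNReal.toReal_nonneg) hf.ennreal_toReal.aemeasurable
  simp only [ENNReal.ofReal_toReal (hfin _)] at h
  rw [h]
  refine setLIntegral_congr_fun measurableSet_Ioi fun s hs => ?_
  congr 1
  ext x
  simp only [mem_ofPred_eq]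
  rw [ENNReal.ofReal_lt_iff_lt_toReal (le_of_lt hs) (hfin x)]

/-! ### The one-dimensional Brunn–Minkowski inequality -/

/-- The translates `A + min B` and `max A + B` lie in `C` and meet only in the point `max A + min
B`. -/
theorem volume_add_le_of_isCompact {A B C : Set ℝ} (hA : IsCompact A) (hB : IsCompact B)
    (hA0 : A.Nonempty) (hB0 : B.Nonempty) (hC : ∀ a ∈ A, ∀ b ∈ B, a + b ∈ C) :
    volume A + volume B ≤ volume C := by
  obtain ⟨a, haA, ha⟩ := hA.exists_isGreatest hA0
  obtain ⟨b, hbB, hb⟩ := hB.exists_isLeast hB0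
  have h1 : volume ((fun x => x + b) '' A) = volume A := by simp
  have h2 : volume ((fun x => a + x) '' B) = volume B := by simp
  have hd : AEDisjoint volume ((fun x => x + b) '' A) ((fun x => a + x) '' B) := by
    refine measure_mono_null (t := {a + b}) ?_ (by simp)
    rintro z ⟨⟨x, hx, rfl⟩, ⟨y, hy, hxy⟩⟩
    have := ha hx
    have := hb hy
    simp only at hxy ⊢
    simp only [mem_singleton_iff]
    linarith
  rw [← h1, ← h2, ← measure_union₀ _ hd]
  · refine measure_mono (union_subset ?_ ?_)
    · rintro _ ⟨x, hx, rfl⟩; exact hC x hx b hbB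
    · rintro _ ⟨x, hx, rfl⟩; exact hC a haA x hx
  · exact (hB.image (by fun_prop)).measurableSet.nullMeasurableSet

/-- Inner regularity reduces to compact sets. Null sets are treated apart, because strict
approximation from below needs both measures to be nonzero; if one set is null, a translate of the
other already lies in `C`. -/
theorem volume_add_le_of_measurableSet {A B C : Set ℝ} (hA : MeasurableSet A) (hB : MeasurableSet B)
    (hA0 : A.Nonempty) (hB0 : B.Nonempty) (hC : ∀ a ∈ A, ∀ b ∈ B, a + b ∈ C) :
    volume A + volume B ≤ volume C := by
  refine ENNReal.le_of_forall_nnreal_lt fun r hr => ?_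
  by_cases hA1 : volume A = 0
  · obtain ⟨a, ha⟩ := hA0
    rw [hA1, zero_add] at hr
    refine hr.le.trans ?_
    have : volume ((fun x => a + x) '' B) = volume B := by simp
    rw [← this]
    refine measure_mono ?_
    rintro _ ⟨x, hx, rfl⟩; exact hC a ha x hx
  by_cases hB1 : volume B = 0
  · obtain ⟨a, ha⟩ := hB0
    rw [hB1, add_zero] at hr
    refine hr.le.trans ?_
    have : volume ((fun x => x + a) '' A) = volume A := by simp
    rw [← this]
    refine measure_mono ?_
    rintro _ ⟨x, hx, rfl⟩; exact hC x hx a ha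
  obtain ⟨a', ha', b', hb', hab⟩ := ENNReal.exists_lt_add_of_lt_add hr hA1 hB1
  obtain ⟨K, hKA, hK, hKv⟩ := hA.exists_lt_isCompact ha'
  obtain ⟨L, hLB, hL, hLv⟩ := hB.exists_lt_isCompact hb'
  have hK0 : K.Nonempty := by
    rw [nonempty_iff_ne_empty]; rintro rfl; simp at hKv
  have hL0 : L.Nonempty := by
    rw [nonempty_iff_ne_empty]; rintro rfl; simp at hLv
  calc (r : ℝ≥0∞) ≤ a' + b' := hab.le
    _ ≤ volume K + volume L := add_le_add hKv.le hLv.le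
    _ ≤ volume C := volume_add_le_of_isCompact hK hL hK0 hL0
        fun a ha b hb => hC a (hKA ha) b (hLB hb)

/-! ### The Prékopa–Leindler inequality -/

/-- A measure on a real vector space satisfies the Prékopa–Leindler inequality. -/
def IsPrekopaLeindler {α : Type*} [MeasurableSpace α] [AddCommGroup α] [Module ℝ α]
    (μ : Measure α) : Prop :=
  ∀ (t : ℝ), 0 < t → t < 1 → ∀ f g h : α → ℝ≥0∞, Measurable f → Measurable g → Measurable h →
    (∀ x y, f x ^ (1 - t) * g y ^ t ≤ h ((1 - t) • x + t • y)) →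
    (∫⁻ x, f x ∂μ) ^ (1 - t) * (∫⁻ x, g x ∂μ) ^ t ≤ ∫⁻ x, h x ∂μ

/-- For two fixed first coordinates, the inequality in the second factor is precisely the hypothesis
needed for the marginals in the first factor. -/
theorem IsPrekopaLeindler.prod {α β : Type*} [MeasurableSpace α] [AddCommGroup α] [Module ℝ α]
    [MeasurableSpace β] [AddCommGroup β] [Module ℝ β] {μ : Measure α} {ν : Measure β}
    [SFinite μ] [SFinite ν]
    (hμ : IsPrekopaLeindler μ) (hν : IsPrekopaLeindler ν) : IsPrekopaLeindler (μ.prod ν) := by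
  intro t ht0 ht1 f g h hf hg hh H
  rw [lintegral_prod _ hf.aemeasurable, lintegral_prod _ hg.aemeasurable,
    lintegral_prod _ hh.aemeasurable]
  refine hμ t ht0 ht1 _ _ _ hf.lintegral_prod_right' hg.lintegral_prod_right'
    hh.lintegral_prod_right' fun x y => ?_
  refine hν t ht0 ht1 _ _ _ (hf.comp measurable_prodMk_left) (hg.comp measurable_prodMk_left)
    (hh.comp measurable_prodMk_left) fun x' y' => ?_
  exact H (x, x') (y, y')

theorem IsPrekopaLeindler.of_measurePreserving {α β : Type*} [MeasurableSpace α] [AddCommGroup α]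
    [Module ℝ α] [MeasurableSpace β] [AddCommGroup β] [Module ℝ β] {μ : Measure α} {ν : Measure β}
    (hν : IsPrekopaLeindler ν) (e : β ≃ᵐ α) (he : MeasurePreserving e ν μ)
    (hlin : ∀ (t : ℝ) (x y : β), e ((1 - t) • x + t • y) = (1 - t) • e x + t • e y) :
    IsPrekopaLeindler μ := by
  intro t ht0 ht1 f g h hf hg hh H
  rw [← he.lintegral_comp_emb e.measurableEmbedding, ← he.lintegral_comp_emb e.measurableEmbedding,
    ← he.lintegral_comp_emb e.measurableEmbedding]
  refine hν t ht0 ht1 _ _ _ (hf.comp e.measurable) (hg.comp e.measurable) (hh.comp e.measurable)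
    fun x y => ?_
  rw [hlin]
  exact H _ _

theorem rpow_mul_rpow_le_add {t : ℝ} (ht0 : 0 < t) (ht1 : t < 1) (p q : ℝ≥0∞) :
    p ^ (1 - t) * q ^ t ≤ ENNReal.ofReal (1 - t) * p + ENNReal.ofReal t * q := by
  have ht1' : 0 < 1 - t := by linarith
  rcases eq_or_ne p ⊤ with rfl | hp
  · rw [ENNReal.mul_top (by simpa using ht1)]; simp
  rcases eq_or_ne q ⊤ with rfl | hq
  · rw [ENNReal.mul_top (by simpa using ht0)]; simp
  lift p to ℝ≥0 using hp
  lift q to ℝ≥0 using hq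
  have := NNReal.geom_mean_le_arith_mean2_weighted (1 - t).toNNReal t.toNNReal p q (by
    rw [← Real.toNNReal_add ht1'.le ht0.le]; simp)
  rw [Real.coe_toNNReal _ ht1'.le, Real.coe_toNNReal _ ht0.le] at this
  rw [← ENNReal.coe_rpow_of_nonneg _ ht1'.le, ← ENNReal.coe_rpow_of_nonneg _ ht0.le]
  simp only [ENNReal.ofReal]
  exact_mod_cast this

/-- With both suprema equal to `1`, the superlevel sets of `f` and `g` at every height below `1` are
nonempty, so one-dimensional Brunn–Minkowski applies at each height. Integrating over heights bounds
even the arithmetic mean of the two integrals. -/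
theorem prekopaLeindler_real_of_normalized {t : ℝ} (ht0 : 0 < t) (ht1 : t < 1) {f g h : ℝ → ℝ≥0∞}
    (hf : Measurable f) (hg : Measurable g) (hh : Measurable h) (hf1 : ⨆ x, f x = 1)
    (hg1 : ⨆ x, g x = 1)
    (H : ∀ x y, f x ^ (1 - t) * g y ^ t ≤ h ((1 - t) • x + t • y)) :
    (∫⁻ x, f x) ^ (1 - t) * (∫⁻ x, g x) ^ t ≤ ∫⁻ x, h x := by
  have hfle : ∀ x, f x ≤ 1 := fun x => hf1 ▸ le_iSup f x
  have hgle : ∀ x, g x ≤ 1 := fun x => hg1 ▸ le_iSup g x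
  have ht1' : 0 < 1 - t := by linarith
  have key : ∀ s ∈ Ioi (0 : ℝ), ENNReal.ofReal (1 - t) * volume {x | ENNReal.ofReal s < f x}
      + ENNReal.ofReal t * volume {x | ENNReal.ofReal s < g x}
      ≤ volume {x | ENNReal.ofReal s < min (h x) 1} := by
    intro s hs
    by_cases hs1 : 1 ≤ s
    · have h1 : {x | ENNReal.ofReal s < f x} = ∅ := by
        ext x; simpa using (hfle x).trans (by simpa using ENNReal.ofReal_le_ofReal hs1)
      have h2 : {x | ENNReal.ofReal s < g x} = ∅ := by
        ext x; simpa using (hgle x).trans (by simpa using ENNReal.ofReal_le_ofReal hs1)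
      simp [h1, h2]
    push Not at hs1
    have hs1' : ENNReal.ofReal s < 1 := by simpa using (ENNReal.ofReal_lt_one).2 hs1
    set A := {x | ENNReal.ofReal s < f x} with hAdef
    set B := {x | ENNReal.ofReal s < g x} with hBdef
    have hA0 : A.Nonempty := by
      obtain ⟨x, hx⟩ := lt_iSup_iff.1 (hf1.symm ▸ hs1'); exact ⟨x, hx⟩
    have hB0 : B.Nonempty := by
      obtain ⟨x, hx⟩ := lt_iSup_iff.1 (hg1.symm ▸ hs1'); exact ⟨x, hx⟩
    have hA : MeasurableSet A := measurableSet_lt measurable_const hf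
    have hB : MeasurableSet B := measurableSet_lt measurable_const hg
    have e1 : volume ((fun x => (1 - t) * x) '' A) = ENNReal.ofReal (1 - t) * volume A := by
      have := Measure.addHaar_smul (volume : Measure ℝ) (1 - t) A
      simpa [← image_smul, abs_of_pos ht1'] using this
    have e2 : volume ((fun x => t * x) '' B) = ENNReal.ofReal t * volume B := by
      have := Measure.addHaar_smul (volume : Measure ℝ) t B
      simpa [← image_smul, abs_of_pos ht0] using this
    rw [← e1, ← e2]
    refine volume_add_le_of_measurableSet ?_ ?_ (hA0.image _) (hB0.image _) ?_
    · exact (measurableEmbedding_mulLeft₀ ht1'.ne').measurableSet_image.2 hA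
    · exact (measurableEmbedding_mulLeft₀ ht0.ne').measurableSet_image.2 hB
    · rintro _ ⟨x, hx, rfl⟩ _ ⟨y, hy, rfl⟩
      refine lt_min (lt_of_lt_of_le ?_ (H x y)) hs1'
      have : ENNReal.ofReal s = ENNReal.ofReal s ^ (1 - t) * ENNReal.ofReal s ^ t := by
        rw [← ENNReal.rpow_add _ _ (by simpa using hs) ENNReal.ofReal_ne_top]; simp
      rw [this]
      exact ENNReal.mul_lt_mul (ENNReal.rpow_lt_rpow hx ht1') (ENNReal.rpow_lt_rpow hy ht0)
  have hfi := lintegral_eq_lintegral_superlevel volume hf fun x => ((hfle x).trans_lt (by simp)).ne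
  have hgi := lintegral_eq_lintegral_superlevel volume hg fun x => ((hgle x).trans_lt (by simp)).ne
  have hhi := lintegral_eq_lintegral_superlevel volume (hh.min measurable_const)
    fun x => ((min_le_right (h x) 1).trans_lt (by simp)).ne
  have hmeas : ∀ (F : ℝ → ℝ≥0∞), Measurable (fun s : ℝ => volume {x | ENNReal.ofReal s < F x}) := by
    intro F
    refine Antitone.measurable fun s s' hss => measure_mono fun x hx => ?_
    exact lt_of_le_of_lt (ENNReal.ofReal_le_ofReal hss) hx
  calc (∫⁻ x, f x) ^ (1 - t) * (∫⁻ x, g x) ^ t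
      ≤ ENNReal.ofReal (1 - t) * (∫⁻ x, f x) + ENNReal.ofReal t * (∫⁻ x, g x) := by
        exact rpow_mul_rpow_le_add ht0 ht1 _ _
    _ = ∫⁻ s in Ioi (0 : ℝ), (ENNReal.ofReal (1 - t) * volume {x | ENNReal.ofReal s < f x}
      + ENNReal.ofReal t * volume {x | ENNReal.ofReal s < g x}) := by
        rw [lintegral_add_left ((hmeas f).const_mul _), lintegral_const_mul _ (hmeas f),
          lintegral_const_mul _ (hmeas g), hfi, hgi]
    _ ≤ ∫⁻ x, min (h x) 1 := by
        rw [hhi]; exact setLIntegral_mono' measurableSet_Ioi key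
    _ ≤ ∫⁻ x, h x := lintegral_mono fun x => min_le_left _ _

/-- Hypothesis and conclusion are homogeneous, of degree `1 - t` in `f` and `t` in `g`, so each
function can be divided by its supremum. -/
theorem prekopaLeindler_real_of_le {t : ℝ} (ht0 : 0 < t) (ht1 : t < 1) {f g h : ℝ → ℝ≥0∞}
    (hf : Measurable f) (hg : Measurable g) (hh : Measurable h) {n : ℝ≥0∞} (hn : n ≠ ⊤)
    (hfn : ∀ x, f x ≤ n) (hgn : ∀ x, g x ≤ n)
    (H : ∀ x y, f x ^ (1 - t) * g y ^ t ≤ h ((1 - t) • x + t • y)) :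
    (∫⁻ x, f x) ^ (1 - t) * (∫⁻ x, g x) ^ t ≤ ∫⁻ x, h x := by
  have ht1' : 0 < 1 - t := by linarith
  set a := ⨆ x, f x with ha
  set b := ⨆ x, g x with hb
  have hat : a ≠ ⊤ := ((iSup_le hfn).trans_lt hn.lt_top).ne
  have hbt : b ≠ ⊤ := ((iSup_le hgn).trans_lt hn.lt_top).ne
  rcases eq_or_ne a 0 with ha0 | ha0
  · have : ∀ x, f x = 0 := fun x => le_antisymm (ha0 ▸ le_iSup f x) bot_le
    simp [this, ht1']
  rcases eq_or_ne b 0 with hb0 | hb0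
  · have : ∀ x, g x = 0 := fun x => le_antisymm (hb0 ▸ le_iSup g x) bot_le
    simp [this, ht0]
  have ha' : a⁻¹ ≠ ⊤ := by simpa using ha0
  have hb' : b⁻¹ ≠ ⊤ := by simpa using hb0
  have key := prekopaLeindler_real_of_normalized ht0 ht1 (f := fun x => a⁻¹ * f x)
    (g := fun x => b⁻¹ * g x) (h := fun x => (a⁻¹ ^ (1 - t) * b⁻¹ ^ t) * h x) (hf.const_mul _)
    (hg.const_mul _) (hh.const_mul _)
    (by rw [← ENNReal.mul_iSup, ← ha, ENNReal.inv_mul_cancel ha0 hat])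
    (by rw [← ENNReal.mul_iSup, ← hb, ENNReal.inv_mul_cancel hb0 hbt])
    (fun x y => by
      rw [ENNReal.mul_rpow_of_nonneg _ _ ht1'.le, ENNReal.mul_rpow_of_nonneg _ _ ht0.le,
        mul_mul_mul_comm]
      gcongr
      exact H x y)
  rw [lintegral_const_mul _ hf, lintegral_const_mul _ hg, lintegral_const_mul _ hh,
    ENNReal.mul_rpow_of_nonneg _ _ ht1'.le, ENNReal.mul_rpow_of_nonneg _ _ ht0.le,
    mul_mul_mul_comm] at key
  refine (ENNReal.mul_le_mul_iff_right ?_ ?_).1 key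
  · refine mul_ne_zero ?_ ?_
    · simp [ENNReal.rpow_eq_zero_iff, hat, ha0, ht1'.not_gt]
    · simp [ENNReal.rpow_eq_zero_iff, hbt, hb0, ht0.not_gt]
  · exact ENNReal.mul_ne_top (ENNReal.rpow_ne_top_of_nonneg ht1'.le ha')
      (ENNReal.rpow_ne_top_of_nonneg ht0.le hb')

theorem iSup_min_natCast (c : ℝ≥0∞) : ⨆ n : ℕ, min c n = c := by
  refine le_antisymm (iSup_le fun n => min_le_left _ _) ?_
  rcases eq_or_ne c ⊤ with rfl | hc
  · simp [ENNReal.iSup_natCast]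
  · obtain ⟨n, hn⟩ := ENNReal.exists_nat_gt hc
    exact le_iSup_of_le n (le_min le_rfl hn.le)

theorem lintegral_eq_iSup_min {α : Type*} [MeasurableSpace α] {μ : Measure α} {f : α → ℝ≥0∞}
    (hf : Measurable f) : ∫⁻ x, f x ∂μ = ⨆ n : ℕ, ∫⁻ x, min (f x) n ∂μ := by
  rw [← lintegral_iSup (fun n => hf.min measurable_const)]
  · simp only [iSup_min_natCast]
  · exact fun n m hnm x => min_le_min_left _ (by exact_mod_cast hnm)

theorem isPrekopaLeindler_real : IsPrekopaLeindler (volume : Measure ℝ) := by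
  intro t ht0 ht1 f g h hf hg hh H
  have ht1' : 0 < 1 - t := by linarith
  have key : ∀ n : ℕ, (∫⁻ x, min (f x) n) ^ (1 - t) * (∫⁻ x, min (g x) n) ^ t ≤ ∫⁻ x, h x := by
    intro n
    refine prekopaLeindler_real_of_le ht0 ht1 (hf.min measurable_const) (hg.min measurable_const)
      hh (ENNReal.natCast_ne_top n) (fun x => min_le_right _ _) (fun x => min_le_right _ _)
      fun x y => ?_
    refine le_trans ?_ (H x y)
    gcongr <;> exact min_le_left _ _
  have lim : ∀ F : ℝ → ℝ≥0∞, Measurable F → ∀ p : ℝ,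
      Tendsto (fun n : ℕ => (∫⁻ x, min (F x) n) ^ p) atTop (𝓝 ((∫⁻ x, F x) ^ p)) := by
    intro F hF p
    refine (ENNReal.continuous_rpow_const.tendsto _).comp ?_
    rw [lintegral_eq_iSup_min hF]
    exact tendsto_atTop_iSup fun n m hnm =>
      lintegral_mono fun x => min_le_min_left _ (by exact_mod_cast hnm)
  -- Vanishing integrals are split off since multiplication on `ℝ≥0∞` is not continuous at `0 · ∞`.
  rcases eq_or_ne (∫⁻ x, f x) 0 with hf0 | hf0
  · simp [hf0, ht1']
  rcases eq_or_ne (∫⁻ x, g x) 0 with hg0 | hg0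
  · simp [hg0, ht0]
  refine le_of_tendsto (ENNReal.Tendsto.mul (lim f hf _) (Or.inl ?_) (lim g hg _) (Or.inl ?_))
    (Eventually.of_forall key)
  · simp [ENNReal.rpow_eq_zero_iff, hf0, ht1'.not_gt]
  · simp [ENNReal.rpow_eq_zero_iff, hg0, ht0.not_gt]

theorem isPrekopaLeindler_E3 : IsPrekopaLeindler (volume : Measure E3) := by
  have h3 : IsPrekopaLeindler (volume : Measure (ℝ × ℝ × ℝ)) :=
    isPrekopaLeindler_real.prod (isPrekopaLeindler_real.prod isPrekopaLeindler_real)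
  have h2 : IsPrekopaLeindler (volume : Measure (ℝ × (Fin 2 → ℝ))) :=
    isPrekopaLeindler_real.prod
      ((isPrekopaLeindler_real.prod isPrekopaLeindler_real).of_measurePreserving
        MeasurableEquiv.finTwoArrow.symm
        (volume_preserving_finTwoArrow ℝ).symm
        (fun t x y => by ext i; fin_cases i <;> simp [MeasurableEquiv.finTwoArrow]))
  have h1 : IsPrekopaLeindler (volume : Measure (Fin 3 → ℝ)) :=
    h2.of_measurePreserving (MeasurableEquiv.piFinSuccAbove (fun _ => ℝ) 0).symm
      (volume_preserving_piFinSuccAbove (fun _ => ℝ) 0).symm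
      (fun t x y => by
        ext i
        refine Fin.cases ?_ (fun j => ?_) i <;>
          simp [MeasurableEquiv.piFinSuccAbove, Fin.insertNthEquiv])
  exact h1.of_measurePreserving (MeasurableEquiv.toLp 2 (Fin 3 → ℝ))
    (PiLp.volume_preserving_toLp (Fin 3))
    (fun t x y => rfl)

/-! ### Brunn–Minkowski for a set and a ball, and the isoperimetric profile -/

/-- The volume of the unit ball of `E3`. -/
noncomputable def unitBallVolume : ℝ := Real.pi * 4 / 3

theorem unitBallVolume_pos : 0 < unitBallVolume := by unfold unitBallVolume; positivity

theorem volume_ball_E3 (x : E3) {r : ℝ} (hr : 0 ≤ r) :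
    volume (Metric.ball x r) = ENNReal.ofReal (unitBallVolume * r ^ 3) := by
  rw [EuclideanSpace.volume_ball_fin_three, mul_comm, ENNReal.ofReal_mul unitBallVolume_pos.le,
    ENNReal.ofReal_pow hr]; rfl

open scoped Pointwise in
/-- The Brunn–Minkowski inequality for an open set and a ball. -/
theorem ofReal_add_pow_le_volume_thickening {A : Set E3} (hA : IsOpen A) {a h : ℝ} (ha : 0 < a)
    (hAa : volume A = ENNReal.ofReal (unitBallVolume * a ^ 3)) (hh : 0 < h) :
    ENNReal.ofReal (unitBallVolume * (a + h) ^ 3) ≤ volume (Metric.thickening h A) := by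
  have hω := unitBallVolume_pos
  -- For this `t` the dilate `(1 - t)⁻¹ • A` has the volume of a ball of radius `a + h`. Both
  -- functions fed to Prékopa–Leindler thus have the same integral, which is its own geometric mean,
  -- while the convex combination of the two sets lies in `A + B(0, h)`.
  set t := h / (a + h) with ht
  have hah : 0 < a + h := by positivity
  have ht0 : 0 < t := by positivity
  have ht1 : t < 1 := by rw [ht, div_lt_one hah]; linarith
  have h1t : 1 - t = a / (a + h) := by rw [ht]; field_simp; ring
  have h1t0 : 0 < 1 - t := by linarith
  have key := isPrekopaLeindler_E3 t ht0 ht1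
    (((1 - t)⁻¹ • A).indicator 1) ((Metric.ball (0 : E3) (a + h)).indicator 1)
    ((Metric.thickening h A).indicator 1)
    (measurable_one.indicator (hA.measurableSet.const_smul₀ _))
    (measurable_one.indicator measurableSet_ball)
    (measurable_one.indicator Metric.isOpen_thickening.measurableSet) (fun x y => ?_)
  · rw [lintegral_indicator_one (hA.measurableSet.const_smul₀ _),
      lintegral_indicator_one measurableSet_ball,
      lintegral_indicator_one Metric.isOpen_thickening.measurableSet,
      Measure.addHaar_smul, hAa, volume_ball_E3 _ hah.le, ← ENNReal.ofReal_mul (by positivity)] at key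
    have e : |(1 - t)⁻¹ ^ Module.finrank ℝ E3| * (unitBallVolume * a ^ 3)
        = unitBallVolume * (a + h) ^ 3 := by
      rw [finrank_euclideanSpace_fin, abs_of_pos (by positivity), h1t]
      field_simp
    rw [e] at key
    have hpos : ENNReal.ofReal (unitBallVolume * (a + h) ^ 3) ≠ 0 := by
      simp only [ne_eq, ENNReal.ofReal_eq_zero, not_le]; positivity
    rwa [← ENNReal.rpow_add _ _ hpos ENNReal.ofReal_ne_top, sub_add_cancel, ENNReal.rpow_one] at key
  · by_cases hx : x ∈ (1 - t)⁻¹ • A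
    swap
    · simp [indicator_of_notMem hx, h1t0]
    by_cases hy : y ∈ Metric.ball (0 : E3) (a + h)
    swap
    · simp only [indicator_of_notMem hy, ENNReal.zero_rpow_of_pos ht0, mul_zero, zero_le]
    obtain ⟨z, hz, rfl⟩ := hx
    have : (1 - t) • ((1 - t)⁻¹ • z) + t • y ∈ Metric.thickening h A := by
      rw [smul_smul, mul_inv_cancel₀ h1t0.ne', one_smul]
      refine Metric.mem_thickening_iff.2 ⟨z, hz, ?_⟩
      rw [dist_eq_norm, add_sub_cancel_left, norm_smul, Real.norm_eq_abs, abs_of_pos ht0]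
      rw [mem_ball_zero_iff] at hy
      calc t * ‖y‖ < t * (a + h) := by gcongr
        _ = h := by rw [ht]; field_simp
    have hx' : (1 - t)⁻¹ • z ∈ (1 - t)⁻¹ • A := ⟨z, hz, rfl⟩
    simp only [] 
    rw [indicator_of_mem hx', indicator_of_mem hy, indicator_of_mem this]
    simp

/-- The surface-area density `3 ω^{1/3} V^{2/3}` of a ball of volume `V`. -/
noncomputable def isoProfile (V : ℝ≥0∞) : ℝ≥0∞ :=
  ENNReal.ofReal (3 * unitBallVolume ^ (1 / 3 : ℝ)) * V ^ (2 / 3 : ℝ)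

theorem isoProfile_ofReal {a : ℝ} (ha : 0 ≤ a) :
    isoProfile (ENNReal.ofReal (unitBallVolume * a ^ 3)) =
      ENNReal.ofReal (3 * unitBallVolume * a ^ 2) := by
  have hω := unitBallVolume_pos
  rw [isoProfile, ENNReal.ofReal_rpow_of_nonneg (by positivity) (by norm_num),
    ← ENNReal.ofReal_mul (by positivity)]
  congr 1
  rw [Real.mul_rpow hω.le (by positivity), ← Real.rpow_natCast a 3, ← Real.rpow_mul ha]
  have : unitBallVolume ^ (1 / 3 : ℝ) * unitBallVolume ^ (2 / 3 : ℝ) = unitBallVolume := by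
    rw [← Real.rpow_add hω]; norm_num
  have e2 : a ^ (((3 : ℕ) : ℝ) * (2 / 3)) = a ^ 2 := by
    rw [← Real.rpow_natCast a 2]; norm_num
  rw [e2]
  linear_combination (3 * a ^ 2) * this

theorem isoProfile_mono : Monotone isoProfile := fun a b h => by
  unfold isoProfile; gcongr

theorem exists_volumeRadius {V : ℝ≥0∞} (hV : V ≠ ⊤) :
    ∃ a : ℝ, 0 ≤ a ∧ V = ENNReal.ofReal (unitBallVolume * a ^ 3) := by
  have hω := unitBallVolume_pos
  refine ⟨(V.toReal / unitBallVolume) ^ (1 / 3 : ℝ), by positivity, ?_⟩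
  rw [← Real.rpow_natCast, ← Real.rpow_mul (by positivity)]
  norm_num
  rw [mul_div_cancel₀ _ hω.ne', ENNReal.ofReal_toReal hV]

/-- Keeps the terms of order at most one in `h` of `(a + h)³`. -/
theorem volume_add_mul_isoProfile_le {A : Set E3} (hA : IsOpen A) {h : ℝ} (hh : 0 < h)
    (hfin : volume A ≠ ⊤) :
    volume A + ENNReal.ofReal h * isoProfile (volume A) ≤ volume (Metric.thickening h A) := by
  have hω := unitBallVolume_pos
  obtain ⟨a, ha, hAa⟩ := exists_volumeRadius hfin
  rcases ha.eq_or_lt with rfl | ha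
  · simp [hAa, isoProfile]
  refine le_trans ?_ (ofReal_add_pow_le_volume_thickening hA ha hAa hh)
  rw [hAa, isoProfile_ofReal ha.le, ← ENNReal.ofReal_mul hh.le, ← ENNReal.ofReal_add (by positivity) (by positivity)]
  refine ENNReal.ofReal_le_ofReal ?_
  have : 0 ≤ unitBallVolume * (3 * a * h ^ 2 + h ^ 3) := by positivity
  nlinarith

/-! ### The isoperimetric inequality integrated over level sets -/

/-- The supremum of `w` over the open ball of radius `h`. -/
noncomputable def ballSup (w : E3 → ℝ) (h : ℝ) (x : E3) : ℝ≥0∞ :=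
  ⨆ y ∈ Metric.ball x h, ENNReal.ofReal (w y)

/-- This is the purpose of `ballSup`: Brunn–Minkowski can be applied height by height. -/
theorem superlevel_ballSup (w : E3 → ℝ) (h : ℝ) (s : ℝ≥0∞) :
    {x | s < ballSup w h x} = Metric.thickening h {x | s < ENNReal.ofReal (w x)} := by
  ext x
  simp only [mem_ofPred_eq, ballSup, lt_iSup_iff, Metric.mem_thickening_iff, Metric.mem_ball]
  constructor
  · rintro ⟨y, hy, hs⟩; exact ⟨y, hs, by rwa [dist_comm]⟩
  · rintro ⟨y, hs, hy⟩; exact ⟨y, by rwa [dist_comm], hs⟩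

theorem measurable_ballSup (w : E3 → ℝ) (h : ℝ) : Measurable (ballSup w h) :=
  measurable_of_Ioi fun s => by
    have := superlevel_ballSup w h s
    change MeasurableSet {x | s < ballSup w h x}
    rw [this]; exact Metric.isOpen_thickening.measurableSet

theorem ballSup_le {w : E3 → ℝ} {h c : ℝ} {x : E3} (hc : ∀ y ∈ Metric.ball x h, w y ≤ c) :
    ballSup w h x ≤ ENNReal.ofReal c :=
  iSup₂_le fun y hy => ENNReal.ofReal_le_ofReal (hc y hy)

theorem LipschitzWith.ballSup_le {C : ℝ≥0} {w : E3 → ℝ} (hw : LipschitzWith C w) (h : ℝ) (x : E3) :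
    ballSup w h x ≤ ENNReal.ofReal (w x + C * h) := by
  refine IsocapacitaryMass.ballSup_le fun y hy => ?_
  have h1 := hw.dist_le_mul y x
  rw [Real.dist_eq] at h1
  have h2 : (C : ℝ) * dist y x ≤ C * h := by
    gcongr; exact (Metric.mem_ball.1 hy).le
  linarith [le_abs_self (w y - w x)]

theorem measurable_comp_superlevel {α : Type*} [MeasurableSpace α] (μ : Measure α) (f : α → ℝ≥0∞)
    {Θ : ℝ≥0∞ → ℝ≥0∞} (hΘ : Monotone Θ) :
    Measurable fun s : ℝ => Θ (μ {x | ENNReal.ofReal s < f x}) :=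
  Antitone.measurable fun _ _ hss => hΘ <| measure_mono fun _ hx =>
    lt_of_le_of_lt (ENNReal.ofReal_le_ofReal hss) hx

/-- A discrete substitute for the coarea formula: the layer cake formula for `w` and for `ballSup w
h`, with `volume_add_mul_isoProfile_le` at each height. -/
theorem mul_lintegral_isoProfile_le {C : ℝ≥0} {w : E3 → ℝ} (hw : LipschitzWith C w)
    (hsupp : HasCompactSupport w) {h : ℝ} (hh : 0 < h) :
    ENNReal.ofReal h * ∫⁻ t in Ioi (0 : ℝ), isoProfile (volume {x | ENNReal.ofReal t < ENNReal.ofReal (w x)})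
      ≤ ∫⁻ x, (ballSup w h x - ENNReal.ofReal (w x)) := by
  have hwc := hw.continuous
  have hwm : Measurable fun x => ENNReal.ofReal (w x) := by fun_prop
  have hfin : ∫⁻ x, ENNReal.ofReal (w x) ≠ ⊤ :=
    (hwc.integrable_of_hasCompactSupport hsupp).lintegral_lt_top.ne
  rw [lintegral_sub hwm hfin]
  · refine ENNReal.le_sub_of_add_le_left hfin ?_
    rw [lintegral_eq_lintegral_superlevel volume hwm (fun x => ENNReal.ofReal_ne_top),
      lintegral_eq_lintegral_superlevel volume (measurable_ballSup w h)
        (fun x => ((LipschitzWith.ballSup_le hw h x).trans_lt ENNReal.ofReal_lt_top).ne),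
      ← lintegral_const_mul _ (measurable_comp_superlevel volume _ isoProfile_mono),
      ← lintegral_add_left (measurable_comp_superlevel volume _ (Θ := fun v => v) monotone_id)]
    refine setLIntegral_mono' measurableSet_Ioi fun t ht => ?_
    rw [superlevel_ballSup]
    refine volume_add_mul_isoProfile_le ?_ hh ?_
    · exact isOpen_lt continuous_const (ENNReal.continuous_ofReal.comp hwc)
    · refine ((measure_mono (t := tsupport w) ?_).trans_lt hsupp.measure_lt_top).ne
      intro x hx
      refine subset_tsupport w ?_
      intro h0
      simp [h0] at hx
  · refine Eventually.of_forall fun x => ?_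
    exact le_iSup₂_of_le (f := fun y (_ : y ∈ Metric.ball x h) => ENNReal.ofReal (w y)) x (Metric.mem_ball_self hh) le_rfl

theorem limsup_ballSup_sub_le {w : E3 → ℝ} {x : E3} (hw : DifferentiableAt ℝ w x) (hw0 : 0 ≤ w x) {h : ℕ → ℝ}
    (hpos : ∀ n, 0 < h n) (hlim : Tendsto h atTop (𝓝 0)) :
    limsup (fun n => (ENNReal.ofReal (h n))⁻¹ * (ballSup w (h n) x - ENNReal.ofReal (w x))) atTop
      ≤ ‖fderiv ℝ w x‖ₑ := by
  refine ENNReal.le_of_forall_pos_le_add fun ε hε _ => ?_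
  refine limsup_le_of_le (by isBoundedDefault) ?_
  have hd := hw.hasFDerivAt.isLittleO.def (c := ε) (by exact_mod_cast hε)
  obtain ⟨δ, hδ, hball⟩ := Metric.eventually_nhds_iff_ball.1 hd
  filter_upwards [(tendsto_order.1 hlim).2 δ hδ] with n hn
  have hle : ballSup w (h n) x ≤ ENNReal.ofReal (w x + (‖fderiv ℝ w x‖ + ε) * h n) := by
    refine ballSup_le fun y hy => ?_
    have h1 := hball y (Metric.ball_subset_ball hn.le hy)
    have hyn : ‖y - x‖ ≤ h n := by rw [← dist_eq_norm]; exact (Metric.mem_ball.1 hy).le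
    have h2 := (fderiv ℝ w x).le_opNorm (y - x)
    have h3 := (Real.norm_eq_abs _ ▸ le_abs_self _ : (fderiv ℝ w x) (y - x) ≤ ‖(fderiv ℝ w x) (y - x)‖)
    have h4 := (Real.norm_eq_abs _ ▸ le_abs_self _ :
      w y - w x - (fderiv ℝ w x) (y - x) ≤ ‖w y - w x - (fderiv ℝ w x) (y - x)‖)
    have h5 : (‖fderiv ℝ w x‖ + ε) * ‖y - x‖ ≤ (‖fderiv ℝ w x‖ + ε) * h n := by gcongr
    linarith
  have hn0 : ENNReal.ofReal (h n) ≠ 0 := by simpa using hpos n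
  rw [ENNReal.inv_mul_le_iff hn0 ENNReal.ofReal_ne_top]
  refine tsub_le_iff_left.2 (hle.trans ?_)
  rw [ENNReal.ofReal_add hw0 (mul_nonneg (by positivity) (hpos n).le), mul_comm,
    ENNReal.ofReal_mul (hpos n).le, ENNReal.ofReal_add (norm_nonneg _) (by positivity), ofReal_norm]
  simp

/-- The sharp isoperimetric inequality, integrated over the superlevel sets of a Lipschitz
function. -/
theorem lintegral_isoProfile_le {C : ℝ≥0} {w : E3 → ℝ} (hw : LipschitzWith C w)
    (hsupp : HasCompactSupport w) (hw0 : ∀ x, 0 ≤ w x) :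
    ∫⁻ t in Ioi (0 : ℝ), isoProfile (volume {x | ENNReal.ofReal t < ENNReal.ofReal (w x)})
      ≤ ∫⁻ x, ‖fderiv ℝ w x‖ₑ := by
  set h : ℕ → ℝ := fun n => 1 / ((n : ℝ) + 1) with hh
  have hpos : ∀ n, 0 < h n := fun n => by simp only [hh]; positivity
  have hle1 : ∀ n, h n ≤ 1 := fun n => by
    simp only [hh]; rw [div_le_one (by positivity)]; linarith [(Nat.cast_nonneg n : (0 : ℝ) ≤ n)]
  have hlim : Tendsto h atTop (𝓝 0) := tendsto_one_div_add_atTop_nhds_zero_nat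
  set D : ℕ → E3 → ℝ≥0∞ := fun n x =>
    (ENNReal.ofReal (h n))⁻¹ * (ballSup w (h n) x - ENNReal.ofReal (w x)) with hD
  have hsub : ∀ n, Measurable fun x => ballSup w (h n) x - ENNReal.ofReal (w x) := fun n =>
    (measurable_ballSup w (h n)).sub (by have := hw.continuous; fun_prop)
  have hDm : ∀ n, Measurable (D n) := fun n => (hsub n).const_mul _
  have hstep : ∀ n, ∫⁻ t in Ioi (0 : ℝ),
      isoProfile (volume {x | ENNReal.ofReal t < ENNReal.ofReal (w x)}) ≤ ∫⁻ x, D n x := by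
    intro n
    have hn0 : ENNReal.ofReal (h n) ≠ 0 := by simpa using hpos n
    simp only [hD]
    rw [lintegral_const_mul _ (hsub n),
      ← ENNReal.mul_le_iff_le_inv hn0 ENNReal.ofReal_ne_top]
    exact mul_lintegral_isoProfile_le hw hsupp (hpos n)
  -- All step sizes are at most `1`, so every quotient `D n` vanishes off this compact set and is at
  -- most the Lipschitz constant on it. This is the domination needed for the reverse Fatou lemma.
  set K := Metric.cthickening 1 (tsupport w) with hK
  have hKc : IsCompact K := hsupp.isCompact.cthickening
  have hDle : ∀ n x, D n x ≤ K.indicator (fun _ => (C : ℝ≥0∞)) x := by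
    intro n x
    have hn0 : ENNReal.ofReal (h n) ≠ 0 := by simpa using hpos n
    simp only [hD]
    rw [ENNReal.inv_mul_le_iff hn0 ENNReal.ofReal_ne_top]
    by_cases hx : x ∈ K
    · rw [indicator_of_mem hx]
      refine tsub_le_iff_left.2 ((LipschitzWith.ballSup_le hw (h n) x).trans ?_)
      rw [ENNReal.ofReal_add (hw0 x) (mul_nonneg C.coe_nonneg (hpos n).le), mul_comm (C : ℝ),
        ENNReal.ofReal_mul (hpos n).le]
      simp
    · have : ballSup w (h n) x ≤ ENNReal.ofReal 0 := by
        refine ballSup_le fun y hy => le_of_eq ?_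
        refine image_eq_zero_of_notMem_tsupport fun hy' => hx ?_
        refine Metric.mem_cthickening_of_dist_le x y 1 _ hy' ?_
        rw [dist_comm]; exact (Metric.mem_ball.1 hy).le.trans (hle1 n)
      have h0 : ballSup w (h n) x = 0 := by simpa using this
      simp [h0]
  have hfin : ∫⁻ x, K.indicator (fun _ => (C : ℝ≥0∞)) x ≠ ⊤ := by
    rw [lintegral_indicator_const hKc.isClosed.measurableSet]
    exact ENNReal.mul_ne_top ENNReal.coe_ne_top hKc.measure_lt_top.ne
  calc _ ≤ limsup (fun n => ∫⁻ x, D n x) atTop :=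
        le_limsup_of_frequently_le (Frequently.of_forall hstep)
    _ ≤ ∫⁻ x, limsup (fun n => D n x) atTop :=
        limsup_lintegral_le _ hDm (fun n => Eventually.of_forall (hDle n)) hfin
    _ ≤ ∫⁻ x, ‖fderiv ℝ w x‖ₑ := by
        refine lintegral_mono_ae ?_
        filter_upwards [hw.ae_differentiableAt] with x hx
        exact limsup_ballSup_sub_le hx (hw0 x) hpos hlim

/-- Compactness gives a constant on a ball one unit larger than the support. If one point lies
beyond that ball, then either both values vanish or the points are at least `1` apart, and the sup
bound `D` serves as a Lipschitz constant. -/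
theorem exists_lipschitzWith_of_hasCompactSupport {w : E3 → ℝ} (hw : LocallyLipschitz w)
    (hsupp : HasCompactSupport w) : ∃ C : ℝ≥0, LipschitzWith C w := by
  obtain ⟨R, hR⟩ := hsupp.isCompact.isBounded.subset_closedBall (0 : E3)
  obtain ⟨C, hC⟩ := (hw.locallyLipschitzOn (s := Metric.closedBall (0 : E3) (R + 1))).exists_lipschitzOnWith_of_compact
    (isCompact_closedBall _ _)
  obtain ⟨D, hD⟩ := hsupp.exists_bound_of_continuous hw.continuous
  have hz : ∀ x, R < ‖x‖ → w x = 0 := fun x hx => by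
    refine image_eq_zero_of_notMem_tsupport fun h => ?_
    have := hR h
    rw [mem_closedBall_zero_iff] at this
    linarith
  have hfar : ∀ x y, R + 1 < ‖y‖ → dist (w x) (w y) ≤ D.toNNReal * dist x y := by
    intro x y hy
    rw [hz y (by linarith)]
    by_cases hx : ‖x‖ ≤ R
    · have h1 : 1 ≤ dist x y := by
        rw [dist_comm, dist_eq_norm]
        linarith [norm_sub_norm_le y x]
      rw [dist_zero_right]
      calc ‖w x‖ ≤ D := hD x
        _ ≤ D.toNNReal := Real.le_coe_toNNReal D
        _ = D.toNNReal * 1 := (mul_one _).symm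
        _ ≤ _ := by gcongr
    · rw [hz x (by linarith)]; simp; positivity
  refine ⟨max C D.toNNReal, LipschitzWith.of_dist_le_mul fun x y => ?_⟩
  have hC1 : (C : ℝ) ≤ (max C D.toNNReal : ℝ≥0) := by exact_mod_cast le_max_left _ _
  have hC2 : (D.toNNReal : ℝ) ≤ (max C D.toNNReal : ℝ≥0) := by exact_mod_cast le_max_right _ _
  by_cases hy : R + 1 < ‖y‖
  · exact (hfar x y hy).trans (by gcongr)
  by_cases hx : R + 1 < ‖x‖
  · rw [dist_comm, dist_comm x y]; exact (hfar y x hx).trans (by gcongr)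
  · exact (hC.dist_le_mul x (by simpa using hx) y (by simpa using hy)).trans (by gcongr)

/-! ### Isoperimetry for the sublevel sets of a competitor -/

/-- The truncation `(b - φ⁺)⁺`. -/
noncomputable def truncation (φ : E3 → ℝ) (b : ℝ) (x : E3) : ℝ := max 0 (b - max 0 (φ x))

theorem locallyLipschitz_truncation {φ : E3 → ℝ} (hφ : LocallyLipschitz φ) (b : ℝ) :
    LocallyLipschitz (truncation φ b) := by
  have h1 : LocallyLipschitz fun x => max 0 (φ x) := hφ.const_max 0
  have h2 : LipschitzWith 1 fun t : ℝ => b - t := by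
    refine LipschitzWith.of_dist_le_mul fun x y => ?_
    simp [dist_eq_norm, norm_sub_rev]
  exact (h2.locallyLipschitz.comp h1).const_max 0

theorem hasCompactSupport_truncation {φ : E3 → ℝ} (hφ1 : Tendsto φ (cocompact E3) (𝓝 1)) {b : ℝ}
    (hb : b < 1) : HasCompactSupport (truncation φ b) := by
  have h := (tendsto_order.1 hφ1).1 b hb
  rw [hasCompactSupport_iff_eventuallyEq, coclosedCompact_eq_cocompact]
  filter_upwards [h] with x hx
  have : φ x ≤ max 0 (φ x) := le_max_right _ _
  simp only [truncation, Pi.zero_apply, sup_eq_left]; linarith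

/-- Off `{0 < φ < b}` the truncation attains its global maximum or minimum, so `fderiv` vanishes
there, also by convention when the derivative does not exist. No almost-everywhere argument is
needed. -/
theorem enorm_fderiv_truncation_le (φ : E3 → ℝ) (b : ℝ) {x : E3} (hc : ContinuousAt φ x) :
    ‖fderiv ℝ (truncation φ b) x‖ₑ ≤ {x | 0 < φ x ∧ φ x < b}.indicator (fun x => ‖fderiv ℝ φ x‖ₑ) x := by
  by_cases hx : 0 < φ x ∧ φ x < b
  · rw [indicator_of_mem (show x ∈ {x | 0 < φ x ∧ φ x < b} from hx)]
    have : truncation φ b =ᶠ[𝓝 x] fun y => b - φ y := by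
      filter_upwards [hc.eventually (lt_mem_nhds hx.1), hc.eventually (gt_mem_nhds hx.2)] with y h1 h2
      simp only [truncation]
      rw [max_eq_right h1.le, max_eq_right (by linarith)]
    rw [this.fderiv_eq, fderiv_const_sub, enorm_neg]
  · rw [indicator_of_notMem (show x ∉ {x | 0 < φ x ∧ φ x < b} from hx)]
    have : fderiv ℝ (truncation φ b) x = 0 := by
      by_cases h0 : 0 < φ x
      · have hb : b ≤ φ x := by by_contra h; exact hx ⟨h0, not_le.1 h⟩
        refine IsLocalMin.fderiv_eq_zero (Eventually.of_forall fun y => ?_)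
        have : truncation φ b x = 0 := by
          simp only [truncation, sup_eq_left]; linarith [le_max_right 0 (φ x)]
        rw [this]; exact le_max_left _ _
      · refine IsLocalMax.fderiv_eq_zero (Eventually.of_forall fun y => ?_)
        simp only [truncation]
        rw [max_eq_left (not_lt.1 h0)]
        exact max_le_max le_rfl (by linarith [le_max_left 0 (φ y)])
    rw [← ofReal_norm, this, norm_zero, ENNReal.ofReal_zero]

/-- The superlevel sets of `(b - φ⁺)⁺` are sublevel sets of `φ`, with heights reflected by `t ↦ b -
t`. The condition `b < 1` makes the support compact. -/
theorem lintegral_isoProfile_sublevel_le {φ : E3 → ℝ} (hφ : LocallyLipschitz φ)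
    (hφ1 : Tendsto φ (cocompact E3) (𝓝 1)) {b : ℝ} (hb1 : b < 1) :
    ∫⁻ s in Ioo 0 b, isoProfile (volume {x | φ x < s})
      ≤ ∫⁻ x in {x | 0 < φ x ∧ φ x < b}, ‖fderiv ℝ φ x‖ₑ := by
  obtain ⟨C, hC⟩ := exists_lipschitzWith_of_hasCompactSupport (locallyLipschitz_truncation hφ b)
    (hasCompactSupport_truncation hφ1 hb1)
  have h := lintegral_isoProfile_le hC (hasCompactSupport_truncation hφ1 hb1)
    (fun x => le_max_left _ _)
  have hcont := hφ.continuous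
  have hms : MeasurableSet {x | 0 < φ x ∧ φ x < b} :=
    ((isOpen_lt continuous_const hcont).inter (isOpen_lt hcont continuous_const)).measurableSet
  have hr : ∫⁻ x, ‖fderiv ℝ (truncation φ b) x‖ₑ ≤
      ∫⁻ x in {x | 0 < φ x ∧ φ x < b}, ‖fderiv ℝ φ x‖ₑ := by
    rw [← lintegral_indicator hms]
    exact lintegral_mono fun x => enorm_fderiv_truncation_le φ b hcont.continuousAt
  refine le_trans (b := ∫⁻ t in Ioo 0 b, isoProfile (volume {x | φ x < b - t})) (le_of_eq ?_)
    ((le_trans ?_ h).trans hr)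
  · have hmp : MeasurePreserving (fun t : ℝ => b - t) (volume.restrict (Ioo 0 b))
        (volume.restrict (Ioo 0 b)) := by
      have := ((volume : Measure ℝ).measurePreserving_sub_left b).restrict_preimage
        (s := Ioo 0 b) measurableSet_Ioo
      simpa using this
    exact (hmp.lintegral_comp_emb (MeasurableEquiv.subLeft b).measurableEmbedding
      (fun s => isoProfile (volume {x | φ x < s}))).symm
  · refine (setLIntegral_mono' measurableSet_Ioo fun t ht => ?_).trans
      (lintegral_mono_set Ioo_subset_Ioi_self)
    refine isoProfile_mono (measure_mono fun x hx => ?_)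
    simp only [mem_ofPred_eq] at hx ⊢
    rw [ENNReal.ofReal_lt_ofReal_iff_of_nonneg ht.1.le]
    refine lt_max_of_lt_right ?_
    have : max 0 (φ x) < b - t := max_lt (by linarith [ht.2]) hx
    linarith

/-- This brings weights into the isoperimetric inequality: to compare two weighted integrals it
suffices to compare the measures of the superlevel sets of the weights. -/
theorem lintegral_le_of_superlevel_le {α β : Type*} [MeasurableSpace α] [MeasurableSpace β]
    {μ : Measure α} {ν : Measure β} {f : α → ℝ≥0∞} {g : β → ℝ≥0∞} (hf : Measurable f)
    (hg : Measurable g) (hf' : ∀ x, f x ≠ ⊤) (hg' : ∀ x, g x ≠ ⊤)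
    (h : ∀ t : ℝ, 0 < t → μ {x | ENNReal.ofReal t < f x} ≤ ν {x | ENNReal.ofReal t < g x}) :
    ∫⁻ x, f x ∂μ ≤ ∫⁻ x, g x ∂ν := by
  rw [lintegral_eq_lintegral_superlevel μ hf hf', lintegral_eq_lintegral_superlevel ν hg hg']
  exact setLIntegral_mono' measurableSet_Ioi h

/-- Comparison of the weighted level-set measures along initial segments. -/
theorem lintegral_isoProfile_le_of_lowerSet {φ : E3 → ℝ} (hφ : LocallyLipschitz φ)
    (hφ1 : Tendsto φ (cocompact E3) (𝓝 1)) {J : Set ℝ} (hJ : J ⊆ Ioo 0 1)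
    (hlow : ∀ s ∈ J, ∀ r, 0 < r → r ≤ s → r ∈ J) :
    ∫⁻ s in J, isoProfile (volume {x | φ x < s}) ≤ ∫⁻ x in φ ⁻¹' J, ‖fderiv ℝ φ x‖ₑ := by
  rcases J.eq_empty_or_nonempty with rfl | hne
  · simp
  set c := sSup J with hc
  have hbdd : BddAbove J := ⟨1, fun s hs => (hJ hs).2.le⟩
  have hsub : Ioo 0 c ⊆ J := fun r hr => by
    obtain ⟨s, hs, hrs⟩ := exists_lt_of_lt_csSup hne hr.2
    exact hlow s hs r hr.1 hrs.le
  have hsup : J ⊆ Ioc 0 c := fun s hs => ⟨(hJ hs).1, le_csSup hbdd hs⟩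
  have hc1 : c ≤ 1 := csSup_le hne fun s hs => (hJ hs).2.le
  have hlim : ∃ u : ℕ → ℝ, StrictMono u ∧ (∀ n, u n < c) ∧ Tendsto u atTop (𝓝 c) :=
    exists_seq_strictMono_tendsto c
  obtain ⟨u, hu, huc, hulim⟩ := hlim
  -- The unweighted inequality requires an upper end strictly below `1`, hence the exhaustion from
  -- inside. The endpoint `c` is a null set on the left-hand side.
  have hU : Ioo 0 c = ⋃ n, Ioo 0 (u n) := by
    ext s; simp only [mem_Ioo, mem_iUnion]
    constructor
    · rintro ⟨h0, h1⟩
      obtain ⟨n, hn⟩ := ((tendsto_order.1 hulim).1 s h1).exists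
      exact ⟨n, h0, hn⟩
    · rintro ⟨n, h0, h1⟩; exact ⟨h0, h1.trans (huc n)⟩
  calc ∫⁻ s in J, isoProfile (volume {x | φ x < s})
      ≤ ∫⁻ s in Ioc 0 c, isoProfile (volume {x | φ x < s}) := lintegral_mono_set hsup
    _ = ∫⁻ s in Ioo 0 c, isoProfile (volume {x | φ x < s}) := by
        rw [restrict_Ioo_eq_restrict_Ioc]
    _ = ⨆ n, ∫⁻ s in Ioo 0 (u n), isoProfile (volume {x | φ x < s}) := by
        rw [hU, setLIntegral_iUnion_of_directed]
        exact directed_of_isDirected_le fun m n hmn => Ioo_subset_Ioo_right (hu.monotone hmn)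
    _ ≤ ∫⁻ x in φ ⁻¹' J, ‖fderiv ℝ φ x‖ₑ := by
        refine iSup_le fun n => (lintegral_isoProfile_sublevel_le hφ hφ1 ((huc n).trans_le hc1)).trans
          (lintegral_mono_set fun x hx => hsub ⟨hx.1, hx.2.trans (huc n)⟩)

/-- The distribution function `|{φ ≤ s}|`. -/
noncomputable def sublevelVolume (φ : E3 → ℝ) (s : ℝ) : ℝ≥0∞ := volume {x | φ x ≤ s}

theorem sublevelVolume_mono (φ : E3 → ℝ) : Monotone (sublevelVolume φ) :=
  fun _ _ h => measure_mono fun _ hx => le_trans hx h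

theorem sublevelVolume_ne_top {φ : E3 → ℝ} (hφ1 : Tendsto φ (cocompact E3) (𝓝 1)) {s : ℝ}
    (hs : s < 1) : sublevelVolume φ s ≠ ⊤ := by
  obtain ⟨K, hK, hsub⟩ := mem_cocompact.1 ((tendsto_order.1 hφ1).1 s hs)
  refine ((measure_mono fun x hx => ?_).trans_lt hK.measure_lt_top).ne
  by_contra hxK
  exact (not_lt.2 hx) (show s < φ x from hsub hxK)

/-- The values of `φ` on `{0 < φ < 1, |{φ ≤ φ x}| < n}` are reached on a set of measure at most
`n - |{φ ≤ 0}|`. -/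
theorem volume_sublevelVolume_lt_le {φ : E3 → ℝ} (hφ1 : Tendsto φ (cocompact E3) (𝓝 1))
    (hc : Continuous φ) (n : ℝ≥0∞) :
    volume {x | (0 < φ x ∧ φ x < 1) ∧ sublevelVolume φ (φ x) < n} ≤ n - sublevelVolume φ 0 := by
  set E := {x | (0 < φ x ∧ φ x < 1) ∧ sublevelVolume φ (φ x) < n} with hE
  have hm0 : MeasurableSet {x | φ x ≤ 0} := (isClosed_le hc continuous_const).measurableSet
  rcases E.eq_empty_or_nonempty with he | hne
  · simp [he]
  refine ENNReal.le_sub_of_add_le_right (sublevelVolume_ne_top hφ1 one_pos) ?_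
  have hdisj : Disjoint E {x | φ x ≤ 0} :=
    disjoint_left.2 fun x hx hx' => absurd hx.1.1 (not_lt.2 hx')
  rw [sublevelVolume, ← measure_union hdisj hm0]
  have hne' : (φ '' E).Nonempty := hne.image φ
  have hbdd : BddAbove (φ '' E) := ⟨1, by rintro _ ⟨x, hx, rfl⟩; exact hx.1.2.le⟩
  obtain ⟨u, hu, hulim, humem⟩ := exists_seq_tendsto_sSup hne' hbdd
  -- The distribution function may jump. If the supremum of the values is attained, `E ∪ {φ ≤ 0}`
  -- lies in one sublevel set of measure below `n`; otherwise it is covered by an increasing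
  -- sequence of such sets.
  by_cases hmax : sSup (φ '' E) ∈ φ '' E
  · obtain ⟨x, hx, hxe⟩ := hmax
    refine (measure_mono ?_).trans hx.2.le
    rintro y (hy | hy)
    · exact (le_csSup hbdd ⟨y, hy, rfl⟩).trans hxe.symm.le
    · exact le_trans (α := ℝ) hy hx.1.1.le
  · have hsub : E ∪ {x | φ x ≤ 0} ⊆ ⋃ k, {x | φ x ≤ u k} := by
      rintro y hy
      have hlt : φ y < sSup (φ '' E) := by
        rcases hy with hy | hy
        · exact lt_of_le_of_ne (le_csSup hbdd ⟨y, hy, rfl⟩) fun h => hmax (h ▸ ⟨y, hy, rfl⟩)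
        · obtain ⟨x, hx⟩ := hne
          exact lt_of_le_of_lt hy (hx.1.1.trans_le (le_csSup hbdd ⟨x, hx, rfl⟩))
      obtain ⟨k, hk⟩ := ((tendsto_order.1 hulim).1 _ hlt).exists
      exact mem_iUnion.2 ⟨k, hk.le⟩
    refine (measure_mono hsub).trans ?_
    have hmono : Monotone fun k => {x | φ x ≤ u k} :=
      fun i j hij x hx => le_trans (α := ℝ) hx (hu hij)
    rw [hmono.measure_iUnion]
    refine iSup_le fun k => ?_
    obtain ⟨x, hx, hxe⟩ := humem k
    rw [← hxe]; exact hx.2.le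

theorem lintegral_Ioi_rpow_neg {V : ℝ} (hV : 0 < V) :
    ∫⁻ n in Ioi V, ENNReal.ofReal n ^ (-(4 / 3) : ℝ) = ENNReal.ofReal (3 * V ^ (-(1 / 3) : ℝ)) := by
  have h1 : ∫⁻ n in Ioi V, ENNReal.ofReal n ^ (-(4 / 3) : ℝ) =
      ∫⁻ n in Ioi V, ENNReal.ofReal (n ^ (-(4 / 3) : ℝ)) :=
    setLIntegral_congr_fun measurableSet_Ioi fun n hn => by
      rw [ENNReal.ofReal_rpow_of_pos (hV.trans hn)]
  rw [h1, ← ofReal_integral_eq_lintegral_ofReal (integrableOn_Ioi_rpow_of_lt (by norm_num) hV),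
    integral_Ioi_rpow_of_lt (by norm_num) hV]
  · congr 1
    norm_num
    ring
  · exact (ae_restrict_mem measurableSet_Ioi).mono fun n hn =>
      Real.rpow_nonneg (hV.trans hn).le _

/-- The weight `|{φ ≤ s⁺}|^{-2/3}`. -/
noncomputable def levelWeight (φ : E3 → ℝ) (s : ℝ) : ℝ≥0∞ :=
  sublevelVolume φ (max s 0) ^ (-(2 / 3) : ℝ)

theorem levelWeight_antitone (φ : E3 → ℝ) : Antitone (levelWeight φ) := by
  intro s t h
  unfold levelWeight
  rw [ENNReal.rpow_neg, ENNReal.rpow_neg, ENNReal.inv_le_inv]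
  exact ENNReal.rpow_le_rpow (sublevelVolume_mono φ (max_le_max_right 0 h)) (by norm_num)

theorem levelWeight_ne_top {φ : E3 → ℝ} (h0 : sublevelVolume φ 0 ≠ 0) (s : ℝ) :
    levelWeight φ s ≠ ⊤ := by
  have : sublevelVolume φ (max s 0) ≠ 0 := fun h =>
    h0 (le_antisymm (h ▸ sublevelVolume_mono φ (le_max_right s 0)) bot_le)
  rw [levelWeight, ne_eq, ENNReal.rpow_eq_top_iff]
  rintro (⟨h, -⟩ | ⟨-, h⟩)
  · exact this h
  · norm_num at h

/-- The power `-2/3` cancels the isoperimetric profile, so the integrand is almost everywhere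
constant: `{φ < s}` and `{φ ≤ s}` differ in measure for at most countably many `s`. -/
theorem lintegral_levelWeight_mul_isoProfile {φ : E3 → ℝ} (hc : Continuous φ)
    (hφ1 : Tendsto φ (cocompact E3) (𝓝 1)) (h0 : sublevelVolume φ 0 ≠ 0) :
    ∫⁻ s in Ioo 0 1, isoProfile (volume {x | φ x < s}) * levelWeight φ s =
      ENNReal.ofReal (3 * unitBallVolume ^ (1 / 3 : ℝ)) := by
  have hcount : {s : ℝ | 0 < volume {x | φ x = s}}.Countable :=
    Measure.countable_meas_level_set_pos hc.measurable
  have hae : ∀ᵐ s : ℝ, volume {x | φ x = s} = 0 := by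
    have := hcount.ae_notMem (volume : Measure ℝ)
    filter_upwards [this] with s hs
    simpa using hs
  have : ∫⁻ s in Ioo (0 : ℝ) 1, isoProfile (volume {x | φ x < s}) * levelWeight φ s =
      ∫⁻ s in Ioo (0 : ℝ) 1, ENNReal.ofReal (3 * unitBallVolume ^ (1 / 3 : ℝ)) := by
    refine setLIntegral_congr_fun_ae measurableSet_Ioo ?_
    filter_upwards [hae] with s hs hs01
    have e : volume {x | φ x < s} = sublevelVolume φ s := by
      refine le_antisymm (measure_mono fun x (hx : φ x < s) => hx.le) ?_
      have : {x | φ x ≤ s} = {x | φ x < s} ∪ {x | φ x = s} := by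
        ext x; simp [le_iff_lt_or_eq]
      rw [sublevelVolume, this]
      exact (measure_union_le _ _).trans (by rw [hs, add_zero])
    have hn0 : sublevelVolume φ s ≠ 0 := fun h =>
      h0 (le_antisymm (h ▸ sublevelVolume_mono φ hs01.1.le) bot_le)
    have hnt := sublevelVolume_ne_top hφ1 hs01.2
    rw [e, isoProfile, levelWeight, max_eq_left hs01.1.le, mul_assoc,
      ← ENNReal.rpow_add _ _ hn0 hnt]
    norm_num
  rw [this]; simp

/-- The weight decreases in `s`, so its superlevel sets in `(0, 1)` are initial segments, and
`lintegral_isoProfile_le_of_lowerSet` compares them. -/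
theorem lintegral_levelWeight_mul_isoProfile_le {φ : E3 → ℝ} (hφ : LocallyLipschitz φ)
    (hφ1 : Tendsto φ (cocompact E3) (𝓝 1)) (h0 : sublevelVolume φ 0 ≠ 0) :
    ∫⁻ s in Ioo 0 1, isoProfile (volume {x | φ x < s}) * levelWeight φ s ≤
      ∫⁻ x in {x | 0 < φ x ∧ φ x < 1}, ‖fderiv ℝ φ x‖ₑ * levelWeight φ (φ x) := by
  have hc := hφ.continuous
  have hms : MeasurableSet {x | 0 < φ x ∧ φ x < 1} :=
    ((isOpen_lt continuous_const hc).inter (isOpen_lt hc continuous_const)).measurableSet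
  have hwm : Measurable (levelWeight φ) := (levelWeight_antitone φ).measurable
  have hiso : Measurable fun s => isoProfile (volume {x | φ x < s}) :=
    Monotone.measurable fun s t hst => isoProfile_mono (measure_mono fun x hx => lt_of_lt_of_le hx hst)
  have hder : Measurable fun x => ‖fderiv ℝ φ x‖ₑ := (measurable_fderiv ℝ φ).enorm
  have e1 := lintegral_withDensity_eq_lintegral_mul (volume.restrict (Ioo (0 : ℝ) 1)) hiso hwm
  have e2 := lintegral_withDensity_eq_lintegral_mul (volume.restrict {x | 0 < φ x ∧ φ x < 1}) hder
    (hwm.comp hc.measurable)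
  simp only [Pi.mul_apply, Function.comp_apply] at e1 e2
  rw [← e1, ← e2]
  refine lintegral_le_of_superlevel_le hwm (hwm.comp hc.measurable)
    (fun s => levelWeight_ne_top h0 s) (fun s => levelWeight_ne_top h0 _) fun t ht => ?_
  have m1 : MeasurableSet {s | ENNReal.ofReal t < levelWeight φ s} :=
    measurableSet_lt measurable_const hwm
  have m2 : MeasurableSet {x | ENNReal.ofReal t < levelWeight φ (φ x)} :=
    measurableSet_lt measurable_const (hwm.comp hc.measurable)
  rw [withDensity_apply _ m1, withDensity_apply _ m2, Measure.restrict_restrict m1,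
    Measure.restrict_restrict m2]
  refine (lintegral_isoProfile_le_of_lowerSet hφ hφ1 inter_subset_right ?_).trans (le_of_eq ?_)
  · rintro s ⟨hs, hs1⟩ r hr hrs
    exact ⟨lt_of_lt_of_le hs (levelWeight_antitone φ hrs), hr, hrs.trans_lt hs1.2⟩
  · rfl

/-- By `volume_sublevelVolume_lt_le`, the values of the distribution function along `φ` are at most
as concentrated near `V` as Lebesgue measure on `(V, ∞)`. The bound is the integral of the
decreasing function `n^(-4/3)` over that half-line. -/
theorem lintegral_levelWeight_sq_le {φ : E3 → ℝ} (hc : Continuous φ)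
    (hφ1 : Tendsto φ (cocompact E3) (𝓝 1)) {V : ℝ} (hV : 0 < V)
    (h0 : sublevelVolume φ 0 = ENNReal.ofReal V) :
    ∫⁻ x in {x | 0 < φ x ∧ φ x < 1}, levelWeight φ (φ x) ^ 2 ≤
      ENNReal.ofReal (3 * V ^ (-(1 / 3) : ℝ)) := by
  have h0' : sublevelVolume φ 0 ≠ 0 := by rw [h0]; simpa using hV
  have hms : MeasurableSet {x | 0 < φ x ∧ φ x < 1} :=
    ((isOpen_lt continuous_const hc).inter (isOpen_lt hc continuous_const)).measurableSet
  have hwm : Measurable (levelWeight φ) := (levelWeight_antitone φ).measurable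
  have hm1 : Measurable fun x => levelWeight φ (φ x) ^ 2 := (hwm.comp hc.measurable).pow_const 2
  have hm2 : Measurable fun n : ℝ => (ENNReal.ofReal (max V n)) ^ (-(4 / 3) : ℝ) :=
    (Measurable.ennreal_ofReal (by fun_prop)).pow_const _
  have e : ∫⁻ n in Ioi V, ENNReal.ofReal n ^ (-(4 / 3) : ℝ) =
      ∫⁻ n in Ioi V, (ENNReal.ofReal (max V n)) ^ (-(4 / 3) : ℝ) :=
    setLIntegral_congr_fun measurableSet_Ioi fun n hn => by
      rw [max_eq_right (le_of_lt hn)]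
  rw [← lintegral_Ioi_rpow_neg hV, e]
  refine lintegral_le_of_superlevel_le hm1 hm2
    (fun x => ENNReal.pow_ne_top (levelWeight_ne_top h0' _)) (fun n => ?_) fun t ht => ?_
  · have : 0 < max V n := lt_max_of_lt_left hV
    simp [ENNReal.rpow_eq_top_iff, hV]
  rw [Measure.restrict_apply (measurableSet_lt measurable_const hm1),
    Measure.restrict_apply (measurableSet_lt measurable_const hm2)]
  have key : ∀ v : ℝ≥0∞, ENNReal.ofReal t < v ^ (-(4 / 3) : ℝ) ↔ v < ENNReal.ofReal (t ^ (-(3 / 4) : ℝ)) := by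
    intro v
    rw [← ENNReal.ofReal_rpow_of_pos ht, ENNReal.rpow_neg, ENNReal.rpow_neg, ENNReal.lt_inv_iff_lt_inv,
      ← ENNReal.lt_rpow_inv_iff (by norm_num : (0 : ℝ) < 4 / 3), ENNReal.inv_rpow]
    norm_num
  have hset : {x | ENNReal.ofReal t < levelWeight φ (φ x) ^ 2} ∩ {x | 0 < φ x ∧ φ x < 1} =
      {x | (0 < φ x ∧ φ x < 1) ∧ sublevelVolume φ (φ x) < ENNReal.ofReal (t ^ (-(3 / 4) : ℝ))} := by
    ext x
    simp only [mem_inter_iff, mem_ofPred_eq]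
    rw [and_comm]
    refine and_congr_right fun hx => ?_
    rw [← key, levelWeight, max_eq_left hx.1.le, ← ENNReal.rpow_natCast, ← ENNReal.rpow_mul]
    norm_num
  rw [hset]
  refine (volume_sublevelVolume_lt_le hφ1 hc _).trans ?_
  rw [h0, ← ENNReal.ofReal_sub _ hV.le, ← Real.volume_Ioo]
  refine measure_mono fun n hn => ⟨?_, hn.1⟩
  have : 0 < max V n := lt_max_of_lt_left hV
  rw [mem_ofPred_eq, key, max_eq_right hn.1.le]
  exact (ENNReal.ofReal_lt_ofReal_iff (hV.trans (hn.1.trans hn.2))).2 hn.2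

/-- The sharp isocapacitary (Poincaré–Faber–Szegő) inequality in `E3`. -/
theorem isocapacitary_inequality {φ : E3 → ℝ} (hφ : LocallyLipschitz φ)
    (hφ1 : Tendsto φ (cocompact E3) (𝓝 1)) {R : ℝ} (hR : 0 < R)
    (h0 : volume {x | φ x ≤ 0} = ENNReal.ofReal (unitBallVolume * R ^ 3)) :
    ENNReal.ofReal (3 * unitBallVolume * R) ≤
      ∫⁻ x in {x | 0 < φ x ∧ φ x < 1}, ‖fderiv ℝ φ x‖ₑ ^ 2 := by
  have hω := unitBallVolume_pos
  have hc := hφ.continuous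
  have hV : 0 < unitBallVolume * R ^ 3 := by positivity
  have h0' : sublevelVolume φ 0 ≠ 0 := by
    rw [sublevelVolume, h0]; simpa using hV
  have hwm : Measurable fun x => levelWeight φ (φ x) :=
    (levelWeight_antitone φ).measurable.comp hc.measurable
  have hder : Measurable fun x => ‖fderiv ℝ φ x‖ₑ := (measurable_fderiv ℝ φ).enorm
  -- The optimal constant in `2cpq ≤ p² + c²q²` with `p = |∇φ|` and `q` the weight: equality holds
  -- for the potential `1 - R/r` of a ball. With `ω` for `unitBallVolume` and `E` for the energy,
  -- the estimates combine to `6ωR ≤ E + 3ωR`.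
  set c := R * unitBallVolume ^ (2 / 3 : ℝ) with hcdef
  have hc0 : 0 < c := by positivity
  set D := {x | 0 < φ x ∧ φ x < 1}
  have h1 := (lintegral_levelWeight_mul_isoProfile hc hφ1 h0').symm.le.trans
    (lintegral_levelWeight_mul_isoProfile_le hφ hφ1 h0')
  have h2 := lintegral_levelWeight_sq_le hc hφ1 hV h0
  have hpt : ∀ x, ENNReal.ofReal (2 * c) * (‖fderiv ℝ φ x‖ₑ * levelWeight φ (φ x)) ≤
      ‖fderiv ℝ φ x‖ₑ ^ 2 + ENNReal.ofReal (c ^ 2) * levelWeight φ (φ x) ^ 2 := by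
    intro x
    have hw := levelWeight_ne_top h0' (φ x)
    rw [← ofReal_norm, ← ENNReal.ofReal_toReal hw]
    set p := (levelWeight φ (φ x)).toReal
    have hp : 0 ≤ p := ENNReal.toReal_nonneg
    rw [← ENNReal.ofReal_mul (norm_nonneg _), ← ENNReal.ofReal_mul (by positivity),
      ← ENNReal.ofReal_pow (norm_nonneg _), ← ENNReal.ofReal_pow hp,
      ← ENNReal.ofReal_mul (by positivity), ← ENNReal.ofReal_add (by positivity) (by positivity)]
    exact ENNReal.ofReal_le_ofReal (by nlinarith [sq_nonneg (‖fderiv ℝ φ x‖ - c * p)])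
  have h3 : ENNReal.ofReal (2 * c) * ∫⁻ x in D, ‖fderiv ℝ φ x‖ₑ * levelWeight φ (φ x) ≤
      (∫⁻ x in D, ‖fderiv ℝ φ x‖ₑ ^ 2) + ENNReal.ofReal (c ^ 2) * ∫⁻ x in D, levelWeight φ (φ x) ^ 2 := by
    have hm : Measurable fun x => ‖fderiv ℝ φ x‖ₑ * levelWeight φ (φ x) := hder.mul hwm
    rw [← lintegral_const_mul _ hm, ← lintegral_const_mul _ (hwm.pow_const 2),
      ← lintegral_add_left (hder.pow_const 2)]
    exact lintegral_mono hpt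
  have h4 : ENNReal.ofReal (2 * c * (3 * unitBallVolume ^ (1 / 3 : ℝ))) ≤
      (∫⁻ x in D, ‖fderiv ℝ φ x‖ₑ ^ 2) +
        ENNReal.ofReal (c ^ 2 * (3 * (unitBallVolume * R ^ 3) ^ (-(1 / 3) : ℝ))) := by
    rw [ENNReal.ofReal_mul (by positivity), ENNReal.ofReal_mul (by positivity : 0 ≤ c ^ 2)]
    calc _ ≤ _ := mul_le_mul_right h1 _
      _ ≤ _ := h3
      _ ≤ _ := by gcongr
  have e1 : unitBallVolume ^ (2 / 3 : ℝ) * unitBallVolume ^ (1 / 3 : ℝ) = unitBallVolume := by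
    rw [← Real.rpow_add hω]; norm_num
  have e2 : (unitBallVolume * R ^ 3) ^ (-(1 / 3) : ℝ) = (unitBallVolume ^ (1 / 3 : ℝ))⁻¹ * R⁻¹ := by
    rw [Real.mul_rpow hω.le (by positivity), Real.rpow_neg hω.le, ← Real.rpow_natCast R 3,
      ← Real.rpow_mul hR.le]
    have : ((3 : ℕ) : ℝ) * (-(1 / 3)) = -1 := by norm_num
    rw [this, Real.rpow_neg_one]
  have e3 : (unitBallVolume ^ (2 / 3 : ℝ)) * (unitBallVolume ^ (1 / 3 : ℝ))⁻¹ = unitBallVolume ^ (1 / 3 : ℝ) := by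
    rw [← Real.rpow_neg hω.le, ← Real.rpow_add hω]; norm_num
  have e4 : c ^ 2 * (3 * (unitBallVolume * R ^ 3) ^ (-(1 / 3) : ℝ)) = 3 * unitBallVolume * R := by
    rw [e2, hcdef]
    calc _ = 3 * R * (R * R⁻¹) * (unitBallVolume ^ (2 / 3 : ℝ) *
          (unitBallVolume ^ (2 / 3 : ℝ) * (unitBallVolume ^ (1 / 3 : ℝ))⁻¹)) := by ring
      _ = _ := by rw [e3, e1, mul_inv_cancel₀ hR.ne']; ring
  have e5 : 2 * c * (3 * unitBallVolume ^ (1 / 3 : ℝ)) = 3 * unitBallVolume * R + 3 * unitBallVolume * R := by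
    rw [hcdef]; linear_combination (6 * R) * e1
  rw [e4, e5, ENNReal.ofReal_add (by positivity) (by positivity)] at h4
  exact (ENNReal.add_le_add_iff_right ENNReal.ofReal_ne_top).1 h4

/-! ### Partial derivatives on `E3` -/

/-- The partial derivative `∂_i f`. -/
noncomputable def pd (i : Fin 3) (f : E3 → ℝ) (x : E3) : ℝ := fderiv ℝ f x (stdVec i)

/-- The Laplacian `∑ ∂_i ∂_i f`. -/
noncomputable def lap (f : E3 → ℝ) (x : E3) : ℝ := ∑ i, pd i (pd i f) x

theorem norm_stdVec (i : Fin 3) : ‖stdVec i‖ = 1 := by simp [stdVec]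

theorem inner_stdVec (x : E3) (i : Fin 3) : inner ℝ x (stdVec i) = x i := by
  simp [stdVec, EuclideanSpace.inner_single_right]

theorem sum_smul_stdVec (x : E3) : ∑ i, x i • stdVec i = x := by
  ext j; fin_cases j <;> simp [stdVec, Fin.sum_univ_three]

theorem abs_pd_le (i : Fin 3) (f : E3 → ℝ) (x : E3) : |pd i f x| ≤ ‖fderiv ℝ f x‖ := by
  have := (fderiv ℝ f x).le_opNorm (stdVec i)
  rwa [norm_stdVec, mul_one] at this

theorem fderiv_apply_eq_sum (f : E3 → ℝ) (x v : E3) : fderiv ℝ f x v = ∑ i, v i * pd i f x := by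
  conv_lhs => rw [← sum_smul_stdVec v]
  simp [pd]

theorem pd_mul {i : Fin 3} {f g : E3 → ℝ} {x : E3} (hf : DifferentiableAt ℝ f x)
    (hg : DifferentiableAt ℝ g x) :
    pd i (fun y => f y * g y) x = f x * pd i g x + pd i f x * g x := by
  simp only [pd]
  rw [fderiv_fun_mul hf hg]
  simp [mul_comm]

theorem pd_add {i : Fin 3} {f g : E3 → ℝ} {x : E3} (hf : DifferentiableAt ℝ f x)
    (hg : DifferentiableAt ℝ g x) :
    pd i (fun y => f y + g y) x = pd i f x + pd i g x := by
  simp only [pd]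
  rw [fderiv_fun_add hf hg]; rfl

theorem pd_sub {i : Fin 3} {f g : E3 → ℝ} {x : E3} (hf : DifferentiableAt ℝ f x)
    (hg : DifferentiableAt ℝ g x) :
    pd i (fun y => f y - g y) x = pd i f x - pd i g x := by
  simp only [pd]
  rw [fderiv_fun_sub hf hg]; rfl

theorem pd_congr {i : Fin 3} {f g : E3 → ℝ} {x : E3} (h : f =ᶠ[𝓝 x] g) :
    pd i f =ᶠ[𝓝 x] pd i g := by
  filter_upwards [h.eventuallyEq_nhds] with y hy
  simp only [pd, hy.fderiv_eq]

theorem contDiffAt_pd {i : Fin 3} {f : E3 → ℝ} {x : E3} {n m : WithTop ℕ∞}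
    (hf : ContDiffAt ℝ n f x) (hmn : m + 1 ≤ n) : ContDiffAt ℝ m (pd i f) x :=
  (hf.fderiv_right hmn).clm_apply contDiffAt_const

theorem contDiff_pd {i : Fin 3} {f : E3 → ℝ} {n m : WithTop ℕ∞}
    (hf : ContDiff ℝ n f) (hmn : m + 1 ≤ n) : ContDiff ℝ m (pd i f) :=
  (hf.fderiv_right hmn).clm_apply contDiff_const

theorem tsupport_pd_subset (i : Fin 3) (f : E3 → ℝ) : tsupport (pd i f) ⊆ tsupport f := by
  refine closure_minimal (fun x hx => ?_) (isClosed_tsupport f)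
  by_contra h
  have h0 : f =ᶠ[𝓝 x] fun _ => 0 := notMem_tsupport_iff_eventuallyEq.1 h
  refine hx ?_
  simp [pd, h0.fderiv_eq]

theorem hasCompactSupport_pd {i : Fin 3} {f : E3 → ℝ} (hf : HasCompactSupport f) :
    HasCompactSupport (pd i f) :=
  hf.of_isClosed_subset (isClosed_tsupport _) (tsupport_pd_subset i f)

theorem lap_eq_laplacian {f : E3 → ℝ} {x : E3} (hf : ContDiffAt ℝ 2 f x) :
    lap f x = Laplacian.laplacian f x := by
  rw [InnerProductSpace.laplacian_eq_iteratedFDeriv_orthonormalBasis f (EuclideanSpace.basisFun (Fin 3) ℝ)]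
  refine Finset.sum_congr rfl fun i _ => ?_
  rw [iteratedFDeriv_two_apply]
  simp only [Matrix.cons_val_zero, Matrix.cons_val_one, EuclideanSpace.basisFun_apply]
  have hd : DifferentiableAt ℝ (fderiv ℝ f) x :=
    (hf.fderiv_right (m := 1) (by norm_num)).differentiableAt (by norm_num)
  change fderiv ℝ (fun y => fderiv ℝ f y (stdVec i)) x (stdVec i) = _
  rw [fderiv_clm_apply hd (differentiableAt_const _)]
  simp [stdVec]

/-- Regularity of `u` on the support of `q` suffices, so functions controlled only outside a ball
can be paired with cutoffs. -/
theorem contDiff_mul_of_tsupport {n : WithTop ℕ∞} {u q : E3 → ℝ} (hq : ContDiff ℝ n q)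
    (hu : ∀ x ∈ tsupport q, ContDiffAt ℝ n u x) : ContDiff ℝ n fun x => u x * q x := by
  rw [contDiff_iff_contDiffAt]
  intro x
  by_cases hx : x ∈ tsupport q
  · exact (hu x hx).mul hq.contDiffAt
  · have h0 : q =ᶠ[𝓝 x] fun _ => 0 := notMem_tsupport_iff_eventuallyEq.1 hx
    refine ContDiffAt.congr_of_eventuallyEq (f := fun _ => (0 : ℝ)) contDiffAt_const ?_
    filter_upwards [h0] with y hy; simp [hy]

theorem continuous_mul_of_tsupport {u q : E3 → ℝ} (hq : Continuous q)
    (hu : ∀ x ∈ tsupport q, ContinuousAt u x) : Continuous fun x => u x * q x := by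
  rw [continuous_iff_continuousAt]
  intro x
  by_cases hx : x ∈ tsupport q
  · exact (hu x hx).mul hq.continuousAt
  · have h0 : q =ᶠ[𝓝 x] fun _ => 0 := notMem_tsupport_iff_eventuallyEq.1 hx
    refine ContinuousAt.congr (f := fun _ => (0 : ℝ)) continuousAt_const ?_
    filter_upwards [h0] with y hy; simp [hy]

theorem integrable_mul_of_tsupport {u q : E3 → ℝ} (hq : Continuous q) (hs : HasCompactSupport q)
    (hu : ∀ x ∈ tsupport q, ContinuousAt u x) : Integrable fun x => u x * q x :=
  (continuous_mul_of_tsupport hq hu).integrable_of_hasCompactSupport hs.mul_left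

theorem integral_pd_eq_zero {i : Fin 3} {f : E3 → ℝ} (hf : ContDiff ℝ 1 f)
    (hs : HasCompactSupport f) : ∫ x, pd i f x = 0 := by
  have h := integral_mul_fderiv_eq_neg_fderiv_mul_of_integrable (μ := (volume : Measure E3))
    (f := fun _ => (1 : ℝ)) (g := f) (v := stdVec i) (by simp) ?_ ?_ (fun _ _ => differentiableAt_const _)
    (fun x _ => hf.differentiable (by norm_num) x)
  · simpa [pd] using h
  · have := (contDiff_pd (i := i) (m := 0) hf (by norm_num)).continuous.integrable_of_hasCompactSupport
      (μ := (volume : Measure E3)) (hasCompactSupport_pd hs)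
    simpa [pd] using! this
  · simpa using hf.continuous.integrable_of_hasCompactSupport hs

/-- Integration by parts against a compactly supported function. -/
theorem integral_mul_pd {i : Fin 3} {u q : E3 → ℝ} (hq : ContDiff ℝ 1 q) (hs : HasCompactSupport q)
    (hu : ∀ x ∈ tsupport q, ContDiffAt ℝ 1 u x) :
    ∫ x, u x * pd i q x = -∫ x, pd i u x * q x := by
  have h0 := integral_pd_eq_zero (i := i) (contDiff_mul_of_tsupport hq hu) hs.mul_left
  have e : ∀ x, pd i (fun y => u y * q y) x = u x * pd i q x + pd i u x * q x := by
    intro x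
    by_cases hx : x ∈ tsupport q
    · exact pd_mul ((hu x hx).differentiableAt (by norm_num)) (hq.contDiffAt.differentiableAt (by norm_num))
    · have h1 : q =ᶠ[𝓝 x] fun _ => 0 := notMem_tsupport_iff_eventuallyEq.1 hx
      have h2 : (fun y => u y * q y) =ᶠ[𝓝 x] fun _ => 0 := by
        filter_upwards [h1] with y hy; simp [hy]
      simp [pd, h1.fderiv_eq, h2.fderiv_eq, h1.eq_of_nhds]
  simp only [e] at h0
  rw [integral_add] at h0
  · linarith
  · refine integrable_mul_of_tsupport (contDiff_pd (m := 0) hq (by norm_num)).continuous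
      (hasCompactSupport_pd hs) fun x hx => (hu x (tsupport_pd_subset i q hx)).continuousAt
  · exact integrable_mul_of_tsupport hq.continuous hs fun x hx =>
      (contDiffAt_pd (m := 0) (hu x hx) (by norm_num)).continuousAt

theorem lap_mul {f g : E3 → ℝ} (hf : ContDiff ℝ 2 f) (hg : ContDiff ℝ 2 g) (x : E3) :
    lap (fun y => f y * g y) x = f x * lap g x + 2 * ∑ i, pd i f x * pd i g x + lap f x * g x := by
  have hfd := hf.differentiable (by norm_num)
  have hgd := hg.differentiable (by norm_num)
  have hf1 : ∀ i, Differentiable ℝ (pd i f) := fun i =>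
    (contDiff_pd (m := 1) hf (by norm_num)).differentiable (by norm_num)
  have hg1 : ∀ i, Differentiable ℝ (pd i g) := fun i =>
    (contDiff_pd (m := 1) hg (by norm_num)).differentiable (by norm_num)
  have e : ∀ i, pd i (fun y => f y * g y) = fun y => f y * pd i g y + pd i f y * g y := fun i => by
    ext y; exact pd_mul (hfd y) (hgd y)
  simp only [lap, Finset.mul_sum, Finset.sum_mul, ← Finset.sum_add_distrib]
  refine Finset.sum_congr rfl fun i _ => ?_
  rw [e, pd_add (f := fun y => f y * pd i g y) (g := fun y => pd i f y * g y)
      ((hfd x).mul (hg1 i x)) ((hf1 i x).mul (hgd x)), pd_mul (hfd x) (hg1 i x),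
    pd_mul (hf1 i x) (hgd x)]
  ring

theorem integral_mul_lap {u q : E3 → ℝ} (hq : ContDiff ℝ 2 q) (hs : HasCompactSupport q)
    (hu : ∀ x ∈ tsupport q, ContDiffAt ℝ 2 u x) :
    ∫ x, u x * lap q x = ∫ x, lap u x * q x := by
  simp only [lap, Finset.mul_sum, Finset.sum_mul]
  rw [integral_finsetSum, integral_finsetSum]
  · refine Finset.sum_congr rfl fun i _ => ?_
    rw [integral_mul_pd (contDiff_pd (m := 1) hq (by norm_num)) (hasCompactSupport_pd hs)
      fun x hx => (hu x (tsupport_pd_subset i q hx)).of_le (by norm_num),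
      integral_mul_pd (hq.of_le (by norm_num)) hs
      fun x hx => contDiffAt_pd (hu x hx) (by norm_num), neg_neg]
  · intro i _
    exact integrable_mul_of_tsupport hq.continuous hs fun x hx =>
      (contDiffAt_pd (m := 0) (n := 1) (contDiffAt_pd (hu x hx) (by norm_num)) (by norm_num)).continuousAt
  · intro i _
    refine integrable_mul_of_tsupport
      (contDiff_pd (m := 0) (n := 1) (contDiff_pd hq (by norm_num)) (by norm_num)).continuous
      (hasCompactSupport_pd (hasCompactSupport_pd hs)) fun x hx =>
        (hu x (tsupport_pd_subset i _ (tsupport_pd_subset i _ hx))).continuousAt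

/-! ### Powers of `|x|² + c` -/

/-- `(|x|² + c)^p`. -/
noncomputable def sqPow (c p : ℝ) (x : E3) : ℝ := (‖x‖ ^ 2 + c) ^ p

theorem hasFDerivAt_sqPow {c p : ℝ} {x : E3} (h : 0 < ‖x‖ ^ 2 + c) :
    HasFDerivAt (sqPow c p) ((2 * p * sqPow c (p - 1) x) • innerSL ℝ x) x := by
  have h1 : HasFDerivAt (fun y : E3 => ‖y‖ ^ 2 + c) (2 • innerSL ℝ x) x :=
    (hasStrictFDerivAt_norm_sq x).hasFDerivAt.add_const c
  have := h1.rpow_const (p := p) (Or.inl h.ne')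
  have e : (2 * p * sqPow c (p - 1) x) • innerSL ℝ x =
      (p * (‖x‖ ^ 2 + c) ^ (p - 1)) • 2 • (innerSL ℝ x : E3 →L[ℝ] ℝ) := by
    ext v; simp [sqPow]; ring
  rw [e]; exact this

theorem contDiffAt_sqPow {c p : ℝ} {x : E3} (h : 0 < ‖x‖ ^ 2 + c) {n : WithTop ℕ∞} :
    ContDiffAt ℝ n (sqPow c p) x :=
  ((contDiff_norm_sq ℝ).contDiffAt.add contDiffAt_const).rpow_const_of_ne h.ne'

theorem pd_sqPow {c p : ℝ} {x : E3} (h : 0 < ‖x‖ ^ 2 + c) (i : Fin 3) :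
    pd i (sqPow c p) x = 2 * p * (x i * sqPow c (p - 1) x) := by
  rw [pd, (hasFDerivAt_sqPow h).fderiv]
  simp only [smul_apply, innerSL_apply_apply, inner_stdVec, smul_eq_mul]
  ring

theorem hasFDerivAt_coord (i : Fin 3) (x : E3) :
    HasFDerivAt (fun y : E3 => y i) (EuclideanSpace.proj i : E3 →L[ℝ] ℝ) x :=
  (EuclideanSpace.proj i : E3 →L[ℝ] ℝ).hasFDerivAt

theorem pd_coord (i j : Fin 3) (x : E3) : pd i (fun y : E3 => y j) x = if i = j then 1 else 0 := by
  rw [pd, (hasFDerivAt_coord j x).fderiv]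
  simp [stdVec, eq_comm]

/-- For `c > 0` this is the Laplacian of a regularised Newton kernel. Its integral does not depend
on `c`, and it concentrates at the origin as `c → 0`. -/
theorem lap_sqPow_neg_half {c : ℝ} {x : E3} (h : 0 < ‖x‖ ^ 2 + c) :
    lap (sqPow c (-(1 / 2))) x = -3 * c * sqPow c (-(5 / 2)) x := by
  have hev : ∀ᶠ y in 𝓝 x, 0 < ‖y‖ ^ 2 + c :=
    (Continuous.continuousAt (by fun_prop)).eventually (lt_mem_nhds h)
  have e : ∀ i, pd i (sqPow c (-(1 / 2))) =ᶠ[𝓝 x] fun y => (-y i) * sqPow c (-(3 / 2)) y := fun i => by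
    filter_upwards [hev] with y hy
    rw [pd_sqPow hy]
    norm_num
  have e2 : ∀ i, pd i (pd i (sqPow c (-(1 / 2)))) x =
      3 * (x i) ^ 2 * sqPow c (-(5 / 2)) x - sqPow c (-(3 / 2)) x := fun i => by
    rw [(pd_congr (e i)).eq_of_nhds, pd_mul (by fun_prop) (hasFDerivAt_sqPow h).differentiableAt,
      pd_sqPow h]
    have : pd i (fun y : E3 => -y i) x = -1 := by
      have h1 := pd_coord i i x
      simp only [pd, if_true] at h1 ⊢
      rw [fderiv_fun_neg]; simpa using h1
    rw [this]; norm_num; ring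
  have e3 : sqPow c (-(3 / 2)) x = (‖x‖ ^ 2 + c) * sqPow c (-(5 / 2)) x := by
    simp only [sqPow]
    rw [← Real.rpow_one_add' h.le (by norm_num)]; norm_num
  simp only [lap, e2]
  rw [Finset.sum_sub_distrib, ← Finset.sum_mul, ← Finset.mul_sum]
  have : ∑ i, (x i) ^ 2 = ‖x‖ ^ 2 := (EuclideanSpace.real_norm_sq_eq x).symm
  rw [this, e3]; simp; ring

/-! ### Cutoff functions -/

/-- The profile of the cutoff functions, as a function of the square of the radius. -/
noncomputable def cutProfile (t : ℝ) : ℝ := Real.smoothTransition (2 - t)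

/-- A smooth radial bump function, `1` on the unit ball and supported in the ball of radius `2`. -/
noncomputable def cutBump (y : E3) : ℝ := cutProfile (‖y‖ ^ 2)

/-- The bump function at scale `s`. -/
noncomputable def cutAt (s : ℝ) (y : E3) : ℝ := cutBump (s⁻¹ • y)

theorem pd_comp_smul {i : Fin 3} {f : E3 → ℝ} (c : ℝ) {x : E3} (hf : DifferentiableAt ℝ f (c • x)) :
    pd i (fun y => f (c • y)) x = c * pd i f (c • x) := by
  have h1 : HasFDerivAt (fun y : E3 => c • y) (c • ContinuousLinearMap.id ℝ E3) x :=
    (hasFDerivAt_id x).const_smul c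
  simp only [pd]
  have h2 : HasFDerivAt (fun y => f (c • y)) _ x := hf.hasFDerivAt.comp x h1
  rw [h2.fderiv]
  simp

theorem pd_comp_sub {i : Fin 3} (f : E3 → ℝ) (x y : E3) :
    pd i (fun y => f (y - x)) y = pd i f (y - x) := by
  simp only [pd]
  rw [fderiv_comp_sub]

theorem lap_comp_sub (f : E3 → ℝ) (x y : E3) : lap (fun y => f (y - x)) y = lap f (y - x) := by
  simp only [lap]
  refine Finset.sum_congr rfl fun i _ => ?_
  have : pd i (fun y => f (y - x)) = fun y => pd i f (y - x) := by ext z; exact pd_comp_sub f x z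
  rw [this, pd_comp_sub]

theorem contDiff_cutProfile {n : ℕ∞} : ContDiff ℝ n cutProfile := by
  unfold cutProfile
  exact Real.smoothTransition.contDiff.comp (contDiff_const.sub contDiff_id)

theorem cutProfile_eq_one {t : ℝ} (ht : t ≤ 1) : cutProfile t = 1 :=
  Real.smoothTransition.one_of_one_le (by linarith)

theorem cutProfile_eq_zero {t : ℝ} (ht : 2 ≤ t) : cutProfile t = 0 :=
  Real.smoothTransition.zero_of_nonpos (by linarith)

theorem contDiff_cutBump {n : ℕ∞} : ContDiff ℝ n cutBump :=
  contDiff_cutProfile.comp (contDiff_norm_sq ℝ)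

theorem cutBump_eq_zero {y : E3} (hy : 2 ≤ ‖y‖) : cutBump y = 0 :=
  cutProfile_eq_zero (by nlinarith)

theorem hasCompactSupport_cutBump : HasCompactSupport cutBump :=
  HasCompactSupport.intro (isCompact_closedBall (0 : E3) 2) fun x hx =>
    cutBump_eq_zero (by simpa using (le_of_lt (by simpa using hx)))

theorem pd_cutBump (i : Fin 3) (y : E3) : pd i cutBump y = 2 * y i * deriv cutProfile (‖y‖ ^ 2) := by
  have h1 : HasDerivAt cutProfile (deriv cutProfile (‖y‖ ^ 2)) (‖y‖ ^ 2) :=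
    ((contDiff_cutProfile (n := 1)).differentiable (by norm_num) _).hasDerivAt
  have h2 : HasFDerivAt cutBump _ y := h1.comp_hasFDerivAt y (hasStrictFDerivAt_norm_sq y).hasFDerivAt
  rw [pd, h2.fderiv]
  simp [inner_stdVec]; ring

theorem contDiff_cutAt (s : ℝ) {n : ℕ∞} : ContDiff ℝ n (cutAt s) :=
  contDiff_cutBump.comp (contDiff_const_smul _)

theorem cutAt_eq_one {s : ℝ} (hs : 0 < s) {y : E3} (hy : ‖y‖ ≤ s) : cutAt s y = 1 := by
  refine cutProfile_eq_one ?_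
  rw [sq_le_one_iff₀ (norm_nonneg _), norm_smul, norm_inv, Real.norm_eq_abs, abs_of_pos hs]
  change s⁻¹ * ‖y‖ ≤ 1
  rwa [inv_mul_le_iff₀ hs, mul_one]

theorem cutAt_eq_zero {s : ℝ} (hs : 0 < s) {y : E3} (hy : 2 * s ≤ ‖y‖) : cutAt s y = 0 := by
  refine cutBump_eq_zero ?_
  rw [norm_smul, norm_inv, Real.norm_eq_abs, abs_of_pos hs]
  rw [le_inv_mul_iff₀ hs]; linarith

theorem cutAt_nonneg (s : ℝ) (y : E3) : 0 ≤ cutAt s y := Real.smoothTransition.nonneg _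

theorem cutAt_le_one (s : ℝ) (y : E3) : cutAt s y ≤ 1 := Real.smoothTransition.le_one _

theorem hasCompactSupport_cutAt {s : ℝ} (hs : 0 < s) : HasCompactSupport (cutAt s) :=
  HasCompactSupport.intro (isCompact_closedBall (0 : E3) (2 * s)) fun x hx =>
    cutAt_eq_zero hs (by simpa using (le_of_lt (by simpa using hx)))

theorem pd_cutAt (i : Fin 3) (s : ℝ) (y : E3) : pd i (cutAt s) y = s⁻¹ * pd i cutBump (s⁻¹ • y) :=
  pd_comp_smul _ ((contDiff_cutBump (n := 1)).differentiable (by norm_num) _)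

theorem pd_pd_cutAt (i j : Fin 3) (s : ℝ) (y : E3) :
    pd j (pd i (cutAt s)) y = s⁻¹ ^ 2 * pd j (pd i cutBump) (s⁻¹ • y) := by
  have e : pd i (cutAt s) = fun y => s⁻¹ * pd i cutBump (s⁻¹ • y) := by ext y; exact pd_cutAt i s y
  have hd : Differentiable ℝ (pd i cutBump) :=
    (contDiff_pd (m := 1) (contDiff_cutBump (n := 2)) (by norm_num)).differentiable (by norm_num)
  rw [e]
  have h2 : DifferentiableAt ℝ (fun y => pd i cutBump (s⁻¹ • y)) y :=
    (hd _).comp y (by fun_prop)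
  rw [pd_mul (differentiableAt_const _) h2, pd_comp_smul _ (hd _)]
  simp [pd]; ring

theorem lap_cutAt (s : ℝ) (y : E3) : lap (cutAt s) y = s⁻¹ ^ 2 * lap cutBump (s⁻¹ • y) := by
  simp only [lap, pd_pd_cutAt, Finset.mul_sum]

theorem exists_bound_cutBump : ∃ T : ℝ, 0 ≤ T ∧ (∀ i x, |pd i cutBump x| ≤ T) ∧
    (∀ i j x, |pd j (pd i cutBump) x| ≤ T) ∧ ∀ x, |lap cutBump x| ≤ T := by
  have hs : HasCompactSupport cutBump := hasCompactSupport_cutBump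
  have h1 : ∀ i, ∃ C, ∀ x, ‖pd i cutBump x‖ ≤ C := fun i =>
    (hasCompactSupport_pd hs).exists_bound_of_continuous
      (contDiff_pd (m := 0) (contDiff_cutBump (n := 1)) (by norm_num)).continuous
  have h2 : ∀ i j, ∃ C, ∀ x, ‖pd j (pd i cutBump) x‖ ≤ C := fun i j =>
    (hasCompactSupport_pd (hasCompactSupport_pd hs)).exists_bound_of_continuous
      (contDiff_pd (m := 0) (n := 1) (contDiff_pd (contDiff_cutBump (n := 2)) (by norm_num)) (by norm_num)).continuous
  choose C1 hC1 using h1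
  choose C2 hC2 using h2
  have p1 : ∀ i, 0 ≤ C1 i := fun i => (norm_nonneg _).trans (hC1 i 0)
  have p2 : ∀ i j, 0 ≤ C2 i j := fun i j => (norm_nonneg _).trans (hC2 i j 0)
  have q1 : 0 ≤ ∑ i, C1 i := Finset.sum_nonneg fun i _ => p1 i
  have q2 : 0 ≤ ∑ i, ∑ j, C2 i j := Finset.sum_nonneg fun i _ => Finset.sum_nonneg fun j _ => p2 i j
  have r1 : ∀ i, C1 i ≤ ∑ i, C1 i := fun i =>
    Finset.single_le_sum (f := C1) (fun i _ => p1 i) (Finset.mem_univ i)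
  have r2 : ∀ i j, C2 i j ≤ ∑ i, ∑ j, C2 i j := fun i j =>
    (Finset.single_le_sum (f := C2 i) (fun j _ => p2 i j) (Finset.mem_univ j)).trans
      (Finset.single_le_sum (f := fun i => ∑ j, C2 i j)
        (fun i _ => Finset.sum_nonneg fun j _ => p2 i j) (Finset.mem_univ i))
  refine ⟨(∑ i, C1 i) + ∑ i, ∑ j, C2 i j, by positivity, fun i x => ?_, fun i j x => ?_, fun x => ?_⟩
  · exact (hC1 i x).trans (by linarith [r1 i])
  · exact (hC2 i j x).trans (by linarith [r2 i j])
  · refine (Finset.abs_sum_le_sum_abs _ _).trans ?_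
    refine (Finset.sum_le_sum fun i _ => (hC2 i i x).trans ?_).trans (le_add_of_nonneg_left q1)
    exact Finset.single_le_sum (f := C2 i) (fun j _ => p2 i j) (Finset.mem_univ i)

theorem pd_cutAt_eq_zero {i : Fin 3} {s : ℝ} (hs : 0 < s) {y : E3} (hy : ‖y‖ < s ∨ 2 * s < ‖y‖) :
    pd i (cutAt s) =ᶠ[𝓝 y] fun _ => 0 := by
  have h : ∃ c : ℝ, cutAt s =ᶠ[𝓝 y] fun _ => c := by
    rcases hy with hy | hy
    · exact ⟨1, by filter_upwards [continuous_norm.continuousAt.eventually (gt_mem_nhds hy)] with z hz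
                   exact cutAt_eq_one hs hz.le⟩
    · exact ⟨0, by filter_upwards [continuous_norm.continuousAt.eventually (lt_mem_nhds hy)] with z hz
                   exact cutAt_eq_zero hs hz.le⟩
  obtain ⟨c, hc⟩ := h
  refine (pd_congr hc).trans (Eventually.of_forall fun z => ?_)
  simp [pd]

theorem lap_cutAt_eq_zero {s : ℝ} (hs : 0 < s) {y : E3} (hy : ‖y‖ < s ∨ 2 * s < ‖y‖) :
    lap (cutAt s) y = 0 := by
  refine Finset.sum_eq_zero fun i _ => ?_
  rw [(pd_congr (pd_cutAt_eq_zero hs hy)).eq_of_nhds]; simp [pd]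

theorem measurable_sqPow (c p : ℝ) : Measurable (sqPow c p) := by
  unfold sqPow; fun_prop

theorem sqPow_nonneg {c : ℝ} (hc : 0 ≤ c) (p : ℝ) (z : E3) : 0 ≤ sqPow c p z :=
  Real.rpow_nonneg (by positivity) _

theorem sqPow_le {c p : ℝ} (hc : 0 ≤ c) (hp : p ≤ 0) {z : E3} (hz : z ≠ 0) :
    sqPow c p z ≤ ‖z‖ ^ (2 * p) := by
  have hz' : 0 < ‖z‖ := norm_pos_iff.2 hz
  rw [Real.rpow_mul hz'.le]
  simp only [sqPow, Real.rpow_two]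
  exact Real.rpow_le_rpow_of_nonpos (by positivity) (by linarith) hp

theorem sqPow_zero (p : ℝ) (z : E3) : sqPow 0 p z = ‖z‖ ^ (2 * p) := by
  rw [Real.rpow_mul (norm_nonneg _)]; simp [sqPow]

theorem sqPow_zero_neg_half (z : E3) : sqPow 0 (-(1 / 2)) z = ‖z‖⁻¹ := by
  rw [sqPow_zero, ← Real.rpow_neg_one]; norm_num

theorem sqPow_zero_neg_three_half (z : E3) : sqPow 0 (-(3 / 2)) z = (‖z‖ ^ 3)⁻¹ := by
  rw [sqPow_zero, ← Real.rpow_natCast, ← Real.rpow_neg (norm_nonneg _)]; norm_num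

/-! ### Green's identity and the Newton representation -/

/-- The terms of `Δ(η k)` containing derivatives of the cutoff `η = cutAt s`, where
`k(y) = (|y - x|² + c)^{-1/2}`. -/
noncomputable def cutKernel (s c : ℝ) (x y : E3) : ℝ :=
  2 * ∑ i, pd i (cutAt s) y * pd i (sqPow c (-(1 / 2))) (y - x) +
    lap (cutAt s) y * sqPow c (-(1 / 2)) (y - x)

theorem abs_pd_sqPow_le {c : ℝ} (hc : 0 ≤ c) {z : E3} (hz : z ≠ 0) (i : Fin 3) :
    |pd i (sqPow c (-(1 / 2))) z| ≤ (‖z‖ ^ 2)⁻¹ := by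
  have hz' : 0 < ‖z‖ := norm_pos_iff.2 hz
  rw [pd_sqPow (by positivity)]
  have h1 : sqPow c (-(1 / 2) - 1) z ≤ ‖z‖ ^ (2 * (-(1 / 2) - 1) : ℝ) := sqPow_le hc (by norm_num) hz
  have h2 : ‖z‖ ^ (2 * (-(1 / 2) - 1) : ℝ) = (‖z‖ ^ 3)⁻¹ := by
    rw [← Real.rpow_natCast, ← Real.rpow_neg (norm_nonneg _)]; norm_num
  have h3 : |z i| ≤ ‖z‖ := by simpa using PiLp.norm_apply_le z i
  have h0 := sqPow_nonneg hc (-(1 / 2) - 1) z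
  rw [abs_mul, abs_mul, abs_mul, abs_of_nonneg h0]
  norm_num
  calc |z i| * sqPow c (-(3 / 2)) z ≤ ‖z‖ * (‖z‖ ^ 3)⁻¹ := by
        refine mul_le_mul h3 ?_ ?_ (norm_nonneg _)
        · rw [← h2]; norm_num at h1 ⊢; exact h1
        · exact sqPow_nonneg hc _ _
    _ = (‖z‖ ^ 2)⁻¹ := by field_simp

theorem sqPow_neg_half_le {c : ℝ} (hc : 0 ≤ c) {z : E3} (hz : z ≠ 0) :
    sqPow c (-(1 / 2)) z ≤ ‖z‖⁻¹ := by
  have := sqPow_le (p := -(1 / 2)) hc (by norm_num) hz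
  rwa [← sqPow_zero, sqPow_zero_neg_half] at this

theorem cutKernel_eq_zero {s : ℝ} (hs : 0 < s) (c : ℝ) (x : E3) {y : E3} (hy : ‖y‖ < s ∨ 2 * s < ‖y‖) :
    cutKernel s c x y = 0 := by
  simp [cutKernel, (pd_cutAt_eq_zero hs hy).eq_of_nhds, lap_cutAt_eq_zero hs hy]

theorem abs_cutKernel_le {T : ℝ} (hT1 : ∀ i x, |pd i cutBump x| ≤ T)
    (hT2 : ∀ x, |lap cutBump x| ≤ T) {s c d : ℝ} (hs : 0 < s) (hc : 0 ≤ c) (hd : 0 < d) {x y : E3}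
    (hxy : d ≤ ‖y - x‖) : |cutKernel s c x y| ≤ T * (6 * s⁻¹ * (d ^ 2)⁻¹ + s⁻¹ ^ 2 * d⁻¹) := by
  have hT : 0 ≤ T := (abs_nonneg _).trans (hT2 0)
  have hne : y - x ≠ 0 := norm_pos_iff.1 (hd.trans_le hxy)
  have e1 : ∀ i, |pd i (cutAt s) y * pd i (sqPow c (-(1 / 2))) (y - x)| ≤ s⁻¹ * T * (d ^ 2)⁻¹ := by
    intro i
    rw [abs_mul, pd_cutAt, abs_mul, abs_of_pos (inv_pos.2 hs)]
    refine mul_le_mul (by gcongr; exact hT1 i _) ((abs_pd_sqPow_le hc hne i).trans ?_) (abs_nonneg _) (by positivity)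
    gcongr
  have e2 : |lap (cutAt s) y * sqPow c (-(1 / 2)) (y - x)| ≤ s⁻¹ ^ 2 * T * d⁻¹ := by
    rw [abs_mul, lap_cutAt, abs_mul, abs_of_pos (by positivity : 0 < s⁻¹ ^ 2),
      abs_of_nonneg (sqPow_nonneg hc _ _)]
    refine mul_le_mul (by gcongr; exact hT2 _) ((sqPow_neg_half_le hc hne).trans ?_)
      (sqPow_nonneg hc _ _) (by positivity)
    gcongr
  have e3 : |∑ i, pd i (cutAt s) y * pd i (sqPow c (-(1 / 2))) (y - x)| ≤ 3 * (s⁻¹ * T * (d ^ 2)⁻¹) := by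
    refine (Finset.abs_sum_le_sum_abs _ _).trans ((Finset.sum_le_sum fun i _ => e1 i).trans ?_)
    simp
  rw [cutKernel]
  refine (abs_add_le _ _).trans ?_
  rw [abs_mul, abs_two]
  linarith

theorem contDiff_sqPow_comp {c p : ℝ} (hc : 0 < c) (x : E3) {n : WithTop ℕ∞} :
    ContDiff ℝ n fun y => sqPow c p (y - x) :=
  contDiff_iff_contDiffAt.2 fun y =>
    (contDiffAt_sqPow (by positivity)).comp y (contDiffAt_id.sub contDiffAt_const)

theorem measurable_cutKernel (s c : ℝ) (x : E3) : Measurable (cutKernel s c x) := by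
  have h1 : ∀ i, Measurable (pd i (cutAt s)) := fun i =>
    (contDiff_pd (m := 0) (contDiff_cutAt s (n := 1)) (by norm_num)).continuous.measurable
  have h2 : Measurable (lap (cutAt s)) := by
    refine Finset.measurable_fun_sum _ fun i _ => ?_
    exact (contDiff_pd (m := 0) (n := 1) (contDiff_pd (contDiff_cutAt s (n := 2)) (by norm_num)) (by norm_num)).continuous.measurable
  have h3 : ∀ i, Measurable (pd i (sqPow c (-(1 / 2)))) := fun i =>
    measurable_fderiv_apply_const ℝ _ _
  have h4 := measurable_sqPow c (-(1 / 2))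
  have hsub : Measurable fun y : E3 => y - x := by fun_prop
  refine (measurable_const.mul (Finset.measurable_fun_sum _ fun i _ => ?_)).add (h2.mul (h4.comp hsub))
  exact (h1 i).mul ((h3 i).comp hsub)

theorem integrable_of_abs_le_on_closedBall {F : E3 → ℝ} (hF : Measurable F) {L C : ℝ}
    (h0 : ∀ y, L < ‖y‖ → F y = 0) (hC : ∀ y, ‖y‖ ≤ L → |F y| ≤ C) : Integrable F := by
  have hi : Integrable ((Metric.closedBall (0 : E3) L).indicator fun _ => C) :=
    (integrable_indicator_iff Metric.isClosed_closedBall.measurableSet).2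
      (integrableOn_const (measure_closedBall_lt_top.ne))
  refine hi.mono' hF.aestronglyMeasurable (Eventually.of_forall fun y => ?_)
  by_cases hy : ‖y‖ ≤ L
  · rw [indicator_of_mem (by simpa using hy)]; exact hC y hy
  · rw [indicator_of_notMem (by simpa using hy), h0 y (not_le.1 hy)]; simp

theorem abs_integral_le_on_closedBall {F : E3 → ℝ} {L C : ℝ} (hL : 0 ≤ L)
    (h0 : ∀ y, L < ‖y‖ → F y = 0) (hC : ∀ y, ‖y‖ ≤ L → |F y| ≤ C) :
    |∫ y, F y| ≤ C * (unitBallVolume * L ^ 3) := by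
  have hi : Integrable ((Metric.closedBall (0 : E3) L).indicator fun _ => C) :=
    (integrable_indicator_iff Metric.isClosed_closedBall.measurableSet).2
      (integrableOn_const (measure_closedBall_lt_top.ne))
  have h := norm_integral_le_of_norm_le hi (Eventually.of_forall (p := fun y => ‖F y‖ ≤ _) fun y => ?_)
  · rw [integral_indicator Metric.isClosed_closedBall.measurableSet, setIntegral_const, smul_eq_mul,
      measureReal_def, Measure.addHaar_closedBall_eq_addHaar_ball, volume_ball_E3 _ hL,
      ENNReal.toReal_ofReal (by have := unitBallVolume_pos; positivity)] at h
    rw [mul_comm]; exact h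
  · by_cases hy : ‖y‖ ≤ L
    · rw [indicator_of_mem (by simpa using hy)]; exact hC y hy
    · rw [indicator_of_notMem (by simpa using hy), h0 y (not_le.1 hy)]; simp

/-- Green's identity for a function harmonic outside the ball of radius `s`. -/
theorem integral_green_cutAt {v W : E3 → ℝ} {s ρ c M : ℝ} (hs : 0 < s) (hsρ : s ≤ ρ) (hc : 0 < c)
    (hv : ∀ y, s ≤ ‖y‖ → ContDiffAt ℝ 2 v y) (hv0 : ∀ y, s ≤ ‖y‖ → lap v y = 0)
    (hW : ∀ y, s ≤ ‖y‖ → W y = v y) (hWm : Measurable W) (hWM : ∀ y, |W y| ≤ M) (x : E3) :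
    (∫ y, W y * ((cutAt ρ y - cutAt s y) * (-3 * c * sqPow c (-(5 / 2)) (y - x)))) +
      (∫ y, W y * cutKernel ρ c x y) - (∫ y, W y * cutKernel s c x y) = 0 := by
  have hρ : 0 < ρ := hs.trans_le hsρ
  set k : E3 → ℝ := fun y => sqPow c (-(1 / 2)) (y - x) with hk
  -- `ζ` lives where `v` is harmonic, so `∫ v Δ(ζk) = ∫ Δv ζk = 0`; the claim is the expansion of
  -- `Δ(ζk)`. Replacing `v` by `W` makes the integrands measurable and controlled on the whole
  -- space.
  set ζ : E3 → ℝ := fun y => cutAt ρ y - cutAt s y with hζ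
  have hkC : ContDiff ℝ 2 k := contDiff_sqPow_comp hc x
  have hζC : ContDiff ℝ 2 ζ := (contDiff_cutAt ρ).sub (contDiff_cutAt s)
  have hζs : HasCompactSupport ζ := (hasCompactSupport_cutAt hρ).sub (hasCompactSupport_cutAt hs)
  have hsupp : tsupport ζ ⊆ {y | s ≤ ‖y‖} := by
    refine closure_minimal (fun y hy => ?_) (isClosed_le continuous_const continuous_norm)
    by_contra h
    have h' : ‖y‖ < s := not_le.1 h
    exact hy (by simp [hζ, cutAt_eq_one hs h'.le, cutAt_eq_one hρ (h'.le.trans hsρ)])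
  have hsuppq : tsupport (fun y => ζ y * k y) ⊆ {y | s ≤ ‖y‖} :=
    (tsupport_mul_subset_left (f := ζ) (g := k)).trans hsupp
  have h0 := integral_mul_lap (u := v) (q := fun y => ζ y * k y) (hζC.mul hkC) hζs.mul_right
    fun y hy => hv y (hsuppq hy)
  have hz : ∫ y, lap v y * (ζ y * k y) = 0 := by
    refine integral_eq_zero_of_ae (Eventually.of_forall fun y => ?_)
    by_cases hy : s ≤ ‖y‖
    · simp [hv0 y hy]
    · have : ζ y = 0 := by
        by_contra h; exact hy (hsupp (subset_tsupport _ h))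
      simp [this]
  rw [hz] at h0
  have hpd : ∀ i y, pd i ζ y = pd i (cutAt ρ) y - pd i (cutAt s) y := fun i y =>
    pd_sub ((contDiff_cutAt ρ (n := 1)).differentiable (by norm_num) y)
      ((contDiff_cutAt s (n := 1)).differentiable (by norm_num) y)
  have hpd' : ∀ (r : ℝ) i, Differentiable ℝ (pd i (cutAt r)) := fun r i =>
    (contDiff_pd (m := 1) (contDiff_cutAt r (n := 2)) (by norm_num)).differentiable (by norm_num)
  have hlapζ : ∀ y, lap ζ y = lap (cutAt ρ) y - lap (cutAt s) y := fun y => by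
    simp only [lap, ← Finset.sum_sub_distrib]
    refine Finset.sum_congr rfl fun i _ => ?_
    have : pd i ζ = fun y => pd i (cutAt ρ) y - pd i (cutAt s) y := funext (hpd i)
    rw [this, pd_sub (hpd' ρ i y) (hpd' s i y)]
  have hpt : ∀ y, v y * lap (fun y => ζ y * k y) y =
      W y * (ζ y * (-3 * c * sqPow c (-(5 / 2)) (y - x))) +
      W y * cutKernel ρ c x y - W y * cutKernel s c x y := by
    intro y
    have hlk : lap k y = -3 * c * sqPow c (-(5 / 2)) (y - x) := by
      rw [hk, lap_comp_sub, lap_sqPow_neg_half (by positivity)]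
    have hpk : ∀ i, pd i k y = pd i (sqPow c (-(1 / 2))) (y - x) := fun i => pd_comp_sub _ x y
    have e : lap (fun y => ζ y * k y) y = ζ y * (-3 * c * sqPow c (-(5 / 2)) (y - x)) +
        cutKernel ρ c x y - cutKernel s c x y := by
      rw [lap_mul hζC hkC, hlk, hlapζ]
      simp only [hpd, hpk, cutKernel, sub_mul, Finset.sum_sub_distrib]
      simp only [hk]
      ring
    by_cases hy : s ≤ ‖y‖
    · rw [hW y hy, e]; ring
    · have hy' : ‖y‖ < s := not_le.1 hy
      have e1 := cutKernel_eq_zero hs c x (Or.inl hy')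
      have e2 := cutKernel_eq_zero hρ c x (Or.inl (hy'.trans_le hsρ))
      have e3 : ζ y = 0 := by simp [hζ, cutAt_eq_one hs hy'.le, cutAt_eq_one hρ (hy'.le.trans hsρ)]
      rw [e, e1, e2, e3]; ring
  have hcontK : ∀ r, Continuous (cutKernel r c x) := by
    intro r
    have h1 : ∀ i, Continuous (pd i (cutAt r)) := fun i => (hpd' r i).continuous
    have h2 : Continuous (lap (cutAt r)) := continuous_finsetSum _ fun i _ =>
      (contDiff_pd (m := 0) (n := 1) (contDiff_pd (contDiff_cutAt r (n := 2)) (by norm_num)) (by norm_num)).continuous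
    have h3 : ∀ i, Continuous fun y => pd i (sqPow c (-(1 / 2))) (y - x) := fun i => by
      have := (contDiff_pd (i := i) (m := 0) (hkC.of_le (by norm_num : (1 : WithTop ℕ∞) ≤ 2)) (by norm_num)).continuous
      refine this.congr fun y => pd_comp_sub _ x y
    unfold cutKernel
    exact (continuous_const.mul (continuous_finsetSum _ fun i _ => (h1 i).mul (h3 i))).add
      (h2.mul hkC.continuous)
  have hint : ∀ F : E3 → ℝ, Continuous F → HasCompactSupport F → Integrable fun y => W y * F y :=
    fun F hF hFs => (hF.integrable_of_hasCompactSupport hFs).bdd_mul hWm.aestronglyMeasurable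
      (Eventually.of_forall hWM)
  have hKs : ∀ r, 0 < r → HasCompactSupport (cutKernel r c x) := fun r hr =>
    HasCompactSupport.intro (isCompact_closedBall (0 : E3) (2 * r)) fun y hy =>
      cutKernel_eq_zero hr c x (Or.inr (by simpa using hy))
  have i1 : Integrable fun y => W y * (ζ y * (-3 * c * sqPow c (-(5 / 2)) (y - x))) :=
    hint _ (hζC.continuous.mul (continuous_const.mul (contDiff_sqPow_comp hc x (n := 0)).continuous)) hζs.mul_right
  have i2 := hint _ (hcontK ρ) (hKs ρ hρ)
  have i3 := hint _ (hcontK s) (hKs s hs)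
  have i12 : Integrable fun y => W y * (ζ y * (-3 * c * sqPow c (-(5 / 2)) (y - x))) +
      W y * cutKernel ρ c x y := i1.add i2
  rw [← integral_add i1 i2, ← integral_sub i12 i3]
  rw [← h0]
  exact integral_congr_ae (Eventually.of_forall fun y => (hpt y).symm)

theorem integrable_sqPow_one : Integrable (sqPow 1 (-(5 / 2))) := by
  have := integrable_rpow_neg_one_add_norm_sq (E := E3) (μ := volume) (r := 5) (by simp; norm_num)
  refine this.congr (Eventually.of_forall fun x => ?_)
  simp only [sqPow]
  rw [add_comm]; norm_num

/-- The normalisation constant `3 ∫ (|z|² + 1)^{-5/2}` of the fundamental solution. -/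
noncomputable def newtonConst : ℝ := 3 * ∫ z, sqPow 1 (-(5 / 2)) z

/-- Only positivity matters: the constant is absorbed into the coefficient of the expansion at
infinity, and its value is not needed. -/
theorem newtonConst_pos : 0 < newtonConst := by
  refine mul_pos (by norm_num) ?_
  have hpos : ∀ z, 0 < sqPow 1 (-(5 / 2)) z := fun z => Real.rpow_pos_of_pos (by positivity) _
  rw [integral_pos_iff_support_of_nonneg (fun z => (hpos z).le) integrable_sqPow_one]
  have : Function.support (sqPow 1 (-(5 / 2))) = univ := by
    ext z; simp [(hpos z).ne']
  rw [this]; simp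

/-- Substitution `y = x + εz`: the prefactor `ε²`, the volume factor `ε³` and the kernel factor
`ε⁻⁵` cancel. -/
theorem integral_scaled_sqPow {ε : ℝ} (hε : 0 < ε) (F : E3 → ℝ) (x : E3) :
    ∫ y, F y * (-3 * ε ^ 2 * sqPow (ε ^ 2) (-(5 / 2)) (y - x)) =
      -3 * ∫ z, F (x + ε • z) * sqPow 1 (-(5 / 2)) z := by
  have h1 := integral_add_left_eq_self (μ := (volume : Measure E3))
    (fun y => F y * (-3 * ε ^ 2 * sqPow (ε ^ 2) (-(5 / 2)) (y - x))) x
  have h2 := Measure.integral_comp_smul (volume : Measure E3)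
    (fun w => F (x + w) * (-3 * ε ^ 2 * sqPow (ε ^ 2) (-(5 / 2)) (x + w - x))) ε
  rw [h1] at h2
  have h3 : ∀ z : E3, F (x + ε • z) * (-3 * ε ^ 2 * sqPow (ε ^ 2) (-(5 / 2)) (x + ε • z - x)) =
      (ε ^ 3)⁻¹ * (-3 * (F (x + ε • z) * sqPow 1 (-(5 / 2)) z)) := by
    intro z
    have : sqPow (ε ^ 2) (-(5 / 2)) (x + ε • z - x) = (ε ^ 5)⁻¹ * sqPow 1 (-(5 / 2)) z := by
      simp only [sqPow, add_sub_cancel_left, norm_smul, Real.norm_eq_abs, abs_of_pos hε]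
      have e : (ε * ‖z‖) ^ 2 + ε ^ 2 = ε ^ 2 * (‖z‖ ^ 2 + 1) := by ring
      rw [e, Real.mul_rpow (by positivity) (by positivity)]
      congr 1
      rw [← Real.rpow_natCast ε 2, ← Real.rpow_mul hε.le, ← Real.rpow_natCast ε 5, ← Real.rpow_neg hε.le]
      norm_num
    rw [this]; field_simp
  simp only [h3] at h2
  rw [integral_const_mul, integral_const_mul, finrank_euclideanSpace_fin, smul_eq_mul,
    abs_of_pos (by positivity)] at h2
  have : (ε ^ 3)⁻¹ ≠ 0 := by positivity
  exact (mul_left_cancel₀ this h2).symm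

theorem tendsto_integral_scaled {F : ℕ → E3 → ℝ} {M l : ℝ} {x : E3} {ε : ℕ → ℝ}
    (hFm : ∀ n, Measurable (F n)) (hM : ∀ n y, |F n y| ≤ M)
    (hlim : ∀ z, Tendsto (fun n => F n (x + ε n • z)) atTop (𝓝 l)) :
    Tendsto (fun n => ∫ z, F n (x + ε n • z) * sqPow 1 (-(5 / 2)) z) atTop
      (𝓝 (l * ∫ z, sqPow 1 (-(5 / 2)) z)) := by
  rw [← integral_const_mul]
  refine tendsto_integral_of_dominated_convergence (fun z => M * sqPow 1 (-(5 / 2)) z) (fun n => ?_)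
    (integrable_sqPow_one.const_mul M) (fun n => Eventually.of_forall fun z => ?_)
    (Eventually.of_forall fun z => (hlim z).mul tendsto_const_nhds)
  · exact (((hFm n).comp (by fun_prop)).mul (measurable_sqPow _ _)).aestronglyMeasurable
  · rw [norm_mul, Real.norm_eq_abs, Real.norm_eq_abs, abs_of_nonneg (sqPow_nonneg zero_le_one _ _)]
    exact mul_le_mul_of_nonneg_right (hM n _) (sqPow_nonneg zero_le_one _ _)

theorem tendsto_pd_sqPow {ε : ℕ → ℝ} (hε : Tendsto ε atTop (𝓝 0)) {z : E3} (hz : z ≠ 0) (i : Fin 3) :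
    Tendsto (fun n => pd i (sqPow (ε n ^ 2) (-(1 / 2))) z) atTop (𝓝 (pd i (sqPow 0 (-(1 / 2))) z)) := by
  have hz' : 0 < ‖z‖ := norm_pos_iff.2 hz
  have h1 : ∀ c, 0 ≤ c → pd i (sqPow c (-(1 / 2))) z = 2 * (-(1 / 2)) * (z i * sqPow c (-(1 / 2) - 1) z) :=
    fun c hc => pd_sqPow (by positivity) i
  rw [h1 0 le_rfl]
  simp only [h1 _ (sq_nonneg _)]
  refine (Tendsto.const_mul _ (Tendsto.const_mul _ ?_))
  refine Tendsto.rpow_const (Tendsto.const_add _ ?_) (Or.inl (by positivity))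
  simpa using hε.pow 2

theorem tendsto_sqPow {ε : ℕ → ℝ} (hε : Tendsto ε atTop (𝓝 0)) {z : E3} (hz : z ≠ 0) (p : ℝ) :
    Tendsto (fun n => sqPow (ε n ^ 2) p z) atTop (𝓝 (sqPow 0 p z)) := by
  have hz' : 0 < ‖z‖ := norm_pos_iff.2 hz
  refine Tendsto.rpow_const (Tendsto.const_add _ ?_) (Or.inl (by positivity))
  simpa using hε.pow 2

/-- The kernel is supported in `s ≤ ‖y‖ ≤ 2s`, at distance at least `‖x‖ - 2s` from `x`, so the
singularity never enters and dominated convergence applies. -/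
theorem tendsto_integral_cutKernel_inner {W : E3 → ℝ} {s M : ℝ} (hs : 0 < s)
    (hWm : Measurable W) (hWM : ∀ y, |W y| ≤ M) {x : E3} (hx : 2 * s < ‖x‖) {ε : ℕ → ℝ}
    (hε : Tendsto ε atTop (𝓝 0)) :
    Tendsto (fun n => ∫ y, W y * cutKernel s (ε n ^ 2) x y) atTop
      (𝓝 (∫ y, W y * cutKernel s 0 x y)) := by
  obtain ⟨T, hT0, hT1, -, hT2⟩ := exists_bound_cutBump
  have hM : 0 ≤ M := (abs_nonneg _).trans (hWM 0)
  set d := ‖x‖ - 2 * s with hd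
  have hdpos : 0 < d := by linarith
  set B := M * (T * (6 * s⁻¹ * (d ^ 2)⁻¹ + s⁻¹ ^ 2 * d⁻¹)) with hB
  have hfar : ∀ y : E3, ‖y‖ ≤ 2 * s → d ≤ ‖y - x‖ := fun y hy => by
    rw [norm_sub_rev]; linarith [norm_sub_norm_le x y]
  refine tendsto_integral_of_dominated_convergence
    ((Metric.closedBall (0 : E3) (2 * s)).indicator fun _ => B) (fun n => ?_) ?_ (fun n => ?_) ?_
  · exact (hWm.mul (measurable_cutKernel _ _ _)).aestronglyMeasurable
  · exact (integrable_indicator_iff Metric.isClosed_closedBall.measurableSet).2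
      (integrableOn_const (measure_closedBall_lt_top.ne))
  · refine Eventually.of_forall fun y => ?_
    by_cases hy : ‖y‖ ≤ 2 * s
    · rw [indicator_of_mem (by simpa using hy), norm_mul]
      exact mul_le_mul (hWM y) (abs_cutKernel_le hT1 hT2 hs (sq_nonneg _) hdpos (hfar y hy))
        (norm_nonneg _) hM
    · rw [indicator_of_notMem (by simpa using hy), cutKernel_eq_zero hs _ _ (Or.inr (not_le.1 hy))]
      simp
  · refine Eventually.of_forall fun y => Tendsto.const_mul _ ?_
    by_cases hy : ‖y‖ ≤ 2 * s
    · have hne : y - x ≠ 0 := norm_pos_iff.1 (hdpos.trans_le (hfar y hy))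
      refine Tendsto.add (Tendsto.const_mul _ (tendsto_finsetSum _ fun i _ => ?_)) ?_
      · exact (tendsto_pd_sqPow hε hne i).const_mul _
      · exact (tendsto_sqPow hε hne _).const_mul _
    · simp only [cutKernel_eq_zero hs _ _ (Or.inr (not_le.1 hy))]
      exact tendsto_const_nhds

/-- Uniformly in the regularisation the kernel is `O(ρ⁻³)` on a region of volume `O(ρ³)`, where `v`
is small. -/
theorem tendsto_integral_cutKernel_outer {v W : E3 → ℝ} {s : ℝ} (hs : 0 < s)
    (hlim : Tendsto v (Bornology.cobounded E3) (𝓝 0)) (hW : ∀ y, s ≤ ‖y‖ → W y = v y) (x : E3)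
    (ε : ℕ → ℝ) {ρ : ℕ → ℝ} (hρ : Tendsto ρ atTop atTop) (hρs : ∀ n, s ≤ ρ n) :
    Tendsto (fun n => ∫ y, W y * cutKernel (ρ n) (ε n ^ 2) x y) atTop (𝓝 0) := by
  obtain ⟨T, hT0, hT1, -, hT2⟩ := exists_bound_cutBump
  rw [Metric.tendsto_atTop']
  intro δ hδ
  have hωp := unitBallVolume_pos
  set δ' := δ / (2 * (26 * T * (unitBallVolume * 8) + 1)) with hδ'
  have hδ'0 : 0 < δ' := by positivity
  have hev := (Metric.tendsto_nhds.1 hlim) δ' hδ'0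
  rw [← comap_norm_atTop, eventually_comap] at hev
  obtain ⟨L, hL⟩ := eventually_atTop.1 hev
  obtain ⟨N, hN⟩ := eventually_atTop.1 (hρ.eventually (eventually_ge_atTop (max L (2 * ‖x‖))))
  refine ⟨N, fun n hn => ?_⟩
  have hn' := hN n hn.le
  have hρ0 : 0 < ρ n := hs.trans_le (hρs n)
  have hbound : ∀ y : E3, ‖y‖ ≤ 2 * ρ n → |W y * cutKernel (ρ n) (ε n ^ 2) x y| ≤
      δ' * (26 * T * (ρ n ^ 3)⁻¹) := by
    intro y hy
    by_cases hy1 : ‖y‖ < ρ n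
    · rw [cutKernel_eq_zero hρ0 _ _ (Or.inl hy1), mul_zero, abs_zero]; positivity
    · push Not at hy1
      have hw : |W y| ≤ δ' := by
        rw [hW y ((hρs n).trans hy1)]
        have := hL ‖y‖ ((le_max_left _ _).trans (hn'.trans hy1)) y rfl
        rw [Real.dist_eq, sub_zero] at this; exact this.le
      have hfar : ρ n / 2 ≤ ‖y - x‖ := by
        have := norm_sub_norm_le y x
        linarith [(le_max_right L (2 * ‖x‖)).trans hn']
      have hk := abs_cutKernel_le hT1 hT2 hρ0 (sq_nonneg (ε n)) (half_pos hρ0) hfar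
      -- `26 = 6 · 4 + 2`, from the distance `d = ρ/2`.
      have e : T * (6 * (ρ n)⁻¹ * ((ρ n / 2) ^ 2)⁻¹ + (ρ n)⁻¹ ^ 2 * (ρ n / 2)⁻¹) =
          26 * T * (ρ n ^ 3)⁻¹ := by
          field_simp; ring
      rw [abs_mul]
      exact mul_le_mul hw (hk.trans_eq e) (abs_nonneg _) hδ'0.le
  have h := abs_integral_le_on_closedBall (by positivity : 0 ≤ 2 * ρ n)
    (F := fun y => W y * cutKernel (ρ n) (ε n ^ 2) x y)
    (fun y hy => by rw [cutKernel_eq_zero hρ0 _ _ (Or.inr hy), mul_zero]) hbound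
  rw [Real.dist_eq, sub_zero]
  refine h.trans_lt ?_
  have e2 : δ' * (26 * T * (ρ n ^ 3)⁻¹) * (unitBallVolume * (2 * ρ n) ^ 3) =
      δ' * (26 * T * (unitBallVolume * 8)) := by field_simp; norm_num
  rw [e2, hδ', div_mul_eq_mul_div, div_lt_iff₀ (by positivity)]
  have : 0 ≤ 26 * T * (unitBallVolume * 8) := by positivity
  nlinarith

/-- The Laplacian of the regularised kernel acts as an approximate identity at `x`. Near `x` the
difference of the cutoffs is eventually `1`, since `2s < ‖x‖` and `ρ → ∞`. -/
theorem tendsto_integral_main {v W : E3 → ℝ} {s M : ℝ} (hs : 0 < s)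
    (hW : ∀ y, s ≤ ‖y‖ → W y = v y) (hWm : Measurable W) (hWM : ∀ y, |W y| ≤ M) {x : E3}
    (hx : 2 * s < ‖x‖) (hvx : ContinuousAt v x) {ε ρ : ℕ → ℝ} (hεpos : ∀ n, 0 < ε n)
    (hε : Tendsto ε atTop (𝓝 0)) (hρ : Tendsto ρ atTop atTop) (hρs : ∀ n, s ≤ ρ n) :
    Tendsto (fun n => ∫ y, W y * ((cutAt (ρ n) y - cutAt s y) *
      (-3 * ε n ^ 2 * sqPow (ε n ^ 2) (-(5 / 2)) (y - x)))) atTop (𝓝 (-(newtonConst * v x))) := by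
  have hM : 0 ≤ M := (abs_nonneg _).trans (hWM 0)
  have hxs : s < ‖x‖ := by linarith
  have e : ∀ n, ∫ y, W y * ((cutAt (ρ n) y - cutAt s y) *
      (-3 * ε n ^ 2 * sqPow (ε n ^ 2) (-(5 / 2)) (y - x))) =
      -3 * ∫ z, (fun y => W y * (cutAt (ρ n) y - cutAt s y)) (x + ε n • z) * sqPow 1 (-(5 / 2)) z := by
    intro n
    rw [← integral_scaled_sqPow (hεpos n) (fun y => W y * (cutAt (ρ n) y - cutAt s y)) x]
    simp only [mul_assoc]
  simp only [e]
  have e2 : -(newtonConst * v x) = -3 * (v x * ∫ z, sqPow 1 (-(5 / 2)) z) := by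
    rw [newtonConst]; ring
  rw [e2]
  refine (tendsto_integral_scaled (F := fun n y => W y * (cutAt (ρ n) y - cutAt s y)) (M := M)
    (l := v x) (fun n => ?_) (fun n y => ?_) fun z => ?_).const_mul _
  · exact hWm.mul ((contDiff_cutAt (ρ n) (n := 0)).continuous.measurable.sub
      (contDiff_cutAt s (n := 0)).continuous.measurable)
  · rw [abs_mul]
    refine (mul_le_mul (hWM y) ?_ (abs_nonneg _) hM).trans_eq (mul_one M)
    rw [abs_le]
    constructor <;> linarith [cutAt_nonneg s y, cutAt_le_one s y, cutAt_nonneg (ρ n) y, cutAt_le_one (ρ n) y]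
  · have hseq : Tendsto (fun n => x + ε n • z) atTop (𝓝 x) := by
      have := (hε.smul_const z).const_add x
      simpa using this
    have hcont : Tendsto (fun n => v (x + ε n • z)) atTop (𝓝 (v x)) :=
      hvx.tendsto.comp hseq
    refine hcont.congr' ?_
    have hn1 : ∀ᶠ n in atTop, 2 * s < ‖x + ε n • z‖ := hseq.norm.eventually (lt_mem_nhds hx)
    have hn2 : ∀ᶠ n in atTop, ‖x + ε n • z‖ < ‖x‖ + 1 := hseq.norm.eventually (gt_mem_nhds (by linarith))
    filter_upwards [hn1, hn2, hρ.eventually (eventually_ge_atTop (‖x‖ + 1))] with n h1 h2 h3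
    rw [hW _ (by linarith), cutAt_eq_one (hs.trans_le (hρs n)) (by linarith), cutAt_eq_zero hs h1.le]
    ring

/-- A function harmonic outside a ball and decaying at infinity is represented by the values on
an annulus. -/
theorem newton_representation {v W : E3 → ℝ} {s M : ℝ} (hs : 0 < s)
    (hv : ∀ y, s ≤ ‖y‖ → ContDiffAt ℝ 2 v y) (hv0 : ∀ y, s ≤ ‖y‖ → lap v y = 0)
    (hlim : Tendsto v (Bornology.cobounded E3) (𝓝 0))
    (hW : ∀ y, s ≤ ‖y‖ → W y = v y) (hWm : Measurable W) (hWM : ∀ y, |W y| ≤ M) {x : E3}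
    (hx : 2 * s < ‖x‖) :
    newtonConst * v x = -∫ y, W y * cutKernel s 0 x y := by
  have hM : 0 ≤ M := (abs_nonneg _).trans (hWM 0)
  set ε : ℕ → ℝ := fun n => 1 / ((n : ℝ) + 1) with hεdef
  set ρ : ℕ → ℝ := fun n => s + n with hρdef
  have hεpos : ∀ n, 0 < ε n := fun n => by simp only [hεdef]; positivity
  have hε : Tendsto ε atTop (𝓝 0) := tendsto_one_div_add_atTop_nhds_zero_nat
  have hρ : Tendsto ρ atTop atTop := tendsto_atTop_add_const_left _ _ tendsto_natCast_atTop_atTop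
  have hρs : ∀ n, s ≤ ρ n := fun n => by simp only [hρdef]; linarith [(Nat.cast_nonneg n : (0 : ℝ) ≤ n)]
  have hgreen := fun n => integral_green_cutAt hs (hρs n) (pow_pos (hεpos n) 2) hv hv0 hW hWm hWM x
  have L1 := tendsto_integral_cutKernel_inner hs hWm hWM hx hε
  have L2 := tendsto_integral_cutKernel_outer hs hlim hW x ε hρ hρs
  have L3 := tendsto_integral_main hs hW hWm hWM hx (hv x (by linarith)).continuousAt hεpos hε hρ hρs
  have L := (L3.add L2).sub L1
  have : Tendsto (fun _ : ℕ => (0 : ℝ)) atTop (𝓝 (-(newtonConst * v x) + 0 - ∫ y, W y * cutKernel s 0 x y)) :=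
    L.congr fun n => hgreen n
  have := tendsto_nhds_unique this tendsto_const_nhds
  linarith

/-! ### Potentials of bounded densities and the expansion at infinity -/

/-- Decay of a kernel that is smooth away from the origin. -/
structure IsDecayingKernel (N : E3 → ℝ) (A : ℝ) (p : ℕ) : Prop where
  measurable : Measurable N
  nonneg : 0 ≤ A
  differentiableAt : ∀ w, w ≠ 0 → DifferentiableAt ℝ N w
  abs_le : ∀ w, w ≠ 0 → |N w| ≤ A / ‖w‖ ^ p
  norm_fderiv_le : ∀ w, w ≠ 0 → ‖fderiv ℝ N w‖ ≤ A / ‖w‖ ^ (p + 1)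

/-- Bounded densities supported in a ball. -/
structure IsBoundedDensity (h : E3 → ℝ) (B L : ℝ) : Prop where
  measurable : Measurable h
  pos : 0 < L
  abs_le : ∀ y, |h y| ≤ B
  eq_zero : ∀ y, L < ‖y‖ → h y = 0

theorem IsBoundedDensity.nonneg {h : E3 → ℝ} {B L : ℝ} (hh : IsBoundedDensity h B L) : 0 ≤ B :=
  (abs_nonneg _).trans (hh.abs_le 0)

theorem IsBoundedDensity.integrable {h : E3 → ℝ} {B L : ℝ} (hh : IsBoundedDensity h B L) : Integrable h :=
  integrable_of_abs_le_on_closedBall hh.measurable hh.eq_zero fun y _ => hh.abs_le y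

/-- The potential `∫ h(y) N(x - y) dy`. -/
noncomputable def potential (h N : E3 → ℝ) (x : E3) : ℝ := ∫ y, h y * N (x - y)

theorem half_norm_le_norm_sub {x y : E3} (h : 2 * ‖y‖ ≤ ‖x‖) : ‖x‖ / 2 ≤ ‖x - y‖ := by
  linarith [norm_sub_norm_le x y]

theorem abs_potential_le {h N : E3 → ℝ} {A B L : ℝ} {p : ℕ} (hN : IsDecayingKernel N A p)
    (hh : IsBoundedDensity h B L) {x : E3} (hx : 2 * L ≤ ‖x‖) :
    |potential h N x| ≤ B * (A * 2 ^ p) * (unitBallVolume * L ^ 3) / ‖x‖ ^ p := by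
  have hL := hh.pos
  have hB := hh.nonneg
  have hA := hN.nonneg
  have hx0 : 0 < ‖x‖ := by linarith
  have := abs_integral_le_on_closedBall (F := fun y => h y * N (x - y)) (L := L)
    (C := B * (A * 2 ^ p / ‖x‖ ^ p)) hL.le (fun y hy => by simp [hh.eq_zero y hy]) fun y hy => ?_
  · refine this.trans_eq ?_; ring
  · have hd := half_norm_le_norm_sub (x := x) (y := y) (by linarith)
    have hne : x - y ≠ 0 := norm_pos_iff.1 (lt_of_lt_of_le (by positivity) hd)
    rw [abs_mul]
    refine mul_le_mul (hh.abs_le y) ((hN.abs_le _ hne).trans ?_) (abs_nonneg _) hB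
    calc A / ‖x - y‖ ^ p ≤ A / (‖x‖ / 2) ^ p := by gcongr
      _ = A * 2 ^ p / ‖x‖ ^ p := by rw [div_pow]; field_simp

/-- For `‖x‖ > 2L` the kernel is evaluated at distance at least `L` from its singularity, which
permits differentiation under the integral. -/
theorem pd_potential {h N : E3 → ℝ} {A B L : ℝ} {p : ℕ} (hN : IsDecayingKernel N A p)
    (hh : IsBoundedDensity h B L) {x : E3} (hx : 2 * L < ‖x‖) (j : Fin 3) :
    DifferentiableAt ℝ (potential h N) x ∧
      pd j (potential h N) x = ∫ y, h y * pd j N (x - y) := by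
  have hL := hh.pos
  have hB := hh.nonneg
  have hA := hN.nonneg
  have hx0 : 0 < ‖x‖ := by linarith
  set S : Set E3 := {z | 2 * L < ‖z‖} with hS
  have hSo : IsOpen S := isOpen_lt continuous_const continuous_norm
  have hfm : Measurable (fderiv ℝ N) := measurable_fderiv ℝ N
  have hne : ∀ z ∈ S, ∀ y, ‖y‖ ≤ L → L ≤ ‖z - y‖ := fun z hz y hy => by
    have : 2 * L < ‖z‖ := hz
    linarith [norm_sub_norm_le z y]
  have hmeas : ∀ z : E3, AEStronglyMeasurable (fun y => h y * N (z - y)) volume := fun z =>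
    (hh.measurable.mul (hN.measurable.comp (by fun_prop))).aestronglyMeasurable
  have key := hasFDerivAt_integral_of_dominated_of_fderiv_le (μ := (volume : Measure E3)) (𝕜 := ℝ)
    (F := fun z y => h y * N (z - y)) (F' := fun z y => h y • fderiv ℝ N (z - y)) (x₀ := x)
    (bound := (Metric.closedBall (0 : E3) L).indicator fun _ => B * (A / L ^ (p + 1))) (s := S)
    (hSo.mem_nhds hx) (Eventually.of_forall hmeas) ?_ ?_ ?_ ?_ ?_
  · refine ⟨key.differentiableAt, ?_⟩
    rw [pd]
    change (fderiv ℝ (fun z => ∫ y, h y * N (z - y)) x) (stdVec j) = _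
    rw [key.fderiv, ContinuousLinearMap.integral_apply]
    · rfl
    · refine Integrable.mono' (g := (Metric.closedBall (0 : E3) L).indicator fun _ => B * (A / L ^ (p + 1)))
        ((integrable_indicator_iff Metric.isClosed_closedBall.measurableSet).2
        (integrableOn_const (measure_closedBall_lt_top.ne))) ?_ (Eventually.of_forall fun y => ?_)
      · exact (hh.measurable.smul (hfm.comp (by fun_prop))).aestronglyMeasurable
      · by_cases hy : ‖y‖ ≤ L
        · rw [indicator_of_mem (by simpa using hy), norm_smul]
          have h1 := hne x hx y hy
          have h2 : x - y ≠ 0 := norm_pos_iff.1 (hL.trans_le h1)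
          refine mul_le_mul (hh.abs_le y) ((hN.norm_fderiv_le _ h2).trans ?_) (norm_nonneg _) hB
          gcongr
        · rw [indicator_of_notMem (by simpa using hy), hh.eq_zero y (not_le.1 hy)]; simp
  · refine integrable_of_abs_le_on_closedBall (L := L) (C := B * (A / L ^ p))
      (hh.measurable.mul (hN.measurable.comp (by fun_prop)))
      (fun y hy => by simp [hh.eq_zero y hy]) fun y hy => ?_
    have h1 := hne x hx y hy
    have h2 : x - y ≠ 0 := norm_pos_iff.1 (hL.trans_le h1)
    rw [abs_mul]
    refine mul_le_mul (hh.abs_le y) ((hN.abs_le _ h2).trans ?_) (abs_nonneg _) hB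
    gcongr
  · exact (hh.measurable.smul (hfm.comp (by fun_prop))).aestronglyMeasurable
  · refine Eventually.of_forall fun y z hz => ?_
    by_cases hy : ‖y‖ ≤ L
    · rw [indicator_of_mem (by simpa using hy), norm_smul]
      have h1 := hne z hz y hy
      have h2 : z - y ≠ 0 := norm_pos_iff.1 (hL.trans_le h1)
      refine mul_le_mul (hh.abs_le y) ((hN.norm_fderiv_le _ h2).trans ?_) (norm_nonneg _) hB
      gcongr
    · rw [indicator_of_notMem (by simpa using hy), hh.eq_zero y (not_le.1 hy)]; simp
  · exact (integrable_indicator_iff Metric.isClosed_closedBall.measurableSet).2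
        (integrableOn_const (measure_closedBall_lt_top.ne))
  · refine Eventually.of_forall fun y z hz => ?_
    by_cases hy : ‖y‖ ≤ L
    · have h1 := hne z hz y hy
      have h2 : z - y ≠ 0 := norm_pos_iff.1 (hL.trans_le h1)
      have h3 : HasFDerivAt (fun z => N (z - y)) (fderiv ℝ N (z - y)) z := by
        have := (hN.differentiableAt _ h2).hasFDerivAt.comp z ((hasFDerivAt_id z).sub_const y)
        simpa using! this
      exact h3.const_mul (h y)
    · simp only [hh.eq_zero y (not_le.1 hy), zero_mul, zero_smul]
      exact hasFDerivAt_const _ _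

theorem IsDecayingKernel.abs_sub_le {N : E3 → ℝ} {A : ℝ} {p : ℕ} (hN : IsDecayingKernel N A p)
    {x y : E3} (hx : x ≠ 0) (hxy : 2 * ‖y‖ ≤ ‖x‖) :
    |N (x - y) - N x| ≤ A * 2 ^ (p + 1) / ‖x‖ ^ (p + 1) * ‖y‖ := by
  have hx0 : 0 < ‖x‖ := norm_pos_iff.2 hx
  have hA := hN.nonneg
  have hball : ∀ z ∈ Metric.closedBall x (‖x‖ / 2), ‖x‖ / 2 ≤ ‖z‖ := fun z hz => by
    rw [mem_closedBall_iff_norm] at hz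
    have := norm_sub_norm_le x z
    rw [norm_sub_rev] at this; linarith
  have hpos : ∀ z ∈ Metric.closedBall x (‖x‖ / 2), z ≠ 0 := fun z hz =>
    norm_pos_iff.1 (lt_of_lt_of_le (by positivity) (hball z hz))
  have := (convex_closedBall x (‖x‖ / 2)).norm_image_sub_le_of_norm_fderiv_le (𝕜 := ℝ) (f := N)
    (C := A * 2 ^ (p + 1) / ‖x‖ ^ (p + 1)) (fun z hz => hN.differentiableAt z (hpos z hz))
    (fun z hz => (hN.norm_fderiv_le z (hpos z hz)).trans ?_)
    (Metric.mem_closedBall_self (by positivity)) (y := x - y)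
    (by rw [mem_closedBall_iff_norm]; simp; linarith)
  · simpa using this
  · calc A / ‖z‖ ^ (p + 1) ≤ A / (‖x‖ / 2) ^ (p + 1) := by
          have := hball z hz; gcongr
      _ = _ := by rw [div_pow]; field_simp

/-- Leading term of the multipole expansion: replacing `N (x - y)` by `N x` costs `‖y‖` times the
gradient of the kernel, one order better in `‖x‖`. -/
theorem abs_potential_sub_le {h N : E3 → ℝ} {A B L : ℝ} {p : ℕ} (hN : IsDecayingKernel N A p)
    (hh : IsBoundedDensity h B L) {x : E3} (hx : 2 * L ≤ ‖x‖) :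
    |potential h N x - (∫ y, h y) * N x| ≤
      B * (A * 2 ^ (p + 1) * L) * (unitBallVolume * L ^ 3) / ‖x‖ ^ (p + 1) := by
  have hL := hh.pos
  have hB := hh.nonneg
  have hA := hN.nonneg
  have hx0 : 0 < ‖x‖ := by linarith
  have hi : Integrable fun y => h y * N (x - y) := by
    refine integrable_of_abs_le_on_closedBall (L := L) (C := B * (A / (‖x‖ / 2) ^ p))
      (hh.measurable.mul (hN.measurable.comp (by fun_prop)))
      (fun y hy => by simp [hh.eq_zero y hy]) fun y hy => ?_
    have hd := half_norm_le_norm_sub (x := x) (y := y) (by linarith)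
    have hne : x - y ≠ 0 := norm_pos_iff.1 (lt_of_lt_of_le (by positivity) hd)
    rw [abs_mul]
    refine mul_le_mul (hh.abs_le y) ((hN.abs_le _ hne).trans ?_) (abs_nonneg _) hB
    gcongr
  rw [potential, ← integral_mul_const, ← integral_sub hi (hh.integrable.mul_const _)]
  have := abs_integral_le_on_closedBall (F := fun y => h y * N (x - y) - h y * N x) (L := L)
    (C := B * (A * 2 ^ (p + 1) / ‖x‖ ^ (p + 1) * L)) hL.le (fun y hy => by simp [hh.eq_zero y hy])
    fun y hy => ?_
  · refine this.trans_eq ?_; ring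
  · rw [← mul_sub, abs_mul]
    refine mul_le_mul (hh.abs_le y) ((hN.abs_sub_le (norm_pos_iff.1 hx0) (by linarith)).trans ?_)
      (abs_nonneg _) hB
    gcongr

theorem isDecayingKernel_newton : IsDecayingKernel (sqPow 0 (-(1 / 2))) 1 1 where
  measurable := measurable_sqPow _ _
  nonneg := zero_le_one
  differentiableAt w hw := (hasFDerivAt_sqPow (by have := norm_pos_iff.2 hw; positivity)).differentiableAt
  abs_le w hw := by rw [sqPow_zero_neg_half, abs_of_nonneg (by positivity)]; simp
  norm_fderiv_le w hw := by
    have hw' : 0 < ‖w‖ := norm_pos_iff.2 hw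
    have e : (-(1 / 2) - 1 : ℝ) = -(3 / 2) := by norm_num
    rw [(hasFDerivAt_sqPow (by positivity)).fderiv, norm_smul, innerSL_apply_norm, e,
      sqPow_zero_neg_three_half, Real.norm_eq_abs, abs_mul, abs_of_nonneg (by positivity : 0 ≤ (‖w‖ ^ 3)⁻¹)]
    norm_num
    refine le_of_eq ?_
    field_simp

/-- The kernel `w_i / |w|³`. -/
noncomputable def dipole (i : Fin 3) (w : E3) : ℝ := w i * sqPow 0 (-(3 / 2)) w

theorem dipole_eq (i : Fin 3) (w : E3) : dipole i w = w i / ‖w‖ ^ 3 := by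
  rw [dipole, sqPow_zero_neg_three_half]; rfl

theorem pd_newton {w : E3} (hw : w ≠ 0) (i : Fin 3) : pd i (sqPow 0 (-(1 / 2))) w = -dipole i w := by
  have hw' : 0 < ‖w‖ := norm_pos_iff.2 hw
  rw [pd_sqPow (by positivity), dipole]
  norm_num

theorem abs_coord_le (w : E3) (i : Fin 3) : |w i| ≤ ‖w‖ := by simpa using PiLp.norm_apply_le w i

theorem isDecayingKernel_dipole (i : Fin 3) : IsDecayingKernel (dipole i) 4 2 where
  measurable := (by fun_prop : Measurable fun w : E3 => w i).mul (measurable_sqPow _ _)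
  nonneg := by norm_num
  differentiableAt w hw :=
    (hasFDerivAt_coord i w).differentiableAt.mul
      (hasFDerivAt_sqPow (by have := norm_pos_iff.2 hw; positivity)).differentiableAt
  abs_le w hw := by
    have hw' : 0 < ‖w‖ := norm_pos_iff.2 hw
    rw [dipole_eq, abs_div, abs_of_nonneg (by positivity : 0 ≤ ‖w‖ ^ 3), div_le_div_iff₀ (by positivity) (by positivity)]
    have := abs_coord_le w i
    calc |w i| * ‖w‖ ^ 2 ≤ ‖w‖ * ‖w‖ ^ 2 := by gcongr
      _ ≤ 4 * ‖w‖ ^ 3 := by nlinarith [pow_pos hw' 3]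
  norm_fderiv_le w hw := by
    have hw' : 0 < ‖w‖ := norm_pos_iff.2 hw
    have h1 : HasFDerivAt (dipole i) _ w := (hasFDerivAt_coord i w).mul (hasFDerivAt_sqPow (c := 0) (p := -(3 / 2)) (x := w) (by positivity))
    rw [h1.fderiv]
    have e5 : sqPow 0 (-(3 / 2) - 1) w = (‖w‖ ^ 5)⁻¹ := by
      rw [sqPow_zero, ← Real.rpow_natCast, ← Real.rpow_neg (norm_nonneg _)]; norm_num
    have hp : ‖(EuclideanSpace.proj i : E3 →L[ℝ] ℝ)‖ ≤ 1 :=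
      ContinuousLinearMap.opNorm_le_bound _ zero_le_one fun v => by simpa using abs_coord_le v i
    refine (norm_add_le _ _).trans ?_
    rw [norm_smul, norm_smul, norm_smul, innerSL_apply_norm, e5, sqPow_zero_neg_three_half,
      Real.norm_eq_abs, Real.norm_eq_abs, Real.norm_eq_abs, abs_mul,
      abs_of_nonneg (by positivity : 0 ≤ (‖w‖ ^ 3)⁻¹), abs_of_nonneg (by positivity : 0 ≤ (‖w‖ ^ 5)⁻¹)]
    norm_num
    calc |w i| * (3 * (‖w‖ ^ 5)⁻¹ * ‖w‖) + (‖w‖ ^ 3)⁻¹ * ‖(EuclideanSpace.proj i : E3 →L[ℝ] ℝ)‖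
        ≤ ‖w‖ * (3 * (‖w‖ ^ 5)⁻¹ * ‖w‖) + (‖w‖ ^ 3)⁻¹ * 1 := by
          have := abs_coord_le w i
          gcongr
      _ = 4 / ‖w‖ ^ 3 := by field_simp; norm_num

theorem eventually_cobounded_norm {P : E3 → Prop} :
    (∀ᶠ x in Bornology.cobounded E3, P x) ↔ ∃ L : ℝ, 0 < L ∧ ∀ x, L ≤ ‖x‖ → P x := by
  rw [← comap_norm_atTop, eventually_comap]
  constructor
  · intro h
    obtain ⟨L, hL⟩ := eventually_atTop.1 h
    exact ⟨max L 1, by positivity, fun x hx => hL ‖x‖ ((le_max_left _ _).trans hx) x rfl⟩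
  · rintro ⟨L, -, hL⟩
    exact eventually_atTop.2 ⟨L, fun b hb x hx => hL x (hx ▸ hb)⟩

theorem exists_truncated_extension {v : E3 → ℝ} {s : ℝ} (hv : ContinuousOn v {y | s ≤ ‖y‖})
    (hlim : Tendsto v (Bornology.cobounded E3) (𝓝 0)) :
    ∃ (W : E3 → ℝ) (M : ℝ), Measurable W ∧ (∀ y, |W y| ≤ M) ∧ ∀ y, s ≤ ‖y‖ → W y = v y := by
  have hcl : IsClosed {y : E3 | s ≤ ‖y‖} := isClosed_le continuous_const continuous_norm
  obtain ⟨L, -, hL⟩ := eventually_cobounded_norm.1 ((Metric.tendsto_nhds.1 hlim) 1 one_pos)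
  have hK : IsCompact ({y : E3 | s ≤ ‖y‖} ∩ Metric.closedBall 0 L) :=
    (isCompact_closedBall _ _).inter_left hcl
  obtain ⟨C, hC⟩ := hK.exists_bound_of_continuousOn (hv.mono inter_subset_left)
  refine ⟨{y : E3 | s ≤ ‖y‖}.indicator v, max C 1, ?_, fun y => ?_, fun y hy => indicator_of_mem (show y ∈ {y : E3 | s ≤ ‖y‖} from hy) v⟩
  · exact hv.measurable_piecewise (g := fun _ => 0) continuousOn_const hcl.measurableSet |> fun h => by
      simpa [piecewise_eq_indicator] using! h
  · by_cases hy : s ≤ ‖y‖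
    · rw [indicator_of_mem (show y ∈ {y : E3 | s ≤ ‖y‖} from hy)]
      by_cases hyL : ‖y‖ ≤ L
      · exact (hC y ⟨hy, by simpa using hyL⟩).trans (le_max_left _ _)
      · have := hL y (not_le.1 hyL).le
        rw [Real.dist_eq, sub_zero] at this
        exact this.le.trans (le_max_right _ _)
    · rw [indicator_of_notMem (show y ∉ {y : E3 | s ≤ ‖y‖} from hy)]; simp

/-- The expansion at infinity of a function harmonic outside a ball. -/
theorem harmonic_expansion {v : E3 → ℝ} {s : ℝ} (hs : 0 < s)
    (hv : ∀ y, s ≤ ‖y‖ → ContDiffAt ℝ 2 v y) (hv0 : ∀ y, s ≤ ‖y‖ → lap v y = 0)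
    (hlim : Tendsto v (Bornology.cobounded E3) (𝓝 0)) :
    ∃ a M : ℝ, 0 ≤ M ∧ ∀ x, 4 * s < ‖x‖ → |v x - a / ‖x‖| ≤ M / ‖x‖ ^ 2 ∧
      ∀ j, |pd j v x + a * dipole j x| ≤ M / ‖x‖ ^ 3 := by
  obtain ⟨W, M, hWm, hWM, hW⟩ := exists_truncated_extension (s := s)
    (fun y hy => (hv y hy).continuousAt.continuousWithinAt) hlim
  obtain ⟨T, hT0, hT1, -, hT2⟩ := exists_bound_cutBump
  have hM : 0 ≤ M := (abs_nonneg _).trans (hWM 0)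
  have hC := newtonConst_pos
  -- The representing kernel splits into a Newton part with density `W Δχ` and dipole parts with
  -- densities `W ∂_iχ`. Only the first contributes at order `1/|x|`, and its total mass determines
  -- `a`.
  set h0 : E3 → ℝ := fun y => W y * lap (cutAt s) y with hh0
  set h1 : Fin 3 → E3 → ℝ := fun i y => W y * pd i (cutAt s) y with hh1
  set L := 2 * s with hL
  set B := M * (s⁻¹ ^ 2 * T) + M * (s⁻¹ * T) with hB
  have b0 : IsBoundedDensity h0 B L := by
    refine ⟨hWm.mul ?_, by positivity, fun y => ?_, fun y hy => by
      simp [hh0, lap_cutAt_eq_zero hs (Or.inr hy)]⟩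
    · refine Finset.measurable_fun_sum _ fun i _ => ?_
      exact (contDiff_pd (m := 0) (n := 1) (contDiff_pd (contDiff_cutAt s (n := 2)) (by norm_num)) (by norm_num)).continuous.measurable
    · simp only [hh0]
      rw [abs_mul, lap_cutAt, abs_mul, abs_of_pos (by positivity : 0 < s⁻¹ ^ 2)]
      have : M * (s⁻¹ ^ 2 * T) ≤ B := le_add_of_nonneg_right (by positivity)
      refine le_trans ?_ this
      have e1 := hWM y
      have e2 := hT2 (s⁻¹ • y)
      gcongr
  have b1 : ∀ i, IsBoundedDensity (h1 i) B L := fun i => by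
    refine ⟨hWm.mul ?_, by positivity, fun y => ?_, fun y hy => by
      simp [hh1, (pd_cutAt_eq_zero hs (Or.inr hy)).eq_of_nhds]⟩
    · exact (contDiff_pd (m := 0) (contDiff_cutAt s (n := 1)) (by norm_num)).continuous.measurable
    · simp only [hh1]
      rw [abs_mul, pd_cutAt, abs_mul, abs_of_pos (by positivity : 0 < s⁻¹)]
      have : M * (s⁻¹ * T) ≤ B := le_add_of_nonneg_left (by positivity)
      refine le_trans ?_ this
      have e1 := hWM y
      have e2 := hT1 i (s⁻¹ • y)
      gcongr
  have hB0 := b0.nonneg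
  have hne : ∀ x : E3, 2 * L < ‖x‖ → ∀ y, ‖y‖ ≤ L → x - y ≠ 0 := fun x hx y hy =>
    norm_pos_iff.1 (by linarith [norm_sub_norm_le x y, b0.pos])
  -- the representation by potentials
  have hrep : ∀ x : E3, 2 * L < ‖x‖ → v x = -newtonConst⁻¹ * (2 * ∑ i, potential (h1 i) (dipole i) x +
      potential h0 (sqPow 0 (-(1 / 2))) x) := by
    intro x hx
    have h := newton_representation hs hv hv0 hlim hW hWm hWM (x := x) (by linarith [b0.pos])
    have e : ∫ y, W y * cutKernel s 0 x y = 2 * ∑ i, potential (h1 i) (dipole i) x +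
        potential h0 (sqPow 0 (-(1 / 2))) x := by
      have hi : ∀ {N : E3 → ℝ} {A : ℝ} {p : ℕ} {h : E3 → ℝ}, IsDecayingKernel N A p →
          IsBoundedDensity h B L → Integrable fun y => h y * N (x - y) := by
        intro N A p h hN hh
        refine integrable_of_abs_le_on_closedBall (L := L) (C := B * (A / (‖x‖ / 2) ^ p))
          (hh.measurable.mul (hN.measurable.comp (by fun_prop)))
          (fun y hy => by simp [hh.eq_zero y hy]) fun y hy => ?_
        have hd := half_norm_le_norm_sub (x := x) (y := y) (by linarith)
        have hx0 : 0 < ‖x‖ := by linarith [b0.pos]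
        have hA := hN.nonneg
        rw [abs_mul]
        refine mul_le_mul (hh.abs_le y) ((hN.abs_le _ (hne x hx y hy)).trans ?_) (abs_nonneg _) hB0
        gcongr
      simp only [potential]
      rw [← integral_finsetSum _ fun i _ => hi (isDecayingKernel_dipole i) (b1 i), ← integral_const_mul,
        ← integral_add ((integrable_finsetSum _ fun i _ => hi (isDecayingKernel_dipole i) (b1 i)).const_mul 2)
          (hi isDecayingKernel_newton b0)]
      refine integral_congr_ae (Eventually.of_forall fun y => ?_)
      by_cases hy : ‖y‖ ≤ L
      · have hd := hne x hx y hy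
        have hd' : y - x ≠ 0 := by rw [← neg_sub]; exact neg_ne_zero.2 hd
        have en : sqPow 0 (-(1 / 2)) (y - x) = sqPow 0 (-(1 / 2)) (x - y) := by
          simp only [sqPow, norm_sub_rev]
        have ed : ∀ i, pd i (sqPow 0 (-(1 / 2))) (y - x) = dipole i (x - y) := fun i => by
          rw [pd_newton hd', dipole_eq, dipole_eq, norm_sub_rev]
          simp; ring
        simp only [cutKernel, ed, en, hh0, hh1]
        rw [mul_add, Finset.mul_sum, Finset.mul_sum, Finset.mul_sum]
        congr 1
        · exact Finset.sum_congr rfl fun i _ => by ring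
        · ring
      · have hy' := not_le.1 hy
        simp [cutKernel_eq_zero hs _ _ (Or.inr hy'), b0.eq_zero y hy', (b1 _).eq_zero y hy']
    rw [e] at h
    field_simp
    linarith
  set I0 := ∫ y, h0 y with hI0
  set D := unitBallVolume * L ^ 3 with hD
  have hω := unitBallVolume_pos
  have hLpos := b0.pos
  set a := -newtonConst⁻¹ * I0 with ha
  set M1 := 2 * (3 * (B * (4 * 2 ^ 2) * D)) + B * (1 * 2 ^ 2 * L) * D with hM1
  set M2 := 2 * (3 * (B * (4 * 2 ^ 3) * D)) + B * (4 * 2 ^ 3 * L) * D with hM2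
  have hM1p : 0 ≤ M1 := by positivity
  have hM2p : 0 ≤ M2 := by positivity
  refine ⟨a, newtonConst⁻¹ * (M1 + M2), by positivity, fun x hx => ?_⟩
  have hx' : 2 * L < ‖x‖ := by linarith
  have hx0 : 0 < ‖x‖ := by linarith
  have hxne : x ≠ 0 := norm_pos_iff.1 hx0
  constructor
  · have e1 : v x - a / ‖x‖ = -newtonConst⁻¹ * (2 * ∑ i, potential (h1 i) (dipole i) x +
        (potential h0 (sqPow 0 (-(1 / 2))) x - I0 * sqPow 0 (-(1 / 2)) x)) := by
      rw [hrep x hx', sqPow_zero_neg_half, ha]; field_simp; ring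
    have e2 : |∑ i, potential (h1 i) (dipole i) x| ≤ 3 * (B * (4 * 2 ^ 2) * D / ‖x‖ ^ 2) := by
      refine (Finset.abs_sum_le_sum_abs _ _).trans ((Finset.sum_le_sum fun i _ =>
        abs_potential_le (isDecayingKernel_dipole i) (b1 i) hx'.le).trans_eq ?_)
      simp [hD]
    have e3 := abs_potential_sub_le isDecayingKernel_newton b0 hx'.le
    rw [e1, abs_mul, abs_neg, abs_of_pos (inv_pos.2 hC), mul_div_assoc]
    refine mul_le_mul_of_nonneg_left ?_ (inv_pos.2 hC).le
    calc _ ≤ 2 * (3 * (B * (4 * 2 ^ 2) * D / ‖x‖ ^ 2)) + B * (1 * 2 ^ (1 + 1) * L) * D / ‖x‖ ^ (1 + 1) := by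
          refine (abs_add_le _ _).trans (add_le_add ?_ e3)
          rw [abs_mul, abs_two]; linarith
      _ = M1 / ‖x‖ ^ 2 := by rw [hM1]; ring
      _ ≤ (M1 + M2) / ‖x‖ ^ 2 := by gcongr; linarith
  · intro j
    have d1 := fun i => pd_potential (isDecayingKernel_dipole i) (b1 i) hx' j
    have d0 := pd_potential isDecayingKernel_newton b0 hx' j
    have hev : v =ᶠ[𝓝 x] fun x => -newtonConst⁻¹ * (2 * ∑ i, potential (h1 i) (dipole i) x +
        potential h0 (sqPow 0 (-(1 / 2))) x) := by
      filter_upwards [continuous_norm.continuousAt.eventually (lt_mem_nhds hx')] with z hz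
      exact hrep z hz
    have e1 : pd j v x = -newtonConst⁻¹ * (2 * ∑ i, pd j (potential (h1 i) (dipole i)) x +
        pd j (potential h0 (sqPow 0 (-(1 / 2)))) x) := by
      rw [(pd_congr hev).eq_of_nhds]
      have f1 : HasFDerivAt (fun x => ∑ i, potential (h1 i) (dipole i) x)
        (∑ i, fderiv ℝ (potential (h1 i) (dipole i)) x) x :=
        HasFDerivAt.fun_sum fun i _ => (d1 i).1.hasFDerivAt
      have f2 : HasFDerivAt (fun x => -newtonConst⁻¹ * (2 * ∑ i, potential (h1 i) (dipole i) x +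
          potential h0 (sqPow 0 (-(1 / 2))) x)) _ x := ((f1.const_mul 2).add d0.1.hasFDerivAt).const_mul (-newtonConst⁻¹)
      rw [pd, f2.fderiv]
      simp only [pd, smul_apply, add_apply, sum_apply, smul_eq_mul]
    have e0 : pd j (potential h0 (sqPow 0 (-(1 / 2)))) x = -potential h0 (dipole j) x := by
      rw [d0.2, potential, ← integral_neg]
      refine integral_congr_ae (Eventually.of_forall fun y => ?_)
      by_cases hy : ‖y‖ ≤ L
      · simp only; rw [pd_newton (hne x hx' y hy)]; ring
      · simp [b0.eq_zero y (not_le.1 hy)]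
    have e2 : |∑ i, pd j (potential (h1 i) (dipole i)) x| ≤ 3 * (B * (4 * 2 ^ 3) * D / ‖x‖ ^ 3) := by
      have g : ∀ i, |pd j (potential (h1 i) (dipole i)) x| ≤ B * (4 * 2 ^ 3) * D / ‖x‖ ^ 3 := fun i => by
        rw [(d1 i).2]
        have hN := isDecayingKernel_dipole i
        refine (abs_integral_le_on_closedBall (F := fun y => h1 i y * pd j (dipole i) (x - y)) (L := L)
          (C := B * (4 * 2 ^ 3 / ‖x‖ ^ 3)) hLpos.le (fun y hy => by simp [(b1 i).eq_zero y hy])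
          fun y hy => ?_).trans_eq (by ring)
        rw [abs_mul]
        refine mul_le_mul ((b1 i).abs_le y) ((abs_pd_le _ _ _).trans
          ((hN.norm_fderiv_le _ (hne x hx' y hy)).trans ?_)) (abs_nonneg _) hB0
        have hd := half_norm_le_norm_sub (x := x) (y := y) (by linarith)
        calc 4 / ‖x - y‖ ^ (2 + 1) ≤ 4 / (‖x‖ / 2) ^ (2 + 1) := by gcongr
          _ = _ := by rw [div_pow]; field_simp; ring
      refine (Finset.abs_sum_le_sum_abs _ _).trans ((Finset.sum_le_sum fun i _ => g i).trans_eq ?_)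
      simp
    have e3 := abs_potential_sub_le (isDecayingKernel_dipole j) b0 hx'.le
    have e4 : pd j v x + a * dipole j x = -newtonConst⁻¹ * (2 * ∑ i, pd j (potential (h1 i) (dipole i)) x -
        (potential h0 (dipole j) x - I0 * dipole j x)) := by
      rw [e1, e0, ha]; ring
    rw [e4, abs_mul, abs_neg, abs_of_pos (inv_pos.2 hC), mul_div_assoc]
    refine mul_le_mul_of_nonneg_left ?_ (inv_pos.2 hC).le
    calc _ ≤ 2 * (3 * (B * (4 * 2 ^ 3) * D / ‖x‖ ^ 3)) + B * (4 * 2 ^ (2 + 1) * L) * D / ‖x‖ ^ (2 + 1) := by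
          refine (abs_sub _ _).trans (add_le_add ?_ e3)
          rw [abs_mul, abs_two]; linarith
      _ = M2 / ‖x‖ ^ 3 := by rw [hM2]; ring
      _ ≤ (M1 + M2) / ‖x‖ ^ 3 := by gcongr; linarith

/-! ### The topology of an end -/

/-- Polar coordinates present the exterior as a continuous image of `(r, ∞) × S²`. -/
theorem isPreconnected_exterior {r : ℝ} (hr : 0 ≤ r) : IsPreconnected {y : E3 | r < ‖y‖} := by
  have hs : IsPreconnected (Metric.sphere (0 : E3) 1) :=
    isPreconnected_sphere (by rw [← Module.finrank_eq_rank]; simp) 0 1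
  have := (isPreconnected_Ioi (a := r)).prod hs
  have h2 := this.image (fun p : ℝ × E3 => p.1 • p.2) (by fun_prop)
  convert h2 using 1
  ext y
  simp only [mem_ofPred_eq, mem_image, mem_prod, mem_Ioi, mem_sphere_zero_iff_norm, Prod.exists]
  constructor
  · intro hy
    have : 0 < ‖y‖ := hr.trans_lt hy
    exact ⟨‖y‖, ‖y‖⁻¹ • y, ⟨hy, by rw [norm_smul, norm_inv, norm_norm]; field_simp⟩, by
      rw [smul_smul, mul_inv_cancel₀ this.ne', one_smul]⟩
  · rintro ⟨t, θ, ⟨ht, hθ⟩, rfl⟩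
    rw [norm_smul, hθ, mul_one, Real.norm_of_nonneg (hr.trans ht.le)]
    exact ht

section Manifold

variable {H : Type*} [TopologicalSpace H] {I : ModelWithCorners ℝ E3 H}
  {M : Type*} [TopologicalSpace M] [ChartedSpace H M]
  {Φ Φ' : OpenPartialHomeomorph M E3}

theorem IsEndChart.exists_exterior_subset (h : IsEndChart I Φ) :
    ∃ r : ℝ, 0 < r ∧ ∀ y : E3, r ≤ ‖y‖ → y ∈ Φ.target := by
  obtain ⟨c, R, hR, ht⟩ := h.target_eq
  refine ⟨‖c‖ + R + 1, by positivity, fun y hy => ?_⟩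
  rw [ht, mem_compl_iff, Metric.mem_closedBall, not_le, dist_eq_norm]
  linarith [norm_sub_norm_le y c]

/-- A manifold with an end chart is compact, unless the chart goes to infinity. -/
theorem IsEndChart.compactSpace_or_tendsto [T2Space M] (h : IsEndChart I Φ) :
    CompactSpace M ∨ Tendsto Φ.symm (Bornology.cobounded E3) (cocompact M) := by
  have hlc : LocallyCompactSpace M := Manifold.locallyCompact_of_finiteDimensional I
  obtain ⟨r0, hr0, hr0t⟩ := h.exists_exterior_subset
  by_cases hc : CompactSpace M
  · exact Or.inl hc
  refine Or.inr ?_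
  rw [tendsto_def]
  intro s hs
  obtain ⟨L, hL, hLs⟩ := mem_cocompact.1 hs
  -- The interior of `L0` contains the compact core, so the frontier lies in the chart domain and
  -- has bounded image. The connected image of a far exterior misses the frontier: either it lies
  -- inside `L0`, and then `M` is compact, or it avoids `L0`.
  obtain ⟨L0, hL0, hLL0⟩ := exists_compact_superset (hL.union (h.isCompact_region r0))
  have hfr : IsCompact (frontier L0) := hL0.of_isClosed_subset isClosed_frontier
    hL0.isClosed.frontier_subset
  have hfsub : frontier L0 ⊆ Φ.source := fun x hx => by
    by_contra hxs
    exact hx.2 (hLL0 (Or.inr fun h => absurd h hxs))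
  obtain ⟨r1, hr1⟩ := (hfr.image_of_continuousOn (Φ.continuousOn.mono hfsub)).isBounded.exists_norm_le
  set r := max r0 r1
  have hsub : ∀ y : E3, r < ‖y‖ → y ∈ Φ.target := fun y hy => hr0t y ((le_max_left _ _).trans hy.le)
  have hconn : IsPreconnected (Φ.symm '' {y : E3 | r < ‖y‖}) :=
    (isPreconnected_exterior (hr0.le.trans (le_max_left _ _))).image _
      (Φ.continuousOn_symm.mono fun y hy => hsub y hy)
  have hdisj : ∀ x ∈ Φ.symm '' {y : E3 | r < ‖y‖}, x ∉ frontier L0 := by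
    rintro _ ⟨y, hy, rfl⟩ hx
    have := hr1 _ (mem_image_of_mem Φ hx)
    rw [Φ.right_inv (hsub y hy)] at this
    exact absurd ((this.trans (le_max_right _ _)).trans_lt hy) (lt_irrefl _)
  have hcover : Φ.symm '' {y : E3 | r < ‖y‖} ⊆ interior L0 ∪ L0ᶜ := fun x hx => by
    by_cases hxL : x ∈ L0
    · left
      by_contra hxi
      exact hdisj x hx ⟨subset_closure hxL, hxi⟩
    · exact Or.inr hxL
  rcases hconn.subset_or_subset isOpen_interior hL0.isClosed.isOpen_compl
    (disjoint_compl_right.mono_left interior_subset) hcover with h1 | h1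
  · refine absurd ⟨?_⟩ hc
    refine ((h.isCompact_region r).union hL0).of_isClosed_subset isClosed_univ fun x _ => ?_
    by_cases hx : x ∈ Φ.source ∧ r < ‖Φ x‖
    · exact Or.inr (interior_subset (h1 ⟨Φ x, hx.2, Φ.left_inv hx.1⟩))
    · exact Or.inl fun hxs => not_lt.1 fun hlt => hx ⟨hxs, hlt⟩
  · refine eventually_cobounded_norm.2 ⟨r + 1, by positivity, fun y hy => hLs fun hyL => ?_⟩
    exact h1 ⟨y, show r < ‖y‖ by linarith, rfl⟩ (interior_subset (hLL0 (Or.inl hyL)))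

theorem IsEndChart.eventually_mem_source (h : IsEndChart I Φ)
    {f : E3 → M} (hf : Tendsto f (Bornology.cobounded E3) (cocompact M)) :
    ∀ᶠ y in Bornology.cobounded E3, f y ∈ Φ.source :=
  hf (by simpa using h.isCompact_compl.compl_mem_cocompact)

theorem IsEndChart.tendsto_cobounded (h : IsEndChart I Φ)
    {f : E3 → M} (hf : Tendsto f (Bornology.cobounded E3) (cocompact M)) :
    Tendsto (fun y => Φ (f y)) (Bornology.cobounded E3) (Bornology.cobounded E3) := by
  rw [← tendsto_norm_atTop_iff_cobounded, tendsto_atTop]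
  intro b
  filter_upwards [hf (h.isCompact_region b).compl_mem_cocompact] with y hy
  rw [mem_preimage, mem_compl_iff, mem_ofPred_eq, Classical.not_imp] at hy
  exact (not_le.1 hy.2).le

/-! ### Change of coordinates -/

/-- The differential of a parametrization as a map of the model space. -/
noncomputable def paramDeriv (I : ModelWithCorners ℝ E3 H) (f : E3 → M) (y : E3) : E3 →L[ℝ] E3 :=
  mfderiv 𝓘(ℝ, E3) I f y

theorem paramDeriv_comp {f h : E3 → M} {T : E3 → E3} {y : E3} (hf : f =ᶠ[𝓝 y] h ∘ T)
    (hT : DifferentiableAt ℝ T y) (hh : MDifferentiableAt 𝓘(ℝ, E3) I h (T y)) :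
    paramDeriv I f y = (paramDeriv I h (T y)).comp (fderiv ℝ T y) := by
  have : HasMFDerivAt 𝓘(ℝ, E3) I f y _ :=
    (hh.hasMFDerivAt.comp y hT.hasFDerivAt.hasMFDerivAt).congr_of_eventuallyEq hf
  exact this.mfderiv

variable [IsManifold I ∞ M]

/-- The metric as a bilinear form on the model space. -/
def metricForm (g : SmoothMetric I M) (x : M) : E3 →L[ℝ] E3 →L[ℝ] ℝ := g.inner x

theorem coeff_eq_metricForm (g : SmoothMetric I M) (f : E3 → M) (i j : Fin 3) (y : E3) :
    coeff g f i j y = metricForm g (f y) (paramDeriv I f y (stdVec i)) (paramDeriv I f y (stdVec j)) := rfl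

theorem metricForm_paramDeriv (g : SmoothMetric I M) (h : E3 → M) (z v w : E3) :
    metricForm g (h z) (paramDeriv I h z v) (paramDeriv I h z w) =
      ∑ k, ∑ l, v k * w l * coeff g h k l z := by
  conv_lhs => rw [← sum_smul_stdVec v, ← sum_smul_stdVec w]
  simp only [map_sum, map_smul, sum_apply, smul_apply, coeff_eq_metricForm, smul_eq_mul, Finset.mul_sum]
  rw [Finset.sum_comm]
  refine Finset.sum_congr rfl fun k _ => Finset.sum_congr rfl fun l _ => by ring

theorem coeff_comp (g : SmoothMetric I M) {f h : E3 → M} {T : E3 → E3} {y : E3} (hf : f =ᶠ[𝓝 y] h ∘ T)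
    (hT : DifferentiableAt ℝ T y) (hh : MDifferentiableAt 𝓘(ℝ, E3) I h (T y)) (i j : Fin 3) :
    coeff g f i j y = ∑ k, ∑ l, fderiv ℝ T y (stdVec i) k * fderiv ℝ T y (stdVec j) l *
      coeff g h k l (T y) := by
  rw [coeff_eq_metricForm, paramDeriv_comp hf hT hh, hf.eq_of_nhds, ← metricForm_paramDeriv]
  rfl

theorem volDensity_comp (g : SmoothMetric I M) {f h : E3 → M} {T : E3 → E3} {y : E3}
    (hf : f =ᶠ[𝓝 y] h ∘ T)
    (hT : DifferentiableAt ℝ T y) (hh : MDifferentiableAt 𝓘(ℝ, E3) I h (T y)) :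
    volDensity g f y = |(fderiv ℝ T y).det| * volDensity g h (T y) := by
  let B := (EuclideanSpace.basisFun (Fin 3) ℝ).toBasis
  set A := LinearMap.toMatrix B B (fderiv ℝ T y : E3 →ₗ[ℝ] E3) with hA
  have hAe : ∀ k i, A k i = fderiv ℝ T y (stdVec i) k := fun k i => by
    simp [hA, LinearMap.toMatrix_apply, B, stdVec]
  have : (Matrix.of fun i j => coeff g f i j y) =
      A.transpose * (Matrix.of fun i j => coeff g h i j (T y)) * A := by
    ext i j
    rw [Matrix.of_apply, coeff_comp g hf hT hh, Finset.sum_comm, Matrix.mul_apply]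
    refine Finset.sum_congr rfl fun l _ => ?_
    rw [Matrix.mul_apply, Finset.sum_mul]
    refine Finset.sum_congr rfl fun k _ => ?_
    rw [Matrix.transpose_apply, Matrix.of_apply, hAe, hAe]; ring
  have hdet : A.det = (fderiv ℝ T y).det := LinearMap.det_toMatrix B _
  rw [volDensity, volDensity, this, Matrix.det_mul, Matrix.det_mul, Matrix.det_transpose, hdet,
    show ∀ a b : ℝ, a * b * a = a ^ 2 * b by intros; ring, Real.sqrt_mul (sq_nonneg _), Real.sqrt_sq_eq_abs]

end Manifold

/-! ### The Riemannian volume measure in an end chart -/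

theorem measurableSet_inter_preimage_of_continuousOn {α β : Type*} [TopologicalSpace α]
    [MeasurableSpace α] [OpensMeasurableSpace α] [TopologicalSpace β] [MeasurableSpace β] [BorelSpace β]
    {f : α → β} {s : Set α} (hf : ContinuousOn f s) (hs : MeasurableSet s) {S : Set β}
    (hS : MeasurableSet S) : MeasurableSet (s ∩ f ⁻¹' S) := by
  have := hs.subtype_image ((continuousOn_iff_continuous_domRestrict.1 hf).measurable hS)
  convert this using 1
  ext x; simp [and_comm]

section Volume

variable {H : Type*} [TopologicalSpace H] {I : ModelWithCorners ℝ E3 H}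
  {M : Type*} [TopologicalSpace M] [ChartedSpace H M] [IsManifold I ∞ M]
  {Φ : OpenPartialHomeomorph M E3}

theorem IsEndChart.contMDiffAt_symm {I : ModelWithCorners ℝ E3 H}
    (h : IsEndChart I Φ) {y : E3} (hy : y ∈ Φ.target) :
    ContMDiffAt 𝓘(ℝ, E3) I ∞ Φ.symm y :=
  h.contMDiffOn_symm.contMDiffAt (Φ.open_target.mem_nhds hy)

/-- The transition map from an end chart to a preferred chart. -/
theorem IsEndChart.contDiffAt_transition (h : IsEndChart I Φ) {p : M} {y : E3} (hy : y ∈ Φ.target)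
    (hp : Φ.symm y ∈ (chartAt H p).source) :
    ContDiffAt ℝ ∞ (fun z => extChartAt I p (Φ.symm z)) y :=
  contMDiffAt_iff_contDiffAt.1
    ((contMDiffAt_extChartAt' hp).comp y (h.contMDiffAt_symm hy))

omit [IsManifold I ∞ M] in
theorem IsEndChart.eventuallyEq_transition (_h : IsEndChart I Φ) {p : M} {y : E3} (hy : y ∈ Φ.target)
    (hp : Φ.symm y ∈ (chartAt H p).source) :
    Φ.symm =ᶠ[𝓝 y] (extChartAt I p).symm ∘ fun z => extChartAt I p (Φ.symm z) := by
  filter_upwards [(Φ.continuousAt_symm hy).eventually ((chartAt H p).open_source.mem_nhds hp)] with z hz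
  exact ((extChartAt I p).left_inv (by rwa [extChartAt_source])).symm

/-- The model may have boundary, but points covered by an end chart are interior. The transition map
has an inverse differentiable within `range I`, so its differential is injective, hence onto, and
its image contains a neighbourhood. -/
theorem IsEndChart.target_mem_nhds (h : IsEndChart I Φ) {p : M} {y : E3} (hy : y ∈ Φ.target)
    (hp : Φ.symm y ∈ (chartAt H p).source) :
    (extChartAt I p).target ∈ 𝓝 (extChartAt I p (Φ.symm y)) := by
  have hT := h.contDiffAt_transition hy hp
  set T := fun z => extChartAt I p (Φ.symm z) with hTdef
  have hp' : Φ.symm y ∈ (extChartAt I p).source := by rwa [extChartAt_source]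
  have hstrict : HasStrictFDerivAt T (fderiv ℝ T y) y := hT.hasStrictFDerivAt (by simp)
  -- the inverse map
  have hS : ContMDiffWithinAt 𝓘(ℝ, E3) 𝓘(ℝ, E3) ∞ (Φ ∘ (extChartAt I p).symm) (range I) (T y) := by
    refine ContMDiffAt.comp_contMDiffWithinAt (I' := I) (T y) ?_ ?_
    · rw [hTdef]
      simp only [(extChartAt I p).left_inv hp']
      exact h.contMDiffOn.contMDiffAt (Φ.open_source.mem_nhds (Φ.map_target hy))
    · exact contMDiffWithinAt_extChartAt_symm_range (I := I) (M := M) p ((extChartAt I p).map_source hp')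
  have hS' := (contMDiffWithinAt_iff_contDiffWithinAt.1 hS).differentiableWithinAt (by simp)
  have hTr : ∀ z, T z ∈ range I := fun z => mem_range_self _
  have hcomp := hS'.hasFDerivWithinAt.comp y hstrict.hasFDerivAt.hasFDerivWithinAt (s := univ)
    (fun z _ => hTr z)
  rw [hasFDerivWithinAt_univ] at hcomp
  have hid : HasFDerivAt (id : E3 → E3) _ y := hcomp.congr_of_eventuallyEq (by
    filter_upwards [h.eventuallyEq_transition hy hp, Φ.open_target.mem_nhds hy] with z hz hz'
    simp only [Function.comp_apply] at hz ⊢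
    rw [← hz, Φ.right_inv hz']; rfl)
  have hid' := hid.unique (hasFDerivAt_id y)
  have hinj : Function.Injective (fderiv ℝ T y) := fun v w hvw => by
    have e := fun v => congrArg (fun L : E3 →L[ℝ] E3 => L v) hid'
    simp only [ContinuousLinearMap.comp_apply, ContinuousLinearMap.id_apply] at e
    rw [← e v, ← e w, hvw]
  have hsurj : (fderiv ℝ T y).range = ⊤ := by
    exact LinearMap.range_eq_top.2 (LinearMap.injective_iff_surjective.1 hinj)
  have hmap := hstrict.map_nhds_eq_of_surj hsurj
  rw [← hmap, mem_map]
  filter_upwards [(Φ.continuousAt_symm hy).eventually ((chartAt H p).open_source.mem_nhds hp)] with z hz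
  exact (extChartAt I p).map_source (by rwa [extChartAt_source])

theorem IsEndChart.volDensity_symm (h : IsEndChart I Φ) (g : SmoothMetric I M) {p : M} {y : E3}
    (hy : y ∈ Φ.target) (hp : Φ.symm y ∈ (chartAt H p).source) :
    volDensity g Φ.symm y = |(fderiv ℝ (fun z => extChartAt I p (Φ.symm z)) y).det| *
      volDensity g (extChartAt I p).symm (extChartAt I p (Φ.symm y)) := by
  refine volDensity_comp g (h.eventuallyEq_transition hy hp)
    ((h.contDiffAt_transition hy hp).differentiableAt (by simp)) ?_
  have hm := h.target_mem_nhds hy hp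
  exact ((contMDiffOn_extChartAt_symm (n := ∞) p).contMDiffAt hm).mdifferentiableAt (by simp)

/-- Change of variables from the preferred chart to the end chart; `volDensity_symm` absorbs the
Jacobian. -/
theorem IsEndChart.chartVolume_apply [MeasurableSpace M] [BorelSpace M] (h : IsEndChart I Φ)
    (g : SmoothMetric I M) (p : M) {S : Set M} (hS : MeasurableSet S) (hSΦ : S ⊆ Φ.source)
    (hSp : S ⊆ (chartAt H p).source) :
    chartVolume g p S = ∫⁻ y in Φ.target ∩ Φ.symm ⁻¹' S, ENNReal.ofReal (volDensity g Φ.symm y) := by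
  have hmt : MeasurableSet (extChartAt I p).target := by
    rw [extChartAt_target]
    exact (((chartAt H p).open_target.preimage I.continuous_symm).measurableSet).inter
      I.isClosed_range.measurableSet
  set μ := (volume : Measure E3).restrict (extChartAt I p).target
  set f := fun y => ENNReal.ofReal (volDensity g (extChartAt I p).symm y)
  have hae : AEMeasurable (extChartAt I p).symm (μ.withDensity f) :=
    ((continuousOn_extChartAt_symm p).aemeasurable hmt).mono_ac (withDensity_absolutelyContinuous _ _)
  have hTB : (extChartAt I p).target ∩ (extChartAt I p).symm ⁻¹' S =
      (fun z => extChartAt I p (Φ.symm z)) '' (Φ.target ∩ Φ.symm ⁻¹' S) := by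
    ext z
    constructor
    · rintro ⟨hz, hzS⟩
      refine ⟨Φ ((extChartAt I p).symm z), ⟨Φ.map_source (hSΦ hzS), ?_⟩, ?_⟩
      · rw [mem_preimage, Φ.left_inv (hSΦ hzS)]; exact hzS
      · simp only [Φ.left_inv (hSΦ hzS), (extChartAt I p).right_inv hz]
    · rintro ⟨y, ⟨hy, hyS⟩, rfl⟩
      have : Φ.symm y ∈ (extChartAt I p).source := by rw [extChartAt_source]; exact hSp hyS
      refine ⟨(extChartAt I p).map_source this, ?_⟩
      rw [mem_preimage, (extChartAt I p).left_inv this]; exact hyS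
  have hmB := measurableSet_inter_preimage_of_continuousOn Φ.continuousOn_symm
    Φ.open_target.measurableSet hS
  have hm2 := measurableSet_inter_preimage_of_continuousOn (continuousOn_extChartAt_symm p) hmt hS
  rw [chartVolume, Measure.map_apply_of_aemeasurable hae hS, withDensity_apply', Measure.restrict_restrict'
    hmt, inter_comm, hTB, lintegral_image_eq_lintegral_abs_det_fderiv_mul _ hmB
    (f' := fun y => fderiv ℝ (fun z => extChartAt I p (Φ.symm z)) y)]
  · refine setLIntegral_congr_fun hmB fun y hy => ?_
    rw [h.volDensity_symm g hy.1 (hSp hy.2), ENNReal.ofReal_mul (abs_nonneg _)]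
  · exact fun y hy => ((h.contDiffAt_transition hy.1 (hSp hy.2)).differentiableAt
      (by simp)).hasFDerivAt.hasFDerivWithinAt
  · intro y hy z hz hyz
    have e := (extChartAt I p).injOn (by rw [extChartAt_source]; exact hSp hy.2)
      (by rw [extChartAt_source]; exact hSp hz.2) hyz
    exact Φ.symm.injOn hy.1 hz.1 e

theorem measurableSet_disjointed_cover [MeasurableSpace M] [BorelSpace M] (u : ℕ → M) (n : ℕ) :
    MeasurableSet (disjointed (fun k => (chartAt H (u k)).source) n) :=
  MeasurableSet.disjointed (fun k => (chartAt H (u k)).open_source.measurableSet) n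

/-- The Riemannian volume in an end chart. -/
theorem IsEndChart.map_restrict_source [MeasurableSpace M] [BorelSpace M] [SecondCountableTopology M]
    [Nonempty M] (h : IsEndChart I Φ) (g : SmoothMetric I M) :
    ((riemannianVolume g).restrict Φ.source).map Φ =
      (volume.restrict Φ.target).withDensity (fun y => ENNReal.ofReal (volDensity g Φ.symm y)) := by
  have hms := Φ.open_source.measurableSet
  have hmt := Φ.open_target.measurableSet
  ext A hA
  rw [Measure.map_apply_of_aemeasurable (Φ.continuousOn.aemeasurable hms) hA, withDensity_apply _ hA,
    Measure.restrict_restrict hA, Measure.restrict_apply' hms, riemannianVolume]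
  set u := (exists_chart_cover H M).choose
  have hu : ⋃ n, (chartAt H (u n)).source = univ := (exists_chart_cover H M).choose_spec
  set D := disjointed (fun k => (chartAt H (u k)).source)
  have hDm : ∀ n, MeasurableSet (D n) := measurableSet_disjointed_cover u
  have hmA : MeasurableSet (Φ ⁻¹' A ∩ Φ.source) := by
    rw [inter_comm]; exact measurableSet_inter_preimage_of_continuousOn Φ.continuousOn hms hA
  rw [Measure.sum_apply _ hmA]
  have hn : ∀ n, ((chartVolume g (u n)).restrict (D n)) (Φ ⁻¹' A ∩ Φ.source) =
      ∫⁻ y in Φ.target ∩ Φ.symm ⁻¹' (Φ ⁻¹' A ∩ Φ.source ∩ D n),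
        ENNReal.ofReal (volDensity g Φ.symm y) := fun n => by
    rw [Measure.restrict_apply hmA]
    exact h.chartVolume_apply g (u n) (hmA.inter (hDm n)) (fun x hx => hx.1.2)
      fun x hx => disjointed_subset (fun k => (chartAt H (u k)).source) n hx.2
  simp_rw [hn]
  rw [← lintegral_iUnion]
  · congr 2
    ext y
    simp only [mem_iUnion, mem_inter_iff, mem_preimage]
    constructor
    · rintro ⟨n, hy, ⟨hyA, -⟩, -⟩
      exact ⟨by rwa [Φ.right_inv hy] at hyA, hy⟩
    · rintro ⟨hyA, hy⟩
      have : Φ.symm y ∈ ⋃ n, D n := by rw [iUnion_disjointed, hu]; trivial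
      obtain ⟨n, hn⟩ := mem_iUnion.1 this
      exact ⟨n, hy, ⟨by rwa [Φ.right_inv hy], Φ.map_target hy⟩, hn⟩
  · exact fun n => measurableSet_inter_preimage_of_continuousOn Φ.continuousOn_symm hmt
      (hmA.inter (hDm n))
  · intro m n hmn
    refine disjoint_left.2 fun y hym hyn => ?_
    exact disjoint_left.1 (disjoint_disjointed (fun k => (chartAt H (u k)).source) hmn) hym.2.2 hyn.2.2

end Volume

/-! ### Volume and energy in a conformally flat chart -/

section Conformal

variable {H : Type*} [TopologicalSpace H] {I : ModelWithCorners ℝ E3 H}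
  {M : Type*} [TopologicalSpace M] [ChartedSpace H M] [IsManifold I ∞ M]
  {Φ : OpenPartialHomeomorph M E3} {g : SmoothMetric I M} {U : E3 → ℝ}

/-- An end chart in which the metric is `U⁴` times the Euclidean one, with `U` harmonic. -/
structure IsHarmonicChart (g : SmoothMetric I M) (Φ : OpenPartialHomeomorph M E3) (U : E3 → ℝ) : Prop
    extends IsEndChart I Φ where
  pos : ∀ y ∈ Φ.target, 0 < U y
  harmonicOnNhd : InnerProductSpace.HarmonicOnNhd U Φ.target
  tendsto_one : Tendsto U (Bornology.cobounded E3) (𝓝 1)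
  coeff_eq : ∀ y ∈ Φ.target, ∀ i j : Fin 3, coeff g Φ.symm i j y = if i = j then U y ^ 4 else 0

theorem IsHarmonicallyFlat.exists_isHarmonicChart (h : IsHarmonicallyFlat g) :
    ∃ (Φ : OpenPartialHomeomorph M E3) (U : E3 → ℝ), IsHarmonicChart g Φ U := by
  obtain ⟨Φ, U, h1, h2, h3, h4, h5⟩ := h
  exact ⟨Φ, U, h1, h2, h3, h4, h5⟩

theorem IsHarmonicChart.contDiffAt (h : IsHarmonicChart g Φ U) {y : E3} (hy : y ∈ Φ.target) :
    ContDiffAt ℝ 2 U y := (h.harmonicOnNhd y hy).1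

theorem IsHarmonicChart.lap_eq_zero (h : IsHarmonicChart g Φ U) {y : E3} (hy : y ∈ Φ.target) :
    lap U y = 0 := by
  rw [lap_eq_laplacian (h.contDiffAt hy)]
  exact (h.harmonicOnNhd y hy).2.eq_of_nhds

theorem IsHarmonicChart.continuousOn (h : IsHarmonicChart g Φ U) : ContinuousOn U Φ.target :=
  fun _ hy => (h.contDiffAt hy).continuousAt.continuousWithinAt

theorem IsHarmonicChart.volDensity_eq (h : IsHarmonicChart g Φ U) {y : E3} (hy : y ∈ Φ.target) :
    volDensity g Φ.symm y = U y ^ 6 := by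
  have hU := h.pos y hy
  have : (Matrix.of fun i j => coeff g Φ.symm i j y) = Matrix.diagonal fun _ => U y ^ 4 := by
    ext i j; rw [Matrix.of_apply, h.coeff_eq y hy, Matrix.diagonal_apply]
  rw [volDensity, this, Matrix.det_diagonal, Finset.prod_const, Finset.card_univ, Fintype.card_fin,
    ← pow_mul, show 4 * 3 = 6 * 2 by norm_num, pow_mul, Real.sqrt_sq (by positivity)]

theorem IsHarmonicChart.metricForm_eq (h : IsHarmonicChart g Φ U) {y : E3} (hy : y ∈ Φ.target) (w : E3) :
    metricForm g (Φ.symm y) (paramDeriv I Φ.symm y w) (paramDeriv I Φ.symm y w) =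
      U y ^ 4 * ‖w‖ ^ 2 := by
  rw [metricForm_paramDeriv, EuclideanSpace.norm_sq_eq, Finset.mul_sum]
  refine Finset.sum_congr rfl fun k _ => ?_
  simp only [h.coeff_eq y hy, mul_ite, mul_zero, Finset.sum_ite_eq, Finset.mem_univ, if_true,
    Real.norm_eq_abs, sq_abs]
  ring

theorem IsEndChart.fderiv_comp_symm {I : ModelWithCorners ℝ E3 H} (h : IsEndChart I Φ) {ψ : M → ℝ} {y : E3} (hy : y ∈ Φ.target)
    (hu : DifferentiableAt ℝ (ψ ∘ Φ.symm) y) (w : E3) :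
    fderiv ℝ (ψ ∘ Φ.symm) y w = diffAt I ψ (Φ.symm y) (paramDeriv I Φ.symm y w) := by
  have hx := Φ.map_target hy
  have hΦ : MDifferentiableAt I 𝓘(ℝ, E3) Φ (Φ.symm y) :=
    (h.contMDiffOn.contMDiffAt (Φ.open_source.mem_nhds hx)).mdifferentiableAt (by simp)
  have hψ : MDifferentiableAt I 𝓘(ℝ, ℝ) ψ (Φ.symm y) := by
    have hu' : MDifferentiableAt 𝓘(ℝ, E3) 𝓘(ℝ, ℝ) (ψ ∘ Φ.symm) (Φ (Φ.symm y)) := by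
      rw [Φ.right_inv hy]; exact hu.mdifferentiableAt
    refine (hu'.comp (Φ.symm y) hΦ).congr_of_eventuallyEq ?_
    filter_upwards [Φ.open_source.mem_nhds hx] with z hz
    simp [Φ.left_inv hz]
  have hs : MDifferentiableAt 𝓘(ℝ, E3) I Φ.symm y := (h.contMDiffAt_symm hy).mdifferentiableAt (by simp)
  rw [← mfderiv_eq_fderiv, mfderiv_comp y hψ hs]
  rfl

/-- The dual norm is tested on the Euclidean gradient direction, scaled to length `U⁻²` and hence to
unit `g`-length. A lower bound is enough for bounding capacities from below, and points of
nondifferentiability are harmless because `fderiv` is zero there. -/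
theorem IsHarmonicChart.le_gradSq (h : IsHarmonicChart g Φ U) (ψ : M → ℝ) {y : E3}
    (hy : y ∈ Φ.target) :
    ENNReal.ofReal ((U y ^ 4)⁻¹) * ‖fderiv ℝ (ψ ∘ Φ.symm) y‖ₑ ^ 2 ≤ gradSq g ψ (Φ.symm y) := by
  have hU := h.pos y hy
  by_cases h0 : fderiv ℝ (ψ ∘ Φ.symm) y = 0
  · rw [h0, ← ofReal_norm, norm_zero]; simp
  have hu : DifferentiableAt ℝ (ψ ∘ Φ.symm) y := by
    by_contra hu; exact h0 (fderiv_zero_of_not_differentiableAt hu)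
  set L := fderiv ℝ (ψ ∘ Φ.symm) y with hL
  set n := (InnerProductSpace.toDual ℝ E3).symm L with hn
  have hnorm : ‖n‖ = ‖L‖ := LinearIsometryEquiv.norm_map _ _
  have hLn : L n = ‖L‖ ^ 2 := by
    rw [← hnorm, ← real_inner_self_eq_norm_sq, hn, InnerProductSpace.toDual_symm_apply]
  have hpos : 0 < ‖L‖ := norm_pos_iff.2 h0
  set w := (U y ^ 2 * ‖L‖)⁻¹ • n with hw
  have hwn : ‖w‖ = (U y ^ 2)⁻¹ := by
    rw [hw, norm_smul, hnorm, Real.norm_of_nonneg (by positivity)]; field_simp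
  have h1 : g.inner (Φ.symm y) (paramDeriv I Φ.symm y w) (paramDeriv I Φ.symm y w) ≤ 1 := by
    refine (h.metricForm_eq hy w).trans_le ?_
    rw [hwn]; field_simp; rfl
  refine le_trans ?_ (le_iSup₂ (f := fun (v : TangentSpace I (Φ.symm y)) (_ : g.inner (Φ.symm y) v v ≤ 1) =>
    ENNReal.ofReal (diffAt I ψ (Φ.symm y) v ^ 2)) (paramDeriv I Φ.symm y w) h1)
  have h2 := h.fderiv_comp_symm hy hu w
  rw [← h2, ← hL, hw, map_smul, hLn, ← ofReal_norm, ← ENNReal.ofReal_pow (norm_nonneg _),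
    ← ENNReal.ofReal_mul (by positivity)]
  refine ENNReal.ofReal_le_ofReal (le_of_eq ?_)
  rw [smul_eq_mul]; field_simp

variable [MeasurableSpace M] [BorelSpace M] [SecondCountableTopology M] [Nonempty M]

theorem IsHarmonicChart.map_restrict_source_eq (h : IsHarmonicChart g Φ U) :
    ((riemannianVolume g).restrict Φ.source).map Φ =
      (volume.restrict Φ.target).withDensity (fun y => ENNReal.ofReal (U y ^ 6)) := by
  rw [h.map_restrict_source g]
  refine withDensity_congr_ae ?_
  filter_upwards [ae_restrict_mem Φ.open_target.measurableSet] with y hy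
  rw [h.volDensity_eq hy]

theorem IsHarmonicChart.volume_preimage (h : IsHarmonicChart g Φ U) {A : Set E3} (hA : MeasurableSet A)
    (hAt : A ⊆ Φ.target) :
    riemannianVolume g (Φ.source ∩ Φ ⁻¹' A) = ∫⁻ y in A, ENNReal.ofReal (U y ^ 6) := by
  have hms := Φ.open_source.measurableSet
  rw [← inter_eq_left.2 hAt, ← Measure.restrict_restrict hA, ← withDensity_apply _ hA,
    ← h.map_restrict_source_eq, Measure.map_apply_of_aemeasurable (Φ.continuousOn.aemeasurable hms) hA,
    Measure.restrict_apply' hms, inter_comm, inter_eq_left.2 hAt]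

/-- The conformal weights combine as `U⁻⁴ · U⁶ = U²`. Since only an inequality is sought,
measurability of `gradSq` plays no part. -/
theorem IsHarmonicChart.lintegral_le (h : IsHarmonicChart g Φ U) (ψ : M → ℝ) :
    ∫⁻ y in Φ.target, ENNReal.ofReal (U y ^ 2) * ‖fderiv ℝ (ψ ∘ Φ.symm) y‖ₑ ^ 2 ≤
      ∫⁻ x, gradSq g ψ x ∂(riemannianVolume g) := by
  set F : E3 → ℝ≥0∞ := fun y => ENNReal.ofReal ((U y ^ 4)⁻¹) * ‖fderiv ℝ (ψ ∘ Φ.symm) y‖ₑ ^ 2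
  have hmt := Φ.open_target.measurableSet
  have hms := Φ.open_source.measurableSet
  have hUm : AEMeasurable U (volume.restrict Φ.target) := h.continuousOn.aemeasurable hmt
  calc ∫⁻ y in Φ.target, ENNReal.ofReal (U y ^ 2) * ‖fderiv ℝ (ψ ∘ Φ.symm) y‖ₑ ^ 2
      = ∫⁻ y, F y ∂((volume.restrict Φ.target).withDensity (fun y => ENNReal.ofReal (U y ^ 6))) := by
        rw [lintegral_withDensity_eq_lintegral_mul₀ (hUm.pow_const 6).ennreal_ofReal]
        · refine setLIntegral_congr_fun hmt fun y hy => ?_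
          have := h.pos y hy
          simp only [F, Pi.mul_apply]
          rw [← mul_assoc, ← ENNReal.ofReal_mul (by positivity)]
          congr 2; field_simp
        · exact ((hUm.pow_const 4).inv.ennreal_ofReal).mul
            ((measurable_fderiv ℝ (ψ ∘ Φ.symm)).enorm.pow_const 2).aemeasurable
    _ = ∫⁻ y, F y ∂(((riemannianVolume g).restrict Φ.source).map Φ) := by
        rw [h.map_restrict_source_eq]
    _ ≤ ∫⁻ x in Φ.source, F (Φ x) ∂(riemannianVolume g) := lintegral_map_le _ _
    _ ≤ ∫⁻ x in Φ.source, gradSq g ψ x ∂(riemannianVolume g) := by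
        refine setLIntegral_mono' hms fun x hx => ?_
        have := h.le_gradSq ψ (Φ.map_source hx)
        rwa [Φ.left_inv hx] at this
    _ ≤ _ := setLIntegral_le_lintegral _ _

end Conformal

/-! ### Competitors read in an end chart -/

section Competitor

variable {H : Type*} [TopologicalSpace H] {I : ModelWithCorners ℝ E3 H}
  {M : Type*} [TopologicalSpace M] [ChartedSpace H M] [IsManifold I ∞ M]
  {Φ : OpenPartialHomeomorph M E3}

/-- In a preferred chart the Lipschitz bound holds only relative to `range I`; the smooth transition
map takes values there and carries the bound to a full neighbourhood. -/
theorem IsEndChart.exists_lipschitzOnWith (h : IsEndChart I Φ) {ψ : M → ℝ} (hψ : IsLocallyLipschitz I ψ)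
    {y : E3} (hy : y ∈ Φ.target) : ∃ C : ℝ≥0, ∃ s ∈ 𝓝 y, LipschitzOnWith C (ψ ∘ Φ.symm) s := by
  set p := Φ.symm y
  have hp : p ∈ (chartAt H p).source := mem_chart_source H p
  obtain ⟨C, s, hs, hL⟩ := hψ p
  have hT := h.contDiffAt_transition hy hp
  obtain ⟨K, t, ht, hKt⟩ := (hT.of_le (m := 1) (by simp)).exists_lipschitzOnWith
  set T := fun z => extChartAt I p (Φ.symm z)
  have hs' : T ⁻¹' s ∈ 𝓝 y := by
    have : Tendsto T (𝓝 y) (𝓝[range I] (T y)) :=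
      tendsto_nhdsWithin_iff.2 ⟨hT.continuousAt, Eventually.of_forall fun z => mem_range_self _⟩
    exact this hs
  obtain ⟨w, hw, hw'⟩ := (h.eventuallyEq_transition hy hp).exists_mem
  refine ⟨C * K, t ∩ T ⁻¹' s ∩ w, inter_mem (inter_mem ht hs') hw, ?_⟩
  have h1 := hL.comp (hKt.mono (s := t ∩ T ⁻¹' s) inter_subset_left) fun z hz => hz.2
  intro a ha b hb
  have := h1 ha.1 hb.1
  simp only [Function.comp_apply] at this ⊢
  have ea := hw' ha.2
  have eb := hw' hb.2
  simp only [Function.comp_apply] at ea eb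
  rw [ea, eb]
  exact this

end Competitor

/-! ### The flux of a dipole against a cutoff -/

theorem hasDerivAt_cutProfile_sq (t : ℝ) :
    HasDerivAt (fun t : ℝ => cutProfile (t ^ 2)) (2 * t * deriv cutProfile (t ^ 2)) t := by
  have hd : HasDerivAt (fun t : ℝ => t ^ 2) (2 * t) t := by simpa using hasDerivAt_pow 2 t
  have h1 : HasDerivAt cutProfile (deriv cutProfile (t ^ 2)) (t ^ 2) :=
    ((contDiff_cutProfile (n := 1)).differentiable (by norm_num) _).hasDerivAt
  rw [mul_comm]
  exact HasDerivAt.comp (h₂ := cutProfile) (h := fun t : ℝ => t ^ 2) t h1 hd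

theorem contDiff_cutProfile_sq : ContDiff ℝ 1 fun t : ℝ => cutProfile (t ^ 2) :=
  (contDiff_cutProfile (n := 1)).comp (by fun_prop)

theorem hasCompactSupport_cutProfile_sq : HasCompactSupport fun t : ℝ => cutProfile (t ^ 2) := by
  refine HasCompactSupport.intro (isCompact_closedBall (0 : ℝ) 2) fun r hr => ?_
  refine cutProfile_eq_zero ?_
  have h1 : 2 < |r| := by simpa using hr
  rw [← sq_abs]; nlinarith

theorem integrable_deriv_cutProfile_sq : Integrable fun t : ℝ => 2 * t * deriv cutProfile (t ^ 2) := by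
  have h := (contDiff_cutProfile_sq.continuous_deriv le_rfl).integrable_of_hasCompactSupport (μ := volume)
    hasCompactSupport_cutProfile_sq.deriv
  rwa [show deriv (fun t : ℝ => cutProfile (t ^ 2)) = fun t => 2 * t * deriv cutProfile (t ^ 2) from
    funext fun t => (hasDerivAt_cutProfile_sq t).deriv] at h

theorem integral_deriv_cutProfile_sq : ∫ t in Ioi (0 : ℝ), 2 * t * deriv cutProfile (t ^ 2) = -1 := by
  have h := hasCompactSupport_cutProfile_sq.integral_Ioi_deriv_eq contDiff_cutProfile_sq 0
  rw [zero_pow two_ne_zero, cutProfile_eq_one zero_le_one,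
    show deriv (fun t : ℝ => cutProfile (t ^ 2)) = fun t => 2 * t * deriv cutProfile (t ^ 2) from
    funext fun t => (hasDerivAt_cutProfile_sq t).deriv] at h
  exact h

theorem sum_dipole_mul_pd_cutAt (s : ℝ) (y : E3) :
    ∑ i, dipole i y * pd i (cutAt s) y =
      2 * s⁻¹ ^ 2 * deriv cutProfile ((s⁻¹ * ‖y‖) ^ 2) / ‖y‖ := by
  have h : ∀ i, dipole i y * pd i (cutAt s) y =
      y i ^ 2 * (2 * s⁻¹ ^ 2 * deriv cutProfile ((s⁻¹ * ‖y‖) ^ 2) / ‖y‖ ^ 3) := fun i => by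
    have : ‖s⁻¹ • y‖ ^ 2 = (s⁻¹ * ‖y‖) ^ 2 := by
      rw [norm_smul, mul_pow, mul_pow, Real.norm_eq_abs, sq_abs]
    rw [dipole_eq, pd_cutAt, pd_cutBump, this]
    simp only [PiLp.smul_apply, smul_eq_mul]; ring
  simp only [h]
  rw [← Finset.sum_mul, show ∑ i, y i ^ 2 = ‖y‖ ^ 2 by
    rw [EuclideanSpace.norm_sq_eq]; simp]
  rcases eq_or_ne y 0 with rfl | hy
  · simp
  · have := norm_pos_iff.2 hy
    field_simp

/-- The field `y/|y|³` has flux `4π = 3ω` through every centred sphere, and the radial derivative of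
the cutoff integrates to `-1` at every scale. -/
theorem integral_sum_dipole_mul_pd_cutAt {s : ℝ} (hs : 0 < s) :
    ∫ y, ∑ i, dipole i y * pd i (cutAt s) y = -(3 * unitBallVolume) := by
  simp only [sum_dipole_mul_pd_cutAt]
  rw [integral_fun_norm_addHaar volume
    (fun r => 2 * s⁻¹ ^ 2 * deriv cutProfile ((s⁻¹ * r) ^ 2) / r)]
  have hv : (volume : Measure E3).real (Metric.ball 0 1) = unitBallVolume := by
    rw [Measure.real, volume_ball_E3 0 zero_le_one, one_pow, mul_one,
      ENNReal.toReal_ofReal unitBallVolume_pos.le]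
  have hint : ∫ r in Ioi (0 : ℝ), r ^ (Module.finrank ℝ E3 - 1) •
      (2 * s⁻¹ ^ 2 * deriv cutProfile ((s⁻¹ * r) ^ 2) / r) = -1 := by
    have h := integral_comp_mul_left_Ioi' (fun t : ℝ => 2 * t * deriv cutProfile (t ^ 2)) 0 (inv_pos.2 hs)
    rw [mul_zero, integral_deriv_cutProfile_sq, ← integral_smul] at h
    rw [← h]
    refine setIntegral_congr_fun measurableSet_Ioi fun r hr => ?_
    have hr : 0 < r := hr
    simp; field_simp
  rw [hint, hv]
  simp

/-! ### Locally Lipschitz functions -/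

theorem _root_.LocallyLipschitz.mul_real {f h : E3 → ℝ} (hf : LocallyLipschitz f) (hh : LocallyLipschitz h) :
    LocallyLipschitz fun x => f x * h x := by
  have h1 : LocallyLipschitz fun p : ℝ × ℝ => p.1 * p.2 :=
    (contDiff_fst.mul contDiff_snd : ContDiff ℝ 1 fun p : ℝ × ℝ => p.1 * p.2).locallyLipschitz
  exact h1.comp (hf.prodMk hh)

theorem exists_lipschitzWith_mul_cutAt {f : E3 → ℝ} (hf : LocallyLipschitz f) {ρ : ℝ} (hρ : 0 < ρ) :
    ∃ C : ℝ≥0, LipschitzWith C fun y => f y * cutAt ρ y :=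
  exists_lipschitzWith_of_hasCompactSupport
    (hf.mul_real (contDiff_cutAt ρ (n := 1)).locallyLipschitz) (hasCompactSupport_cutAt hρ).mul_left

theorem mul_cutAt_eventuallyEq (f : E3 → ℝ) {ρ : ℝ} (hρ : 0 < ρ) {y : E3} (hy : ‖y‖ < ρ) :
    f =ᶠ[𝓝 y] fun y => f y * cutAt ρ y := by
  filter_upwards [continuous_norm.continuousAt.eventually (gt_mem_nhds hy)] with z hz
  rw [cutAt_eq_one hρ hz.le, mul_one]

theorem exists_norm_fderiv_le {f : E3 → ℝ} (hf : LocallyLipschitz f) (r : ℝ) :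
    ∃ C : ℝ, 0 ≤ C ∧ ∀ y, ‖y‖ ≤ r → ‖fderiv ℝ f y‖ ≤ C := by
  have hρ : 0 < |r| + 1 := by positivity
  obtain ⟨C, hC⟩ := exists_lipschitzWith_mul_cutAt hf hρ
  refine ⟨C, C.2, fun y hy => ?_⟩
  rw [(mul_cutAt_eventuallyEq f hρ (hy.trans_lt (by linarith [le_abs_self r]))).fderiv_eq]
  exact norm_fderiv_le_of_lipschitz ℝ hC

theorem ae_differentiableAt_of_locallyLipschitz {f : E3 → ℝ} (hf : LocallyLipschitz f) :
    ∀ᵐ y, DifferentiableAt ℝ f y := by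
  have : ∀ n : ℕ, ∀ᵐ y, DifferentiableAt ℝ (fun y => f y * cutAt (n + 1 : ℝ) y) y := fun n => by
    obtain ⟨C, hC⟩ := exists_lipschitzWith_mul_cutAt hf (ρ := n + 1) (by positivity)
    exact hC.ae_differentiableAt
  filter_upwards [ae_all_iff.2 this] with y hy
  obtain ⟨n, hn⟩ := exists_nat_gt ‖y‖
  exact (hy n).congr_of_eventuallyEq (mul_cutAt_eventuallyEq f (by positivity) (by linarith))

theorem integral_pd_eq_zero_of_locallyLipschitz {i : Fin 3} {f : E3 → ℝ} (hf : LocallyLipschitz f)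
    (hs : HasCompactSupport f) : ∫ x, pd i f x = 0 := by
  obtain ⟨C, hC⟩ := exists_lipschitzWith_of_hasCompactSupport hf hs
  have h := LipschitzWith.integral_lineDeriv_mul_eq (μ := (volume : Measure E3)) (LipschitzWith.const (1 : ℝ)) hC hs (-stdVec i)
  simp only [neg_neg, mul_one] at h
  have e : ∫ x, lineDeriv ℝ f x (stdVec i) = ∫ x, pd i f x :=
    integral_congr_ae (by
      filter_upwards [hC.ae_differentiableAt] with x hx
      exact hx.lineDeriv_eq_fderiv)
  rw [← e, ← h]
  simp [lineDeriv]

theorem norm_fderiv_sq (f : E3 → ℝ) (x : E3) : ‖fderiv ℝ f x‖ ^ 2 = ∑ i, pd i f x ^ 2 := by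
  have h : ‖fderiv ℝ f x‖ = ‖(InnerProductSpace.toDual ℝ E3).symm (fderiv ℝ f x)‖ :=
    (LinearIsometryEquiv.norm_map _ _).symm
  rw [h, EuclideanSpace.norm_sq_eq]
  refine Finset.sum_congr rfl fun i _ => ?_
  rw [Real.norm_eq_abs, sq_abs, ← inner_stdVec, InnerProductSpace.toDual_symm_apply]
  rfl

theorem measurable_pd (i : Fin 3) (f : E3 → ℝ) : Measurable (pd i f) :=
  measurable_fderiv_apply_const ℝ f (stdVec i)

theorem integrable_pd_of_locallyLipschitz {f : E3 → ℝ} (hf : LocallyLipschitz f)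
    (hs : HasCompactSupport f) (i : Fin 3) : Integrable (pd i f) := by
  obtain ⟨C, hC⟩ := exists_lipschitzWith_of_hasCompactSupport hf hs
  obtain ⟨L, hL⟩ := (hasCompactSupport_pd (i := i) hs).isBounded.exists_norm_le
  refine integrable_of_abs_le_on_closedBall (L := L) (C := C) (measurable_pd i f) (fun y hy => ?_)
    fun y _ => (abs_pd_le i f y).trans (norm_fderiv_le_of_lipschitz ℝ hC)
  by_contra h
  exact absurd (hL y (subset_tsupport _ h)) (not_le.2 hy)

theorem integrable_cutAt_mul {f : E3 → ℝ} (hf : Measurable f) {ρ C : ℝ} (hρ : 0 < ρ)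
    (hC : ∀ y, ‖y‖ ≤ 2 * ρ → |f y| ≤ C) : Integrable fun y => cutAt ρ y * f y := by
  refine integrable_of_abs_le_on_closedBall (L := 2 * ρ) (C := C)
    ((contDiff_cutAt ρ (n := 1)).continuous.measurable.mul hf)
    (fun y hy => by rw [cutAt_eq_zero hρ hy.le, zero_mul]) fun y hy => ?_
  rw [abs_mul, abs_of_nonneg (cutAt_nonneg ρ y)]
  exact (mul_le_of_le_one_left (abs_nonneg _) (cutAt_le_one ρ y)).trans (hC y hy)

theorem exists_abs_le_of_continuous {f : E3 → ℝ} (hf : Continuous f) (r : ℝ) :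
    ∃ C : ℝ, 0 ≤ C ∧ ∀ y, ‖y‖ ≤ r → |f y| ≤ C := by
  obtain ⟨C, hC⟩ := (isCompact_closedBall (0 : E3) r).exists_bound_of_continuousOn hf.continuousOn
  exact ⟨max C 0, le_max_right _ _, fun y hy => (hC y (by simpa using hy)).trans (le_max_left _ _)⟩

/-! ### The energy identity and the weighted energy bound -/

/-- The energy of `U u` in terms of the weighted energy of `u`, when `U` is harmonic. -/
theorem integral_cutAt_mul_energy {U u : E3 → ℝ} (hU : ContDiff ℝ 2 U) (hu : LocallyLipschitz u)
    (h0 : ∀ y, u y = 0 ∨ lap U y = 0) {ρ : ℝ} (hρ : 0 < ρ) :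
    ∫ y, cutAt ρ y * ‖fderiv ℝ (fun y => U y * u y) y‖ ^ 2 =
      (∫ y, cutAt ρ y * (U y ^ 2 * ‖fderiv ℝ u y‖ ^ 2)) -
        ∫ y, ∑ i, u y ^ 2 * U y * pd i U y * pd i (cutAt ρ) y := by
  have hU1 : ContDiff ℝ 1 U := hU.of_le (by norm_num)
  have hpU : ∀ i, ContDiff ℝ 1 (pd i U) := fun i => contDiff_pd hU (by norm_num)
  have hχ : ContDiff ℝ 1 (cutAt ρ) := contDiff_cutAt ρ (n := 1)
  have hχs := hasCompactSupport_cutAt hρ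
  have hφ : LocallyLipschitz fun y => U y * u y := hU1.locallyLipschitz.mul_real hu
  -- The integral of `div(χ u² U ∇U)` vanishes. This divergence is `χ|∇(Uu)|² - χU²|∇u|²` plus the
  -- term with `∇χ`, since `u² U ΔU` is zero by `h0`.
  set F : Fin 3 → E3 → ℝ := fun i y => u y * u y * (U y * pd i U y) * cutAt ρ y with hF
  have hFl : ∀ i, LocallyLipschitz (F i) := fun i =>
    ((hu.mul_real hu).mul_real (hU1.mul (hpU i)).locallyLipschitz).mul_real hχ.locallyLipschitz
  have hFs : ∀ i, HasCompactSupport (F i) := fun i => hχs.mul_left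
  have hFz : ∫ y, ∑ i, pd i (F i) y = 0 := by
    rw [integral_finsetSum _ fun i _ => integrable_pd_of_locallyLipschitz (hFl i) (hFs i) i]
    exact Finset.sum_eq_zero fun i _ => integral_pd_eq_zero_of_locallyLipschitz (hFl i) (hFs i)
  have i1 : Integrable fun y => cutAt ρ y * ‖fderiv ℝ (fun y => U y * u y) y‖ ^ 2 := by
    obtain ⟨C, hC0, hC⟩ := exists_norm_fderiv_le hφ (2 * ρ)
    refine integrable_cutAt_mul (C := C ^ 2) ((measurable_fderiv ℝ _).norm.pow_const 2) hρ fun y hy => ?_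
    rw [abs_of_nonneg (by positivity)]
    have := hC y hy
    gcongr
  have i2 : Integrable fun y => cutAt ρ y * (U y ^ 2 * ‖fderiv ℝ u y‖ ^ 2) := by
    obtain ⟨C, hC0, hC⟩ := exists_norm_fderiv_le hu (2 * ρ)
    obtain ⟨D, hD0, hD⟩ := exists_abs_le_of_continuous hU.continuous (2 * ρ)
    refine integrable_cutAt_mul (C := D ^ 2 * C ^ 2) ((hU.continuous.measurable.pow_const 2).mul
      ((measurable_fderiv ℝ _).norm.pow_const 2)) hρ fun y hy => ?_
    simp only [Pi.mul_apply]
    rw [abs_of_nonneg (by positivity), ← sq_abs (U y)]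
    have := hC y hy
    have := hD y hy
    gcongr
  have i3 : ∀ i, Integrable fun y => u y ^ 2 * U y * pd i U y * pd i (cutAt ρ) y := fun i => by
    refine Continuous.integrable_of_hasCompactSupport ?_ (hasCompactSupport_pd hχs).mul_left
    exact (((hu.continuous.pow 2).mul hU.continuous).mul (hpU i).continuous).mul
      (contDiff_pd (m := 0) hχ (by norm_num)).continuous
  have i3' := integrable_finsetSum Finset.univ fun i _ => i3 i
  have hae : ∀ᵐ y, ∑ i, pd i (F i) y = cutAt ρ y * ‖fderiv ℝ (fun y => U y * u y) y‖ ^ 2 -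
      cutAt ρ y * (U y ^ 2 * ‖fderiv ℝ u y‖ ^ 2) +
        ∑ i, u y ^ 2 * U y * pd i U y * pd i (cutAt ρ) y := by
    filter_upwards [ae_differentiableAt_of_locallyLipschitz hu] with y hy
    have dU : DifferentiableAt ℝ U y := hU1.differentiable (by norm_num) y
    have dp : ∀ i, DifferentiableAt ℝ (pd i U) y := fun i => (hpU i).differentiable (by norm_num) y
    have dχ : DifferentiableAt ℝ (cutAt ρ) y := hχ.differentiable (by norm_num) y
    have e1 : ∀ i, pd i (F i) y = cutAt ρ y * (2 * u y * pd i u y * (U y * pd i U y) +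
        u y ^ 2 * pd i U y ^ 2) + cutAt ρ y * (u y ^ 2 * U y) * pd i (pd i U) y +
        u y ^ 2 * U y * pd i U y * pd i (cutAt ρ) y := fun i => by
      simp only [hF]
      rw [pd_mul ((hy.fun_mul hy).fun_mul (dU.fun_mul (dp i))) dχ, pd_mul (hy.fun_mul hy) (dU.fun_mul (dp i)),
        pd_mul hy hy, pd_mul dU (dp i)]
      ring
    have e2 : ∀ i, pd i (fun y => U y * u y) y = pd i U y * u y + U y * pd i u y := fun i => by
      rw [pd_mul dU hy]; ring
    have e3 : cutAt ρ y * (u y ^ 2 * U y) * ∑ i, pd i (pd i U) y = 0 := by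
      rcases h0 y with h | h
      · simp [h]
      · change cutAt ρ y * (u y ^ 2 * U y) * lap U y = 0
        rw [h, mul_zero]
    simp only [e1, norm_fderiv_sq, e2, Finset.sum_add_distrib]
    rw [← Finset.mul_sum, ← Finset.mul_sum, e3, add_zero]
    congr 1
    simp only [Fin.sum_univ_three]
    ring
  have i4 : Integrable fun y => cutAt ρ y * ‖fderiv ℝ (fun y => U y * u y) y‖ ^ 2 -
      cutAt ρ y * (U y ^ 2 * ‖fderiv ℝ u y‖ ^ 2) := i1.sub i2
  rw [integral_congr_ae hae, integral_add i4 i3', integral_sub i1 i2] at hFz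
  linarith

/-- The dipole part gives the same value at every scale. The error is `o(ρ⁻²)` times a cutoff
gradient `O(ρ⁻¹)` on a region of volume `O(ρ³)`. -/
theorem tendsto_integral_flux {w : Fin 3 → E3 → ℝ} {a : ℝ} (hw : ∀ i, Measurable (w i))
    (h : ∀ ε > 0, ∃ L : ℝ, ∀ y, L ≤ ‖y‖ → ∀ i, |w i y + a * dipole i y| ≤ ε / ‖y‖ ^ 2) :
    Tendsto (fun ρ : ℝ => ∫ y, ∑ i, w i y * pd i (cutAt ρ) y) atTop (𝓝 (3 * unitBallVolume * a)) := by
  obtain ⟨T, hT0, hT1, -, -⟩ := exists_bound_cutBump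
  have hω := unitBallVolume_pos
  rw [Metric.tendsto_atTop]
  intro ε hε
  set δ := ε / (2 * (3 * T * unitBallVolume * 8 + 1))
  have hden : 0 < 3 * T * unitBallVolume * 8 + 1 := by positivity
  have hδ : 0 < δ := by positivity
  obtain ⟨L, hL⟩ := h δ hδ
  refine ⟨max L 1, fun ρ hρ => ?_⟩
  have hρ1 : 1 ≤ ρ := (le_max_right _ _).trans hρ
  have hρ0 : 0 < ρ := by linarith
  have hzero : ∀ y, ‖y‖ < ρ ∨ 2 * ρ < ‖y‖ → ∀ i, pd i (cutAt ρ) y = 0 := fun y hy i =>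
    (pd_cutAt_eq_zero hρ0 hy).eq_of_nhds
  have hpd : ∀ i y, |pd i (cutAt ρ) y| ≤ T / ρ := fun i y => by
    rw [pd_cutAt, abs_mul, abs_of_pos (inv_pos.2 hρ0), div_eq_inv_mul]
    exact mul_le_mul_of_nonneg_left (hT1 i _) (inv_pos.2 hρ0).le
  have hmd : ∀ i, Measurable (dipole i) := fun i => (isDecayingKernel_dipole i).measurable
  have hbound : ∀ y, |∑ i, (w i y + a * dipole i y) * pd i (cutAt ρ) y| ≤ 3 * (δ / ρ ^ 2 * (T / ρ)) := by
    intro y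
    by_cases hy : ‖y‖ < ρ ∨ 2 * ρ < ‖y‖
    · simp only [hzero y hy, mul_zero, Finset.sum_const_zero, abs_zero]; positivity
    · push Not at hy
      refine (Finset.abs_sum_le_sum_abs _ _).trans ((Finset.sum_le_sum (g := fun _ => δ / ρ ^ 2 * (T / ρ)) fun i _ => ?_).trans_eq
        (by simp))
      rw [abs_mul]
      have h1 := hL y (((le_max_left _ _).trans hρ).trans hy.1) i
      have h2 := hpd i y
      have h3 := hy.1
      calc _ ≤ δ / ‖y‖ ^ 2 * (T / ρ) := by gcongr
        _ ≤ _ := by gcongr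
  have hm1 : Measurable fun y => ∑ i, (w i y + a * dipole i y) * pd i (cutAt ρ) y :=
    Finset.measurable_fun_sum _ fun i _ => ((hw i).add ((hmd i).const_mul a)).mul (measurable_pd i _)
  have hz1 : ∀ y, 2 * ρ < ‖y‖ → ∑ i, (w i y + a * dipole i y) * pd i (cutAt ρ) y = 0 := fun y hy => by
    simp only [hzero y (Or.inr hy), mul_zero, Finset.sum_const_zero]
  have hi1 := integrable_of_abs_le_on_closedBall hm1 hz1 fun y _ => hbound y
  have hi2 : Integrable fun y => ∑ i, dipole i y * pd i (cutAt ρ) y := by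
    by_contra hn
    have := integral_sum_dipole_mul_pd_cutAt hρ0
    rw [integral_undef hn] at this
    linarith
  have e : ∫ y, ∑ i, w i y * pd i (cutAt ρ) y =
      (∫ y, ∑ i, (w i y + a * dipole i y) * pd i (cutAt ρ) y) + 3 * unitBallVolume * a := by
    have h1 : ∀ y, ∑ i, w i y * pd i (cutAt ρ) y = (∑ i, (w i y + a * dipole i y) * pd i (cutAt ρ) y) -
        a * ∑ i, dipole i y * pd i (cutAt ρ) y := fun y => by
      rw [Finset.mul_sum, ← Finset.sum_sub_distrib]
      exact Finset.sum_congr rfl fun i _ => by ring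
    simp only [h1]
    rw [integral_sub hi1 (hi2.const_mul a), integral_const_mul, integral_sum_dipole_mul_pd_cutAt hρ0]
    ring
  have h3 := abs_integral_le_on_closedBall (by positivity) hz1 fun y _ => hbound y
  rw [e, Real.dist_eq, add_sub_cancel_right]
  refine h3.trans_lt ?_
  have : 3 * (δ / ρ ^ 2 * (T / ρ)) * (unitBallVolume * (2 * ρ) ^ 3) = δ * (3 * T * unitBallVolume * 8) := by
    field_simp; ring
  rw [this]
  calc δ * (3 * T * unitBallVolume * 8) ≤ δ * (3 * T * unitBallVolume * 8 + 1) := by gcongr; linarith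
    _ = ε / 2 := by simp only [δ]; field_simp
    _ < ε := by linarith

/-- The weighted energy of a function vanishing on a large set is bounded below in terms of the
volume radius of that set and the leading coefficient of the harmonic weight. -/
theorem weighted_energy_ge {U u : E3 → ℝ} {s a M R ρ : ℝ} (hU : ContDiff ℝ 2 U)
    (hlap : ∀ y, ρ < ‖y‖ → lap U y = 0) (hUpos : ∀ y, ρ < ‖y‖ → 0 < U y)
    (hU1 : Tendsto U (Bornology.cobounded E3) (𝓝 1))
    (hasym : ∀ x, s < ‖x‖ → ∀ j, |pd j U x + a * dipole j x| ≤ M / ‖x‖ ^ 3)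
    (hu : LocallyLipschitz u) (hu0 : ∀ y, ‖y‖ ≤ ρ → u y = 0)
    (hu1 : Tendsto u (Bornology.cobounded E3) (𝓝 1)) (hR : 0 < R)
    (hvol : ENNReal.ofReal (unitBallVolume * R ^ 3) ≤ volume {y | u y ≤ 0}) :
    ENNReal.ofReal (3 * unitBallVolume * (R + a)) ≤
      ∫⁻ y, ENNReal.ofReal (U y ^ 2) * ‖fderiv ℝ u y‖ₑ ^ 2 := by
  have hω := unitBallVolume_pos
  set E := ∫⁻ y, ENNReal.ofReal (U y ^ 2) * ‖fderiv ℝ u y‖ₑ ^ 2 with hE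
  by_cases hEtop : E = ⊤
  · rw [hEtop]; exact le_top
  set φ : E3 → ℝ := fun y => U y * u y with hφdef
  have hφ : LocallyLipschitz φ := (hU.of_le (by norm_num)).locallyLipschitz.mul_real hu
  have hφ1 : Tendsto φ (cocompact E3) (𝓝 1) := by
    rw [← Metric.cobounded_eq_cocompact]; simpa using hU1.mul hu1
  -- `U` may fail to be positive inside the ball of radius `ρ`, but `u` vanishes there.
  have hset : {y | φ y ≤ 0} = {y | u y ≤ 0} := by
    ext y
    simp only [mem_ofPred_eq, hφdef]
    rcases le_or_gt ‖y‖ ρ with hy | hy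
    · simp [hu0 y hy]
    · have hp := hUpos y hy
      exact ⟨fun h => le_of_mul_le_mul_left (by simpa using h) hp,
        fun h => mul_nonpos_of_nonneg_of_nonpos hp.le h⟩
  obtain ⟨R', hR'0, hR'⟩ := exists_volumeRadius (V := volume {y | φ y ≤ 0})
    (sublevelVolume_ne_top hφ1 zero_lt_one)
  have hRR' : R ≤ R' := by
    rw [← hset, hR', ENNReal.ofReal_le_ofReal_iff (by positivity)] at hvol
    exact le_of_pow_le_pow_left₀ three_ne_zero hR'0 (le_of_mul_le_mul_left hvol hω)
  have hiso := isocapacitary_inequality hφ hφ1 (hR.trans_le hRR') hR'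
  have hiso2 : ENNReal.ofReal (3 * unitBallVolume * R) ≤ ∫⁻ y, ‖fderiv ℝ φ y‖ₑ ^ 2 :=
    (ENNReal.ofReal_le_ofReal (by gcongr)).trans (hiso.trans (setLIntegral_le_lintegral _ _))
  -- truncation
  have hFat : ∫⁻ y, ‖fderiv ℝ φ y‖ₑ ^ 2 ≤ liminf (fun n : ℕ => ∫⁻ y, ENNReal.ofReal
      (cutAt n y * ‖fderiv ℝ φ y‖ ^ 2)) atTop := by
    refine le_trans (lintegral_mono fun y => ?_) (lintegral_liminf_le fun n => ?_)
    · have : Tendsto (fun n : ℕ => ENNReal.ofReal (cutAt n y * ‖fderiv ℝ φ y‖ ^ 2)) atTop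
          (𝓝 (‖fderiv ℝ φ y‖ₑ ^ 2)) := by
        refine tendsto_const_nhds.congr' ?_
        filter_upwards [eventually_ge_atTop (⌈‖y‖⌉₊ + 1)] with n hn
        have h1 : (⌈‖y‖⌉₊ : ℝ) + 1 ≤ n := by exact_mod_cast hn
        have h2 := Nat.le_ceil ‖y‖
        have h3 := norm_nonneg y
        rw [cutAt_eq_one (by linarith) (by linarith), one_mul, ENNReal.ofReal_pow (norm_nonneg _), ofReal_norm]
      exact this.liminf_eq.ge
    · exact ((contDiff_cutAt n (n := 1)).continuous.measurable.mul
        ((measurable_fderiv ℝ φ).norm.pow_const 2)).ennreal_ofReal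
  -- Since `u²U → 1`, the boundary field inherits the dipole asymptotics of `∇U`. The limit `3ωa =
  -- 4πa` is the gain over the Euclidean bound.
  have hflux : Tendsto (fun r : ℝ => ∫ y, ∑ i, u y ^ 2 * U y * pd i U y * pd i (cutAt r) y) atTop
      (𝓝 (3 * unitBallVolume * a)) := by
    have hpU : ∀ i, Measurable (pd i U) := fun i => measurable_pd i U
    refine tendsto_integral_flux (fun i => ((hu.continuous.measurable.pow_const 2).mul
      hU.continuous.measurable).mul (hpU i)) fun ε hε => ?_
    have hlim : Tendsto (fun y => u y ^ 2 * U y - 1) (Bornology.cobounded E3) (𝓝 0) := by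
      simpa using ((hu1.pow 2).mul hU1).sub_const 1
    have hK : 0 < 2 * (4 * |a| + |M| + 1) := by positivity
    obtain ⟨L1, hL1, hL1'⟩ := eventually_cobounded_norm.1
      ((Metric.tendsto_nhds.1 hlim) (min 1 (ε / (2 * (4 * |a| + |M| + 1)))) (by positivity))
    refine ⟨max (max L1 1) (max (s + 1) (4 * |M| / ε)), fun y hy i => ?_⟩
    have hy1 := ((le_max_left _ _).trans (le_max_left _ _)).trans hy
    have hy2 := ((le_max_right _ _).trans (le_max_left _ _)).trans hy
    have hy3 := ((le_max_left _ _).trans (le_max_right _ _)).trans hy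
    have hy4 := ((le_max_right _ _).trans (le_max_right _ _)).trans hy
    have hy0 : 0 < ‖y‖ := by linarith
    have hne : y ≠ 0 := norm_pos_iff.1 hy0
    have h1 := hL1' y hy1
    rw [Real.dist_eq, sub_zero, lt_min_iff] at h1
    have h2 := hasym y (by linarith) i
    have h3 : |dipole i y| ≤ 4 / ‖y‖ ^ 2 := (isDecayingKernel_dipole i).abs_le y hne
    have h2' : |pd i U y + a * dipole i y| ≤ |M| / ‖y‖ ^ 3 := h2.trans (by gcongr; exact le_abs_self M)
    have hM3 : |M| / ‖y‖ ^ 3 ≤ |M| / ‖y‖ ^ 2 := by gcongr; norm_num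
    have hM4 : |M| / ‖y‖ ^ 3 ≤ ε / 4 / ‖y‖ ^ 2 := by
      rw [div_le_iff₀ hε] at hy4
      rw [div_le_div_iff₀ (by positivity) (by positivity)]
      nlinarith [pow_pos hy0 2, pow_pos hy0 3]
    have h4 : |pd i U y| ≤ (4 * |a| + |M| + 1) / ‖y‖ ^ 2 := by
      calc |pd i U y| = |(pd i U y + a * dipole i y) - a * dipole i y| := by ring_nf
        _ ≤ |M| / ‖y‖ ^ 2 + |a| * (4 / ‖y‖ ^ 2) := by
            refine (abs_sub _ _).trans (add_le_add (h2'.trans hM3) ?_)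
            rw [abs_mul]; gcongr
        _ ≤ _ := by
            rw [mul_div_assoc', ← add_div]
            exact div_le_div_of_nonneg_right (by linarith) (by positivity)
    calc |u y ^ 2 * U y * pd i U y + a * dipole i y|
        = |(u y ^ 2 * U y - 1) * pd i U y + (pd i U y + a * dipole i y)| := by ring_nf
      _ ≤ ε / (2 * (4 * |a| + |M| + 1)) * ((4 * |a| + |M| + 1) / ‖y‖ ^ 2) + ε / 4 / ‖y‖ ^ 2 := by
          refine (abs_add_le _ _).trans (add_le_add ?_ (h2'.trans hM4))
          rw [abs_mul]
          exact mul_le_mul h1.2.le h4 (abs_nonneg _) (by positivity)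
      _ = (3 / 4 * ε) / ‖y‖ ^ 2 := by field_simp; ring
      _ ≤ _ := by gcongr; linarith
  have h0 : ∀ y, u y = 0 ∨ lap U y = 0 := fun y => by
    rcases le_or_gt ‖y‖ ρ with hy | hy
    · exact Or.inl (hu0 y hy)
    · exact Or.inr (hlap y hy)
  have hle : ∀ᶠ n : ℕ in atTop, ∫⁻ y, ENNReal.ofReal (cutAt n y * ‖fderiv ℝ φ y‖ ^ 2) ≤
      ENNReal.ofReal (E.toReal - ∫ y, ∑ i, u y ^ 2 * U y * pd i U y * pd i (cutAt n) y) := by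
    filter_upwards [eventually_gt_atTop 0] with n hn
    have hn : (0 : ℝ) < n := by exact_mod_cast hn
    have hnn : ∀ y, 0 ≤ cutAt n y * ‖fderiv ℝ φ y‖ ^ 2 := fun y => mul_nonneg (cutAt_nonneg _ _) (by positivity)
    have hint : Integrable fun y => cutAt n y * ‖fderiv ℝ φ y‖ ^ 2 := by
      obtain ⟨C, hC0, hC⟩ := exists_norm_fderiv_le hφ (2 * n)
      refine integrable_cutAt_mul (C := C ^ 2) ((measurable_fderiv ℝ _).norm.pow_const 2) hn fun y hy => ?_
      rw [abs_of_nonneg (by positivity)]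
      have := hC y hy
      gcongr
    rw [← ofReal_integral_eq_lintegral_ofReal hint (Eventually.of_forall hnn),
      integral_cutAt_mul_energy hU hu h0 hn]
    refine ENNReal.ofReal_le_ofReal (sub_le_sub_right ?_ _)
    have hm : Measurable fun y => cutAt n y * (U y ^ 2 * ‖fderiv ℝ u y‖ ^ 2) :=
      (contDiff_cutAt n (n := 1)).continuous.measurable.mul
        ((hU.continuous.measurable.pow_const 2).mul ((measurable_fderiv ℝ u).norm.pow_const 2))
    have hnn' : ∀ y, 0 ≤ cutAt n y * (U y ^ 2 * ‖fderiv ℝ u y‖ ^ 2) := fun y =>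
      mul_nonneg (cutAt_nonneg _ _) (by positivity)
    rw [integral_eq_lintegral_of_nonneg_ae (Eventually.of_forall hnn') hm.aestronglyMeasurable]
    refine ENNReal.toReal_mono hEtop (lintegral_mono fun y => ?_)
    rw [← ofReal_norm, ← ENNReal.ofReal_pow (norm_nonneg _), ← ENNReal.ofReal_mul (by positivity)]
    exact ENNReal.ofReal_le_ofReal (mul_le_of_le_one_left (by positivity) (cutAt_le_one _ _))
  have hlim : Tendsto (fun n : ℕ => ENNReal.ofReal (E.toReal - ∫ y, ∑ i, u y ^ 2 * U y * pd i U y *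
      pd i (cutAt n) y)) atTop (𝓝 (ENNReal.ofReal (E.toReal - 3 * unitBallVolume * a))) :=
    ENNReal.tendsto_ofReal ((hflux.comp tendsto_natCast_atTop_atTop).const_sub _)
  have hfin := hiso2.trans (hFat.trans ((liminf_le_liminf hle).trans hlim.liminf_eq.le))
  -- `ENNReal.ofReal` truncates negative numbers, so the comparison passes to the reals unless its
  -- left side is nonpositive, which `R > 0` excludes.
  rw [ENNReal.ofReal_le_ofReal_iff'] at hfin
  rw [← ENNReal.ofReal_toReal hEtop]
  refine ENNReal.ofReal_le_ofReal ?_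
  rcases hfin with h | h
  · linarith
  · exfalso
    have : 0 < 3 * unitBallVolume * R := by positivity
    linarith

/-! ### The lower bound for the capacity -/

/-- `U = 1 + a / |x| + O(|x|⁻²)` at infinity, together with the first derivatives. -/
def HasExpansion (U : E3 → ℝ) (a : ℝ) : Prop :=
  ∃ s M : ℝ, 0 < s ∧ 0 ≤ M ∧ ∀ x, s < ‖x‖ → |U x - 1 - a / ‖x‖| ≤ M / ‖x‖ ^ 2 ∧
    ∀ j, |pd j U x + a * dipole j x| ≤ M / ‖x‖ ^ 3

theorem exists_contDiff_extension {U : E3 → ℝ} {s : ℝ} (hs : 0 < s)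
    (hU : ∀ y, s ≤ ‖y‖ → ContDiffAt ℝ 2 U y) :
    ∃ W : E3 → ℝ, ContDiff ℝ 2 W ∧ ∀ y, 2 * s ≤ ‖y‖ → W y = U y := by
  refine ⟨fun y => U y * (1 - cutAt s y), ?_, fun y hy => by simp [cutAt_eq_zero hs hy]⟩
  refine contDiff_mul_of_tsupport (contDiff_const.sub (contDiff_cutAt s (n := 2))) fun x hx => ?_
  refine hU x ?_
  have hcl : IsClosed {y : E3 | s ≤ ‖y‖} := isClosed_le continuous_const continuous_norm
  refine closure_minimal (fun y hy => ?_) hcl hx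
  by_contra hlt
  exact hy (by simp [cutAt_eq_one hs (not_le.1 hlt).le])

section

variable {H : Type*} [TopologicalSpace H] {I : ModelWithCorners ℝ E3 H}
  {M : Type*} [TopologicalSpace M] [ChartedSpace H M] [IsManifold I ∞ M]
  {Φ : OpenPartialHomeomorph M E3} {g : SmoothMetric I M} {U : E3 → ℝ}

theorem IsHarmonicChart.exists_hasExpansion (h : IsHarmonicChart g Φ U) : ∃ a, HasExpansion U a := by
  obtain ⟨s, hs, hst⟩ := h.exists_exterior_subset
  have hp : ∀ i, pd i (fun y => U y - 1) = pd i U := fun i => by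
    ext x; simp only [pd, fderiv_sub_const]
  obtain ⟨a, M, hM, ha⟩ := harmonic_expansion (v := fun y => U y - 1) hs
    (fun y hy => (h.contDiffAt (hst y hy)).sub contDiffAt_const)
    (fun y hy => by
      have := h.lap_eq_zero (hst y hy)
      simp only [lap, hp] at this ⊢
      exact this) (by simpa using h.tendsto_one.sub_const 1)
  refine ⟨a, 4 * s, M, by positivity, hM, fun x hx => ⟨(ha x hx).1, fun j => ?_⟩⟩
  have := (ha x hx).2 j
  rwa [hp] at this

variable [MeasurableSpace M] [BorelSpace M] [SecondCountableTopology M] [Nonempty M]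

/-- Whatever the core of `M` looks like, it is replaced by a Euclidean ball on which the competitor
is zero; `R` measures the resulting subset of `E3`. Discarding the energy in the core only lowers
the bound. -/
theorem IsHarmonicChart.capacity_ge (h : IsHarmonicChart g Φ U)
    (hΦ : Tendsto Φ.symm (Bornology.cobounded E3) (cocompact M)) {a : ℝ} (ha : HasExpansion U a) :
    ∃ ρ₀ : ℝ, 0 < ρ₀ ∧ (∀ y, ρ₀ ≤ ‖y‖ → y ∈ Φ.target) ∧ ∀ ρ, ρ₀ ≤ ρ → ∀ (K : Set M) (R : ℝ), 0 < R →
      {x | x ∈ Φ.source → ‖Φ x‖ ≤ ρ} ⊆ K →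
      ENNReal.ofReal (unitBallVolume * R ^ 3) ≤ volume {y | ‖y‖ ≤ ρ ∨ Φ.symm y ∈ K} →
      ENNReal.ofReal (R + a) ≤ capacity g K := by
  obtain ⟨s, hs, hst⟩ := h.exists_exterior_subset
  obtain ⟨t, B, ht, hB, hexp⟩ := ha
  obtain ⟨W, hW, hWU⟩ := exists_contDiff_extension hs fun y hy => h.contDiffAt (hst y hy)
  have hev : ∀ y, 2 * s < ‖y‖ → W =ᶠ[𝓝 y] U := fun y hy => by
    filter_upwards [continuous_norm.continuousAt.eventually (lt_mem_nhds hy)] with z hz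
    exact hWU z hz.le
  refine ⟨2 * s, by positivity, fun y hy => hst y (by linarith), fun ρ hρ K R hR hK hvol => ?_⟩
  refine le_iInf₂ fun ψ hψ => ?_
  -- `ψ` vanishes on `K`, which contains every point with coordinates of norm at most `ρ`. The
  -- extension by zero therefore agrees with `ψ ∘ Φ.symm` on the whole target, and no regularity is
  -- lost on the sphere of radius `ρ`.
  set u : E3 → ℝ := fun y => if ‖y‖ ≤ ρ then 0 else ψ (Φ.symm y) with hu
  have hut : ∀ y ∈ Φ.target, u y = ψ (Φ.symm y) := fun y hy => by
    simp only [hu]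
    split_ifs with hle
    · refine (hψ.eq_zero _ (hK fun _ => ?_)).symm
      rwa [Φ.right_inv hy]
    · rfl
  have hu0 : ∀ y, ‖y‖ ≤ ρ → u y = 0 := fun y hy => if_pos hy
  have hnear0 : ∀ y, ‖y‖ < ρ → u =ᶠ[𝓝 y] fun _ => 0 := fun y hy => by
    filter_upwards [continuous_norm.continuousAt.eventually (gt_mem_nhds hy)] with z hz
    exact hu0 z hz.le
  have hmem : ∀ y, ρ ≤ ‖y‖ → y ∈ Φ.target := fun y hy => hst y (by linarith)
  have hnear1 : ∀ y ∈ Φ.target, u =ᶠ[𝓝 y] ψ ∘ Φ.symm := fun y hy => by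
    filter_upwards [Φ.open_target.mem_nhds hy] with z hz using hut z hz
  have hul : LocallyLipschitz u := by
    intro y
    rcases lt_or_ge ‖y‖ ρ with hy | hy
    · obtain ⟨w, hw, hw'⟩ := (hnear0 y hy).exists_mem
      refine ⟨0, w, hw, fun a ha b hb => ?_⟩
      rw [hw' ha, hw' hb]; simp
    · obtain ⟨C, w, hw, hL⟩ := h.exists_lipschitzOnWith hψ.locallyLipschitz (hmem y hy)
      obtain ⟨w', hw', he⟩ := (hnear1 y (hmem y hy)).exists_mem
      refine ⟨C, w ∩ w', inter_mem hw hw', fun a ha b hb => ?_⟩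
      rw [he ha.2, he hb.2]; exact hL ha.1 hb.1
  have hu1 : Tendsto u (Bornology.cobounded E3) (𝓝 1) := by
    refine (hψ.tendsto_one.comp hΦ).congr' ?_
    refine eventually_cobounded_norm.2 ⟨max ρ 1, by positivity, fun y hy => ?_⟩
    exact (hut y (hmem y ((le_max_left _ _).trans hy))).symm
  have hsub : {y | ‖y‖ ≤ ρ ∨ Φ.symm y ∈ K} ⊆ {y | u y ≤ 0} := by
    intro y hy
    rcases le_or_gt ‖y‖ ρ with hyρ | hyρ
    · exact (hu0 y hyρ).le
    · rw [mem_ofPred_eq, hut y (hmem y hyρ.le), hψ.eq_zero _ (hy.resolve_left (not_le.2 hyρ))]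
  have hmain := weighted_energy_ge (U := W) (u := u) (a := a) (M := B) (R := R) (ρ := ρ)
    (s := max t (2 * s)) hW
    (fun y hy => by
      have e := h.lap_eq_zero (hmem y hy.le)
      have hev := hev y (by linarith)
      rw [← e]
      exact Finset.sum_congr rfl fun i _ => (pd_congr (pd_congr hev)).eq_of_nhds)
    (fun y hy => by rw [hWU y (by linarith)]; exact h.pos y (hmem y hy.le))
    (h.tendsto_one.congr' (eventually_cobounded_norm.2 ⟨2 * s, by positivity, fun y hy => (hWU y hy).symm⟩))
    (fun x hx j => by
      rw [(pd_congr (hev x ((le_max_right _ _).trans_lt hx))).eq_of_nhds]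
      exact (hexp x ((le_max_left _ _).trans_lt hx)).2 j)
    hul hu0 hu1 hR (hvol.trans (measure_mono hsub))
  have hle : ∫⁻ y, ENNReal.ofReal (W y ^ 2) * ‖fderiv ℝ u y‖ₑ ^ 2 ≤
      ∫⁻ y in Φ.target, ENNReal.ofReal (U y ^ 2) * ‖fderiv ℝ (ψ ∘ Φ.symm) y‖ₑ ^ 2 := by
    rw [← lintegral_indicator Φ.open_target.measurableSet]
    refine lintegral_mono fun y => ?_
    rcases lt_or_ge ‖y‖ ρ with hy | hy
    · rw [(hnear0 y hy).fderiv_eq, ← ofReal_norm, fderiv_fun_const, Pi.zero_apply, norm_zero]; simp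
    · rw [indicator_of_mem (hmem y hy), hWU y (by linarith), (hnear1 y (hmem y hy)).fderiv_eq]
  have h4 : 3 * unitBallVolume * (R + a) = (R + a) * (4 * Real.pi) := by
    rw [unitBallVolume]; ring
  rw [ENNReal.le_div_iff_mul_le (Or.inl (by simp [Real.pi_pos])) (Or.inl ENNReal.ofReal_ne_top),
    ← ENNReal.ofReal_mul' (by positivity), ← h4]
  exact hmain.trans (hle.trans (h.lintegral_le ψ))

end

/-! ### The upper bound for the volume -/

theorem lintegral_inv_norm_ball {R : ℝ} (hR : 0 < R) :
    ∫⁻ y in Metric.ball (0 : E3) R, ENNReal.ofReal ‖y‖⁻¹ = ENNReal.ofReal (2 * Real.pi * R ^ 2) := by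
  set f : ℝ → ℝ := (Iio R).indicator fun r => r⁻¹
  have hv : (volume : Measure E3).real (Metric.ball 0 1) = unitBallVolume := by
    rw [Measure.real, volume_ball_E3 0 zero_le_one, one_pow, mul_one,
      ENNReal.toReal_ofReal unitBallVolume_pos.le]
  have hpow : ∀ r ∈ Ioi (0 : ℝ), r ^ (Module.finrank ℝ E3 - 1) • f r = (Iio R).indicator (fun r => r) r :=
    fun r hr => by
      have hr : 0 < r := hr
      by_cases h : r ∈ Iio R
      · simp only [f, indicator_of_mem h]; simp; field_simp
      · simp [f, indicator_of_notMem h]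
  have hio : IntegrableOn ((Iio R).indicator (fun r : ℝ => r)) (Ioi 0) := by
    rw [IntegrableOn, integrable_indicator_iff measurableSet_Iio, IntegrableOn,
      Measure.restrict_restrict measurableSet_Iio, inter_comm, Ioi_inter_Iio]
    exact (continuous_id.integrableOn_Icc).mono_set Ioo_subset_Icc_self
  have hint : Integrable (fun y : E3 => f ‖y‖) := by
    rw [integrable_fun_norm_addHaar]
    exact hio.congr_fun (fun r hr => (hpow r hr).symm) measurableSet_Ioi
  have hval : ∫ y : E3, f ‖y‖ = 2 * Real.pi * R ^ 2 := by
    rw [integral_fun_norm_addHaar volume f, setIntegral_congr_fun measurableSet_Ioi hpow,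
      setIntegral_indicator measurableSet_Iio, Ioi_inter_Iio, ← integral_Ioc_eq_integral_Ioo,
      ← intervalIntegral.integral_of_le hR.le, integral_id, hv]
    simp [unitBallVolume]; ring
  rw [← hval, ofReal_integral_eq_lintegral_ofReal hint (Eventually.of_forall fun y => ?_),
    ← lintegral_indicator Metric.isOpen_ball.measurableSet]
  · refine lintegral_congr fun y => ?_
    by_cases h : ‖y‖ < R
    · rw [indicator_of_mem (by simpa using h)]
      simp only [f, indicator_of_mem (show ‖y‖ ∈ Iio R from h)]
    · rw [indicator_of_notMem (by simpa using h)]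
      simp only [f, indicator_of_notMem (show ‖y‖ ∉ Iio R from h), ENNReal.ofReal_zero]
  · by_cases h : ‖y‖ < R
    · simp only [f, indicator_of_mem (show ‖y‖ ∈ Iio R from h), Pi.zero_apply]; positivity
    · simp [f, indicator_of_notMem (show ‖y‖ ∉ Iio R from h)]

/-- Among sets of given volume, the centred ball has the largest integral of `1 / |x|`. -/
theorem lintegral_inv_norm_le {A : Set E3} (hA : MeasurableSet A) {R : ℝ} (hR : 0 < R)
    (hvol : volume A ≤ ENNReal.ofReal (unitBallVolume * R ^ 3)) :
    ∫⁻ y in A, ENNReal.ofReal ‖y‖⁻¹ ≤ ENNReal.ofReal (2 * Real.pi * R ^ 2) := by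
  set B := Metric.ball (0 : E3) R
  have hB : MeasurableSet B := Metric.isOpen_ball.measurableSet
  have hvB : volume B = ENNReal.ofReal (unitBallVolume * R ^ 3) := volume_ball_E3 0 hR.le
  -- Bathtub principle: apart from the common part, `1/|y|` is at most `1/R` on `A \ B` and at least
  -- `1/R` on `B \ A` away from the origin, and the second set has the larger measure.
  have hAB : volume (A \ B) ≤ volume (B \ A) := by
    have h1 := measure_inter_add_sdiff (μ := volume) A hB
    have h2 := measure_inter_add_sdiff (μ := volume) B hA
    rw [inter_comm] at h2
    have hfin : volume (A ∩ B) ≠ ⊤ := measure_ne_top_of_subset inter_subset_right (by rw [hvB]; simp)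
    rw [← hvB, ← h1, ← h2] at hvol
    exact (ENNReal.add_le_add_iff_left hfin).1 hvol
  rw [← lintegral_inter_add_sdiff _ A hB, ← lintegral_inv_norm_ball hR, ← lintegral_inter_add_sdiff _ B hA,
    inter_comm B A]
  refine add_le_add_right ?_ _
  calc ∫⁻ y in A \ B, ENNReal.ofReal ‖y‖⁻¹ ≤ ∫⁻ _ in A \ B, ENNReal.ofReal R⁻¹ := by
        refine setLIntegral_mono' (hA.diff hB) fun y hy => ENNReal.ofReal_le_ofReal ?_
        have : R ≤ ‖y‖ := by simpa [B] using hy.2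
        gcongr
    _ = ENNReal.ofReal R⁻¹ * volume (A \ B) := by rw [setLIntegral_const]
    _ ≤ ENNReal.ofReal R⁻¹ * volume (B \ A) := by gcongr
    _ = ∫⁻ _ in B \ A, ENNReal.ofReal R⁻¹ := by rw [setLIntegral_const]
    _ ≤ _ := by
        refine lintegral_mono_ae ?_
        have h0 : ∀ᵐ y : E3 ∂(volume.restrict (B \ A)), y ≠ 0 :=
          ae_restrict_of_ae (Measure.ae_ne volume 0)
        filter_upwards [ae_restrict_mem (hB.diff hA), h0] with y hy hy0
        refine ENNReal.ofReal_le_ofReal ?_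
        have h1 : ‖y‖ < R := by simpa [B] using hy.1
        have h2 := norm_pos_iff.2 hy0
        gcongr

/-- First-order expansion of `(1 + at + Mt²)⁶` at `t = 0`, used for `t = |y|⁻¹`. -/
theorem HasExpansion.eventually_pow_six_le {U : E3 → ℝ} {a : ℝ} (h : HasExpansion U a) {ε : ℝ} (hε : 0 < ε) :
    ∃ L : ℝ, 0 < L ∧ ∀ y, L ≤ ‖y‖ → 0 < U y → U y ^ 6 ≤ 1 + (6 * a + ε) * ‖y‖⁻¹ := by
  obtain ⟨s, M, hs, hM, hexp⟩ := h
  have hd : HasDerivAt (fun t : ℝ => (1 + a * t + M * t ^ 2) ^ 6) (6 * a) 0 := by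
    have h1 : HasDerivAt (fun t : ℝ => 1 + a * t + M * t ^ 2) a 0 := by
      have h2 := (((hasDerivAt_id (0 : ℝ)).const_mul a).const_add 1).fun_add
        (((hasDerivAt_id (0 : ℝ)).fun_pow 2).const_mul M)
      simpa using h2
    simpa using h1.fun_pow 6
  have ho := hd.isLittleO.def hε
  obtain ⟨δ, hδ, hδ'⟩ := Metric.eventually_nhds_iff.1 ho
  refine ⟨s + 1 + 2 / δ, by positivity, fun y hy hpos => ?_⟩
  have hy0 : 0 < ‖y‖ := lt_of_lt_of_le (by positivity) hy
  have hys : s < ‖y‖ := by have : 0 < 2 / δ := by positivity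
                           linarith
  have ht : ‖y‖⁻¹ < δ := by
    rw [inv_lt_comm₀ hy0 hδ]
    have : δ⁻¹ ≤ 2 / δ := by rw [div_eq_mul_inv]; have := inv_pos.2 hδ; linarith
    linarith
  have h1 := hδ' (y := ‖y‖⁻¹) (by rw [Real.dist_eq, sub_zero, abs_of_pos (inv_pos.2 hy0)]; exact ht)
  simp only [sub_zero, mul_zero, add_zero, ne_eq, OfNat.ofNat_ne_zero, not_false_eq_true, zero_pow,
    one_pow, smul_eq_mul, Real.norm_eq_abs, abs_of_pos (inv_pos.2 hy0)] at h1
  have h2 : U y ≤ 1 + a * ‖y‖⁻¹ + M * ‖y‖⁻¹ ^ 2 := by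
    have := (abs_le.1 (hexp y hys).1).2
    rw [div_eq_mul_inv, div_eq_mul_inv, ← inv_pow] at this
    linarith
  have h3 := pow_le_pow_left₀ hpos.le h2 6
  have h4 := (abs_le.1 h1).2
  linarith

section

variable {H : Type*} [TopologicalSpace H] {I : ModelWithCorners ℝ E3 H}
  {M : Type*} [TopologicalSpace M] [ChartedSpace H M] [IsManifold I ∞ M]
  {Φ : OpenPartialHomeomorph M E3} {g : SmoothMetric I M} {U : E3 → ℝ}
  [MeasurableSpace M] [BorelSpace M] [SecondCountableTopology M] [Nonempty M]

/-- The inner region contributes a fixed constant, which disappears after division by the squared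
capacity. Outside it the density is `U⁶`, and its `1/|y|` term is bounded by rearrangement; `0 ≤ a`
keeps the coefficient nonnegative. -/
theorem IsHarmonicChart.volume_le (h : IsHarmonicChart g Φ U) {a ε : ℝ} (ha : HasExpansion U a)
    (hε : 0 < ε) (ha0 : 0 ≤ a) :
    ∃ ρ₀ : ℝ, 0 < ρ₀ ∧ ∀ ρ, ρ₀ ≤ ρ → ∀ (K : Set M) (R : ℝ), MeasurableSet K → 0 < R →
      volume {y | ‖y‖ ≤ ρ ∨ Φ.symm y ∈ K} ≤ ENNReal.ofReal (unitBallVolume * R ^ 3) →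
      riemannianVolume g K ≤ riemannianVolume g {x | x ∈ Φ.source → ‖Φ x‖ ≤ ρ} +
        ENNReal.ofReal (unitBallVolume * R ^ 3 + (6 * a + ε) * (2 * Real.pi * R ^ 2)) := by
  obtain ⟨s, hs, hst⟩ := h.exists_exterior_subset
  obtain ⟨L, hL, hL'⟩ := ha.eventually_pow_six_le hε
  refine ⟨max s L, by positivity, fun ρ hρ K R hK hR hvol => ?_⟩
  set A := (Φ.target ∩ Φ.symm ⁻¹' K) ∩ {y | ρ < ‖y‖} with hA
  have hAm : MeasurableSet A := (measurableSet_inter_preimage_of_continuousOn Φ.continuousOn_symm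
    Φ.open_target.measurableSet hK).inter (measurableSet_lt measurable_const measurable_norm)
  have hsub : K ⊆ {x | x ∈ Φ.source → ‖Φ x‖ ≤ ρ} ∪ (Φ.source ∩ Φ ⁻¹' A) := fun x hx => by
    by_cases hxr : x ∈ Φ.source ∧ ρ < ‖Φ x‖
    · refine Or.inr ⟨hxr.1, ⟨Φ.map_source hxr.1, ?_⟩, hxr.2⟩
      rwa [mem_preimage, Φ.left_inv hxr.1]
    · exact Or.inl fun hxs => not_lt.1 fun hlt => hxr ⟨hxs, hlt⟩
  refine (measure_mono hsub).trans ((measure_union_le _ _).trans (add_le_add_right ?_ _))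
  rw [h.volume_preimage hAm fun y hy => hy.1.1]
  have hAv : volume A ≤ ENNReal.ofReal (unitBallVolume * R ^ 3) :=
    (measure_mono fun y hy => Or.inr hy.1.2).trans hvol
  have hω := unitBallVolume_pos
  calc ∫⁻ y in A, ENNReal.ofReal (U y ^ 6)
      ≤ ∫⁻ y in A, (1 + ENNReal.ofReal (6 * a + ε) * ENNReal.ofReal ‖y‖⁻¹) := by
        refine setLIntegral_mono' hAm fun y hy => ?_
        rw [← ENNReal.ofReal_mul (by positivity), ← ENNReal.ofReal_one,
          ← ENNReal.ofReal_add zero_le_one (by positivity)]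
        refine ENNReal.ofReal_le_ofReal (hL' y ?_ (h.pos y hy.1.1))
        exact ((le_max_right _ _).trans hρ).trans (le_of_lt hy.2)
    _ = volume A + ENNReal.ofReal (6 * a + ε) * ∫⁻ y in A, ENNReal.ofReal ‖y‖⁻¹ := by
        rw [lintegral_add_left measurable_const, lintegral_const_mul _ (by fun_prop), setLIntegral_const, one_mul]
    _ ≤ ENNReal.ofReal (unitBallVolume * R ^ 3) +
        ENNReal.ofReal (6 * a + ε) * ENNReal.ofReal (2 * Real.pi * R ^ 2) := by
        gcongr
        exact lintegral_inv_norm_le hAm hR hAv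
    _ = _ := by
        rw [← ENNReal.ofReal_mul (by positivity), ← ENNReal.ofReal_add (by positivity) (by positivity)]

end

/-! ### From the two bounds to the isocapacitary mass -/

/-- The elementary estimate behind the bound on the deficit. -/
theorem deficit_estimate {V V0 κ R a ε N : ℝ} (hN : 0 < N) (hNR : N ≤ R) (ha : 0 ≤ a) (hε : 0 ≤ ε)
    (hV0 : 0 ≤ V0) (hκ : R + a ≤ κ)
    (hV : V ≤ V0 + (unitBallVolume * R ^ 3 + (6 * a + ε) * (2 * Real.pi * R ^ 2))) :
    1 / (4 * Real.pi * κ ^ 2) * (V - 4 * Real.pi / 3 * κ ^ 3) ≤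
      2 * a + ε / 2 + a ^ 2 / N + V0 / (4 * Real.pi * N ^ 2) := by
  have hR : 0 < R := hN.trans_le hNR
  have hκ0 : 0 < κ := by linarith
  have hNκ : N ≤ κ := by linarith
  have hπ := Real.pi_pos
  -- `R` is replaced by `κ - a` in the cubic term and by `κ` in the quadratic one. The cube
  -- contributes `-4πaκ²` and the quadratic term `12πaκ²`; the sum `8πaκ²` is `2a` after
  -- normalisation.
  have h1 : V ≤ V0 + (unitBallVolume * (κ - a) ^ 3 + (6 * a + ε) * (2 * Real.pi * κ ^ 2)) := by
    refine hV.trans ?_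
    have hω := unitBallVolume_pos
    have e1 : R ≤ κ - a := by linarith
    have e2 : R ≤ κ := by linarith
    gcongr
  have h2 : a ^ 2 / κ ≤ a ^ 2 / N := by gcongr
  have h3 : V0 / (4 * Real.pi * κ ^ 2) ≤ V0 / (4 * Real.pi * N ^ 2) := by gcongr
  have h4 : 1 / (4 * Real.pi * κ ^ 2) * (V - 4 * Real.pi / 3 * κ ^ 3) ≤
      1 / (4 * Real.pi * κ ^ 2) * (V0 + (8 * Real.pi * a * κ ^ 2 + 2 * Real.pi * ε * κ ^ 2 +
        4 * Real.pi * a ^ 2 * κ)) := by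
    refine mul_le_mul_of_nonneg_left ?_ (by positivity)
    have : unitBallVolume * (κ - a) ^ 3 = 4 * Real.pi / 3 * κ ^ 3 - 4 * Real.pi * a * κ ^ 2 +
        4 * Real.pi * a ^ 2 * κ - 4 * Real.pi / 3 * a ^ 3 := by rw [unitBallVolume]; ring
    have h5 : 0 ≤ 4 * Real.pi / 3 * a ^ 3 := by positivity
    linarith
  have h6 : 1 / (4 * Real.pi * κ ^ 2) * (V0 + (8 * Real.pi * a * κ ^ 2 + 2 * Real.pi * ε * κ ^ 2 +
        4 * Real.pi * a ^ 2 * κ)) = 2 * a + ε / 2 + a ^ 2 / κ + V0 / (4 * Real.pi * κ ^ 2) := by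
    field_simp; ring
  linarith

theorem deficit_nonpos_of_volume {κ : ℝ} (hκ : 0 ≤ κ) :
    1 / (4 * Real.pi * κ ^ 2) * (0 - 4 * Real.pi / 3 * κ ^ 3) ≤ 0 := by
  have := Real.pi_pos
  exact mul_nonpos_of_nonneg_of_nonpos (by positivity) (by rw [zero_sub, neg_nonpos]; positivity)

section

variable {H : Type*} [TopologicalSpace H] {I : ModelWithCorners ℝ E3 H}
  {M : Type*} [TopologicalSpace M] [ChartedSpace H M] [IsManifold I ∞ M]
  {Φ : OpenPartialHomeomorph M E3} {g : SmoothMetric I M} {U : E3 → ℝ}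
  [MeasurableSpace M] [SecondCountableTopology M] [Nonempty M]

/-- With no points at infinity the limit condition is vacuous, so the zero function is a competitor.
-/
theorem capacity_eq_zero_of_compactSpace [CompactSpace M] (g : SmoothMetric I M) (K : Set M) :
    capacity g K = 0 := by
  have hc : IsCompetitor I K (fun _ : M => (0 : ℝ)) := by
    refine ⟨fun p => ⟨0, univ, univ_mem, ?_⟩, fun _ _ => rfl, ?_⟩
    · exact (LipschitzWith.const (0 : ℝ)).lipschitzOnWith
    · rw [cocompact_eq_bot]; exact tendsto_bot
  refine le_antisymm ((iInf₂_le _ hc).trans ?_) zero_le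
  have : ∀ x, gradSq g (fun _ : M => (0 : ℝ)) x = 0 := fun x => by
    simp [gradSq, diffAt, mfderiv_const]
    exact fun _ _ => rfl
  simp [this]

theorem massCV_le_of_eventually {g : SmoothMetric I M} {m : ℝ}
    (h : ∀ K : ℕ → Set M, IsExhaustion K → ∀ ε > 0, ∀ᶠ j in atTop, deficit g (K j) ≤ m + ε) :
    massCV g ≤ (m : EReal) := by
  refine iSup₂_le fun K hK => ?_
  refine EReal.le_of_forall_lt_iff_le.1 fun z hz => ?_
  have hz' : m < z := EReal.coe_lt_coe_iff.1 hz
  refine limsup_le_of_le (by isBoundedDefault) ?_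
  filter_upwards [h K hK (z - m) (sub_pos.2 hz')] with j hj
  exact EReal.coe_le_coe_iff.2 (by linarith)

/-- Zero capacity makes every deficit `0`, by the convention `1 / 0 = 0`. -/
theorem massCV_le_of_compactSpace [CompactSpace M] (g : SmoothMetric I M) {m : ℝ} (hm : 0 ≤ m) :
    massCV g ≤ (m : EReal) := by
  refine massCV_le_of_eventually fun K _ ε hε => Eventually.of_forall fun j => ?_
  rw [deficit, capacity_eq_zero_of_compactSpace]
  simp; positivity

variable [BorelSpace M]

theorem IsHarmonicChart.massCV_le [T2Space M] (h : IsHarmonicChart g Φ U)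
    (hΦ : Tendsto Φ.symm (Bornology.cobounded E3) (cocompact M)) {a : ℝ} (ha : HasExpansion U a)
    (ha0 : 0 ≤ a) : massCV g ≤ ((2 * a : ℝ) : EReal) := by
  refine massCV_le_of_eventually fun K hK ε hε => ?_
  have hω := unitBallVolume_pos
  have hπ := Real.pi_pos
  obtain ⟨ρ₁, hρ₁, hmem, hcap⟩ := h.capacity_ge hΦ ha
  obtain ⟨ρ₂, hρ₂, hvol⟩ := h.volume_le ha hε ha0
  set ρ := max ρ₁ ρ₂
  have hρ : 0 < ρ := lt_max_of_lt_left hρ₁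
  set B : ℝ → Set M := fun r => {x | x ∈ Φ.source → ‖Φ x‖ ≤ r}
  set V0 := (riemannianVolume g (B ρ)).toReal
  -- the comparison radius
  obtain ⟨N, hNρ, hN⟩ : ∃ N : ℝ, ρ ≤ N ∧ a ^ 2 / N + V0 / (4 * Real.pi * N ^ 2) ≤ ε / 2 := by
    have hlim : Tendsto (fun N : ℝ => a ^ 2 / N + V0 / (4 * Real.pi * N ^ 2)) atTop (𝓝 (0 + 0)) :=
      (tendsto_const_nhds.div_atTop tendsto_id).add (tendsto_const_nhds.div_atTop
        ((tendsto_pow_atTop two_ne_zero).const_mul_atTop (by positivity)))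
    rw [add_zero] at hlim
    obtain ⟨N, h1, h2⟩ := ((eventually_ge_atTop ρ).and
      (hlim.eventually (gt_mem_nhds (half_pos hε)))).exists
    exact ⟨N, h1, h2.le⟩
  have hN0 : 0 < N := hρ.trans_le hNρ
  filter_upwards [hK.absorbs (B N) (h.isCompact_region N)] with j hj
  have hBN : B ρ ⊆ B N := fun x hx hxs => (hx hxs).trans hNρ
  set κ := (capacity g (K j)).toReal with hκ
  -- `toReal` sends infinity to `0`: infinite volume makes the deficit nonpositive, infinite
  -- capacity makes it zero.
  by_cases hV0 : riemannianVolume g (B ρ) = ⊤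
  · have : riemannianVolume g (K j) = ⊤ := top_le_iff.1 (hV0 ▸ measure_mono (hBN.trans hj))
    rw [deficit, this, ENNReal.toReal_top]
    exact (deficit_nonpos_of_volume ENNReal.toReal_nonneg).trans (by positivity)
  by_cases hc : capacity g (K j) = ⊤
  · rw [deficit, hc]; simp; positivity
  -- the volume radius
  have hfin : volume {y | ‖y‖ ≤ ρ ∨ Φ.symm y ∈ K j} ≠ ⊤ := by
    obtain ⟨L, hL, hL'⟩ := eventually_cobounded_norm.1 (hΦ (hK.isCompact j).compl_mem_cocompact)
    refine ((measure_mono fun y hy => ?_).trans_lt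
      (measure_closedBall_lt_top (μ := volume) (x := (0 : E3)) (r := max L ρ))).ne
    rw [mem_closedBall_zero_iff]
    rcases hy with hy | hy
    · exact hy.trans (le_max_right _ _)
    · by_contra hlt
      exact hL' y ((le_max_left _ _).trans (not_le.1 hlt).le) hy
  obtain ⟨R, hR0, hR⟩ := exists_volumeRadius hfin
  have hNR : N ≤ R := by
    have hsub : Metric.ball (0 : E3) N ⊆ {y | ‖y‖ ≤ ρ ∨ Φ.symm y ∈ K j} := fun y hy => by
      have hy : ‖y‖ < N := by simpa using hy
      by_cases hyρ : ‖y‖ ≤ ρ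
      · exact Or.inl hyρ
      · refine Or.inr (hj fun _ => ?_)
        rw [Φ.right_inv (hmem y ((le_max_left _ _).trans (not_le.1 hyρ).le))]
        exact hy.le
    have := measure_mono (μ := volume) hsub
    rw [hR, volume_ball_E3 0 hN0.le, ENNReal.ofReal_le_ofReal_iff (by positivity)] at this
    exact le_of_pow_le_pow_left₀ three_ne_zero hR0 (le_of_mul_le_mul_left this hω)
  have hRpos : 0 < R := hN0.trans_le hNR
  have h1 := hcap ρ (le_max_left _ _) (K j) R hRpos (hBN.trans hj) hR.ge
  rw [ENNReal.ofReal_le_iff_le_toReal hc] at h1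
  have h2 := hvol ρ (le_max_right _ _) (K j) R (hK.isCompact j).measurableSet hRpos hR.le
  have h3 : (riemannianVolume g (K j)).toReal ≤
      V0 + (unitBallVolume * R ^ 3 + (6 * a + ε) * (2 * Real.pi * R ^ 2)) := by
    have h4 := ENNReal.toReal_mono (ENNReal.add_ne_top.2 ⟨hV0, ENNReal.ofReal_ne_top⟩) h2
    rwa [ENNReal.toReal_add hV0 ENNReal.ofReal_ne_top, ENNReal.toReal_ofReal (by positivity)] at h4
  -- One `ε/2` comes from the volume bound; the other covers the two terms made small by the choice
  -- of `N`.
  refine (deficit_estimate hN0 hNR ha0 hε.le ENNReal.toReal_nonneg h1 h3).trans ?_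
  linarith

end

/-! ### Averaging the flux over radii -/

theorem integral_polar {F : E3 → ℝ} (hF : Integrable F) :
    ∫ y, F y = ∫ r in Ioi (0 : ℝ), ∫ θ : Metric.sphere (0 : E3) 1, r ^ 2 * F (r • (θ : E3))
      ∂((volume : Measure E3).toSphere) := by
  have hmp := (volume : Measure E3).measurePreserving_homeomorphUnitSphereProd
  have hemb := (homeomorphUnitSphereProd E3).measurableEmbedding
  set G : Metric.sphere (0 : E3) 1 × Ioi (0 : ℝ) → ℝ := fun p => F ((p.2 : ℝ) • (p.1 : E3)) with hG
  have hGF : ∀ x : ({0}ᶜ : Set E3), G (homeomorphUnitSphereProd E3 x) = F x := fun x => by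
    simp only [hG]
    rw [← homeomorphUnitSphereProd_symm_apply_coe, Homeomorph.symm_apply_apply]
  have hdim : Module.finrank ℝ E3 - 1 = 2 := by simp
  have hint : Integrable G ((volume : Measure E3).toSphere.prod (Measure.volumeIoiPow 2)) := by
    rw [hdim] at hmp
    rw [← hmp.integrable_comp_emb hemb]
    have h1 : IntegrableOn F {0}ᶜ := hF.integrableOn
    rw [integrableOn_iff_comap_subtypeVal (measurableSet_singleton (0 : E3)).compl] at h1
    refine h1.congr (Eventually.of_forall fun x => (hGF x).symm)
  calc ∫ y, F y = ∫ x : ({(0)}ᶜ : Set E3), F x ∂((volume : Measure E3).comap (↑)) := by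
        rw [integral_subtype_comap (measurableSet_singleton _).compl F, restrict_compl_singleton]
    _ = ∫ p, G p ∂((volume : Measure E3).toSphere.prod (Measure.volumeIoiPow 2)) := by
        rw [hdim] at hmp
        rw [← hmp.integral_comp hemb]
        exact integral_congr_ae (Eventually.of_forall fun x => (hGF x).symm)
    _ = ∫ r : Ioi (0 : ℝ), ∫ θ, G (θ, r) ∂((volume : Measure E3).toSphere) ∂(Measure.volumeIoiPow 2) :=
        integral_prod_symm _ hint
    _ = _ := by
        simp only [Measure.volumeIoiPow, ENNReal.ofReal, hG]
        rw [integral_withDensity_eq_integral_smul, integral_subtype_comap measurableSet_Ioi fun a : ℝ =>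
          Real.toNNReal (a ^ 2) • ∫ θ : Metric.sphere (0 : E3) 1, F (a • (θ : E3)) ∂((volume : Measure E3).toSphere)]
        · refine setIntegral_congr_fun measurableSet_Ioi fun r hr => ?_
          rw [NNReal.smul_def, Real.coe_toNNReal _ (pow_nonneg (le_of_lt hr) _), smul_eq_mul, integral_const_mul]
        · exact (measurable_subtype_coe.pow_const _).real_toNNReal

/-- The average of flux integrals against the gradient of a radial cutoff. -/
theorem tendsto_flux_average {q : Fin 3 → E3 → ℝ} {l C L : ℝ} (hq : ∀ j, Measurable (q j))
    (hb : ∀ j y, L ≤ ‖y‖ → |q j y| ≤ C)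
    (hl : Tendsto (fun r : ℝ => ∫ θ : Metric.sphere (0 : E3) 1, r ^ 2 * ∑ j, q j (r • (θ : E3)) * (θ : E3) j
      ∂((volume : Measure E3).toSphere)) atTop (𝓝 l)) :
    Tendsto (fun ρ : ℝ => ∫ y, ∑ j, q j y * pd j (cutAt ρ) y) atTop (𝓝 (-l)) := by
  set φ : ℝ → ℝ := fun r => ∫ θ : Metric.sphere (0 : E3) 1, r ^ 2 * ∑ j, q j (r • (θ : E3)) * (θ : E3) j
      ∂((volume : Measure E3).toSphere) with hφ
  set k : ℝ → ℝ := fun t => 2 * t * deriv cutProfile (t ^ 2) with hk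
  have hC : 0 ≤ |C| := abs_nonneg C
  obtain ⟨T, hT0, hT1, -, -⟩ := exists_bound_cutBump
  have hk0 : ∀ t : ℝ, 0 < t → t < 1 → k t = 0 := fun t ht ht1 => by
    have : cutProfile =ᶠ[𝓝 (t ^ 2)] fun _ => 1 := by
      filter_upwards [gt_mem_nhds (show t ^ 2 < 1 by nlinarith)] with x hx using cutProfile_eq_one hx.le
    simp [hk, this.deriv_eq]
  have hφm : Measurable φ := by
    have h1 : Measurable fun p : ℝ × Metric.sphere (0 : E3) 1 =>
        p.1 ^ 2 * ∑ j, q j (p.1 • (p.2 : E3)) * (p.2 : E3) j := by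
      have h2 : Measurable fun p : ℝ × Metric.sphere (0 : E3) 1 => p.1 • (p.2 : E3) := by fun_prop
      refine (measurable_fst.pow_const 2).mul (Finset.measurable_fun_sum _ fun j _ => ?_)
      exact ((hq j).comp h2).mul (by fun_prop)
    exact (h1.stronglyMeasurable.integral_prod_right').measurable
  -- In polar coordinates, with `r = ρt`, the volume integral averages the fluxes `φ (ρt)` with a
  -- weight `k` of total mass `-1`. As `k` vanishes on `(0, 1)`, only radii of at least `ρ` matter.
  have heq : ∀ ρ : ℝ, max L 1 ≤ ρ → ∫ y, ∑ j, q j y * pd j (cutAt ρ) y = ∫ t in Ioi (0 : ℝ), k t * φ (ρ * t) := by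
    intro ρ hρ
    have hρ1 : 1 ≤ ρ := (le_max_right _ _).trans hρ
    have hρ0 : 0 < ρ := by linarith
    have hz : ∀ y, ‖y‖ < ρ ∨ 2 * ρ < ‖y‖ → ∀ j, pd j (cutAt ρ) y = 0 := fun y hy j =>
      (pd_cutAt_eq_zero hρ0 hy).eq_of_nhds
    have hint : Integrable fun y => ∑ j, q j y * pd j (cutAt ρ) y := by
      refine integrable_finsetSum _ fun j _ => ?_
      refine integrable_of_abs_le_on_closedBall (L := 2 * ρ) (C := |C| * (ρ⁻¹ * T))
        ((hq j).mul (measurable_pd j _)) (fun y hy => by simp [hz y (Or.inr hy)]) fun y _ => ?_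
      by_cases hy : ‖y‖ < ρ
      · rw [hz y (Or.inl hy), mul_zero, abs_zero]; positivity
      · have h1 := (hb j y ((le_max_left _ _).trans (hρ.trans (not_lt.1 hy)))).trans (le_abs_self C)
        rw [abs_mul, pd_cutAt, abs_mul, abs_of_pos (inv_pos.2 hρ0)]
        have h2 := hT1 j (ρ⁻¹ • y)
        gcongr
    rw [integral_polar hint]
    have hin : ∀ r ∈ Ioi (0 : ℝ), (∫ θ : Metric.sphere (0 : E3) 1, r ^ 2 * ∑ j, q j (r • (θ : E3)) *
        pd j (cutAt ρ) (r • (θ : E3)) ∂((volume : Measure E3).toSphere)) = ρ⁻¹ • (k (ρ⁻¹ * r) * φ (ρ * (ρ⁻¹ * r))) := by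
      intro r hr
      have hr : 0 < r := hr
      rw [mul_inv_cancel_left₀ hρ0.ne', hφ, smul_eq_mul, ← mul_assoc, ← integral_const_mul]
      refine integral_congr_ae (Eventually.of_forall fun θ => ?_)
      have hθ : ‖(θ : E3)‖ = 1 := by simp
      have hp : ∀ j, pd j (cutAt ρ) (r • (θ : E3)) = ρ⁻¹ * k (ρ⁻¹ * r) * (θ : E3) j := fun j => by
        rw [pd_cutAt, pd_cutBump, smul_smul, norm_smul, hθ, mul_one, Real.norm_eq_abs, sq_abs]
        simp only [hk, PiLp.smul_apply, smul_eq_mul]; ring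
      simp only [hp, Finset.mul_sum]
      exact Finset.sum_congr rfl fun j _ => by ring
    rw [setIntegral_congr_fun measurableSet_Ioi hin, integral_smul,
      integral_comp_mul_left_Ioi' (fun t => k t * φ (ρ * t)) 0 (inv_pos.2 hρ0), mul_zero]
  have hval : ∫ t in Ioi (0 : ℝ), k t * l = -l := by
    rw [integral_mul_const, integral_deriv_cutProfile_sq]; ring
  rw [← hval]
  refine Tendsto.congr' (f₁ := fun ρ : ℝ => ∫ t in Ioi (0 : ℝ), k t * φ (ρ * t)) ?_ ?_
  · filter_upwards [eventually_ge_atTop (max L 1)] with ρ hρ using (heq ρ hρ).symm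
  obtain ⟨R0, hR0⟩ := eventually_atTop.1 ((Metric.tendsto_nhds.1 hl) 1 one_pos)
  refine tendsto_integral_filter_of_dominated_convergence (fun t => |k t| * (|l| + 1)) ?_ ?_ ?_ ?_
  · refine Eventually.of_forall fun ρ => ?_
    have hkm : Measurable k := by
      simp only [hk]
      have := (measurable_deriv cutProfile).comp ((measurable_id (α := ℝ)).pow_const 2)
      exact (measurable_id.const_mul 2).mul this
    exact (hkm.mul (hφm.comp (measurable_id.const_mul ρ))).aestronglyMeasurable
  · filter_upwards [eventually_ge_atTop (max R0 1)] with ρ hρ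
    filter_upwards [ae_restrict_mem measurableSet_Ioi] with t ht
    have ht : 0 < t := ht
    rw [Real.norm_eq_abs, abs_mul]
    rcases lt_or_ge t 1 with h1 | h1
    · rw [hk0 t ht h1]; simp
    · have h2 : R0 ≤ ρ * t := by
        have := le_max_left R0 1
        have := le_max_right R0 1
        nlinarith
      have h3 := hR0 _ h2
      rw [Real.dist_eq] at h3
      have h4 : |φ (ρ * t)| ≤ |l| + 1 := by
        have := abs_sub_abs_le_abs_sub (φ (ρ * t)) l
        simp only [hφ] at this ⊢; linarith
      gcongr
  · exact (integrable_deriv_cutProfile_sq.abs.mul_const _).integrableOn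
  · filter_upwards [ae_restrict_mem measurableSet_Ioi] with t ht
    exact (hl.comp (tendsto_id.atTop_mul_const ht)).const_mul (k t)

/-! ### The averaged flux as a pairing with a divergence-free field -/

theorem pd_pd_eq {f : E3 → ℝ} {x : E3} (hf : ContDiffAt ℝ 2 f x) (i j : Fin 3) :
    pd i (pd j f) x = fderiv ℝ (fderiv ℝ f) x (stdVec i) (stdVec j) := by
  have hd : DifferentiableAt ℝ (fderiv ℝ f) x :=
    (hf.fderiv_right (m := 1) (by norm_num)).differentiableAt (by norm_num)
  change fderiv ℝ (fun y => fderiv ℝ f y (stdVec j)) x (stdVec i) = _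
  rw [fderiv_clm_apply hd (differentiableAt_const _)]
  simp

theorem pd_comm {f : E3 → ℝ} {x : E3} (hf : ContDiffAt ℝ 2 f x) (i j : Fin 3) :
    pd i (pd j f) x = pd j (pd i f) x := by
  rw [pd_pd_eq hf, pd_pd_eq hf]
  exact (hf.isSymmSndFDerivAt (by simp)).eq _ _

/-- The matrix field `δ_ij Δχ - ∂_i ∂_j χ` of a cutoff function. -/
noncomputable def cutHess (ρ : ℝ) (i j : Fin 3) (y : E3) : ℝ :=
  (if i = j then lap (cutAt ρ) y else 0) - pd i (pd j (cutAt ρ)) y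

theorem contDiff_pd_cutAt (ρ : ℝ) (j : Fin 3) (n : ℕ) : ContDiff ℝ n (pd j (cutAt ρ)) :=
  contDiff_pd (contDiff_cutAt ρ (n := (n + 1 : ℕ))) (by norm_cast)

theorem contDiff_pd_pd_cutAt (ρ : ℝ) (i j : Fin 3) (n : ℕ) : ContDiff ℝ n (pd i (pd j (cutAt ρ))) :=
  contDiff_pd (contDiff_pd_cutAt ρ j (n + 1)) (by norm_cast)

theorem contDiff_lap_cutAt (ρ : ℝ) (n : ℕ) : ContDiff ℝ n (lap (cutAt ρ)) :=
  ContDiff.sum fun i _ => contDiff_pd_pd_cutAt ρ i i n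

theorem contDiff_cutHess (ρ : ℝ) (i j : Fin 3) (n : ℕ) : ContDiff ℝ n (cutHess ρ i j) := by
  unfold cutHess
  refine ContDiff.sub ?_ (contDiff_pd_pd_cutAt ρ i j n)
  split_ifs
  · exact contDiff_lap_cutAt ρ n
  · exact contDiff_const

theorem pd_pd_cutAt_eq_zero {ρ : ℝ} (hρ : 0 < ρ) {y : E3} (hy : ‖y‖ < ρ ∨ 2 * ρ < ‖y‖) (i j : Fin 3) :
    pd i (pd j (cutAt ρ)) y = 0 := by
  rw [(pd_congr (pd_cutAt_eq_zero hρ hy)).eq_of_nhds]; simp [pd]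

theorem cutHess_eq_zero {ρ : ℝ} (hρ : 0 < ρ) {y : E3} (hy : ‖y‖ < ρ ∨ 2 * ρ < ‖y‖) (i j : Fin 3) :
    cutHess ρ i j y = 0 := by
  simp [cutHess, lap_cutAt_eq_zero hρ hy, pd_pd_cutAt_eq_zero hρ hy]

theorem tsupport_subset_of_eq_zero {f : E3 → ℝ} {ρ : ℝ} (h : ∀ y, ‖y‖ < ρ → f y = 0) {y : E3}
    (hy : y ∈ tsupport f) : ρ ≤ ‖y‖ := by
  have hcl : IsClosed {y : E3 | ρ ≤ ‖y‖} := isClosed_le continuous_const continuous_norm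
  refine closure_minimal (fun z hz => ?_) hcl hy
  by_contra hlt
  exact hz (h z (not_le.1 hlt))

theorem hasCompactSupport_cutHess {ρ : ℝ} (hρ : 0 < ρ) (i j : Fin 3) : HasCompactSupport (cutHess ρ i j) :=
  HasCompactSupport.intro (isCompact_closedBall (0 : E3) (2 * ρ)) fun x hx =>
    cutHess_eq_zero hρ (Or.inr (by simpa using hx)) i j

theorem norm_of_mem_tsupport_cutHess {ρ : ℝ} (hρ : 0 < ρ) {i j : Fin 3} {y : E3}
    (hy : y ∈ tsupport (cutHess ρ i j)) : ρ ≤ ‖y‖ :=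
  tsupport_subset_of_eq_zero (fun _ hz => cutHess_eq_zero hρ (Or.inl hz) i j) hy

theorem norm_of_mem_tsupport_pd_cutAt {ρ : ℝ} (hρ : 0 < ρ) {j : Fin 3} {y : E3}
    (hy : y ∈ tsupport (pd j (cutAt ρ))) : ρ ≤ ‖y‖ :=
  tsupport_subset_of_eq_zero (fun _ hz => (pd_cutAt_eq_zero hρ (Or.inl hz)).eq_of_nhds) hy

theorem norm_of_mem_tsupport_pd_pd_cutAt {ρ : ℝ} (hρ : 0 < ρ) {i j : Fin 3} {y : E3}
    (hy : y ∈ tsupport (pd i (pd j (cutAt ρ)))) : ρ ≤ ‖y‖ :=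
  norm_of_mem_tsupport_pd_cutAt hρ (tsupport_pd_subset _ _ hy)

/-- Integration by parts moves the remaining derivative from `σ` to the cutoff. The averaged flux
then depends on the values of `σ` alone, and errors of size `o(1/|y|)` are negligible without
control of their derivatives. -/
theorem integral_flux_eq {σ : Fin 3 → Fin 3 → E3 → ℝ} {ρ : ℝ} (hρ : 0 < ρ)
    (hσ : ∀ i j y, ρ ≤ ‖y‖ → ContDiffAt ℝ 1 (σ i j) y) :
    ∫ y, ∑ j, (∑ i, (pd i (σ i j) y - pd j (σ i i) y)) * pd j (cutAt ρ) y =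
      ∫ y, ∑ i, ∑ j, σ i j y * cutHess ρ i j y := by
  have hχs := hasCompactSupport_cutAt hρ
  have hps : ∀ j, HasCompactSupport (pd j (cutAt ρ)) := fun j => hasCompactSupport_pd hχs
  have ibp : ∀ (u : E3 → ℝ) (i j : Fin 3), (∀ y, ρ ≤ ‖y‖ → ContDiffAt ℝ 1 u y) →
      ∫ y, pd i u y * pd j (cutAt ρ) y = -∫ y, u y * pd i (pd j (cutAt ρ)) y := fun u i j hu => by
    rw [integral_mul_pd (contDiff_pd_cutAt ρ j 1) (hps j)
      (fun y hy => hu y (norm_of_mem_tsupport_pd_cutAt hρ hy)), neg_neg]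
  have int1 : ∀ (u : E3 → ℝ) (i j : Fin 3), (∀ y, ρ ≤ ‖y‖ → ContDiffAt ℝ 1 u y) →
      Integrable fun y => pd i u y * pd j (cutAt ρ) y := fun u i j hu =>
    integrable_mul_of_tsupport (contDiff_pd_cutAt ρ j 0).continuous (hps j) fun y hy =>
      (contDiffAt_pd (m := 0) (hu y (norm_of_mem_tsupport_pd_cutAt hρ hy)) (by norm_num)).continuousAt
  have int2 : ∀ (u : E3 → ℝ) (i j : Fin 3), (∀ y, ρ ≤ ‖y‖ → ContDiffAt ℝ 1 u y) →
      Integrable fun y => u y * pd i (pd j (cutAt ρ)) y := fun u i j hu =>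
    integrable_mul_of_tsupport (contDiff_pd_pd_cutAt ρ i j 0).continuous (hasCompactSupport_pd (hps j))
      fun y hy => (hu y (norm_of_mem_tsupport_pd_pd_cutAt hρ hy)).continuousAt
  have int3 : ∀ i j, Integrable fun y => pd i (σ i j) y * pd j (cutAt ρ) y - pd j (σ i i) y * pd j (cutAt ρ) y :=
    fun i j => (int1 _ i j (hσ i j)).sub (int1 _ j j (hσ i i))
  have int4 : ∀ i j, Integrable fun y =>
      σ i i y * pd j (pd j (cutAt ρ)) y - σ i j y * pd i (pd j (cutAt ρ)) y :=
    fun i j => (int2 _ j j (hσ i i)).sub (int2 _ i j (hσ i j))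
  have e1 : ∫ y, ∑ j, (∑ i, (pd i (σ i j) y - pd j (σ i i) y)) * pd j (cutAt ρ) y =
      ∑ j, ∑ i, ((∫ y, pd i (σ i j) y * pd j (cutAt ρ) y) - ∫ y, pd j (σ i i) y * pd j (cutAt ρ) y) := by
    simp only [Finset.sum_mul, sub_mul]
    rw [integral_finsetSum _ fun j _ => integrable_finsetSum _ fun i _ => int3 i j]
    refine Finset.sum_congr rfl fun j _ => ?_
    rw [integral_finsetSum _ fun i _ => int3 i j]
    exact Finset.sum_congr rfl fun i _ => integral_sub (int1 _ i j (hσ i j)) (int1 _ j j (hσ i i))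
  have e2 : ∫ y, ∑ i, ∑ j, σ i j y * cutHess ρ i j y =
      ∑ j, ∑ i, ((∫ y, σ i i y * pd j (pd j (cutAt ρ)) y) - ∫ y, σ i j y * pd i (pd j (cutAt ρ)) y) := by
    have : ∀ y, ∑ i, ∑ j, σ i j y * cutHess ρ i j y =
        ∑ j, ∑ i, (σ i i y * pd j (pd j (cutAt ρ)) y - σ i j y * pd i (pd j (cutAt ρ)) y) := fun y => by
      simp only [cutHess, mul_sub, Finset.sum_sub_distrib, mul_ite, mul_zero, Finset.sum_ite_eq,
        Finset.mem_univ, if_true]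
      congr 1
      · simp only [lap, Finset.mul_sum]; rw [Finset.sum_comm]
      · rw [Finset.sum_comm]
    simp only [this]
    rw [integral_finsetSum _ fun j _ => integrable_finsetSum _ fun i _ => int4 i j]
    refine Finset.sum_congr rfl fun j _ => ?_
    rw [integral_finsetSum _ fun i _ => int4 i j]
    exact Finset.sum_congr rfl fun i _ => integral_sub (int2 _ j j (hσ i i)) (int2 _ i j (hσ i j))
  rw [e1, e2]
  refine Finset.sum_congr rfl fun j _ => Finset.sum_congr rfl fun i _ => ?_
  rw [ibp _ i j (hσ i j), ibp _ j j (hσ i i)]; ring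

theorem cutHess_symm (ρ : ℝ) (i j : Fin 3) (y : E3) : cutHess ρ i j y = cutHess ρ j i y := by
  simp only [cutHess, eq_comm (a := i)]
  rw [pd_comm ((contDiff_cutAt ρ (n := 2)).contDiffAt)]

/-- Both terms reduce to `∂_jΔχ`, because partial derivatives commute. -/
theorem sum_pd_cutHess (ρ : ℝ) (j : Fin 3) (y : E3) : ∑ i, pd i (cutHess ρ i j) y = 0 := by
  have h1 : ∀ i, pd i (cutHess ρ i j) y =
      (if i = j then pd i (lap (cutAt ρ)) y else 0) - pd i (pd i (pd j (cutAt ρ))) y := fun i => by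
    have : cutHess ρ i j = fun y => (if i = j then lap (cutAt ρ) y else 0) - pd i (pd j (cutAt ρ)) y := rfl
    rw [this]
    have hd := ((contDiff_pd_pd_cutAt ρ i j 1).differentiable (by norm_num)) y
    split_ifs with hij
    · rw [pd_sub (((contDiff_lap_cutAt ρ 1).differentiable (by norm_num)) y) hd]
    · rw [pd_sub (differentiableAt_const _) hd]; simp [pd]
  have h2 : pd j (lap (cutAt ρ)) y = ∑ i, pd i (pd i (pd j (cutAt ρ))) y := by
    have e : fderiv ℝ (lap (cutAt ρ)) y = ∑ i, fderiv ℝ (pd i (pd i (cutAt ρ))) y := by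
      have : lap (cutAt ρ) = fun y => ∑ i, pd i (pd i (cutAt ρ)) y := rfl
      rw [this, fderiv_fun_sum fun i _ => ((contDiff_pd_pd_cutAt ρ i i 1).differentiable (by norm_num)) y]
    rw [pd, e, sum_apply]
    refine Finset.sum_congr rfl fun i _ => ?_
    change pd j (pd i (pd i (cutAt ρ))) y = _
    rw [pd_comm (contDiff_pd_cutAt ρ i 2).contDiffAt]
    refine (pd_congr (Eventually.of_forall fun z => ?_)).eq_of_nhds
    exact pd_comm ((contDiff_cutAt ρ (n := 2)).contDiffAt) j i
  simp only [h1, Finset.sum_sub_distrib, Finset.sum_ite_eq', Finset.mem_univ, if_true]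
  rw [h2, sub_self]

/-- By symmetry of `cutHess`, integration by parts leaves its divergence, which is zero:
infinitesimal changes of coordinates do not affect the averaged flux. -/
theorem integral_linear_flux {η : Fin 3 → E3 → ℝ} {ρ : ℝ} (hρ : 0 < ρ)
    (hη : ∀ j y, ρ ≤ ‖y‖ → ContDiffAt ℝ 1 (η j) y) :
    ∫ y, ∑ i, ∑ j, (pd i (η j) y + pd j (η i) y) * cutHess ρ i j y = 0 := by
  have int1 : ∀ i j, Integrable fun y => pd i (η j) y * cutHess ρ i j y := fun i j =>
    integrable_mul_of_tsupport (contDiff_cutHess ρ i j 0).continuous (hasCompactSupport_cutHess hρ i j)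
      fun y hy => (contDiffAt_pd (m := 0) (hη j y (norm_of_mem_tsupport_cutHess hρ hy)) (by norm_num)).continuousAt
  have int2 : ∀ i j, Integrable fun y => η j y * pd i (cutHess ρ i j) y := fun i j =>
    integrable_mul_of_tsupport (contDiff_pd (m := 0) (contDiff_cutHess ρ i j 1) (by norm_num)).continuous
      (hasCompactSupport_pd (hasCompactSupport_cutHess hρ i j))
      fun y hy => (hη j y (norm_of_mem_tsupport_cutHess hρ (tsupport_pd_subset _ _ hy))).continuousAt
  have e1 : ∀ y, ∑ i, ∑ j, (pd i (η j) y + pd j (η i) y) * cutHess ρ i j y =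
      2 * ∑ j, ∑ i, pd i (η j) y * cutHess ρ i j y := fun y => by
    simp only [add_mul, Finset.sum_add_distrib, two_mul]
    congr 1
    · rw [Finset.sum_comm]
    · exact Finset.sum_congr rfl fun i _ => Finset.sum_congr rfl fun j _ => by rw [cutHess_symm]
  simp only [e1]
  rw [integral_const_mul, integral_finsetSum _ fun j _ => integrable_finsetSum _ fun i _ => int1 i j]
  have e2 : ∀ j, ∫ y, ∑ i, pd i (η j) y * cutHess ρ i j y = 0 := fun j => by
    rw [integral_finsetSum _ fun i _ => int1 i j]
    have e3 : ∀ i, ∫ y, pd i (η j) y * cutHess ρ i j y = -∫ y, η j y * pd i (cutHess ρ i j) y := fun i => by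
      rw [integral_mul_pd (contDiff_cutHess ρ i j 1) (hasCompactSupport_cutHess hρ i j)
        fun y hy => hη j y (norm_of_mem_tsupport_cutHess hρ hy), neg_neg]
    simp only [e3]
    rw [Finset.sum_neg_distrib, ← integral_finsetSum _ fun i _ => int2 i j]
    simp [← Finset.mul_sum, sum_pd_cutHess]
  simp [e2]

/-- The trace of `cutHess` is `2Δχ`, and one integration by parts gives twice the dipole flux `-3ω`.
-/
theorem integral_inv_norm_flux {ρ : ℝ} (hρ : 0 < ρ) :
    ∫ y, ∑ i, ∑ j, (if i = j then ‖y‖⁻¹ else 0) * cutHess ρ i j y = -(6 * unitBallVolume) := by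
  have e1 : ∀ y, ∑ i, ∑ j, (if i = j then ‖y‖⁻¹ else 0) * cutHess ρ i j y =
      2 * ∑ i, ‖y‖⁻¹ * pd i (pd i (cutAt ρ)) y := fun y => by
    simp only [ite_mul, zero_mul, Finset.sum_ite_eq, Finset.mem_univ, if_true, cutHess, lap,
      Fin.sum_univ_three]
    ring
  simp only [e1]
  have hs : ∀ i, HasCompactSupport (pd i (cutAt ρ)) := fun i => hasCompactSupport_pd (hasCompactSupport_cutAt hρ)
  have hne : ∀ i, ∀ y ∈ tsupport (pd i (cutAt ρ)), y ≠ 0 := fun i y hy =>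
    norm_pos_iff.1 (hρ.trans_le (norm_of_mem_tsupport_pd_cutAt hρ hy))
  have hc : ∀ i, ∀ y ∈ tsupport (pd i (cutAt ρ)), ContDiffAt ℝ 1 (sqPow 0 (-(1 / 2))) y := fun i y hy =>
    contDiffAt_sqPow (by have := norm_pos_iff.2 (hne i y hy); positivity)
  have e2 : ∀ i, ∫ y, ‖y‖⁻¹ * pd i (pd i (cutAt ρ)) y = ∫ y, dipole i y * pd i (cutAt ρ) y := fun i => by
    simp only [← sqPow_zero_neg_half]
    rw [integral_mul_pd (contDiff_pd_cutAt ρ i 1) (hs i) (hc i), ← integral_neg]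
    refine integral_congr_ae (Eventually.of_forall fun y => ?_)
    by_cases hy : y = 0
    · have : pd i (cutAt ρ) y = 0 := (pd_cutAt_eq_zero hρ (Or.inl (by simpa [hy] using hρ))).eq_of_nhds
      simp [this]
    · simp only [pd_newton hy]; ring
  have i1 : ∀ i, Integrable fun y : E3 => ‖y‖⁻¹ * pd i (pd i (cutAt ρ)) y := fun i => by
    simp only [← sqPow_zero_neg_half]
    exact integrable_mul_of_tsupport (contDiff_pd_pd_cutAt ρ i i 0).continuous (hasCompactSupport_pd (hs i))
      fun y hy => (hc i y (tsupport_pd_subset _ _ hy)).continuousAt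
  have i2 : ∀ i, Integrable fun y : E3 => dipole i y * pd i (cutAt ρ) y := fun i => by
    refine integrable_mul_of_tsupport (contDiff_pd_cutAt ρ i 0).continuous (hs i) fun y hy => ?_
    have h1 : ContinuousAt (sqPow 0 (-(3 / 2))) y :=
      (contDiffAt_sqPow (n := 1) (by have := norm_pos_iff.2 (hne i y hy); positivity)).continuousAt
    exact ((hasFDerivAt_coord i y).continuousAt).mul h1
  rw [integral_const_mul, integral_finsetSum _ fun i _ => i1 i]
  simp only [e2]
  rw [← integral_finsetSum _ fun i _ => i2 i, integral_sum_dipole_mul_pd_cutAt hρ]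
  ring

/-- The limit of the averaged fluxes of an asymptotically conformally flat tensor field. -/
theorem tendsto_integral_cutHess {σ : Fin 3 → Fin 3 → E3 → ℝ} {η : Fin 3 → E3 → ℝ} {b L₀ : ℝ}
    (hσ : ∀ i j y, L₀ ≤ ‖y‖ → ContDiffAt ℝ 1 (σ i j) y)
    (hη : ∀ j y, L₀ ≤ ‖y‖ → ContDiffAt ℝ 1 (η j) y)
    (hrem : ∀ ε > 0, ∃ L : ℝ, ∀ y, L ≤ ‖y‖ → ∀ i j,
      |σ i j y - b * (if i = j then ‖y‖⁻¹ else 0) - (pd i (η j) y + pd j (η i) y)| ≤ ε / ‖y‖) :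
    Tendsto (fun ρ : ℝ => ∫ y, ∑ i, ∑ j, σ i j y * cutHess ρ i j y) atTop (𝓝 (-(6 * unitBallVolume * b))) := by
  obtain ⟨T, hT0, -, hT2, hT3⟩ := exists_bound_cutBump
  have hω := unitBallVolume_pos
  rw [Metric.tendsto_atTop]
  intro ε hε
  -- Nine entries, each at most `2T/ρ²`, over a ball of volume `8ωρ³`; the `1` keeps `K` positive.
  set K := 9 * (2 * T) * unitBallVolume * 8 + 1 with hK
  have hK0 : 0 < K := by positivity
  obtain ⟨L, hL⟩ := hrem (ε / (2 * K)) (by positivity)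
  refine ⟨max (max L L₀) 1, fun ρ hρ => ?_⟩
  have hρ1 : 1 ≤ ρ := (le_max_right _ _).trans hρ
  have hρ0 : 0 < ρ := by linarith
  have hρL : L ≤ ρ := ((le_max_left _ _).trans (le_max_left _ _)).trans hρ
  have hρL0 : L₀ ≤ ρ := ((le_max_right _ _).trans (le_max_left _ _)).trans hρ
  have hZ : ∀ i j y, |cutHess ρ i j y| ≤ 2 * T / ρ ^ 2 := fun i j y => by
    have h1 : |pd i (pd j (cutAt ρ)) y| ≤ T / ρ ^ 2 := by
      rw [pd_pd_cutAt, abs_mul, abs_of_pos (by positivity), inv_pow, div_eq_inv_mul]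
      exact mul_le_mul_of_nonneg_left (hT2 _ _ _) (by positivity)
    have h2 : |lap (cutAt ρ) y| ≤ T / ρ ^ 2 := by
      rw [lap_cutAt, abs_mul, abs_of_pos (by positivity), inv_pow, div_eq_inv_mul]
      exact mul_le_mul_of_nonneg_left (hT3 _) (by positivity)
    rw [cutHess, two_mul, add_div]
    refine (abs_sub _ _).trans (add_le_add ?_ h1)
    split_ifs
    · exact h2
    · rw [abs_zero]; positivity
  set R : Fin 3 → Fin 3 → E3 → ℝ := fun i j y =>
    σ i j y - b * (if i = j then ‖y‖⁻¹ else 0) - (pd i (η j) y + pd j (η i) y) with hR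
  have intZ : ∀ (u : E3 → ℝ) (i j : Fin 3), (∀ y, ρ ≤ ‖y‖ → ContinuousAt u y) →
      Integrable fun y => u y * cutHess ρ i j y := fun u i j hu =>
    integrable_mul_of_tsupport (contDiff_cutHess ρ i j 0).continuous (hasCompactSupport_cutHess hρ0 i j)
      fun y hy => hu y (norm_of_mem_tsupport_cutHess hρ0 hy)
  have c1 : ∀ i j y, ρ ≤ ‖y‖ → ContinuousAt (σ i j) y := fun i j y hy => (hσ i j y (hρL0.trans hy)).continuousAt
  have c2 : ∀ (i j : Fin 3) (y : E3), ρ ≤ ‖y‖ → ContinuousAt (fun y : E3 => if i = j then ‖y‖⁻¹ else 0) y :=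
    fun i j y hy => by
      split_ifs
      · exact continuous_norm.continuousAt.inv₀ (by linarith)
      · exact continuousAt_const
  have c3 : ∀ i j y, ρ ≤ ‖y‖ → ContinuousAt (fun y => pd i (η j) y + pd j (η i) y) y := fun i j y hy =>
    (contDiffAt_pd (m := 0) (hη j y (hρL0.trans hy)) (by norm_num)).continuousAt.add
      (contDiffAt_pd (m := 0) (hη i y (hρL0.trans hy)) (by norm_num)).continuousAt
  have c4 : ∀ i j y, ρ ≤ ‖y‖ → ContinuousAt (R i j) y := fun i j y hy =>
    ((c1 i j y hy).sub ((c2 i j y hy).const_mul b)).sub (c3 i j y hy)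
  have intS : ∀ (u : Fin 3 → Fin 3 → E3 → ℝ), (∀ i j y, ρ ≤ ‖y‖ → ContinuousAt (u i j) y) →
      Integrable fun y => ∑ i, ∑ j, u i j y * cutHess ρ i j y := fun u hu =>
    integrable_finsetSum _ fun i _ => integrable_finsetSum _ fun j _ => intZ _ i j (hu i j)
  have e : ∫ y, ∑ i, ∑ j, σ i j y * cutHess ρ i j y =
      (∫ y, ∑ i, ∑ j, R i j y * cutHess ρ i j y) - 6 * unitBallVolume * b := by
    have h1 : ∀ y, ∑ i, ∑ j, σ i j y * cutHess ρ i j y =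
        ((∑ i, ∑ j, R i j y * cutHess ρ i j y) +
          b * ∑ i, ∑ j, (if i = j then ‖y‖⁻¹ else 0) * cutHess ρ i j y) +
          ∑ i, ∑ j, (pd i (η j) y + pd j (η i) y) * cutHess ρ i j y := fun y => by
      simp only [Finset.mul_sum, ← Finset.sum_add_distrib, hR]
      exact Finset.sum_congr rfl fun i _ => Finset.sum_congr rfl fun j _ => by ring
    simp only [h1]
    have i1 := intS R c4
    have i2 := (intS (fun i j (y : E3) => if i = j then ‖y‖⁻¹ else 0) c2).const_mul b
    have i3 := intS (fun i j y => pd i (η j) y + pd j (η i) y) c3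
    have i12 : Integrable fun y => (∑ i, ∑ j, R i j y * cutHess ρ i j y) +
        b * ∑ i, ∑ j, (if i = j then ‖y‖⁻¹ else 0) * cutHess ρ i j y := i1.add i2
    rw [integral_add i12 i3, integral_add i1 i2, integral_const_mul, integral_inv_norm_flux hρ0,
      integral_linear_flux hρ0 fun j y hy => hη j y (hρL0.trans hy)]
    ring
  have hb : |∫ y, ∑ i, ∑ j, R i j y * cutHess ρ i j y| ≤
      9 * ((ε / (2 * K)) / ρ * (2 * T / ρ ^ 2)) * (unitBallVolume * (2 * ρ) ^ 3) := by
    refine abs_integral_le_on_closedBall (by positivity) (fun y hy => ?_) fun y _ => ?_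
    · simp [cutHess_eq_zero hρ0 (Or.inr hy)]
    · have h1 : ∀ i j, |R i j y * cutHess ρ i j y| ≤ (ε / (2 * K)) / ρ * (2 * T / ρ ^ 2) := fun i j => by
        rcases lt_or_ge ‖y‖ ρ with hy | hy
        · rw [cutHess_eq_zero hρ0 (Or.inl hy), mul_zero, abs_zero]; positivity
        · rw [abs_mul]
          have h2 := hL y (hρL.trans hy) i j
          exact mul_le_mul (h2.trans (by gcongr)) (hZ i j y) (abs_nonneg _) (by positivity)
      refine (Finset.abs_sum_le_sum_abs _ _).trans ((Finset.sum_le_sum fun i _ =>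
        (Finset.abs_sum_le_sum_abs _ _).trans (Finset.sum_le_sum fun j _ => h1 i j)).trans_eq ?_)
      simp; ring
  rw [e, Real.dist_eq, show ∀ x z : ℝ, x - z - -z = x by intros; ring]
  refine hb.trans_lt ?_
  have : 9 * ((ε / (2 * K)) / ρ * (2 * T / ρ ^ 2)) * (unitBallVolume * (2 * ρ) ^ 3) =
      ε / (2 * K) * (K - 1) := by
    rw [hK]; field_simp; ring
  rw [this]
  calc ε / (2 * K) * (K - 1) < ε / (2 * K) * (2 * K) := by
        apply mul_lt_mul_of_pos_left _ (by positivity); linarith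
    _ = ε := by field_simp

/-! ### Maps with decaying differential -/

open Bornology Asymptotics

theorem inner_stdVec_stdVec (i j : Fin 3) : inner ℝ (stdVec i) (stdVec j) = if i = j then (1 : ℝ) else 0 := by
  rw [inner_stdVec]; simp [stdVec, eq_comm]

theorem le_norm_of_mem_segment_smul {F : Type*} [NormedAddCommGroup F] [NormedSpace ℝ F] {s t : ℝ}
    (hst : s ≤ t) {y p : F} (hp : p ∈ segment ℝ (s • y) (t • y)) : s * ‖y‖ ≤ ‖p‖ := by
  obtain ⟨α, β, hα, hβ, h1, rfl⟩ := hp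
  rw [smul_smul, smul_smul, ← add_smul, norm_smul, Real.norm_eq_abs]
  refine mul_le_mul_of_nonneg_right (le_trans ?_ (le_abs_self _)) (norm_nonneg y)
  calc s = α * s + β * s := by rw [← add_mul, h1, one_mul]
    _ ≤ α * s + β * t := by gcongr

/-- A map with bounded differential near infinity grows at most linearly. -/
theorem eventually_norm_le_of_norm_fderiv_le {T : E3 → E3} {κ : ℝ}
    (hT : ∀ᶠ y in cobounded E3, DifferentiableAt ℝ T y)
    (hκ : ∀ᶠ y in cobounded E3, ‖fderiv ℝ T y‖ ≤ κ) :
    ∃ C, ∀ᶠ y in cobounded E3, ‖T y‖ ≤ C + κ * ‖y‖ := by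
  obtain ⟨L, hL, h⟩ := eventually_cobounded_norm.1 (hT.and hκ)
  have hcont : ContinuousOn T (Metric.sphere 0 L) := fun y hy =>
    (h y (by rw [mem_sphere_zero_iff_norm.1 hy])).1.continuousAt.continuousWithinAt
  obtain ⟨C, hC⟩ := (isCompact_sphere (0 : E3) L).exists_bound_of_continuousOn hcont
  refine ⟨C, eventually_cobounded_norm.2 ⟨L, hL, fun y hy => ?_⟩⟩
  have hy0 : 0 < ‖y‖ := hL.trans_le hy
  have hκ0 : 0 ≤ κ := (norm_nonneg _).trans (h y hy).2
  have hseg : ∀ p ∈ segment ℝ ((L / ‖y‖) • y) y, L ≤ ‖p‖ := fun p hp => by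
    have := le_norm_of_mem_segment_smul (s := L / ‖y‖) (t := 1)
      ((div_le_one hy0).2 hy) (by simpa using hp)
    rwa [div_mul_cancel₀ _ hy0.ne'] at this
  have h1 := (convex_segment ((L / ‖y‖) • y) y).norm_image_sub_le_of_norm_fderiv_le (𝕜 := ℝ)
    (fun p hp => (h p (hseg p hp)).1) (fun p hp => (h p (hseg p hp)).2)
    (left_mem_segment _ _ _) (right_mem_segment _ _ _)
  have h2 : ‖T ((L / ‖y‖) • y)‖ ≤ C := hC _ (by
    rw [mem_sphere_zero_iff_norm, norm_smul, Real.norm_of_nonneg (by positivity), div_mul_cancel₀ _ hy0.ne'])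
  have h3 : ‖y - (L / ‖y‖) • y‖ ≤ ‖y‖ := by
    rw [show y - (L / ‖y‖) • y = (1 - L / ‖y‖) • y by rw [sub_smul, one_smul], norm_smul, Real.norm_eq_abs,
      abs_of_nonneg (sub_nonneg.2 ((div_le_one hy0).2 hy))]
    have : 0 ≤ L / ‖y‖ := by positivity
    nlinarith
  calc ‖T y‖ = ‖T ((L / ‖y‖) • y) + (T y - T ((L / ‖y‖) • y))‖ := by rw [add_sub_cancel]
    _ ≤ C + κ * ‖y‖ := (norm_add_le _ _).trans (add_le_add h2 (h1.trans (by gcongr)))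

theorem isLittleO_of_tendsto_fderiv {T : E3 → E3} (hT : ∀ᶠ y in cobounded E3, DifferentiableAt ℝ T y)
    (h0 : Tendsto (fderiv ℝ T) (cobounded E3) (𝓝 0)) : T =o[cobounded E3] fun y => ‖y‖ := by
  refine isLittleO_iff.2 fun c hc => ?_
  obtain ⟨C, hC⟩ := eventually_norm_le_of_norm_fderiv_le hT
    (((tendsto_zero_iff_norm_tendsto_zero.1 h0).eventually (gt_mem_nhds (half_pos hc))).mono fun y hy => hy.le)
  have h2 : ∀ᶠ y : E3 in cobounded E3, C / (c / 2) ≤ ‖y‖ := tendsto_norm_cobounded_atTop.eventually_ge_atTop _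
  filter_upwards [hC, h2] with y hy hy2
  rw [div_le_iff₀ (half_pos hc)] at hy2
  rw [norm_norm]; linarith

/-- The exterior of a ball is not convex, but a nonobtuse angle keeps the segment from `y` to `z`
outside the ball of radius `R`, so the mean value inequality applies along it. -/
theorem norm_sub_le_of_inner_nonneg {f : E3 → E3} {y z : E3} {R B : ℝ} (hR : 0 ≤ R) (hy : 2 * R ≤ ‖y‖)
    (hz : 2 * R ≤ ‖z‖) (hyz : 0 ≤ inner ℝ y z) (hf : ∀ p, R ≤ ‖p‖ → DifferentiableAt ℝ f p)
    (hB : ∀ p, R ≤ ‖p‖ → ‖fderiv ℝ f p‖ ≤ B) : ‖f z - f y‖ ≤ B * ‖z - y‖ := by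
  have hseg : ∀ p ∈ segment ℝ y z, R ≤ ‖p‖ := by
    rintro p ⟨α, β, hα, hβ, h1, rfl⟩
    refine (sq_le_sq₀ hR (norm_nonneg _)).1 ?_
    rw [norm_add_sq_real, norm_smul, norm_smul, inner_smul_left, inner_smul_right,
      Real.norm_of_nonneg hα, Real.norm_of_nonneg hβ]
    simp only [conj_trivial]
    have h2 : (2 * R * α) ^ 2 ≤ (α * ‖y‖) ^ 2 := by
      refine pow_le_pow_left₀ (by positivity) ?_ 2
      nlinarith
    have h3 : (2 * R * β) ^ 2 ≤ (β * ‖z‖) ^ 2 := by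
      refine pow_le_pow_left₀ (by positivity) ?_ 2
      nlinarith
    have h4 : 0 ≤ α * (β * inner ℝ y z) := by positivity
    have h5 : 1 / 2 ≤ α ^ 2 + β ^ 2 := by nlinarith [sq_nonneg (α - β)]
    nlinarith [sq_nonneg R]
  exact (convex_segment y z).norm_image_sub_le_of_norm_fderiv_le (𝕜 := ℝ)
    (fun p hp => hf p (hseg p hp)) (fun p hp => hB p (hseg p hp))
    (left_mem_segment _ _ _) (right_mem_segment _ _ _)

/-- A map whose differential is `O(|y|^{-1-τ})` has a limit at infinity, with error `O(|y|^{-τ})`. -/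
theorem exists_limit_of_fderiv_isBigO {f : E3 → E3} {τ : ℝ} (hτ : 0 < τ)
    (hf : ∀ᶠ y in cobounded E3, DifferentiableAt ℝ f y)
    (hO : fderiv ℝ f =O[cobounded E3] fun y => ‖y‖ ^ (-τ - 1)) :
    ∃ A, (fun y => f y - A) =O[cobounded E3] fun y => ‖y‖ ^ (-τ) := by
  obtain ⟨C, hC, hCb⟩ := hO.exists_pos
  obtain ⟨L, hL, h⟩ := eventually_cobounded_norm.1 (hf.and hCb.bound)
  have hd : ∀ {R : ℝ}, L ≤ R → ∀ p : E3, R ≤ ‖p‖ → DifferentiableAt ℝ f p := fun hR p hp =>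
    (h p (hR.trans hp)).1
  have hB : ∀ {R : ℝ}, L ≤ R → ∀ p : E3, R ≤ ‖p‖ → ‖fderiv ℝ f p‖ ≤ C * R ^ (-τ - 1) := fun {R} hR p hp => by
    have h1 := (h p (hR.trans hp)).2
    rw [Real.norm_of_nonneg (by positivity)] at h1
    exact h1.trans (mul_le_mul_of_nonneg_left
      (Real.rpow_le_rpow_of_nonpos (hL.trans_le hR) hp (by linarith)) hC.le)
  -- The increment of `f` from `2ⁿy` to `2ⁿ⁺¹y` is of order `|y|^(-τ) rⁿ`, so the values along each
  -- ray are summed by a geometric series.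
  set r : ℝ := (2 : ℝ) ^ (-τ) with hr
  have hr1 : r < 1 := Real.rpow_lt_one_of_one_lt_of_neg (by norm_num) (by linarith)
  have hpow : ∀ (n : ℕ) (ρ : ℝ), 0 < ρ → (2 ^ n * ρ) ^ (-τ) = ρ ^ (-τ) * r ^ n := fun n ρ hρ => by
    rw [Real.mul_rpow (by positivity) hρ.le, mul_comm, hr, ← Real.rpow_natCast, ← Real.rpow_natCast,
      ← Real.rpow_mul (by norm_num), ← Real.rpow_mul (by norm_num), mul_comm (n : ℝ)]
  -- increments along the dyadic sequence
  have hstep : ∀ y : E3, L ≤ ‖y‖ → ∀ n : ℕ, dist (f ((2 : ℝ) ^ n • y)) (f ((2 : ℝ) ^ (n + 1) • y)) ≤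
      C * ‖y‖ ^ (-τ) * r ^ n := fun y hy n => by
    have hy0 : 0 < ‖y‖ := hL.trans_le hy
    have hn1 : (1 : ℝ) ≤ 2 ^ n := one_le_pow₀ (by norm_num)
    have hLn : L ≤ 2 ^ n * ‖y‖ := by nlinarith
    have hseg : ∀ p ∈ segment ℝ ((2 : ℝ) ^ n • y) ((2 : ℝ) ^ (n + 1) • y), 2 ^ n * ‖y‖ ≤ ‖p‖ := fun p hp =>
      le_norm_of_mem_segment_smul (pow_le_pow_right₀ (by norm_num) (by omega)) hp
    have h1 := (convex_segment ((2 : ℝ) ^ n • y) ((2 : ℝ) ^ (n + 1) • y)).norm_image_sub_le_of_norm_fderiv_le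
      (𝕜 := ℝ) (fun p hp => hd hLn p (hseg p hp)) (fun p hp => hB hLn p (hseg p hp))
      (left_mem_segment _ _ _) (right_mem_segment _ _ _)
    rw [dist_comm, dist_eq_norm]
    refine h1.trans_eq ?_
    rw [← sub_smul, norm_smul, pow_succ, show (2 : ℝ) ^ n * 2 - 2 ^ n = 2 ^ n by ring,
      Real.norm_of_nonneg (by positivity), mul_assoc, mul_assoc, ← hpow n _ hy0, Real.rpow_sub_one (by positivity)]
    field_simp
  have hlim : ∀ y : E3, L ≤ ‖y‖ → ∃ A, Tendsto (fun n : ℕ => f ((2 : ℝ) ^ n • y)) atTop (𝓝 A) := fun y hy =>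
    cauchySeq_tendsto_of_complete (cauchySeq_of_le_geometric r _ hr1 (hstep y hy))
  have hclose : ∀ (y : E3) (A : E3), L ≤ ‖y‖ → Tendsto (fun n : ℕ => f ((2 : ℝ) ^ n • y)) atTop (𝓝 A) →
      ‖f y - A‖ ≤ C / (1 - r) * ‖y‖ ^ (-τ) := fun y A hy hA => by
    have := dist_le_of_le_geometric_of_tendsto₀ r _ hr1 (hstep y hy) hA
    rw [pow_zero, one_smul, dist_eq_norm] at this
    rwa [div_mul_eq_mul_div]
  -- the limit along rays does not depend on the ray
  have hsame : ∀ (y z A : E3), 2 * L ≤ ‖y‖ → 2 * L ≤ ‖z‖ → 0 ≤ inner ℝ y z →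
      Tendsto (fun n : ℕ => f ((2 : ℝ) ^ n • y)) atTop (𝓝 A) →
      Tendsto (fun n : ℕ => f ((2 : ℝ) ^ n • z)) atTop (𝓝 A) := fun y z A hy hz hyz hA => by
    have hb : ∀ n : ℕ, ‖f ((2 : ℝ) ^ n • z) - f ((2 : ℝ) ^ n • y)‖ ≤ C * L ^ (-τ) / L * ‖z - y‖ * r ^ n := fun n => by
      have hn1 : (1 : ℝ) ≤ 2 ^ n := one_le_pow₀ (by norm_num)
      have hn0 : (0 : ℝ) < 2 ^ n := by positivity
      have hLn : L ≤ 2 ^ n * L := by nlinarith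
      have h1 := norm_sub_le_of_inner_nonneg (f := f) (y := (2 : ℝ) ^ n • y) (z := (2 : ℝ) ^ n • z)
        (R := 2 ^ n * L) (by positivity)
        (by rw [norm_smul, Real.norm_of_nonneg hn0.le]; nlinarith)
        (by rw [norm_smul, Real.norm_of_nonneg hn0.le]; nlinarith)
        (by rw [inner_smul_left, inner_smul_right]; simp only [conj_trivial]; positivity)
        (hd hLn) (hB hLn)
      refine h1.trans_eq ?_
      rw [← smul_sub, norm_smul, Real.norm_of_nonneg hn0.le, Real.rpow_sub_one (by positivity), hpow n L hL]
      field_simp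
    have h0 : Tendsto (fun n : ℕ => f ((2 : ℝ) ^ n • z) - f ((2 : ℝ) ^ n • y)) atTop (𝓝 0) :=
      squeeze_zero_norm hb (by
        simpa using (tendsto_pow_atTop_nhds_zero_of_lt_one (by positivity) hr1).const_mul (C * L ^ (-τ) / L * ‖z - y‖))
    simpa using h0.add hA
  -- The rays through `e 0`, `e 1` and `-e 0` are successively orthogonal, hence share one limit.
  -- Every other ray makes a nonobtuse angle with `e 0` or with `-e 0`.
  set e : Fin 3 → E3 := fun i => (2 * L) • stdVec i with he
  have hen : ∀ i, ‖e i‖ = 2 * L := fun i => by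
    rw [he, norm_smul, norm_stdVec, mul_one, Real.norm_of_nonneg (by positivity)]
  obtain ⟨A, hA⟩ := hlim (e 0) (by rw [hen]; linarith)
  have hA1 := hsame (e 0) (e 1) A (hen 0).ge (hen 1).ge (by
    simp [he, inner_smul_left, inner_smul_right, inner_stdVec_stdVec]) hA
  have hA2 := hsame (e 1) (-e 0) A (hen 1).ge (by rw [norm_neg, hen]) (by
    simp [he, inner_smul_left, inner_smul_right, inner_stdVec_stdVec]) hA1
  refine ⟨A, IsBigO.of_bound (C / (1 - r)) (eventually_cobounded_norm.2 ⟨2 * L, by positivity, fun y hy => ?_⟩)⟩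
  have hyL : L ≤ ‖y‖ := by linarith
  rw [Real.norm_of_nonneg (by positivity)]
  refine hclose y A hyL ?_
  rcases le_total 0 (inner ℝ (e 0) y) with h0 | h0
  · exact hsame (e 0) y A (hen 0).ge hy h0 hA
  · exact hsame (-e 0) y A (by rw [norm_neg, hen]) hy (by rw [inner_neg_left]; linarith) hA2

theorem eventually_cobounded_eventually_nhds {P : E3 → Prop} (h : ∀ᶠ y in cobounded E3, P y) :
    ∀ᶠ y in cobounded E3, ∀ᶠ z in 𝓝 y, P z := by
  obtain ⟨L, hL, hP⟩ := eventually_cobounded_norm.1 h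
  refine eventually_cobounded_norm.2 ⟨L + 1, by positivity, fun y hy => ?_⟩
  filter_upwards [continuous_norm.continuousAt.eventually (lt_mem_nhds (show L < ‖y‖ by linarith))] with z hz
  exact hP z hz.le

theorem HasExpansion.exists_abs_pd_le {U : E3 → ℝ} {a : ℝ} (h : HasExpansion U a) :
    ∃ C, 0 ≤ C ∧ ∀ᶠ x in cobounded E3, ∀ j, |pd j U x| ≤ C / ‖x‖ ^ 2 := by
  obtain ⟨s, M, hs, hM, hx⟩ := h
  refine ⟨M / s + |a| * 4, by positivity, eventually_cobounded_norm.2 ⟨s + 1, by positivity, fun x hxs j => ?_⟩⟩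
  have hx0 : 0 < ‖x‖ := by linarith
  have h1 := (hx x (by linarith)).2 j
  have h2 := (isDecayingKernel_dipole j).abs_le x (norm_pos_iff.1 hx0)
  have h3 : M / ‖x‖ ^ 3 ≤ M / s / ‖x‖ ^ 2 := by
    rw [div_div, pow_succ, mul_comm]
    gcongr; linarith
  have h4 := abs_sub (pd j U x + a * dipole j x) (a * dipole j x)
  rw [add_sub_cancel_right, abs_mul] at h4
  have h5 : |a| * |dipole j x| ≤ |a| * 4 / ‖x‖ ^ 2 := by
    rw [mul_div_assoc]; gcongr
  rw [add_div]; linarith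

theorem HasExpansion.tendsto_norm_mul {U : E3 → ℝ} {a : ℝ} (h : HasExpansion U a) :
    Tendsto (fun x => ‖x‖ * (U x - 1)) (cobounded E3) (𝓝 a) := by
  obtain ⟨s, M, hs, hM, hx⟩ := h
  rw [tendsto_iff_norm_sub_tendsto_zero]
  have h0 : Tendsto (fun x : E3 => M / ‖x‖) (cobounded E3) (𝓝 0) :=
    tendsto_norm_cobounded_atTop.const_div_atTop M
  refine squeeze_zero' (Eventually.of_forall fun x => norm_nonneg _) ?_ h0
  refine eventually_cobounded_norm.2 ⟨s + 1, by positivity, fun x hxs => ?_⟩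
  have hx0 : 0 < ‖x‖ := by linarith
  have h1 := (hx x (by linarith)).1
  have e : ‖x‖ * (U x - 1) - a = ‖x‖ * (U x - 1 - a / ‖x‖) := by field_simp
  rw [e, norm_mul, norm_norm, Real.norm_eq_abs]
  calc ‖x‖ * |U x - 1 - a / ‖x‖| ≤ ‖x‖ * (M / ‖x‖ ^ 2) := by gcongr
    _ = M / ‖x‖ := by field_simp

/-! ### Changes of coordinates that flatten the metric at infinity -/

/-- The frame `∂_i X` of a change of coordinates. -/
noncomputable def frame (X : E3 → E3) (i : Fin 3) (y : E3) : E3 := fderiv ℝ X y (stdVec i)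

/-- The first fundamental form `⟨∂_i X, ∂_j X⟩`. -/
noncomputable def gram (X : E3 → E3) (i j : Fin 3) (y : E3) : ℝ := inner ℝ (frame X i y) (frame X j y)

variable {X : E3 → E3} {y : E3}

theorem fderiv_eq_sum_frame (X : E3 → E3) (y v : E3) : fderiv ℝ X y v = ∑ i, v i • frame X i y := by
  conv_lhs => rw [← sum_smul_stdVec v]
  simp [frame]

theorem differentiableAt_fderiv (hX : ContDiffAt ℝ 2 X y) : DifferentiableAt ℝ (fderiv ℝ X) y :=
  (hX.fderiv_right (m := 1) (by norm_num)).differentiableAt (by norm_num)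

theorem differentiableAt_frame (hX : ContDiffAt ℝ 2 X y) (i : Fin 3) : DifferentiableAt ℝ (frame X i) y :=
  (differentiableAt_fderiv hX).clm_apply (differentiableAt_const _)

theorem fderiv_frame_apply (hX : ContDiffAt ℝ 2 X y) (i : Fin 3) (v : E3) :
    fderiv ℝ (frame X i) y v = fderiv ℝ (fderiv ℝ X) y v (stdVec i) := by
  change fderiv ℝ (fun y => fderiv ℝ X y (stdVec i)) y v = _
  rw [fderiv_clm_apply (differentiableAt_fderiv hX) (differentiableAt_const _)]
  simp

theorem fderiv_frame_symm (hX : ContDiffAt ℝ 2 X y) (i j : Fin 3) :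
    fderiv ℝ (frame X i) y (stdVec j) = fderiv ℝ (frame X j) y (stdVec i) := by
  rw [fderiv_frame_apply hX, fderiv_frame_apply hX]
  exact (hX.isSymmSndFDerivAt (by simp)).eq _ _

theorem pd_gram (hX : ContDiffAt ℝ 2 X y) (k i j : Fin 3) :
    pd k (gram X i j) y = inner ℝ (fderiv ℝ (frame X i) y (stdVec k)) (frame X j y) +
      inner ℝ (frame X i y) (fderiv ℝ (frame X j) y (stdVec k)) := by
  have := ((differentiableAt_frame hX i).hasFDerivAt.inner ℝ (differentiableAt_frame hX j).hasFDerivAt).fderiv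
  rw [pd, show gram X i j = fun y => inner ℝ (frame X i y) (frame X j y) from rfl, this]
  simp [fderivInnerCLM_apply]; ring

/-- The Koszul formula in a flat target. -/
theorem inner_fderiv_frame (hX : ContDiffAt ℝ 2 X y) (i j k : Fin 3) :
    inner ℝ (fderiv ℝ (frame X i) y (stdVec j)) (frame X k y) =
      (pd i (gram X j k) y + pd j (gram X i k) y - pd k (gram X i j) y) / 2 := by
  rw [pd_gram hX, pd_gram hX, pd_gram hX, fderiv_frame_symm hX j i, fderiv_frame_symm hX k i,
    fderiv_frame_symm hX k j, real_inner_comm (frame X j y)]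
  ring

/-- A derivative `b` of the frame is itself expanded in the frame, with coefficients at most `2‖b‖`,
and the Koszul formula bounds each product `⟨b, ∂_kX⟩` by `3β/2`. Hence `‖b‖ ≤ 9β`, and three
directions give `27β`. -/
theorem norm_fderiv_frame_le (hX : ContDiffAt ℝ 2 X y) (hlow : ∀ v, ‖v‖ ≤ 2 * ‖fderiv ℝ X y v‖) {β : ℝ}
    (hβ : ∀ k i j, |pd k (gram X i j) y| ≤ β) (i : Fin 3) : ‖fderiv ℝ (frame X i) y‖ ≤ 27 * β := by
  have hβ0 : 0 ≤ β := (abs_nonneg _).trans (hβ 0 0 0)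
  have hinj : Function.Injective (fderiv ℝ X y : E3 →ₗ[ℝ] E3) := by
    rw [injective_iff_map_eq_zero]
    intro v hv
    have := hlow v
    rw [show fderiv ℝ X y v = 0 from hv, norm_zero, mul_zero] at this
    exact norm_le_zero_iff.1 this
  have hb : ∀ j, ‖fderiv ℝ (frame X i) y (stdVec j)‖ ≤ 9 * β := fun j => by
    set b := fderiv ℝ (frame X i) y (stdVec j) with hbdef
    obtain ⟨v, hv⟩ := LinearMap.injective_iff_surjective.1 hinj b
    have hv : fderiv ℝ X y v = b := hv
    have h1 : ‖b‖ * ‖b‖ = ∑ k, v k * inner ℝ b (frame X k y) := by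
      rw [← real_inner_self_eq_norm_mul_norm]
      have h0 : b = ∑ k, v k • frame X k y := by rw [← hv, fderiv_eq_sum_frame]
      calc inner ℝ b b = inner ℝ b (∑ k, v k • frame X k y) := by rw [← h0]
        _ = _ := by simp [inner_sum, inner_smul_right]
    have h2 : ∀ k, v k * inner ℝ b (frame X k y) ≤ 2 * ‖b‖ * (3 / 2 * β) := fun k => by
      have h3 : |inner ℝ b (frame X k y)| ≤ 3 / 2 * β := by
        rw [hbdef, inner_fderiv_frame hX, abs_le]
        have e1 := abs_le.1 (hβ i j k)
        have e2 := abs_le.1 (hβ j i k)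
        have e3 := abs_le.1 (hβ k i j)
        constructor <;> linarith
      have h4 : |v k| ≤ 2 * ‖b‖ := (abs_coord_le v k).trans (hv ▸ hlow v)
      refine (le_abs_self _).trans ?_
      rw [abs_mul]; gcongr
    have h5 : ‖b‖ * ‖b‖ ≤ 9 * β * ‖b‖ := by
      rw [h1]
      refine (Finset.sum_le_sum fun k _ => h2 k).trans_eq ?_
      simp; ring
    by_contra hlt
    have h6 : 0 < ‖b‖ := by linarith
    exact absurd (le_of_mul_le_mul_right h5 h6) hlt
  refine ContinuousLinearMap.opNorm_le_bound _ (by positivity) fun v => ?_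
  conv_lhs => rw [← sum_smul_stdVec v, map_sum]
  refine (norm_sum_le _ _).trans ((Finset.sum_le_sum fun j _ => ?_).trans_eq (b := ∑ _j : Fin 3, ‖v‖ * (9 * β)) ?_)
  · rw [map_smul, norm_smul]
    exact mul_le_mul (abs_coord_le v j) (hb j) (norm_nonneg _) (norm_nonneg _)
  · simp; ring

theorem fderiv_frame_isBigO {ρ : E3 → ℝ} (hX : ∀ᶠ y in cobounded E3, ContDiffAt ℝ 2 X y)
    (hlow : ∀ᶠ y in cobounded E3, ∀ v, ‖v‖ ≤ 2 * ‖fderiv ℝ X y v‖)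
    (hG : ∀ k i j, pd k (gram X i j) =O[cobounded E3] ρ) (i : Fin 3) :
    fderiv ℝ (frame X i) =O[cobounded E3] ρ := by
  have hS : (fun y => ∑ k, ∑ i, ∑ j, |pd k (gram X i j) y|) =O[cobounded E3] ρ :=
    IsBigO.fun_sum fun k _ => IsBigO.fun_sum fun i _ => IsBigO.fun_sum fun j _ => (hG k i j).abs_left
  refine IsBigO.trans (IsBigO.of_bound 27 ?_) hS
  filter_upwards [hX, hlow] with y h1 h2
  refine (norm_fderiv_frame_le h1 h2 (fun k i j => ?_) i).trans
    (mul_le_mul_of_nonneg_left (le_abs_self _) (by norm_num))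
  have n3 : ∀ k i, 0 ≤ ∑ j, |pd k (gram X i j) y| := fun k i => Finset.sum_nonneg fun j _ => abs_nonneg _
  refine (Finset.single_le_sum (f := fun j => |pd k (gram X i j) y|) (fun j _ => abs_nonneg _)
    (Finset.mem_univ j)).trans ?_
  refine (Finset.single_le_sum (f := fun i => ∑ j, |pd k (gram X i j) y|) (fun i _ => n3 k i)
    (Finset.mem_univ i)).trans ?_
  exact Finset.single_le_sum (f := fun k => ∑ i, ∑ j, |pd k (gram X i j) y|)
    (fun k _ => Finset.sum_nonneg fun i _ => n3 k i) (Finset.mem_univ k)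

theorem pd_comp {U : E3 → ℝ} (hU : DifferentiableAt ℝ U (X y)) (hX : DifferentiableAt ℝ X y) (k : Fin 3) :
    pd k (fun z => U (X z)) y = ∑ j, frame X k y j * pd j U (X y) := by
  rw [pd, show (fun z => U (X z)) = U ∘ X from rfl, fderiv_comp y hU hX, ← fderiv_apply_eq_sum]
  rfl

theorem HasExpansion.tendsto_one {U : E3 → ℝ} {a : ℝ} (h : HasExpansion U a) :
    Tendsto U (cobounded E3) (𝓝 1) := by
  have h1 : Tendsto (fun x : E3 => ‖x‖⁻¹ * (‖x‖ * (U x - 1)) + 1) (cobounded E3) (𝓝 (0 * a + 1)) :=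
    ((tendsto_inv_atTop_zero.comp tendsto_norm_cobounded_atTop).mul h.tendsto_norm_mul).add_const 1
  rw [zero_mul, zero_add] at h1
  refine h1.congr' (eventually_cobounded_norm.2 ⟨1, one_pos, fun x hx => ?_⟩)
  have : ‖x‖ ≠ 0 := by positivity
  field_simp; ring

/-- A change of coordinates `X` that pulls the conformally flat metric `U⁴ δ` back to an
asymptotically flat metric `δ + σ`. -/
structure IsFlatteningMap (X : E3 → E3) (U : E3 → ℝ) (σ : Fin 3 → Fin 3 → E3 → ℝ) (τ a : ℝ) : Prop where
  contDiffAt : ∀ᶠ y in cobounded E3, ContDiffAt ℝ 2 X y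
  norm_le : ∀ᶠ y in cobounded E3, ∀ v, ‖v‖ ≤ 2 * ‖fderiv ℝ X y v‖ ∧ ‖fderiv ℝ X y v‖ ≤ 2 * ‖v‖
  le_norm : ∀ᶠ y in cobounded E3, ‖y‖ ≤ 4 * ‖X y‖
  contDiffAt_factor : ∀ᶠ x in cobounded E3, ContDiffAt ℝ 1 U x
  hasExpansion : HasExpansion U a
  metric_eq : ∀ᶠ y in cobounded E3, ∀ i j,
    σ i j y = U (X y) ^ 4 * gram X i j y - if i = j then 1 else 0
  half_lt : 1 / 2 < τ
  le_one : τ ≤ 1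
  isBigO : ∀ i j, σ i j =O[cobounded E3] fun y => ‖y‖ ^ (-τ)
  pd_isBigO : ∀ k i j, pd k (σ i j) =O[cobounded E3] fun y => ‖y‖ ^ (-τ - 1)

namespace IsFlatteningMap

variable {X : E3 → E3} {U : E3 → ℝ} {σ : Fin 3 → Fin 3 → E3 → ℝ} {τ a : ℝ}

theorem tendsto_cobounded (h : IsFlatteningMap X U σ τ a) : Tendsto X (cobounded E3) (cobounded E3) := by
  rw [← tendsto_norm_atTop_iff_cobounded]
  refine tendsto_atTop_mono' _ ?_ (tendsto_norm_cobounded_atTop.atTop_div_const (show (0 : ℝ) < 4 by norm_num))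
  filter_upwards [h.le_norm] with y hy
  linarith

theorem tendsto_factor (h : IsFlatteningMap X U σ τ a) :
    Tendsto (fun y => U (X y)) (cobounded E3) (𝓝 1) :=
  h.hasExpansion.tendsto_one.comp h.tendsto_cobounded

/-- `∇U` is `O(|x|⁻²)` and `|X|` is at least `|y|/4`; the condition `τ ≤ 1` is what turns `|y|⁻²`
into `O(|y|^(-τ-1))`. -/
theorem pd_factor_isBigO (h : IsFlatteningMap X U σ τ a) (k : Fin 3) :
    pd k (fun z => U (X z)) =O[cobounded E3] fun y => ‖y‖ ^ (-τ - 1) := by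
  obtain ⟨C, hC, hCb⟩ := h.hasExpansion.exists_abs_pd_le
  refine IsBigO.of_bound (3 * (2 * (C * 16))) ?_
  filter_upwards [h.tendsto_cobounded.eventually hCb, h.contDiffAt, h.norm_le, h.le_norm,
    h.tendsto_cobounded.eventually h.contDiffAt_factor, tendsto_norm_cobounded_atTop.eventually_ge_atTop 1]
    with y h1 h2 h3 h4 h5 h6
  rw [pd_comp (h5.differentiableAt (by norm_num)) (h2.differentiableAt (by norm_num)), Real.norm_eq_abs, Real.norm_of_nonneg (by positivity)]
  have e1 : ∀ j, |frame X k y j * pd j U (X y)| ≤ 2 * (C * 16) * ‖y‖ ^ (-τ - 1) := fun j => by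
    have f1 : |frame X k y j| ≤ 2 := (abs_coord_le _ j).trans (by
      have := (h3 (stdVec k)).2
      rwa [norm_stdVec, mul_one] at this)
    have f2 : C / ‖X y‖ ^ 2 ≤ C * 16 * ‖y‖ ^ (-τ - 1) := by
      have hy0 : 0 < ‖y‖ := by linarith
      have f3 : (‖y‖ / 4) ^ 2 ≤ ‖X y‖ ^ 2 := by gcongr; linarith
      have f4 : (‖y‖ ^ 2)⁻¹ ≤ ‖y‖ ^ (-τ - 1) := by
        rw [← Real.rpow_natCast, ← Real.rpow_neg hy0.le]
        exact Real.rpow_le_rpow_of_exponent_le h6 (by have := h.le_one; push_cast; linarith)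
      calc C / ‖X y‖ ^ 2 ≤ C / (‖y‖ / 4) ^ 2 := by gcongr
        _ = C * 16 * (‖y‖ ^ 2)⁻¹ := by field_simp; norm_num
        _ ≤ _ := by gcongr
    rw [abs_mul, mul_assoc]
    exact mul_le_mul f1 ((h1 j).trans f2) (abs_nonneg _) (by norm_num)
  refine (Finset.abs_sum_le_sum_abs _ _).trans ((Finset.sum_le_sum fun j _ => e1 j).trans_eq ?_)
  simp; ring

theorem contDiffAt_metric (h : IsFlatteningMap X U σ τ a) :
    ∀ᶠ y in cobounded E3, ∀ i j, ContDiffAt ℝ 1 (σ i j) y := by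
  filter_upwards [eventually_cobounded_eventually_nhds h.metric_eq, h.contDiffAt,
    h.tendsto_cobounded.eventually h.contDiffAt_factor] with y h1 h2 h3 i j
  have hf : ∀ i, ContDiffAt ℝ 1 (frame X i) y := fun i =>
    (h2.fderiv_right (m := 1) (by norm_num)).clm_apply contDiffAt_const
  refine ContDiffAt.congr_of_eventuallyEq ?_ (h1.mono fun z hz => hz i j)
  exact (((h3.comp y (h2.of_le (by norm_num))).pow 4).mul ((hf i).inner ℝ (hf j))).sub contDiffAt_const

theorem abs_gram_le (h : IsFlatteningMap X U σ τ a) :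
    ∀ᶠ y in cobounded E3, ∀ i j, |gram X i j y| ≤ 4 := by
  filter_upwards [h.norm_le] with y hy i j
  have hf : ∀ i, ‖frame X i y‖ ≤ 2 := fun i => by
    have := (hy (stdVec i)).2
    rwa [norm_stdVec, mul_one] at this
  refine (abs_real_inner_le_norm _ _).trans ?_
  nlinarith [hf i, hf j, norm_nonneg (frame X i y), norm_nonneg (frame X j y)]

/-- Differentiate `σ + δ = U(X)⁴ · gram` and solve for the derivative of `gram`. Far out `1/2 < U <
2`, whence the constant `2048 = 16 · 128`. -/
theorem pd_gram_isBigO (h : IsFlatteningMap X U σ τ a) (k i j : Fin 3) :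
    pd k (gram X i j) =O[cobounded E3] fun y => ‖y‖ ^ (-τ - 1) := by
  have hsum : (fun y => |pd k (σ i j) y| + |pd k (fun z => U (X z)) y|) =O[cobounded E3]
      fun y => ‖y‖ ^ (-τ - 1) :=
    (h.pd_isBigO k i j).abs_left.add (h.pd_factor_isBigO k).abs_left
  refine IsBigO.trans (IsBigO.of_bound 2048 ?_) hsum
  filter_upwards [eventually_cobounded_eventually_nhds h.metric_eq, h.contDiffAt, h.abs_gram_le,
    h.tendsto_cobounded.eventually h.contDiffAt_factor,
    h.tendsto_factor.eventually (lt_mem_nhds (show (1 / 2 : ℝ) < 1 by norm_num)),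
    h.tendsto_factor.eventually (gt_mem_nhds (show (1 : ℝ) < 2 by norm_num))] with y h1 h2 h3 h4 h5 h6
  have hXd := h2.differentiableAt (by norm_num)
  have hH : DifferentiableAt ℝ (fun z => U (X z)) y := (h4.differentiableAt (by norm_num)).comp y hXd
  have hg : DifferentiableAt ℝ (gram X i j) y := (differentiableAt_frame h2 i).inner ℝ (differentiableAt_frame h2 j)
  have e1 : pd k (σ i j) y = pd k (fun z => U (X z) ^ 4 * gram X i j z - if i = j then 1 else 0) y :=
    (pd_congr (h1.mono fun z hz => hz i j)).eq_of_nhds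
  have e2 : pd k (fun z => U (X z) ^ 4) y = 4 * U (X y) ^ 3 * pd k (fun z => U (X z)) y := by
    simp only [pd]
    rw [fderiv_fun_pow 4 hH]
    simp
  rw [pd_sub ((hH.fun_pow 4).fun_mul hg) (differentiableAt_const _), pd_mul (hH.fun_pow 4) hg, e2] at e1
  have e3 : pd k (fun _ : E3 => if i = j then (1 : ℝ) else 0) y = 0 := by simp [pd]
  rw [e3, sub_zero] at e1
  set Hy := U (X y) with hHy
  set p := pd k (fun z => U (X z)) y
  have hH4 : (1 / 16 : ℝ) ≤ Hy ^ 4 := by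
    calc (1 / 16 : ℝ) = (1 / 2) ^ 4 := by norm_num
      _ ≤ Hy ^ 4 := by gcongr
  have hH3 : Hy ^ 3 ≤ 8 := by
    calc Hy ^ 3 ≤ 2 ^ 3 := by gcongr
      _ = 8 := by norm_num
  have e4 : Hy ^ 4 * pd k (gram X i j) y = pd k (σ i j) y - 4 * Hy ^ 3 * p * gram X i j y := by
    rw [e1]; ring
  have e5 : |4 * Hy ^ 3 * p * gram X i j y| ≤ 128 * |p| := by
    rw [abs_mul, abs_mul, abs_of_nonneg (by positivity : 0 ≤ 4 * Hy ^ 3)]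
    calc 4 * Hy ^ 3 * |p| * |gram X i j y| ≤ 4 * 8 * |p| * 4 := by gcongr; exact h3 i j
      _ = _ := by ring
  have e6 : Hy ^ 4 * |pd k (gram X i j) y| ≤ |pd k (σ i j) y| + 128 * |p| := by
    rw [← abs_of_nonneg (by positivity : 0 ≤ Hy ^ 4), ← abs_mul, e4]
    exact (abs_sub _ _).trans (by linarith)
  have e7 : 1 / 16 * |pd k (gram X i j) y| ≤ Hy ^ 4 * |pd k (gram X i j) y| := by gcongr
  rw [Real.norm_eq_abs, Real.norm_of_nonneg (by positivity)]
  linarith [abs_nonneg (pd k (σ i j) y), abs_nonneg p]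

theorem exists_frame_limit (h : IsFlatteningMap X U σ τ a) (i : Fin 3) :
    ∃ A, (fun y => frame X i y - A) =O[cobounded E3] fun y => ‖y‖ ^ (-τ) := by
  refine exists_limit_of_fderiv_isBigO (by linarith [h.half_lt])
    (h.contDiffAt.mono fun y hy => differentiableAt_frame hy i) ?_
  exact fderiv_frame_isBigO h.contDiffAt (h.norm_le.mono fun y hy v => (hy v).1) h.pd_gram_isBigO i

theorem tendsto_rpow_neg {s : ℝ} (hs : 0 < s) : Tendsto (fun y : E3 => ‖y‖ ^ (-s)) (cobounded E3) (𝓝 0) :=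
  (tendsto_rpow_neg_atTop hs).comp tendsto_norm_cobounded_atTop

theorem tendsto_gram (h : IsFlatteningMap X U σ τ a) (i j : Fin 3) :
    Tendsto (gram X i j) (cobounded E3) (𝓝 (if i = j then 1 else 0)) := by
  have h0 : Tendsto (σ i j) (cobounded E3) (𝓝 0) :=
    (h.isBigO i j).trans_tendsto (tendsto_rpow_neg (by linarith [h.half_lt]))
  have h1 := (h0.add_const (if i = j then (1 : ℝ) else 0)).div (h.tendsto_factor.pow 4) (by norm_num)
  rw [zero_add, one_pow, div_one] at h1
  refine h1.congr' ?_
  filter_upwards [h.metric_eq, h.tendsto_factor.eventually (lt_mem_nhds (show (1 / 2 : ℝ) < 1 by norm_num))]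
    with y h2 h3
  have : U (X y) ≠ 0 := by linarith
  simp only [Pi.div_apply]; rw [h2]; field_simp; ring

theorem exists_frame (h : IsFlatteningMap X U σ τ a) : ∃ A : Fin 3 → E3,
    (∀ i j, inner ℝ (A i) (A j) = if i = j then (1 : ℝ) else 0) ∧
    ∀ i, (fun y => frame X i y - A i) =O[cobounded E3] fun y => ‖y‖ ^ (-τ) := by
  choose A hA using h.exists_frame_limit
  have hτ : 0 < τ := by linarith [h.half_lt]
  have hlim : ∀ i, Tendsto (frame X i) (cobounded E3) (𝓝 (A i)) := fun i => by
    simpa using ((hA i).trans_tendsto (tendsto_rpow_neg hτ)).add_const (A i)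
  exact ⟨A, fun i j => tendsto_nhds_unique ((hlim i).inner (hlim j)) (h.tendsto_gram i j), hA⟩

theorem norm_sum_smul_of_orthonormal {A : Fin 3 → E3}
    (hA : ∀ i j, inner ℝ (A i) (A j) = if i = j then (1 : ℝ) else 0) (y : E3) : ‖∑ i, y i • A i‖ = ‖y‖ := by
  refine (sq_eq_sq₀ (norm_nonneg _) (norm_nonneg _)).1 ?_
  rw [← real_inner_self_eq_norm_sq, EuclideanSpace.norm_sq_eq]
  simp only [sum_inner, inner_sum, inner_smul_left, inner_smul_right, hA, conj_trivial, Real.norm_eq_abs, sq_abs]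
  simp [sq]

/-- `X` differs by `o(|y|)` from the linear isometry sending the standard basis to the limit frame.
This transfers the `1/|X|` term of the expansion to `1/|y|`. -/
theorem tendsto_norm_div (h : IsFlatteningMap X U σ τ a) :
    Tendsto (fun y => ‖X y‖ / ‖y‖) (cobounded E3) (𝓝 1) := by
  obtain ⟨A, hAA, hA⟩ := h.exists_frame
  have hτ : 0 < τ := by linarith [h.half_lt]
  set P : E3 →L[ℝ] E3 := ∑ i, (EuclideanSpace.proj i : E3 →L[ℝ] ℝ).smulRight (A i) with hP
  have hPy : ∀ y, P y = ∑ i, y i • A i := fun y => by simp [hP]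
  have hPn : ∀ y, ‖P y‖ = ‖y‖ := fun y => by rw [hPy, norm_sum_smul_of_orthonormal hAA]
  have hd : ∀ᶠ y in cobounded E3, fderiv ℝ (fun y => X y - P y) y = fderiv ℝ X y - P := by
    filter_upwards [h.contDiffAt] with y hy
    rw [fderiv_fun_sub (hy.differentiableAt (by norm_num)) P.differentiableAt, ContinuousLinearMap.fderiv]
  have hsum : Tendsto (fun y => ∑ i, ‖frame X i y - A i‖) (cobounded E3) (𝓝 0) := by
    have := tendsto_finsetSum (Finset.univ : Finset (Fin 3)) fun i _ =>
      ((hA i).trans_tendsto (tendsto_rpow_neg hτ)).norm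
    simpa using this
  have ho : (fun y => X y - P y) =o[cobounded E3] fun y => ‖y‖ := by
    refine isLittleO_of_tendsto_fderiv ?_ ?_
    · filter_upwards [h.contDiffAt] with y hy
      exact (hy.differentiableAt (by norm_num)).fun_sub P.differentiableAt
    · refine squeeze_zero_norm' ?_ hsum
      filter_upwards [hd] with y hy
      rw [hy]
      refine ContinuousLinearMap.opNorm_le_bound _ (Finset.sum_nonneg fun i _ => norm_nonneg _) fun v => ?_
      rw [sub_apply, fderiv_eq_sum_frame, hPy, ← Finset.sum_sub_distrib, Finset.sum_mul]
      refine (norm_sum_le _ _).trans (Finset.sum_le_sum fun i _ => ?_)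
      rw [← smul_sub, norm_smul, mul_comm]
      exact mul_le_mul_of_nonneg_left (abs_coord_le v i) (norm_nonneg _)
  have h1 : Tendsto (fun y => ‖X y - P y‖ / ‖y‖) (cobounded E3) (𝓝 0) := ho.norm_left.tendsto_div_nhds_zero
  rw [tendsto_iff_norm_sub_tendsto_zero]
  refine squeeze_zero' (Eventually.of_forall fun _ => norm_nonneg _) ?_ h1
  filter_upwards [tendsto_norm_cobounded_atTop.eventually_ge_atTop (1 : ℝ)] with y hy
  have hy0 : 0 < ‖y‖ := by linarith
  rw [div_sub_one hy0.ne', norm_div, norm_norm]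
  gcongr
  have := abs_norm_sub_norm_le (X y) (P y)
  rwa [hPn] at this

theorem tendsto_norm_mul_factor (h : IsFlatteningMap X U σ τ a) :
    Tendsto (fun y => ‖y‖ * (U (X y) ^ 4 - 1)) (cobounded E3) (𝓝 (4 * a)) := by
  have h1 : Tendsto (fun y => ‖X y‖ * (U (X y) - 1)) (cobounded E3) (𝓝 a) :=
    h.hasExpansion.tendsto_norm_mul.comp h.tendsto_cobounded
  have h2 := (h1.div h.tendsto_norm_div one_ne_zero).mul
    ((h.tendsto_factor.add_const 1).mul ((h.tendsto_factor.pow 2).add_const 1))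
  rw [show a / 1 * ((1 + 1) * (1 ^ 2 + 1)) = 4 * a by ring] at h2
  refine h2.congr' ?_
  filter_upwards [h.le_norm, tendsto_norm_cobounded_atTop.eventually_ge_atTop (1 : ℝ)] with y hy hy1
  have : 0 < ‖X y‖ := by linarith
  simp only [Pi.div_apply]
  field_simp; ring

/-- Up to an infinitesimal change of coordinates, `σ` is `4a/|y|` times the identity. -/
theorem exists_correction (h : IsFlatteningMap X U σ τ a) : ∃ η : Fin 3 → E3 → ℝ,
    (∀ᶠ y in cobounded E3, ∀ j, ContDiffAt ℝ 1 (η j) y) ∧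
    ∀ i j, Tendsto (fun y => ‖y‖ * (σ i j y - 4 * a * (if i = j then ‖y‖⁻¹ else 0) -
      (pd i (η j) y + pd j (η i) y))) (cobounded E3) (𝓝 0) := by
  obtain ⟨A, hAA, hA⟩ := h.exists_frame
  -- `η` is the displacement of `X` from the identity, read in the frame `A`. With `∂_iX = A_i +
  -- d_i`, the Gram matrix is `δ_ij + ⟨A_j, d_i⟩ + ⟨A_i, d_j⟩ + ⟨d_i, d_j⟩`, and its linear part is
  -- `∂_iη_j + ∂_jη_i`.
  refine ⟨fun j y => inner ℝ (A j) (X y) - inner ℝ (stdVec j) y, ?_, fun i j => ?_⟩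
  · filter_upwards [h.contDiffAt] with y hy j
    exact (contDiffAt_const.inner ℝ (hy.of_le (by norm_num))).sub (contDiffAt_const.inner ℝ contDiffAt_id)
  have hpd : ∀ᶠ y in cobounded E3, ∀ i j, pd i (fun y => inner ℝ (A j) (X y) - inner ℝ (stdVec j) y) y =
      inner ℝ (A j) (frame X i y) - if i = j then 1 else 0 := by
    filter_upwards [h.contDiffAt] with y hy i j
    have hX := hy.differentiableAt (by norm_num)
    rw [pd_sub (((differentiableAt_const _).inner ℝ hX)) ((differentiableAt_const _).inner ℝ differentiableAt_fun_id)]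
    congr 1
    · rw [pd, fderiv_inner_apply ℝ (differentiableAt_const _) hX]; simp [frame]
    · rw [pd, fderiv_inner_apply ℝ (differentiableAt_const _) differentiableAt_fun_id]
      simp [inner_stdVec_stdVec, eq_comm]
  -- The quadratic part is `O(|y|^(-2τ))`, which is `o(1/|y|)` because `τ > 1/2`.
  have hdd : Tendsto (fun y => ‖y‖ * inner ℝ (frame X i y - A i) (frame X j y - A j)) (cobounded E3) (𝓝 0) := by
    have o1 : (fun y => inner ℝ (frame X i y - A i) (frame X j y - A j)) =O[cobounded E3]
        fun y => ‖y‖ ^ (-τ) * ‖y‖ ^ (-τ) :=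
      IsBigO.trans (IsBigO.of_bound 1 (Eventually.of_forall fun y => by
        rw [one_mul, norm_mul, norm_norm, norm_norm]
        exact norm_inner_le_norm _ _)) ((hA i).norm_left.mul (hA j).norm_left)
    have o2 := (isBigO_refl (fun y : E3 => ‖y‖) (cobounded E3)).mul o1
    refine o2.trans_tendsto ((tendsto_rpow_neg (show 0 < 2 * τ - 1 by linarith [h.half_lt])).congr' ?_)
    filter_upwards [tendsto_norm_cobounded_atTop.eventually_ge_atTop (1 : ℝ)] with y hy
    have hy0 : 0 < ‖y‖ := by linarith
    rw [← Real.rpow_add hy0]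
    nth_rewrite 2 [← Real.rpow_one ‖y‖]
    rw [← Real.rpow_add hy0]
    congr 1; ring
  have hF := h.tendsto_norm_mul_factor
  have hlim := (((hF.sub_const (4 * a)).mul_const (if i = j then (1 : ℝ) else 0)).add
    (hF.mul ((h.tendsto_gram i j).sub_const (if i = j then (1 : ℝ) else 0)))).add hdd
  rw [sub_self, sub_self, zero_mul, mul_zero, add_zero, add_zero] at hlim
  refine hlim.congr' ?_
  filter_upwards [hpd, h.metric_eq, tendsto_norm_cobounded_atTop.eventually_ge_atTop (1 : ℝ)] with y h1 h2 h3
  have hy0 : ‖y‖ ≠ 0 := by positivity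
  rw [h1, h1, h2, inner_sub_left, inner_sub_right, inner_sub_right, hAA, real_inner_comm (A j) (frame X i y),
    show inner ℝ (frame X i y) (frame X j y) = gram X i j y from rfl]
  by_cases hij : i = j
  · subst hij; simp only [if_true]; field_simp; ring
  · rw [if_neg hij, if_neg hij, if_neg (Ne.symm hij)]; ring

end IsFlatteningMap

/-- The limit of the averaged flux integrals of an asymptotically flat metric that is conformally
flat in other coordinates. -/
theorem IsFlatteningMap.tendsto_flux {X : E3 → E3} {U : E3 → ℝ} {σ : Fin 3 → Fin 3 → E3 → ℝ} {τ a : ℝ}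
    (h : IsFlatteningMap X U σ τ a) :
    Tendsto (fun ρ : ℝ => ∫ y, ∑ j, (∑ i, (pd i (σ i j) y - pd j (σ i i) y)) * pd j (cutAt ρ) y) atTop
      (𝓝 (-(6 * unitBallVolume * (4 * a)))) := by
  obtain ⟨η, hη, hlim⟩ := h.exists_correction
  obtain ⟨L, hL, hσ⟩ := eventually_cobounded_norm.1 (h.contDiffAt_metric.and hη)
  refine (tendsto_integral_cutHess (b := 4 * a) (fun i j y hy => (hσ y hy).1 i j)
    (fun j y hy => (hσ y hy).2 j) fun ε hε => ?_).congr' ?_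
  · have hall : ∀ᶠ y in cobounded E3, ∀ i j, |‖y‖ * (σ i j y - 4 * a * (if i = j then ‖y‖⁻¹ else 0) -
        (pd i (η j) y + pd j (η i) y))| < ε :=
      eventually_all.2 fun i => eventually_all.2 fun j => by
        simpa [Real.dist_eq] using Metric.tendsto_nhds.1 (hlim i j) ε hε
    obtain ⟨L', hL', hb⟩ := eventually_cobounded_norm.1 hall
    refine ⟨L', fun y hy i j => ?_⟩
    have hy0 : 0 < ‖y‖ := hL'.trans_le hy
    rw [le_div_iff₀ hy0, mul_comm]
    have := (hb y hy i j).le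
    rwa [abs_mul, abs_norm] at this
  · filter_upwards [eventually_ge_atTop L] with ρ hρ
    exact (integral_flux_eq (hL.trans_le hρ) fun i j y hy => (hσ y (hρ.trans hy)).1 i j).symm

/-! ### Transition maps between end charts, and the ADM mass -/

/-- Nine entries with error below `1/18` change the form by at most `‖v‖²/2`. -/
theorem eventually_quadraticForm_bounds {c : Fin 3 → Fin 3 → E3 → ℝ}
    (hc : ∀ i j, Tendsto (c i j) (cobounded E3) (𝓝 (if i = j then 1 else 0))) :
    ∀ᶠ y in cobounded E3, ∀ v : E3, ‖v‖ ^ 2 / 2 ≤ ∑ k, ∑ l, v k * v l * c k l y ∧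
      ∑ k, ∑ l, v k * v l * c k l y ≤ 2 * ‖v‖ ^ 2 := by
  have hall : ∀ᶠ y in cobounded E3, ∀ i j, |c i j y - if i = j then 1 else 0| < 1 / 18 :=
    eventually_all.2 fun i => eventually_all.2 fun j => by
      simpa [Real.dist_eq] using Metric.tendsto_nhds.1 (hc i j) (1 / 18) (by norm_num)
  filter_upwards [hall] with y hy v
  have e : ∑ k, ∑ l, v k * v l * c k l y =
      ‖v‖ ^ 2 + ∑ k, ∑ l, v k * v l * (c k l y - if k = l then 1 else 0) := by
    rw [EuclideanSpace.norm_sq_eq]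
    simp only [mul_sub, Finset.sum_sub_distrib, mul_ite, mul_one, mul_zero, Finset.sum_ite_eq,
      Finset.mem_univ, if_true, Real.norm_eq_abs, sq_abs, ← sq]
    ring
  have hb : |∑ k, ∑ l, v k * v l * (c k l y - if k = l then 1 else 0)| ≤ ‖v‖ ^ 2 / 2 := by
    have h1 : ∀ k l, |v k * v l * (c k l y - if k = l then 1 else 0)| ≤ ‖v‖ * ‖v‖ * (1 / 18) := fun k l => by
      rw [abs_mul, abs_mul]
      have := abs_coord_le v k
      have := abs_coord_le v l
      have := (hy k l).le
      gcongr
    refine (Finset.abs_sum_le_sum_abs _ _).trans ((Finset.sum_le_sum fun i _ =>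
      (Finset.abs_sum_le_sum_abs _ _).trans (Finset.sum_le_sum fun j _ => h1 i j)).trans_eq ?_)
    simp; ring
  rw [e]
  have := abs_le.1 hb
  constructor <;> nlinarith [sq_nonneg ‖v‖]

section Charts

variable {H : Type*} [TopologicalSpace H] {I : ModelWithCorners ℝ E3 H}
  {M : Type*} [TopologicalSpace M] [ChartedSpace H M] [IsManifold I ∞ M]
  {Φ Φ' : OpenPartialHomeomorph M E3} {g : SmoothMetric I M} {U : E3 → ℝ}

/-- The metric coefficients tend to those of the Euclidean metric. -/
def IsAsymptoticallyEuclidean (g : SmoothMetric I M) (Φ : OpenPartialHomeomorph M E3) : Prop :=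
  ∀ i j, Tendsto (coeff g Φ.symm i j) (cobounded E3) (𝓝 (if i = j then 1 else 0))

theorem IsEndChart.eventually_mem_target {I : ModelWithCorners ℝ E3 H} (h : IsEndChart I Φ) :
    ∀ᶠ y in cobounded E3, y ∈ Φ.target := by
  obtain ⟨r, hr, hrt⟩ := h.exists_exterior_subset
  exact eventually_cobounded_norm.2 ⟨r, hr, hrt⟩

theorem IsHarmonicChart.isAsymptoticallyEuclidean (h : IsHarmonicChart g Φ U) :
    IsAsymptoticallyEuclidean g Φ := fun i j => by
  have h1 : Tendsto (fun y => if i = j then U y ^ 4 else 0) (cobounded E3) (𝓝 (if i = j then 1 else 0)) := by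
    split_ifs
    · simpa using h.tendsto_one.pow 4
    · exact tendsto_const_nhds
  refine h1.congr' ?_
  filter_upwards [h.eventually_mem_target] with y hy using (h.coeff_eq y hy i j).symm

theorem IsAFChart.coeff_sub_isBigO {τ : ℝ} (h : IsAFChart g Φ τ) (i j : Fin 3) :
    (fun z => coeff g Φ.symm i j z - if i = j then (1 : ℝ) else 0) =O[cobounded E3] fun y => ‖y‖ ^ (-τ) := by
  have := (h.decay i j 0 (by norm_num)).norm_left
  simp only [norm_iteratedFDeriv_zero, Nat.cast_zero, sub_zero] at this
  exact this.of_norm_left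

theorem IsAFChart.pd_coeff_sub_isBigO {τ : ℝ} (h : IsAFChart g Φ τ) (k i j : Fin 3) :
    pd k (fun z => coeff g Φ.symm i j z - if i = j then (1 : ℝ) else 0) =O[cobounded E3]
      fun y => ‖y‖ ^ (-τ - 1) := by
  have := (h.decay i j 1 (by norm_num)).norm_left
  simp only [norm_iteratedFDeriv_one, Nat.cast_one] at this
  exact (IsBigO.of_bound 1 (Eventually.of_forall fun y => by
    rw [one_mul, norm_norm]; exact abs_pd_le _ _ _)).trans this

theorem IsAFChart.isAsymptoticallyEuclidean {τ : ℝ} (h : IsAFChart g Φ τ) :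
    IsAsymptoticallyEuclidean g Φ := fun i j => by
  have := ((h.coeff_sub_isBigO i j).trans_tendsto
    (IsFlatteningMap.tendsto_rpow_neg (by linarith [h.half_lt]))).add_const (if i = j then (1 : ℝ) else 0)
  simpa using this

theorem IsEndChart.eventually_transition {I : ModelWithCorners ℝ E3 H} (h : IsEndChart I Φ) (h' : IsEndChart I Φ')
    (hΦ : Tendsto Φ.symm (cobounded E3) (cocompact M)) :
    ∀ᶠ y in cobounded E3, ContDiffAt ℝ ∞ (fun y => Φ' (Φ.symm y)) y ∧
      Φ.symm =ᶠ[𝓝 y] Φ'.symm ∘ (fun y => Φ' (Φ.symm y)) ∧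
      MDifferentiableAt 𝓘(ℝ, E3) I Φ'.symm (Φ' (Φ.symm y)) := by
  filter_upwards [h.eventually_mem_target, h'.eventually_mem_source hΦ] with y hy hy'
  refine ⟨?_, ?_, ?_⟩
  · exact contMDiffAt_iff_contDiffAt.1
      ((h'.contMDiffOn.contMDiffAt (Φ'.open_source.mem_nhds hy')).comp y (h.contMDiffAt_symm hy))
  · filter_upwards [(Φ.continuousAt_symm hy).eventually (Φ'.open_source.mem_nhds hy')] with z hz
    exact (Φ'.left_inv hz).symm
  · exact (h'.contMDiffAt_symm (Φ'.map_source hy')).mdifferentiableAt (by simp)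

/-- The transition map between asymptotically Euclidean charts is almost an isometry. -/
theorem IsEndChart.eventually_norm_fderiv_transition (h : IsEndChart I Φ) (h' : IsEndChart I Φ')
    (hΦ : Tendsto Φ.symm (cobounded E3) (cocompact M)) (hg : IsAsymptoticallyEuclidean g Φ)
    (hg' : IsAsymptoticallyEuclidean g Φ') :
    ∀ᶠ y in cobounded E3, ∀ v, ‖v‖ ≤ 2 * ‖fderiv ℝ (fun y => Φ' (Φ.symm y)) y v‖ ∧
      ‖fderiv ℝ (fun y => Φ' (Φ.symm y)) y v‖ ≤ 2 * ‖v‖ := by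
  filter_upwards [h.eventually_transition h' hΦ, eventually_quadraticForm_bounds hg,
    (h'.tendsto_cobounded hΦ).eventually (eventually_quadraticForm_bounds hg')] with y ⟨h1, h2, h3⟩ h4 h5 v
  set X := fun y => Φ' (Φ.symm y) with hX
  have e : ∑ k, ∑ l, v k * v l * coeff g Φ.symm k l y =
      ∑ k, ∑ l, fderiv ℝ X y v k * fderiv ℝ X y v l * coeff g Φ'.symm k l (X y) := by
    rw [← metricForm_paramDeriv, ← metricForm_paramDeriv, paramDeriv_comp h2 (h1.differentiableAt (by simp)) h3,
      h2.eq_of_nhds]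
    rfl
  have a1 := h4 v
  have a2 := h5 (fderiv ℝ X y v)
  rw [e] at a1
  constructor
  · refine (sq_le_sq₀ (norm_nonneg _) (by positivity)).1 ?_
    rw [mul_pow]; linarith
  · refine (sq_le_sq₀ (norm_nonneg _) (by positivity)).1 ?_
    rw [mul_pow]; linarith

/-- The inverse transition map grows at most linearly with slope `2`, so `‖y‖ ≤ C + 2‖X y‖` for the
transition map `X`, and `C ≤ ‖y‖/2` far out. -/
theorem IsEndChart.eventually_le_norm_transition (h : IsEndChart I Φ) (h' : IsEndChart I Φ')
    (hΦ : Tendsto Φ.symm (cobounded E3) (cocompact M)) (hΦ' : Tendsto Φ'.symm (cobounded E3) (cocompact M))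
    (hg : IsAsymptoticallyEuclidean g Φ) (hg' : IsAsymptoticallyEuclidean g Φ') :
    ∀ᶠ y in cobounded E3, ‖y‖ ≤ 4 * ‖Φ' (Φ.symm y)‖ := by
  obtain ⟨C, hC⟩ := eventually_norm_le_of_norm_fderiv_le (T := fun y => Φ (Φ'.symm y)) (κ := 2)
    ((h'.eventually_transition h hΦ').mono fun y hy => hy.1.differentiableAt (by simp))
    ((h'.eventually_norm_fderiv_transition h hΦ' hg' hg).mono fun y hy =>
      ContinuousLinearMap.opNorm_le_bound _ (by norm_num) fun v => (hy v).2)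
  filter_upwards [(h'.tendsto_cobounded hΦ).eventually hC, h.eventually_mem_target, h'.eventually_mem_source hΦ,
    tendsto_norm_cobounded_atTop.eventually_ge_atTop (2 * C)] with y h1 h2 h3 h4
  rw [Φ'.left_inv h3, Φ.right_inv h2] at h1
  linarith

theorem IsAFChart.isFlatteningMap {τ a : ℝ} (h' : IsAFChart g Φ' τ) (h : IsHarmonicChart g Φ U)
    (hΦ : Tendsto Φ.symm (cobounded E3) (cocompact M)) (hΦ' : Tendsto Φ'.symm (cobounded E3) (cocompact M))
    (ha : HasExpansion U a) :
    IsFlatteningMap (fun y => Φ (Φ'.symm y)) U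
      (fun i j z => coeff g Φ'.symm i j z - if i = j then (1 : ℝ) else 0) (min τ 1) a where
  contDiffAt := (h'.eventually_transition h.toIsEndChart hΦ').mono fun y hy => hy.1.of_le (by norm_cast)
  norm_le := h'.eventually_norm_fderiv_transition h.toIsEndChart hΦ' h'.isAsymptoticallyEuclidean
    h.isAsymptoticallyEuclidean
  le_norm := h'.eventually_le_norm_transition h.toIsEndChart hΦ' hΦ h'.isAsymptoticallyEuclidean
    h.isAsymptoticallyEuclidean
  contDiffAt_factor := h.eventually_mem_target.mono fun y hy => (h.contDiffAt hy).of_le (by norm_num)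
  hasExpansion := ha
  metric_eq := by
    filter_upwards [h'.eventually_transition h.toIsEndChart hΦ', (h.tendsto_cobounded hΦ').eventually
      h.eventually_mem_target] with y ⟨h1, h2, h3⟩ h4 i j
    rw [coeff_comp g h2 (h1.differentiableAt (by simp)) h3]
    simp only [h.coeff_eq _ h4, mul_ite, mul_zero, Finset.sum_ite_eq, Finset.mem_univ, if_true, gram, frame,
      PiLp.inner_apply, RCLike.inner_apply, conj_trivial, Finset.mul_sum]
    congr 1
    exact Finset.sum_congr rfl fun k _ => by ring
  half_lt := lt_min h'.half_lt (by norm_num)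
  le_one := min_le_right _ _
  isBigO i j := (h'.coeff_sub_isBigO i j).trans (IsBigO.of_bound 1 (by
    filter_upwards [tendsto_norm_cobounded_atTop.eventually_ge_atTop (1 : ℝ)] with y hy
    rw [one_mul, Real.norm_of_nonneg (by positivity), Real.norm_of_nonneg (by positivity)]
    exact Real.rpow_le_rpow_of_exponent_le hy (by linarith [min_le_left τ 1])))
  pd_isBigO k i j := (h'.pd_coeff_sub_isBigO k i j).trans (IsBigO.of_bound 1 (by
    filter_upwards [tendsto_norm_cobounded_atTop.eventually_ge_atTop (1 : ℝ)] with y hy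
    rw [one_mul, Real.norm_of_nonneg (by positivity), Real.norm_of_nonneg (by positivity)]
    exact Real.rpow_le_rpow_of_exponent_le hy (by linarith [min_le_left τ 1])))

/-- The ADM mass, computed in any asymptotically flat coordinates, is twice the coefficient of `1/|x|`
in the expansion of the harmonic conformal factor. -/
theorem IsHarmonicChart.admMass_eq [T2Space M] [NoncompactSpace M] {a m : ℝ} (h : IsHarmonicChart g Φ U)
    (ha : HasExpansion U a) (hm : IsADMMass g m) : m = 2 * a := by
  obtain ⟨Φ', τ, h', hlim⟩ := hm
  have hnc : ¬ CompactSpace M := not_compactSpace_iff.2 inferInstance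
  have hΦ := h.compactSpace_or_tendsto.resolve_left hnc
  have hΦ' := h'.compactSpace_or_tendsto.resolve_left hnc
  have hF := h'.isFlatteningMap h hΦ hΦ' ha
  set σ : Fin 3 → Fin 3 → E3 → ℝ := fun i j z => coeff g Φ'.symm i j z - if i = j then (1 : ℝ) else 0 with hσ
  have hp : ∀ k i j y, pd k (σ i j) y = partialCoeff g Φ' k i j y := fun k i j y => by
    simp only [pd, hσ, partialCoeff, fderiv_sub_const]
  have h1 := hF.tendsto_flux
  have hsmall : ∀ k i j, Tendsto (pd k (σ i j)) (cobounded E3) (𝓝 0) := fun k i j => by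
    refine (hF.pd_isBigO k i j).trans_tendsto ?_
    have := IsFlatteningMap.tendsto_rpow_neg (s := min τ 1 + 1) (by linarith [hF.half_lt])
    simpa only [neg_add, ← sub_eq_add_neg] using this
  have hq0 : ∀ j, Tendsto (fun y => ∑ i, (pd i (σ i j) y - pd j (σ i i) y)) (cobounded E3) (𝓝 0) := fun j => by
    have := tendsto_finsetSum (Finset.univ : Finset (Fin 3)) fun i _ => (hsmall i i j).sub (hsmall j i i)
    simpa using this
  have hall : ∀ᶠ y in cobounded E3, ∀ j, |∑ i, (pd i (σ i j) y - pd j (σ i i) y)| < 1 :=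
    eventually_all.2 fun j => by simpa [Real.dist_eq] using Metric.tendsto_nhds.1 (hq0 j) 1 one_pos
  obtain ⟨L, -, hL⟩ := eventually_cobounded_norm.1 hall
  have h2 := tendsto_flux_average (q := fun j y => ∑ i, (pd i (σ i j) y - pd j (σ i i) y)) (l := 16 * Real.pi * m)
    (C := 1) (L := L) (fun j => Finset.measurable_fun_sum _ fun i _ => (measurable_pd _ _).sub (measurable_pd _ _))
    (fun j y hy => (hL y hy j).le) ((hlim.const_mul (16 * Real.pi)).congr fun r => by
      rw [admFlux, ← mul_assoc, mul_one_div_cancel (by positivity), one_mul]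
      refine integral_congr_ae (Eventually.of_forall fun θ => ?_)
      simp only [hp, Finset.sum_mul]
      rw [Finset.sum_comm])
  -- The same limit in two ways: `-32πa` from the expansion of the conformal factor and `-16πm` from
  -- the definition of the ADM mass.
  have h3 := tendsto_nhds_unique h1 h2
  rw [unitBallVolume] at h3
  have := Real.pi_pos
  have h4 : Real.pi * (m - 2 * a) = 0 := by linarith
  rcases mul_eq_zero.1 h4 with h5 | h5 <;> linarith

end Charts

end IsocapacitaryMass

theorem mainTheorem3 {H : Type*} [TopologicalSpace H] (I : ModelWithCorners ℝ IsocapacitaryMass.E3 H)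
    (M : Type*) [TopologicalSpace M] [T2Space M] [SecondCountableTopology M] [ConnectedSpace M]
    [MeasurableSpace M] [BorelSpace M] [ChartedSpace H M] [IsManifold I ∞ M]
    (g : IsocapacitaryMass.SmoothMetric I M) (hg : IsocapacitaryMass.IsHarmonicallyFlat g)
    (m : ℝ) (hm : IsocapacitaryMass.IsADMMass g m) (hm0 : 0 ≤ m) :
    IsocapacitaryMass.massCV g ≤ (m : EReal) := by
  obtain ⟨Φ, U, h⟩ := hg.exists_isHarmonicChart
  -- On a compact space the bound is immediate from `0 ≤ m`. Otherwise the end charts go to infinity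
  -- in `M`, and `0 ≤ m` supplies the condition `0 ≤ a` of the volume estimate.
  by_cases hc : CompactSpace M
  · exact IsocapacitaryMass.massCV_le_of_compactSpace g hm0
  · have : NoncompactSpace M := not_compactSpace_iff.1 hc
    obtain ⟨a, ha⟩ := h.exists_hasExpansion
    have hma : m = 2 * a := h.admMass_eq ha hm
    rw [hma]
    exact h.massCV_le (h.compactSpace_or_tendsto.resolve_left hc) ha (by linarith)
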